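/- Let $p$ be a prime and let $K$ be a field of characteristic $0$, complete for a nonarchimedean absolute value normalized by $|p|=p^{-1}$. Let $\mathfrak o_K$ be its valuation ring and let $\Gamma^*$ be the divisible closure of $|K^\times|$. For $r\in(0,1)\cap\Gamma^*$ let $A[r,1)$ be the rigid analytic annulus $r\le |t|<1$ over $K$. A $\nabla$-module on $A[r,1)$ is a coherent locally free sheaf $\mathcal E$ with a connection $\nabla:\mathcal E\to\mathcal E\otimes\Omega^1$. $\nabla$-modules are considered up to shrinking the annulus, i.e. as objects of $\mathcal M=\varinjlim_{r\to1}\mathcal M_r$, where $\mathcal M_r$ is the category of $\nabla$-modules on $A[r,1)$. For $\mathcal E\in\mathcal M$ let $H^0(\mathcal E)=\varinjlim_{a\to1}\ker(\nabla)$ and $H^1(\mathcal E)=\varinjlim_{a\to1}\operatorname{coker}(\nabla)$, the kernel and cokernel being taken on sections over $A[a,1)$. The local duality pairing of $\mathcal E$ is the $K$-bilinear pairing $$H^0(\mathcal E^\vee)\times H^1(\mathcal E)\to H^1(\mathcal E^\vee\otimes\mathcal E)\to H^1(\mathcal O)\cong K,$$ the last map being the residue $\sum c_it^i\,dt\mapsto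 c_{-1}$. Call $\mathcal E$ dualizable if this pairing is perfect, i.e. if it induces isomorphisms $H^0(\mathcal E^\vee)\cong H^1(\mathcal E)^\vee$ and $H^1(\mathcal E)\cong H^0(\mathcal E^\vee)^\vee$ of $K$-vector spaces. A formally étale cover $f:X\to A[s,1)$ is a (nonempty) finite cover which comes from a finite étale algebra over the ring of those analytic functions $\sum_{i\in\mathbb Z}c_it^i$ on $A[s,1)$ with all $c_i\in\mathfrak o_K$. Call $\mathcal E\in\mathcal M$ quasi-constant if for some $s\in(0,1)\cap\Gamma^*$ it is defined on $A[s,1)$ and there is a formally étale cover $f:X\to A[s,1)$ such that $f^*\mathcal E$ is spanned by finitely many horizontal sections. Then: (1) every quasi-constant $\mathcal E\in\mathcal M$ is dualizable; (2) every $\mathcal E\in\mathcal M$ that admits a finite filtration by $\nabla$-submodules whose successive quotients are quasi-constant is dualizable. -/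

import Mathlib

open Filter Topology
open scoped TensorProduct

universe u v

set_option linter.unusedSectionVars false

namespace PadicDE

noncomputable section

/-! ### Laurent series converging on an annulus -/

/-- A nonempty set of positive radii; it cuts out the annulus `{t : |t| ∈ I}`. -/
structure Radii where
  carrier : Set ℝ
  nonempty : carrier.Nonempty
  pos : ∀ ρ ∈ carrier, 0 < ρ

/-- The Laurent series `∑ c_i t^i` over `K` that converge on the annulus `|t| ∈ I`, i.e. such that
`|c_i| ρ^i → 0` as `i → ±∞` for every `ρ ∈ I`. This is the ring of rigid analytic functions
on that annulus. -/
@[ext]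
structure Laurent (K : Type u) [NormedField K] (I : Radii) where
  coeff : ℤ → K
  tendsto' : ∀ ρ ∈ I.carrier, Tendsto (fun i : ℤ => ‖coeff i‖ * ρ ^ i) cofinite (𝓝 0)

namespace Laurent

section Aux

variable {K : Type u} [NormedField K] [IsUltrametricDist K]

theorem null_convTerm {a b : ℤ → K} {ρ : ℝ}
    (ha : Tendsto (fun i : ℤ => ‖a i‖ * ρ ^ i) cofinite (𝓝 0))
    (hb : Tendsto (fun i : ℤ => ‖b i‖ * ρ ^ i) cofinite (𝓝 0)) :
    Tendsto (fun x : ℤ × ℤ => (‖a x.1‖ * ρ ^ x.1) * (‖b x.2‖ * ρ ^ x.2)) cofinite (𝓝 0) :=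
  tendsto_mul_cofinite_nhds_zero ha hb

theorem tendsto_conv_term {a b : ℤ → K} {ρ : ℝ} (hρ : 0 < ρ)
    (ha : Tendsto (fun i : ℤ => ‖a i‖ * ρ ^ i) cofinite (𝓝 0))
    (hb : Tendsto (fun i : ℤ => ‖b i‖ * ρ ^ i) cofinite (𝓝 0)) (n : ℤ) :
    Tendsto (fun i : ℤ => a i * b (n - i)) cofinite (𝓝 0) := by
  rw [tendsto_zero_iff_norm_tendsto_zero]
  have h := (null_convTerm ha hb).comp
    (Function.Injective.tendsto_cofinite (f := fun i : ℤ => (i, n - i))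
      (fun i j h => (Prod.ext_iff.1 h).1))
  have h2 := h.mul_const (ρ ^ (-n))
  rw [zero_mul] at h2
  refine h2.congr fun i => ?_
  have h0 : ρ ^ i * ρ ^ (n - i) * ρ ^ (-n) = 1 := by
    rw [← zpow_add₀ hρ.ne', ← zpow_add₀ hρ.ne']; simp
  simp only [Function.comp, norm_mul]
  linear_combination (‖a i‖ * ‖b (n - i)‖) * h0

theorem summable_conv [CompleteSpace K] {a b : ℤ → K} {ρ : ℝ} (hρ : 0 < ρ)
    (ha : Tendsto (fun i : ℤ => ‖a i‖ * ρ ^ i) cofinite (𝓝 0))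
    (hb : Tendsto (fun i : ℤ => ‖b i‖ * ρ ^ i) cofinite (𝓝 0)) (n : ℤ) :
    Summable (fun i : ℤ => a i * b (n - i)) :=
  NonarchimedeanAddGroup.summable_of_tendsto_cofinite_zero (tendsto_conv_term hρ ha hb n)

theorem null_conv {a b : ℤ → K} {ρ : ℝ} (hρ : 0 < ρ)
    (ha : Tendsto (fun i : ℤ => ‖a i‖ * ρ ^ i) cofinite (𝓝 0))
    (hb : Tendsto (fun i : ℤ => ‖b i‖ * ρ ^ i) cofinite (𝓝 0)) :
    Tendsto (fun n : ℤ => ‖∑' i : ℤ, a i * b (n - i)‖ * ρ ^ n) cofinite (𝓝 0) := by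
  have hab := null_convTerm ha hb
  rw [Metric.tendsto_nhds] at hab ⊢
  intro ε hε
  have h1 := hab (ε / 2) (half_pos hε)
  rw [Filter.eventually_cofinite] at h1 ⊢
  refine (h1.image (fun x : ℤ × ℤ => x.1 + x.2)).subset ?_
  intro n hn
  by_contra hcon
  apply hn
  have key : ∀ i : ℤ, ‖a i * b (n - i)‖ ≤ ε / 2 * ρ ^ (-n) := by
    intro i
    have hi : ¬ ¬ dist ((‖a i‖ * ρ ^ i) * (‖b (n - i)‖ * ρ ^ (n - i))) 0 < ε / 2 := by
      intro hh
      exact hcon ⟨(i, n - i), hh, by simp⟩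
    rw [not_not, Real.dist_eq, sub_zero, abs_of_nonneg (by positivity)] at hi
    have h0 : ρ ^ i * ρ ^ (n - i) * ρ ^ (-n) = 1 := by
      rw [← zpow_add₀ hρ.ne', ← zpow_add₀ hρ.ne']; simp
    calc ‖a i * b (n - i)‖
        = (‖a i‖ * ρ ^ i) * (‖b (n - i)‖ * ρ ^ (n - i)) * ρ ^ (-n) := by
          rw [norm_mul]; linear_combination (-(‖a i‖ * ‖b (n - i)‖)) * h0
      _ ≤ ε / 2 * ρ ^ (-n) := by gcongr
  have hsum := IsUltrametricDist.norm_tsum_le_of_forall_le key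
  rw [Real.dist_eq, sub_zero, abs_of_nonneg (by positivity)]
  have h0 : ρ ^ (-n) * ρ ^ n = 1 := by rw [← zpow_add₀ hρ.ne']; simp
  calc ‖∑' i : ℤ, a i * b (n - i)‖ * ρ ^ n ≤ (ε / 2 * ρ ^ (-n)) * ρ ^ n := by gcongr
    _ = ε / 2 := by rw [mul_assoc, h0, mul_one]
    _ < ε := half_lt_self hε

theorem conv_assoc [CompleteSpace K] {a b c : ℤ → K} {ρ : ℝ} (hρ : 0 < ρ)
    (ha : Tendsto (fun i : ℤ => ‖a i‖ * ρ ^ i) cofinite (𝓝 0))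
    (hb : Tendsto (fun i : ℤ => ‖b i‖ * ρ ^ i) cofinite (𝓝 0))
    (hc : Tendsto (fun i : ℤ => ‖c i‖ * ρ ^ i) cofinite (𝓝 0)) (n : ℤ) :
    ∑' m : ℤ, (∑' i : ℤ, a i * b (m - i)) * c (n - m) =
      ∑' i : ℤ, a i * ∑' j : ℤ, b j * c (n - i - j) := by
  have hS : Summable (fun x : ℤ × ℤ => a x.2 * b (x.1 - x.2) * c (n - x.1)) := by
    apply NonarchimedeanAddGroup.summable_of_tendsto_cofinite_zero
    rw [tendsto_zero_iff_norm_tendsto_zero]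
    have h3 := (tendsto_mul_cofinite_nhds_zero (null_convTerm ha hb) hc).comp
      (Function.Injective.tendsto_cofinite
        (f := fun x : ℤ × ℤ => ((x.2, x.1 - x.2), n - x.1))
        (fun x y h => by
          simp only [Prod.mk.injEq] at h
          ext <;> omega))
    have h2 := h3.mul_const (ρ ^ (-n))
    rw [zero_mul] at h2
    refine h2.congr fun x => ?_
    have h0 : ρ ^ x.2 * ρ ^ (x.1 - x.2) * ρ ^ (n - x.1) * ρ ^ (-n) = 1 := by
      rw [← zpow_add₀ hρ.ne', ← zpow_add₀ hρ.ne', ← zpow_add₀ hρ.ne']; simp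
    simp only [Function.comp, norm_mul]
    linear_combination (‖a x.2‖ * ‖b (x.1 - x.2)‖ * ‖c (n - x.1)‖) * h0
  calc ∑' m : ℤ, (∑' i : ℤ, a i * b (m - i)) * c (n - m)
      = ∑' m : ℤ, ∑' i : ℤ, a i * b (m - i) * c (n - m) := by
        simp_rw [tsum_mul_right]
    _ = ∑' i : ℤ, ∑' m : ℤ, a i * b (m - i) * c (n - m) :=
        hS.tsum_comm.symm
    _ = ∑' i : ℤ, a i * ∑' j : ℤ, b j * c (n - i - j) := by
        refine tsum_congr fun i => ?_
        rw [← tsum_mul_left, ← (Equiv.addRight i).tsum_eq]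
        refine tsum_congr fun j => ?_
        simp only [Equiv.coe_addRight]
        rw [show j + i - i = j by ring, show n - (j + i) = n - i - j by ring, mul_assoc]

end Aux

variable {K : Type u} [NormedField K] [IsUltrametricDist K] [CompleteSpace K] {I : Radii}

theorem coeff_injective : Function.Injective (coeff : Laurent K I → ℤ → K) :=
  fun _ _ h => Laurent.ext h

theorem summable_mul (f g : Laurent K I) (n : ℤ) :
    Summable (fun i : ℤ => f.coeff i * g.coeff (n - i)) := by
  obtain ⟨ρ, hρ⟩ := I.nonempty
  exact summable_conv (I.pos ρ hρ) (f.tendsto' ρ hρ) (g.tendsto' ρ hρ) n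

instance : Zero (Laurent K I) := ⟨⟨fun _ => 0, fun ρ _ => by simp⟩⟩

/-- The constant function `c`. -/
def const (c : K) : Laurent K I where
  coeff := Pi.single 0 c
  tendsto' ρ _ := by
    refine Tendsto.congr' ?_ tendsto_const_nhds
    rw [Filter.EventuallyEq, Filter.eventually_cofinite]
    refine (Set.finite_singleton (0 : ℤ)).subset fun i hi => ?_
    by_contra h
    apply hi
    have : i ≠ 0 := h
    simp [Pi.single_eq_of_ne this]

instance : One (Laurent K I) := ⟨const 1⟩

instance : Add (Laurent K I) where
  add f g :=
    { coeff := fun i => f.coeff i + g.coeff i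
      tendsto' := fun ρ hρ => by
        have hρ0 := I.pos ρ hρ
        have h := (f.tendsto' ρ hρ).add (g.tendsto' ρ hρ)
        rw [add_zero] at h
        refine squeeze_zero (fun i => by positivity) (fun i => ?_) h
        rw [← add_mul]
        gcongr
        exact norm_add_le _ _ }

instance : Neg (Laurent K I) where
  neg f := ⟨fun i => -f.coeff i, fun ρ hρ => by simpa using f.tendsto' ρ hρ⟩

/-- Multiplication of Laurent series: `(fg)_n = ∑_i f_i g_{n-i}`. -/
instance : Mul (Laurent K I) where
  mul f g := ⟨fun n => ∑' i : ℤ, f.coeff i * g.coeff (n - i), fun ρ hρ =>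
    null_conv (I.pos ρ hρ) (f.tendsto' ρ hρ) (g.tendsto' ρ hρ)⟩

instance : SMul K (Laurent K I) where
  smul c f := ⟨fun i => c * f.coeff i, fun ρ hρ => by
    have h := (f.tendsto' ρ hρ).const_mul ‖c‖
    rw [mul_zero] at h
    exact h.congr fun i => by rw [norm_mul, mul_assoc]⟩

@[simp] theorem coeff_zero (i : ℤ) : (0 : Laurent K I).coeff i = 0 := rfl
@[simp] theorem coeff_one : (1 : Laurent K I).coeff = Pi.single 0 1 := rfl
@[simp] theorem coeff_add (f g : Laurent K I) (i : ℤ) :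
    (f + g).coeff i = f.coeff i + g.coeff i := rfl
@[simp] theorem coeff_neg (f : Laurent K I) (i : ℤ) : (-f).coeff i = -f.coeff i := rfl
theorem coeff_mul (f g : Laurent K I) (n : ℤ) :
    (f * g).coeff n = ∑' i : ℤ, f.coeff i * g.coeff (n - i) := rfl
@[simp] theorem coeff_smul (c : K) (f : Laurent K I) (i : ℤ) :
    (c • f).coeff i = c * f.coeff i := rfl

theorem const_mul_coeff (c : K) (f : Laurent K I) (n : ℤ) :
    (const c * f).coeff n = c * f.coeff n := by
  rw [coeff_mul, tsum_eq_single 0]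
  · simp [const]
  · intro i hi
    simp [const, Pi.single_eq_of_ne hi]

theorem mul_comm' (f g : Laurent K I) : f * g = g * f := by
  ext n
  rw [coeff_mul, coeff_mul, ← (Equiv.subLeft n).tsum_eq]
  refine tsum_congr fun i => ?_
  simp [mul_comm]

theorem left_distrib' (f g h : Laurent K I) : f * (g + h) = f * g + f * h := by
  ext n
  rw [coeff_add, coeff_mul, coeff_mul, coeff_mul,
    ← (summable_mul f g n).tsum_add (summable_mul f h n)]
  exact tsum_congr fun i => by simp [mul_add]

theorem one_mul' (f : Laurent K I) : 1 * f = f := by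
  ext n
  exact (const_mul_coeff 1 f n).trans (one_mul _)

theorem zero_mul' (f : Laurent K I) : 0 * f = 0 := by
  ext n
  simp [coeff_mul]

theorem mul_assoc' (f g h : Laurent K I) : f * g * h = f * (g * h) := by
  ext n
  obtain ⟨ρ, hρ⟩ := I.nonempty
  exact conv_assoc (I.pos ρ hρ) (f.tendsto' ρ hρ) (g.tendsto' ρ hρ) (h.tendsto' ρ hρ) n

instance : CommRing (Laurent K I) where
  add_assoc f g h := by ext; simp [add_assoc]
  zero_add f := by ext; simp
  add_zero f := by ext; simp
  add_comm f g := by ext; simp [add_comm]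
  neg_add_cancel f := by ext; simp
  nsmul := nsmulRec
  zsmul := zsmulRec
  mul_assoc := mul_assoc'
  mul_comm := mul_comm'
  one_mul := one_mul'
  mul_one f := by rw [mul_comm', one_mul']
  zero_mul := zero_mul'
  mul_zero f := by rw [mul_comm', zero_mul']
  left_distrib := left_distrib'
  right_distrib f g h := by rw [mul_comm', left_distrib', mul_comm' h, mul_comm' h]

instance : Algebra K (Laurent K I) where
  algebraMap :=
    { toFun := const
      map_one' := rfl
      map_zero' := by ext i; simp [const]
      map_add' := fun a b => by
        ext i
        by_cases hi : i = 0
        · subst hi; simp [const]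
        · simp [const, Pi.single_eq_of_ne hi]
      map_mul' := fun a b => by
        ext i
        rw [const_mul_coeff]
        by_cases hi : i = 0
        · subst hi; simp [const]
        · simp [const, Pi.single_eq_of_ne hi] }
  commutes' _ _ := mul_comm' _ _
  smul_def' c f := by ext i; exact (const_mul_coeff c f i).symm

/-- The derivative `d/dt` of a Laurent series. -/
def derivFun (f : Laurent K I) : Laurent K I where
  coeff i := ((i + 1 : ℤ) : K) * f.coeff (i + 1)
  tendsto' ρ hρ := by
    have hρ0 := I.pos ρ hρ
    have h := ((f.tendsto' ρ hρ).comp (add_left_injective (1 : ℤ)).tendsto_cofinite).mul_const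
      ρ⁻¹
    rw [zero_mul] at h
    refine squeeze_zero (fun i => by positivity) (fun i => ?_) h
    have h1 : ‖((i + 1 : ℤ) : K)‖ ≤ 1 := IsUltrametricDist.norm_intCast_le_one K _
    have h2 : ρ ^ (i + 1) * ρ⁻¹ = ρ ^ i := by
      rw [zpow_add_one₀ hρ0.ne', mul_assoc, mul_inv_cancel₀ hρ0.ne', mul_one]
    simp only [Function.comp, norm_mul]
    rw [mul_assoc (‖f.coeff (i + 1)‖), h2]
    calc ‖((i + 1 : ℤ) : K)‖ * ‖f.coeff (i + 1)‖ * ρ ^ i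
        ≤ 1 * ‖f.coeff (i + 1)‖ * ρ ^ i := by gcongr
      _ = _ := by rw [one_mul]

@[simp] theorem coeff_derivFun (f : Laurent K I) (i : ℤ) :
    f.derivFun.coeff i = ((i + 1 : ℤ) : K) * f.coeff (i + 1) := rfl

theorem derivFun_mul (f g : Laurent K I) :
    (f * g).derivFun = f * g.derivFun + g * f.derivFun := by
  ext n
  rw [mul_comm' g, coeff_add, coeff_derivFun, coeff_mul, coeff_mul, coeff_mul]
  have hs : Summable (fun i : ℤ => f.derivFun.coeff i * g.coeff (n - i)) :=
    summable_mul f.derivFun g n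
  have e : ∑' i : ℤ, f.derivFun.coeff i * g.coeff (n - i) =
      ∑' i : ℤ, ((i : ℤ) : K) * f.coeff i * g.coeff (n + 1 - i) := by
    rw [← (Equiv.addRight (1 : ℤ)).tsum_eq
      (fun i : ℤ => ((i : ℤ) : K) * f.coeff i * g.coeff (n + 1 - i))]
    refine tsum_congr fun i => ?_
    simp only [Equiv.coe_addRight, coeff_derivFun]
    rw [show n + 1 - (i + 1) = n - i by ring]
  have hs' : Summable (fun i : ℤ => ((i : ℤ) : K) * f.coeff i * g.coeff (n + 1 - i)) := by
    rw [← (Equiv.addRight (1 : ℤ)).summable_iff]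
    refine hs.congr fun i => ?_
    simp only [Function.comp, Equiv.coe_addRight, coeff_derivFun]
    rw [show n + 1 - (i + 1) = n - i by ring]
  rw [e, ← (summable_mul f g.derivFun n).tsum_add hs', ← tsum_mul_left]
  refine tsum_congr fun i => ?_
  simp only [coeff_derivFun]
  rw [show n - i + 1 = n + 1 - i by ring]
  push_cast
  ring

/-- The derivation `d/dt`. -/
def deriv : Derivation K (Laurent K I) (Laurent K I) where
  toFun := derivFun
  map_add' f g := by ext i; simp [mul_add]
  map_smul' c f := by ext i; simp; ring
  map_one_eq_zero' := by
    ext i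
    by_cases hi : i + 1 = 0
    · have : ((i + 1 : ℤ) : K) = 0 := by rw [hi]; simp
      show ((i + 1 : ℤ) : K) * _ = 0
      rw [this, zero_mul]
    · show ((i + 1 : ℤ) : K) * (Pi.single 0 1 : ℤ → K) (i + 1) = 0
      rw [Pi.single_eq_of_ne hi, mul_zero]
  leibniz' f g := by simpa using derivFun_mul f g

/-- Restriction of functions to a smaller annulus. -/
def restrict {I I' : Radii} (h : I'.carrier ⊆ I.carrier) : Laurent K I →ₐ[K] Laurent K I' where
  toFun f := ⟨f.coeff, fun ρ hρ => f.tendsto' ρ (h hρ)⟩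
  map_one' := rfl
  map_mul' _ _ := rfl
  map_zero' := rfl
  map_add' _ _ := rfl
  commutes' _ := rfl

@[simp] theorem coeff_restrict {I I' : Radii} (h : I'.carrier ⊆ I.carrier) (f : Laurent K I) :
    (restrict h f).coeff = f.coeff := rfl

variable (K I) in
/-- The subring of functions all of whose coefficients lie in the valuation ring of `K`. -/
def integral : Subring (Laurent K I) where
  carrier := {f | ∀ i, ‖f.coeff i‖ ≤ 1}
  zero_mem' i := by simp
  one_mem' i := by
    by_cases hi : i = 0
    · subst hi; simp
    · simp [Pi.single_eq_of_ne hi]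
  add_mem' {f g} hf hg i :=
    (IsUltrametricDist.norm_add_le_max _ _).trans (max_le (hf i) (hg i))
  neg_mem' {f} hf i := by simpa using hf i
  mul_mem' {f g} hf hg n := by
    rw [coeff_mul]
    refine IsUltrametricDist.norm_tsum_le_of_forall_le fun i => ?_
    rw [norm_mul]
    exact mul_le_one₀ (hf i) (norm_nonneg _) (hg _)

/-- The derivation `d/dt` preserves integrality of the coefficients. -/
def integralDeriv : Derivation ℤ (integral K I) (integral K I) where
  toFun f := ⟨deriv f.1, fun i => by
    show ‖((i + 1 : ℤ) : K) * f.1.coeff (i + 1)‖ ≤ 1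
    rw [norm_mul]
    exact mul_le_one₀ (IsUltrametricDist.norm_intCast_le_one K _) (norm_nonneg _) (f.2 _)⟩
  map_add' f g := Subtype.ext (map_add deriv f.1 g.1)
  map_smul' n f := Subtype.ext ((deriv : Derivation K (Laurent K I) _).toLinearMap.map_smul_of_tower n f.1)
  map_one_eq_zero' := Subtype.ext (Derivation.map_one_eq_zero deriv)
  leibniz' f g := Subtype.ext (Derivation.leibniz deriv f.1 g.1)

end Laurent

/-! ### Annuli with outer radius `1` and their closed subannuli -/

/-- The radii `ρ ∈ (0,1)` in the divisible closure of the value group of `K`. -/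
def Radius (K : Type u) [NormedField K] : Type :=
  {ρ : ℝ // 0 < ρ ∧ ρ < 1 ∧ ∃ n : ℕ, 0 < n ∧ ∃ x : K, x ≠ 0 ∧ ρ ^ n = ‖x‖}

instance (K : Type u) [NormedField K] : LinearOrder (Radius K) :=
  inferInstanceAs (LinearOrder {x : ℝ // 0 < x ∧ x < 1 ∧ ∃ n : ℕ, 0 < n ∧ ∃ y : K, y ≠ 0 ∧ x ^ n = ‖y‖})

variable {K : Type u} [NormedField K]

/-- The half-open interval `[r,1)`. -/
def Radius.halfOpen (r : Radius K) : Radii where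
  carrier := Set.Ico r.1 1
  nonempty := ⟨r.1, le_refl _, r.2.2.1⟩
  pos _ hx := lt_of_lt_of_le r.2.1 hx.1

/-- A closed aligned interval `[lo, hi]` contained in `[r,1)`. -/
structure ClosedInterval (r : Radius K) where
  lo : Radius K
  hi : Radius K
  le_lo : r ≤ lo
  lo_le_hi : lo ≤ hi

namespace ClosedInterval

variable {r : Radius K}

/-- The set of radii in `[lo, hi]`. -/
def radii (J : ClosedInterval r) : Radii where
  carrier := Set.Icc J.lo.1 J.hi.1
  nonempty := ⟨J.lo.1, le_refl _, J.lo_le_hi⟩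
  pos _ hρ := lt_of_lt_of_le J.lo.2.1 hρ.1

/-- Inclusion of closed intervals. -/
instance : LE (ClosedInterval r) := ⟨fun J' J => J.lo ≤ J'.lo ∧ J'.hi ≤ J.hi⟩

theorem le_refl' (J : ClosedInterval r) : J ≤ J := ⟨le_refl _, le_refl _⟩

theorem le_trans' {J J' J'' : ClosedInterval r} (h : J' ≤ J) (h' : J'' ≤ J') : J'' ≤ J :=
  ⟨le_trans h.1 h'.1, le_trans h'.2 h.2⟩

theorem radii_subset {J J' : ClosedInterval r} (h : J' ≤ J) :
    J'.radii.carrier ⊆ J.radii.carrier :=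
  fun _ hρ => ⟨le_trans h.1 hρ.1, le_trans hρ.2 h.2⟩

theorem radii_subset_halfOpen (J : ClosedInterval r) :
    J.radii.carrier ⊆ r.halfOpen.carrier :=
  fun _ hρ => ⟨le_trans J.le_lo hρ.1, lt_of_le_of_lt hρ.2 J.hi.2.2.1⟩

/-- A closed subinterval of `[s,1)`, seen as a closed subinterval of `[r,1)` for `r ≤ s`. -/
abbrev up {r s : Radius K} (h : r ≤ s) (J : ClosedInterval s) : ClosedInterval r where
  lo := J.lo
  hi := J.hi
  le_lo := le_trans h J.le_lo
  lo_le_hi := J.lo_le_hi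

/-- The interval `[c,c]` in `[r,1)`. -/
abbrev point {r : Radius K} (c : Radius K) (h : r ≤ c) : ClosedInterval r := ⟨c, c, h, le_refl _⟩

end ClosedInterval

/-- The ring of rigid analytic functions on the closed annulus `A(J)`. -/
abbrev Func {r : Radius K} (J : ClosedInterval r) : Type u := Laurent K J.radii

variable [IsUltrametricDist K] [CompleteSpace K]

/-- Restriction of functions from `A(J)` to `A(J')`. -/
abbrev resFunc {r : Radius K} {J J' : ClosedInterval r} (h : J' ≤ J) : Func J →+* Func J' :=
  (Laurent.restrict (ClosedInterval.radii_subset h)).toRingHom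

/-- The ring of rigid analytic functions on `A[r,1)` with coefficients in the valuation ring. -/
abbrev IntFunc (r : Radius K) : Type u := Laurent.integral K r.halfOpen

instance {r : Radius K} (J : ClosedInterval r) : Algebra (IntFunc r) (Func J) :=
  ((Laurent.restrict J.radii_subset_halfOpen).toRingHom.comp
    (Laurent.integral K r.halfOpen).subtype).toAlgebra

/-! ### `∇`-modules -/

/-- For a ring homomorphism `φ : R → S`, an `R`-module `M` and an `S`-module `N`, the `φ`-semilinear
map `f : M → N` induces an isomorphism `S ⊗_R M ≃ N`. -/
def IsSemilinearBaseChange {R S : Type*} [CommRing R] [CommRing S] (φ : R →+* S)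
    {M N : Type*} [AddCommGroup M] [AddCommGroup N] [Module R M] [Module S N]
    (f : M →ₛₗ[φ] N) : Prop :=
  letI : Algebra R S := φ.toAlgebra
  letI : Module R N := Module.compHom N φ
  haveI : IsScalarTower R S N := ⟨fun a b c => mul_smul (φ a) b c⟩
  IsBaseChange S ({ toFun := f, map_add' := f.map_add, map_smul' := fun a m => f.map_smulₛₗ a m } :
    M →ₗ[R] N)

/-- A `∇`-module on the annulus `A[r,1)`: a coherent locally free sheaf with a connection.

The sheaf is given by its modules of sections over the closed annuli `A(J)`, `J ⊆ [r,1)`, which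
are finite projective over the ring of functions on `A(J)`, with restriction maps that induce
isomorphisms after base change. Since `Ω¹` is freely generated by `dt`, the connection is given by
the action `D` of `d/dt`, i.e. `∇ v = D v ⊗ dt`. -/
structure NablaModule (r : Radius K) where
  sec : ClosedInterval r → Type v
  [addCommGroup : ∀ J, AddCommGroup (sec J)]
  [module : ∀ J, Module (Func J) (sec J)]
  finite : ∀ J, Module.Finite (Func J) (sec J)
  projective : ∀ J, Module.Projective (Func J) (sec J)
  res : ∀ {J J' : ClosedInterval r} (h : J' ≤ J), sec J →ₛₗ[resFunc h] sec J'
  res_refl : ∀ (J : ClosedInterval r) (v : sec J), res J.le_refl' v = v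
  res_trans : ∀ {J J' J'' : ClosedInterval r} (h : J' ≤ J) (h' : J'' ≤ J') (v : sec J),
    res h' (res h v) = res (ClosedInterval.le_trans' h h') v
  isBaseChange : ∀ {J J' : ClosedInterval r} (h : J' ≤ J),
    IsSemilinearBaseChange (resFunc h) (res h)
  D : ∀ J, sec J →+ sec J
  leibniz : ∀ J (f : Func J) (v : sec J), D J (f • v) = Laurent.deriv f • v + f • D J v
  res_D : ∀ {J J' : ClosedInterval r} (h : J' ≤ J) (v : sec J), res h (D J v) = D J' (res h v)

attribute [instance] NablaModule.addCommGroup NablaModule.module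

namespace NablaModule

variable {r : Radius K}

/-- Restriction of a `∇`-module from `A[r,1)` to `A[s,1)`. -/
def restrict (E : NablaModule.{u, v} r) {s : Radius K} (h : r ≤ s) : NablaModule.{u, v} s where
  sec J := E.sec (J.up h)
  addCommGroup J := E.addCommGroup (J.up h)
  module J := E.module (J.up h)
  finite J := E.finite (J.up h)
  projective J := E.projective (J.up h)
  res {J J'} hJ := E.res (J := J.up h) (J' := J'.up h) hJ
  res_refl J := E.res_refl (J.up h)
  res_trans {J J' J''} hJ hJ' := E.res_trans (J := J.up h) (J' := J'.up h) (J'' := J''.up h) hJ hJ'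
  isBaseChange {J J'} hJ := E.isBaseChange (J := J.up h) (J' := J'.up h) hJ
  D J := E.D (J.up h)
  leibniz J := E.leibniz (J.up h)
  res_D {J J'} hJ := E.res_D (J := J.up h) (J' := J'.up h) hJ

variable (E : NablaModule.{u, v} r)

instance (J : ClosedInterval r) : Module K (E.sec J) :=
  Module.compHom _ (algebraMap K (Func J))

instance (J : ClosedInterval r) : IsScalarTower K (Func J) (E.sec J) :=
  IsScalarTower.of_algebraMap_smul fun _ _ => rfl

instance (J : ClosedInterval r) : Module (IntFunc r) (E.sec J) :=
  Module.compHom _ (algebraMap (IntFunc r) (Func J))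

instance (J : ClosedInterval r) : IsScalarTower (IntFunc r) (Func J) (E.sec J) :=
  IsScalarTower.of_algebraMap_smul fun _ _ => rfl

theorem D_smul (J : ClosedInterval r) (c : K) (v : E.sec J) : E.D J (c • v) = c • E.D J v := by
  rw [← algebraMap_smul (Func J) c v, E.leibniz, Derivation.map_algebraMap, zero_smul, zero_add,
    algebraMap_smul]

theorem res_smul {J J' : ClosedInterval r} (h : J' ≤ J) (c : K) (v : E.sec J) :
    E.res h (c • v) = c • E.res h v := by
  rw [← algebraMap_smul (Func J) c v, map_smulₛₗ, ← algebraMap_smul (Func J') c]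
  rfl

/-- Sections over `A[r,1)`: compatible families of sections over the closed subannuli. -/
def sections : Submodule K (∀ J, E.sec J) where
  carrier := {v | ∀ (J J' : ClosedInterval r) (h : J' ≤ J), E.res h (v J) = v J'}
  zero_mem' _ _ h := (E.res h).map_zero
  add_mem' {v w} hv hw J J' h := ((E.res h).map_add _ _).trans (by rw [hv J J' h, hw J J' h]; rfl)
  smul_mem' c v hv J J' h := (E.res_smul h c _).trans (by rw [hv J J' h]; rfl)

/-- The connection on sections over `A[r,1)` (with `Ω¹` trivialized by `dt`). -/
def nabla : E.sections →ₗ[K] E.sections where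
  toFun v := ⟨fun J => E.D J (v.1 J), fun J J' h => by rw [E.res_D, v.2 J J' h]⟩
  map_add' v w := Subtype.ext (funext fun J => map_add (E.D J) _ _)
  map_smul' c v := Subtype.ext (funext fun J => E.D_smul J c _)

/-- Sections over `A[r,1)` of the dual sheaf `E^∨ = Hom(E, O)`. -/
def dualSections : Submodule K (∀ J, E.sec J →ₗ[Func J] Func J) where
  carrier := {φ | ∀ (J J' : ClosedInterval r) (h : J' ≤ J) (v : E.sec J),
    φ J' (E.res h v) = resFunc h (φ J v)}
  zero_mem' J J' h v := by simp
  add_mem' {φ ψ} hφ hψ J J' h v := by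
    simp only [Pi.add_apply, LinearMap.add_apply, map_add, hφ J J' h v, hψ J J' h v]
  smul_mem' c φ hφ J J' h v := by
    simp only [Pi.smul_apply, LinearMap.smul_apply, hφ J J' h v]
    exact (map_smul (Laurent.restrict (ClosedInterval.radii_subset h)) c (φ J v)).symm

/-- The dual connection over `A(J)`: `(D φ)(v) = d/dt (φ v) - φ (D v)`. -/
def dualD (J : ClosedInterval r) : (E.sec J →ₗ[Func J] Func J) →ₗ[K] (E.sec J →ₗ[Func J] Func J)
    where
  toFun φ :=
    { toFun := fun v => Laurent.deriv (φ v) - φ (E.D J v)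
      map_add' := fun v w => by simp only [map_add]; abel
      map_smul' := fun f v => by
        simp only [map_smul, E.leibniz, map_add, smul_eq_mul, Derivation.leibniz,
          RingHom.id_apply]
        ring }
  map_add' φ ψ := by
    ext1 v
    simp only [LinearMap.add_apply, LinearMap.coe_mk, AddHom.coe_mk, map_add]
    abel
  map_smul' c φ := by
    ext1 v
    simp only [LinearMap.smul_apply, LinearMap.coe_mk, AddHom.coe_mk, RingHom.id_apply, smul_sub]
    rw [Derivation.map_smul]

theorem dualD_apply (J : ClosedInterval r) (φ : E.sec J →ₗ[Func J] Func J) (v : E.sec J) :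
    E.dualD J φ v = Laurent.deriv (φ v) - φ (E.D J v) := rfl

/-- The dual connection on sections of `E^∨` over `A[r,1)`. -/
def dualNabla : E.dualSections →ₗ[K] E.dualSections where
  toFun φ := ⟨fun J => E.dualD J (φ.1 J), fun J J' h v => by
    rw [dualD_apply, dualD_apply, ← E.res_D, φ.2 J J' h, φ.2 J J' h, map_sub]
    rfl⟩
  map_add' φ ψ := Subtype.ext (funext fun J => map_add (E.dualD J) _ _)
  map_smul' c φ := Subtype.ext (funext fun J => map_smul (E.dualD J) c _)

/-! ### Cohomology and the local duality pairing -/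

section Levels

variable {a b : Radius K} (ha : r ≤ a) (hb : r ≤ b) (h : a ≤ b)

/-- Restriction of sections from `A[a,1)` to `A[b,1)`. -/
def sectionsMap : (E.restrict ha).sections →ₗ[K] (E.restrict hb).sections where
  toFun v := ⟨fun J => v.1 (J.up h), fun J J' hJ => v.2 (J.up h) (J'.up h) hJ⟩
  map_add' _ _ := rfl
  map_smul' _ _ := rfl

/-- Restriction of sections of the dual from `A[a,1)` to `A[b,1)`. -/
def dualSectionsMap : (E.restrict ha).dualSections →ₗ[K] (E.restrict hb).dualSections where
  toFun φ := ⟨fun J => φ.1 (J.up h), fun J J' hJ => φ.2 (J.up h) (J'.up h) hJ⟩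
  map_add' _ _ := rfl
  map_smul' _ _ := rfl

end Levels

/-- Horizontal sections of `E^∨` over `A[r,1)`. -/
abbrev kerDual : Submodule K E.dualSections := LinearMap.ker E.dualNabla

/-- The cokernel of `∇` on sections over `A[r,1)`. -/
abbrev coker : Type v := E.sections ⧸ LinearMap.range E.nabla

/-- Transition maps of the system of horizontal sections of `E^∨`. -/
def kerDualMap (a b : Set.Ici r) (h : a ≤ b) :
    (E.restrict a.2).kerDual →ₗ[K] (E.restrict b.2).kerDual :=
  (E.dualSectionsMap a.2 b.2 h).restrict fun φ hφ => by
    rw [LinearMap.mem_ker] at hφ ⊢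
    exact Subtype.ext (funext fun J =>
      congrFun (congrArg Subtype.val hφ) (J.up h))

/-- Transition maps of the system of cokernels of `∇`. -/
def cokerMap (a b : Set.Ici r) (h : a ≤ b) :
    (E.restrict a.2).coker →ₗ[K] (E.restrict b.2).coker :=
  Submodule.mapQ _ _ (E.sectionsMap a.2 b.2 h) (by
    rintro _ ⟨w, rfl⟩
    exact ⟨E.sectionsMap a.2 b.2 h w, rfl⟩)

/-- `H⁰(E^∨)`: the direct limit of the horizontal sections of `E^∨` on `A[a,1)` as `a → 1`. -/
abbrev H0Dual : Type (max u v) :=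
  Module.DirectLimit (fun a : Set.Ici r => (E.restrict a.2).kerDual) E.kerDualMap

/-- `H¹(E)`: the direct limit of the cokernels of `∇` on `A[a,1)` as `a → 1`. -/
abbrev H1 : Type v :=
  Module.DirectLimit (fun a : Set.Ici r => (E.restrict a.2).coker) E.cokerMap

/-- The residue map, sending the class of `∑ c_i t^i dt` to `c_{-1}`. -/
def residue {I : Radii} : Laurent K I →ₗ[K] K where
  toFun f := f.coeff (-1)
  map_add' _ _ := rfl
  map_smul' _ _ := rfl

theorem residue_deriv {I : Radii} (f : Laurent K I) : residue (Laurent.deriv f) = 0 := by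
  show (((-1 : ℤ) + 1 : ℤ) : K) * f.coeff (-1 + 1) = 0
  simp

/-- For a section `φ` of `E^∨` and a section `v dt` of `E ⊗ Ω¹` over `A[r,1)`, the residue of the
`1`-form `φ(v) dt`. It may be computed on any closed subannulus; here we use `|t| = r`. -/
def residuePairing : E.dualSections →ₗ[K] E.sections →ₗ[K] K :=
  LinearMap.mk₂ K
    (fun φ v => residue (φ.1 (.point r (le_refl r)) (v.1 (.point r (le_refl r)))))
    (fun _ _ _ => by
      simp only [Submodule.coe_add, Pi.add_apply, LinearMap.add_apply, map_add])
    (fun _ _ _ => by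
      simp only [Submodule.coe_smul, Pi.smul_apply, LinearMap.smul_apply, map_smul])
    (fun _ _ _ => by simp only [Submodule.coe_add, Pi.add_apply, map_add])
    (fun c φ v => by
      simp only [Submodule.coe_smul, Pi.smul_apply]
      rw [LinearMap.map_smul_of_tower, map_smul])

theorem residuePairing_apply (φ : E.dualSections) (v : E.sections) (J : ClosedInterval r) :
    E.residuePairing φ v = residue (φ.1 J (v.1 J)) := by
  have key : ∀ (J J' : ClosedInterval r) (_ : J' ≤ J),
      residue (φ.1 J' (v.1 J')) = residue (φ.1 J (v.1 J)) := by
    intro J J' h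
    rw [← v.2 J J' h, φ.2 J J' h]
    rfl
  let J₀ : ClosedInterval r := ⟨r, J.hi, le_refl r, le_trans J.le_lo J.lo_le_hi⟩
  exact (key J₀ _ ⟨le_refl r, J₀.lo_le_hi⟩).trans (key J₀ J ⟨J.le_lo, le_refl _⟩).symm

/-- The pairing `ker(∇ on E^∨) × coker(∇ on E) → K` over `A[r,1)`. -/
def levelPairing : E.kerDual →ₗ[K] E.coker →ₗ[K] K :=
  LinearMap.flip <| Submodule.liftQ _ (E.residuePairing.domRestrict E.kerDual).flip (by
    rintro _ ⟨w, rfl⟩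
    rw [LinearMap.mem_ker]
    ext φ
    have hφ : E.dualD (.point r (le_refl r)) (φ.1.1 (.point r (le_refl r))) = 0 :=
      congrFun (congrArg Subtype.val (LinearMap.mem_ker.1 φ.2)) _
    have h2 := LinearMap.congr_fun hφ (w.1 (.point r (le_refl r)))
    rw [dualD_apply, LinearMap.zero_apply, sub_eq_zero] at h2
    show residue (φ.1.1 (.point r (le_refl r)) (E.D _ (w.1 (.point r (le_refl r))))) = 0
    rw [← h2, residue_deriv])

theorem levelPairing_mk (φ : E.kerDual) (v : E.sections) :
    E.levelPairing φ (Submodule.Quotient.mk v) = E.residuePairing φ.1 v := rfl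

theorem levelPairing_map (a b : Set.Ici r) (h : a ≤ b) (φ : (E.restrict a.2).kerDual)
    (x : (E.restrict a.2).coker) :
    (E.restrict b.2).levelPairing (E.kerDualMap a b h φ) (E.cokerMap a b h x) =
      (E.restrict a.2).levelPairing φ x := by
  obtain ⟨v, rfl⟩ := Submodule.Quotient.mk_surjective _ x
  rw [levelPairing_mk,
    residuePairing_apply _ _ _ ((ClosedInterval.point b.1 (le_refl b.1)).up h)]
  rfl

/-- The pairing of a horizontal section of `E^∨` over `A[a,1)` with a class in the cokernel of `∇`
over `A[b,1)`, computed over `A[max(a,b),1)`. -/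
def mixedPairing (a b : Set.Ici r) :
    (E.restrict a.2).kerDual →ₗ[K] (E.restrict b.2).coker →ₗ[K] K :=
  (E.restrict (max a b).2).levelPairing.compl₁₂
    (E.kerDualMap a (max a b) (le_max_left a b)) (E.cokerMap b (max a b) (le_max_right a b))

theorem cokerMap_cokerMap (a b c : Set.Ici r) (h : a ≤ b) (h' : b ≤ c)
    (x : (E.restrict a.2).coker) :
    E.cokerMap b c h' (E.cokerMap a b h x) = E.cokerMap a c (h.trans h') x := by
  obtain ⟨v, rfl⟩ := Submodule.Quotient.mk_surjective _ x
  rfl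

theorem kerDualMap_kerDualMap (a b c : Set.Ici r) (h : a ≤ b) (h' : b ≤ c)
    (φ : (E.restrict a.2).kerDual) :
    E.kerDualMap b c h' (E.kerDualMap a b h φ) = E.kerDualMap a c (h.trans h') φ := rfl

theorem mixedPairing_eq (a b c : Set.Ici r) (h : a ≤ c) (h' : b ≤ c)
    (φ : (E.restrict a.2).kerDual) (x : (E.restrict b.2).coker) :
    E.mixedPairing a b φ x =
      (E.restrict c.2).levelPairing (E.kerDualMap a c h φ) (E.cokerMap b c h' x) := by
  have e := E.levelPairing_map (max a b) c (max_le h h')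
    (E.kerDualMap a (max a b) (le_max_left a b) φ) (E.cokerMap b (max a b) (le_max_right a b) x)
  have e₁ := E.kerDualMap_kerDualMap a (max a b) c (le_max_left a b) (max_le h h') φ
  have e₂ := E.cokerMap_cokerMap b (max a b) c (le_max_right a b) (max_le h h') x
  exact e.symm.trans (congrArg₂ (fun ψ y => (E.restrict c.2).levelPairing ψ y) e₁ e₂)

theorem mixedPairing_map (a a' b b' : Set.Ici r) (h : a ≤ a') (h' : b ≤ b')
    (φ : (E.restrict a.2).kerDual) (x : (E.restrict b.2).coker) :
    E.mixedPairing a' b' (E.kerDualMap a a' h φ) (E.cokerMap b b' h' x) =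
      E.mixedPairing a b φ x := by
  have e := E.mixedPairing_eq a' b' (max a' b') (le_max_left _ _) (le_max_right _ _)
    (E.kerDualMap a a' h φ) (E.cokerMap b b' h' x)
  have e' := E.mixedPairing_eq a b (max a' b') (h.trans (le_max_left _ _))
    (h'.trans (le_max_right _ _)) φ x
  have e₁ := E.kerDualMap_kerDualMap a a' (max a' b') h (le_max_left _ _) φ
  have e₂ := E.cokerMap_cokerMap b b' (max a' b') h' (le_max_right _ _) x
  exact e.trans ((congrArg₂ (fun ψ y => (E.restrict (max a' b').2).levelPairing ψ y) e₁ e₂).trans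
    e'.symm)

theorem kerDualMap_self (a : Set.Ici r) (φ : (E.restrict a.2).kerDual) :
    E.kerDualMap a a le_rfl φ = φ := rfl

theorem cokerMap_self (a : Set.Ici r) (x : (E.restrict a.2).coker) :
    E.cokerMap a a le_rfl x = x := by
  obtain ⟨v, rfl⟩ := Submodule.Quotient.mk_surjective _ x
  rfl

/-- The pairing of a horizontal section of `E^∨` over `A[a,1)` with `H¹(E)`. -/
def pairingH1 (a : Set.Ici r) : (E.restrict a.2).kerDual →ₗ[K] E.H1 →ₗ[K] K :=
  LinearMap.flip <| Module.DirectLimit.lift K _ _ _ (fun b => (E.mixedPairing a b).flip) (by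
    intro b b' h x
    refine LinearMap.ext fun φ => ?_
    exact (congrArg (fun ψ => E.mixedPairing a b' ψ _) (E.kerDualMap_self a φ)).symm.trans
      (E.mixedPairing_map a a b b' le_rfl h φ x))

theorem pairingH1_of (a b : Set.Ici r) (φ : (E.restrict a.2).kerDual)
    (x : (E.restrict b.2).coker) :
    E.pairingH1 a φ (Module.DirectLimit.of K _ _ E.cokerMap b x) = E.mixedPairing a b φ x := by
  rw [pairingH1, LinearMap.flip_apply, Module.DirectLimit.lift_of, LinearMap.flip_apply]

/-- The local duality pairing `H⁰(E^∨) × H¹(E) → H¹(O) ≃ K`. -/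
def localDuality : E.H0Dual →ₗ[K] E.H1 →ₗ[K] K :=
  Module.DirectLimit.lift K _ _ _ E.pairingH1 (by
    intro a a' h φ
    refine Module.DirectLimit.hom_ext fun b => LinearMap.ext fun x => ?_
    have e := E.mixedPairing_map a a' b b h le_rfl φ x
    have e₁ := congrArg (E.mixedPairing a' b (E.kerDualMap a a' h φ)) (E.cokerMap_self b x)
    exact (E.pairingH1_of a' b (E.kerDualMap a a' h φ) x).trans
      ((e₁.symm.trans e).trans (E.pairingH1_of a b φ x).symm))

theorem localDuality_of (a b : Set.Ici r) (φ : (E.restrict a.2).kerDual)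
    (x : (E.restrict b.2).coker) :
    E.localDuality (Module.DirectLimit.of K _ _ E.kerDualMap a φ)
      (Module.DirectLimit.of K _ _ E.cokerMap b x) = E.mixedPairing a b φ x := by
  rw [localDuality, Module.DirectLimit.lift_of, pairingH1_of]

/-- `E` is dualizable if its local duality pairing is perfect: it induces isomorphisms
`H⁰(E^∨) ≃ H¹(E)^∨` and `H¹(E) ≃ H⁰(E^∨)^∨`. -/
def IsDualizable : Prop :=
  Function.Bijective E.localDuality ∧ Function.Bijective E.localDuality.flip

end NablaModule

/-! ### Quasi-constant `∇`-modules -/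


/-- The unique derivation of a formally étale `A`-algebra `S` extending a derivation of `A`. -/
def etaleDeriv {A S : Type*} [CommRing A] [CommRing S] [Algebra A S] [Algebra.FormallyEtale A S]
    (d : Derivation ℤ A A) : Derivation ℤ S S :=
  ((LinearMap.liftBaseChange S (Algebra.linearMap A S ∘ₗ d.liftKaehlerDifferential)) ∘ₗ
    (KaehlerDifferential.tensorKaehlerEquivOfFormallyEtale ℤ A S).symm.toLinearMap).compDer
      (KaehlerDifferential.D ℤ S)

theorem etaleDeriv_algebraMap {A S : Type*} [CommRing A] [CommRing S] [Algebra A S]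
    [Algebra.FormallyEtale A S] (d : Derivation ℤ A A) (a : A) :
    etaleDeriv (S := S) d (algebraMap A S a) = algebraMap A S (d a) := by
  simp [etaleDeriv, KaehlerDifferential.tensorKaehlerEquivOfFormallyEtale_symm_D_algebraMap]

namespace NablaModule

variable {r : Radius K} (E : NablaModule.{u, v} r)

section Pullback

variable (S : Type u) [CommRing S] [Algebra (IntFunc r) S]

/-- Let `f : X → A[r,1)` be the finite cover whose functions over `A(J)` are `S ⊗ O(A(J))`. This is
the module of sections of `f^* E` over the inverse image of `A(J)`. -/
abbrev pullback (J : ClosedInterval r) : Type (max u v) := S ⊗[IntFunc r] E.sec J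

/-- The restriction map of `E`, as a map linear over the integral functions on `A[r,1)`. -/
def resInt {J J' : ClosedInterval r} (h : J' ≤ J) : E.sec J →ₗ[IntFunc r] E.sec J' where
  toFun := E.res h
  map_add' := map_add _
  map_smul' a v := by
    rw [← algebraMap_smul (Func J) a v, map_smulₛₗ, RingHom.id_apply,
      ← algebraMap_smul (Func J') a]
    rfl

/-- The restriction maps of `f^* E`. -/
def pullbackRes {J J' : ClosedInterval r} (h : J' ≤ J) :
    E.pullback S J →ₗ[S] E.pullback S J' :=
  (E.resInt h).baseChange S

/-- Multiplication on `f^* E` by (the pullback of) a function on `A(J)`. -/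
def pullbackSMul (J : ClosedInterval r) (f : Func J) : E.pullback S J →ₗ[S] E.pullback S J :=
  (Algebra.lsmul (IntFunc r) (IntFunc r) (E.sec J) f).baseChange S

theorem D_smul_int (J : ClosedInterval r) (a : IntFunc r) (v : E.sec J) :
    E.D J (a • v) = Laurent.integralDeriv a • v + a • E.D J v := by
  rw [← algebraMap_smul (Func J) a v, E.leibniz, algebraMap_smul,
    ← algebraMap_smul (Func J) (Laurent.integralDeriv a) v]
  rfl

/-- The pulled back connection on `f^* E`: `D (s ⊗ v) = ds/dt ⊗ v + s ⊗ D v`. -/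
def pullbackD [Algebra.FormallyEtale (IntFunc r) S] (J : ClosedInterval r) :
    E.pullback S J →+ E.pullback S J :=
  TensorProduct.liftAddHom
    (AddMonoidHom.mk' (fun s => AddMonoidHom.mk'
        (fun v => etaleDeriv (A := IntFunc r) Laurent.integralDeriv s ⊗ₜ[IntFunc r] v
          + s ⊗ₜ[IntFunc r] E.D J v)
        (fun v w => by simp only [map_add, TensorProduct.tmul_add]; abel))
      (fun s s' => by
        ext v
        simp only [AddMonoidHom.mk'_apply, AddMonoidHom.add_apply, map_add,
          TensorProduct.add_tmul]
        abel))
    (fun a s v => by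
      simp only [AddMonoidHom.mk'_apply, D_smul_int, TensorProduct.tmul_add, Algebra.smul_def a s,
        Derivation.leibniz, etaleDeriv_algebraMap]
      simp only [smul_eq_mul, TensorProduct.add_tmul, TensorProduct.tmul_smul,
        TensorProduct.smul_tmul', Algebra.smul_def, mul_comm s]
      abel)

theorem pullbackD_tmul [Algebra.FormallyEtale (IntFunc r) S] (J : ClosedInterval r) (s : S)
    (v : E.sec J) :
    E.pullbackD S J (s ⊗ₜ v) =
      etaleDeriv (A := IntFunc r) Laurent.integralDeriv s ⊗ₜ v + s ⊗ₜ E.D J v := rfl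

/-- `f^* E` is spanned by finitely many horizontal sections `w_1, …, w_n` over `X`: over each
closed annulus, `f^* E` is generated by the `w_i` as a module over the functions
`S ⊗ O(A(J))` on the inverse image of `A(J)`. -/
def IsConstantOver [Algebra.FormallyEtale (IntFunc r) S] : Prop :=
  ∃ (n : ℕ) (w : Fin n → ∀ J : ClosedInterval r, E.pullback S J),
    (∀ i (J J' : ClosedInterval r) (h : J' ≤ J), E.pullbackRes S h (w i J) = w i J') ∧
    (∀ i J, E.pullbackD S J (w i J) = 0) ∧
    ∀ J, Submodule.span S {x | ∃ i, ∃ f : Func J, x = E.pullbackSMul S J f (w i J)} = ⊤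

end Pullback

/-- `E` is quasi-constant if, on some `A[s,1)`, it becomes spanned by finitely many horizontal
sections after pullback to a (nonempty) formally étale cover of `A[s,1)`, i.e. a finite étale
cover that is defined over the ring of functions with integral coefficients. -/
def IsQuasiConstant : Prop :=
  ∃ (s : Radius K) (h : r ≤ s) (S : Type u) (_ : CommRing S) (_ : Algebra (IntFunc s) S)
    (_ : Algebra.Etale (IntFunc s) S),
    Nontrivial S ∧ Module.Finite (IntFunc s) S ∧ (E.restrict h).IsConstantOver S

/-- On the whole of `A[r,1)`, `E` has a finite filtration `0 = F_0 ⊆ F_1 ⊆ ⋯ ⊆ F_l = E` by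
`∇`-submodules whose successive quotients are (isomorphic to) quasi-constant `∇`-modules. -/
def HasQuasiConstantFiltrationOn : Prop :=
  ∃ (l : ℕ) (F : Fin (l + 1) → ∀ J : ClosedInterval r, Submodule (Func J) (E.sec J))
    (Q : Fin l → NablaModule.{u, v} r)
    (π : ∀ (i : Fin l) (J : ClosedInterval r), F i.succ J →ₗ[Func J] (Q i).sec J),
    (∀ J, F 0 J = ⊥) ∧ (∀ J, F (Fin.last l) J = ⊤) ∧
    (∀ (i : Fin l) J, F i.castSucc J ≤ F i.succ J) ∧
    (∀ i J, ∀ v ∈ F i J, E.D J v ∈ F i J) ∧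
    (∀ i (J J' : ClosedInterval r) (h : J' ≤ J), ∀ v ∈ F i J, E.res h v ∈ F i J') ∧
    (∀ i J, Function.Surjective (π i J)) ∧
    (∀ (i : Fin l) J (v : F i.succ J), π i J v = 0 ↔ v.1 ∈ F i.castSucc J) ∧
    (∀ (i : Fin l) J (v v' : F i.succ J), v'.1 = E.D J v.1 → π i J v' = (Q i).D J (π i J v)) ∧
    (∀ (i : Fin l) (J J' : ClosedInterval r) (h : J' ≤ J) (v : F i.succ J) (v' : F i.succ J'),
      v'.1 = E.res h v.1 → π i J' v' = (Q i).res h (π i J v)) ∧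
    ∀ i, (Q i).IsQuasiConstant

/-- `E`, as an object of the direct limit of the categories of `∇`-modules on `A[s,1)`, has a
finite filtration whose successive quotients are quasi-constant. -/
def HasQuasiConstantFiltration : Prop :=
  ∃ (s : Radius K) (h : r ≤ s), (E.restrict h).HasQuasiConstantFiltrationOn

end NablaModule

end

end PadicDE

namespace PadicDE

noncomputable section

/-! Three properties near the outer boundary force perfectness: `E` has a finite dual basis there,
the horizontal sections of `E^∨` have bounded dimension, and a section having zero residue against
all of them becomes a derivative after shrinking. The first makes `H⁰(E^∨) → H¹(E)^∨` injective
(pair with `t^n e_i`), the third makes `H¹(E) → H⁰(E^∨)^∨` injective, and the second gives the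
finite dimension that turns two injections into bijections (`isDualizable_of_good`). These
properties are `Good`; `VeryGood` adds the mirror conditions for `E^∨`.

The model is the structure sheaf: since `|1/n| ≤ n`, the residue is the only obstruction to
integrating a Laurent series, at the cost of a smaller annulus. For quasi-constant `E` the whole
cover is not needed. One point of it suffices, namely a homomorphism from `S` to the functions on a
ramified annulus `t = u^e v(u)` over a finite extension `N` of `K` (`exists_coverPoint`). Pulled
back along it, `E` is generated by horizontal sections, and a minimal set of them is a basis because
the constant terms of a relation again form a relation (`const_relation`). Coordinates are
integrated in `u` and brought back by the trace, which commutes with `d` and respects residues; this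
gives `CoverBasis.veryGood`.

The point comes from reduction, and here the integrality of the cover is essential. Integral
functions reduce to `κ((t))`, where `κ` is the residue field of an algebraic closure of `K`. The
reduced cover has a point in a finite separable extension of `κ((t))`, which embeds into `κ((u))`
with `t = u^e w` because `κ` is algebraically closed (`exists_uniformization`). Finitely many
coefficients of `w` and of the point are lifted to a finite `N`. A positive `u`-order of the
reduction means Gauss norm less than `1` near the outer boundary, so Newton's method is a
contraction there and produces a true point (`exists_coverPoint_of_newton`).

For filtrations, an extension of a very good family by a good one is good (`ShortExact.good`). The
sequence splits over functions because a first derived limit vanishes. Integrating in the quotient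
leaves a section of the subobject, which is corrected through horizontal sections of the quotient;
the finite linear system that arises is solvable because a horizontal form whose obstruction is
orthogonal to those sections extends. Induction along the filtration concludes. -/

theorem tendsto_zero_of_uniform_bound {ι κ : Type*} {a : ι → κ → ℝ} {b : κ → ℝ}
    (hb : ∀ n, 0 ≤ b n)
    (hab : ∀ n, ∀ ε : ℝ, 0 < ε → (∀ i, a i n ≤ ε) → b n ≤ ε)
    (hs : ∀ ε : ℝ, 0 < ε → ∃ s : Set ι, s.Finite ∧ ∀ i, i ∉ s → ∀ n, a i n ≤ ε)
    (ha : ∀ i, Tendsto (a i) cofinite (𝓝 0)) :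
    Tendsto b cofinite (𝓝 0) := by
  rw [Metric.tendsto_nhds]
  intro ε hε
  obtain ⟨s, hsf, hs⟩ := hs (ε / 2) (half_pos hε)
  have h1 : ∀ᶠ n in cofinite, ∀ i ∈ s, a i n < ε / 2 :=
    (Filter.eventually_all_finite hsf).2 fun i _ =>
      (ha i).eventually (gt_mem_nhds (half_pos hε))
  filter_upwards [h1] with n hn
  have : b n ≤ ε / 2 := hab n _ (half_pos hε) fun i => by
    by_cases hi : i ∈ s
    · exact (hn i hi).le
    · exact hs i hi n
  rw [Real.dist_eq, sub_zero, abs_of_nonneg (hb n)]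
  linarith

/-! ### Gauss norms, convergent sums and fixed points of Laurent series -/

namespace Laurent

variable {N : Type u} [NormedField N] [IsUltrametricDist N] {I : Radii}

/-- The Gauss norm of `f` at radius `ρ` is at most `M`. -/
def GaussLE (ρ M : ℝ) (f : Laurent N I) : Prop := ∀ i, ‖f.coeff i‖ * ρ ^ i ≤ M

theorem GaussLE.mono {ρ M M' : ℝ} {f : Laurent N I} (h : GaussLE ρ M f) (hM : M ≤ M') :
    GaussLE ρ M' f := fun i => (h i).trans hM

theorem GaussLE.nonneg {ρ M : ℝ} {f : Laurent N I} (h : GaussLE ρ M f) : 0 ≤ M := by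
  have := h 0
  simp only [zpow_zero, mul_one] at this
  exact (norm_nonneg _).trans this

theorem GaussLE.norm_coeff_le {ρ M : ℝ} (hρ : 0 < ρ) {f : Laurent N I} (h : GaussLE ρ M f)
    (i : ℤ) : ‖f.coeff i‖ ≤ M * ρ ^ (-i) := by
  have h0 : ρ ^ i * ρ ^ (-i) = 1 := by rw [← zpow_add₀ hρ.ne']; simp
  calc ‖f.coeff i‖ = ‖f.coeff i‖ * ρ ^ i * ρ ^ (-i) := by rw [mul_assoc, h0, mul_one]
    _ ≤ M * ρ ^ (-i) := by
      have := h i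
      gcongr

theorem gaussLE_of_norm_coeff_le {ρ M : ℝ} (hρ : 0 < ρ) {f : Laurent N I}
    (h : ∀ i, ‖f.coeff i‖ ≤ M * ρ ^ (-i)) : GaussLE ρ M f := fun i => by
  have h0 : ρ ^ (-i) * ρ ^ i = 1 := by rw [← zpow_add₀ hρ.ne']; simp
  calc ‖f.coeff i‖ * ρ ^ i ≤ M * ρ ^ (-i) * ρ ^ i := by
        have := h i
        gcongr
    _ = M := by rw [mul_assoc, h0, mul_one]

theorem exists_gaussLE {ρ : ℝ} (hρ : ρ ∈ I.carrier) (f : Laurent N I) :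
    ∃ M, 0 < M ∧ GaussLE ρ M f := by
  have hρ0 := I.pos ρ hρ
  have h := (f.tendsto' ρ hρ).eventually (gt_mem_nhds one_pos)
  rw [Filter.eventually_cofinite] at h
  obtain ⟨M, hM⟩ := (h.image fun i => ‖f.coeff i‖ * ρ ^ i).bddAbove
  refine ⟨max M 1, by positivity, fun i => ?_⟩
  by_cases hi : ‖f.coeff i‖ * ρ ^ i < 1
  · exact hi.le.trans (le_max_right _ _)
  · exact (hM ⟨i, hi, rfl⟩).trans (le_max_left _ _)

variable [CompleteSpace N]

theorem gaussLE_zero {ρ M : ℝ} (hM : 0 ≤ M) : GaussLE ρ M (0 : Laurent N I) := fun i => by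
  simpa using hM

theorem GaussLE.add {ρ M : ℝ} (hρ : 0 < ρ) {f g : Laurent N I} (hf : GaussLE ρ M f)
    (hg : GaussLE ρ M g) : GaussLE ρ M (f + g) :=
  gaussLE_of_norm_coeff_le hρ fun i =>
    (IsUltrametricDist.norm_add_le_max _ _).trans
      (max_le (hf.norm_coeff_le hρ i) (hg.norm_coeff_le hρ i))

theorem GaussLE.neg {ρ M : ℝ} {f : Laurent N I} (hf : GaussLE ρ M f) : GaussLE ρ M (-f) :=
  fun i => by simpa using hf i

theorem GaussLE.sub {ρ M : ℝ} (hρ : 0 < ρ) {f g : Laurent N I} (hf : GaussLE ρ M f)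
    (hg : GaussLE ρ M g) : GaussLE ρ M (f - g) := by
  rw [sub_eq_add_neg]; exact hf.add hρ hg.neg

theorem GaussLE.sum {ι : Type*} {ρ M : ℝ} (hρ : 0 < ρ) (hM : 0 ≤ M) (s : Finset ι)
    {f : ι → Laurent N I} (hf : ∀ i ∈ s, GaussLE ρ M (f i)) : GaussLE ρ M (∑ i ∈ s, f i) := by
  classical
  induction s using Finset.induction_on with
  | empty => simpa using gaussLE_zero hM
  | insert a s ha ih =>
    rw [Finset.sum_insert ha]
    exact (hf a (Finset.mem_insert_self _ _)).add hρ
      (ih fun i hi => hf i (Finset.mem_insert_of_mem hi))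

theorem GaussLE.mul {ρ M M' : ℝ} (hρ : 0 < ρ) {f g : Laurent N I} (hf : GaussLE ρ M f)
    (hg : GaussLE ρ M' g) : GaussLE ρ (M * M') (f * g) :=
  gaussLE_of_norm_coeff_le hρ fun n => by
    rw [coeff_mul]
    refine IsUltrametricDist.norm_tsum_le_of_forall_le fun i => ?_
    rw [norm_mul]
    have h0 : ρ ^ (-i) * ρ ^ (-(n - i)) = ρ ^ (-n) := by
      rw [← zpow_add₀ hρ.ne']; congr 1; ring
    calc ‖f.coeff i‖ * ‖g.coeff (n - i)‖ ≤ (M * ρ ^ (-i)) * (M' * ρ ^ (-(n - i))) := by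
          have := hf.nonneg
          exact mul_le_mul (hf.norm_coeff_le hρ i) (hg.norm_coeff_le hρ _) (norm_nonneg _)
            (by positivity)
      _ = M * M' * ρ ^ (-n) := by rw [← h0]; ring

theorem gaussLE_one {ρ : ℝ} : GaussLE ρ 1 (1 : Laurent N I) := fun i => by
  by_cases hi : i = 0
  · subst hi; simp
  · simp [Pi.single_eq_of_ne hi]

theorem GaussLE.pow {ρ M : ℝ} (hρ : 0 < ρ) {f : Laurent N I} (hf : GaussLE ρ M f) (n : ℕ) :
    GaussLE ρ (M ^ n) (f ^ n) := by
  induction n with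
  | zero => simpa using gaussLE_one
  | succ n ih => rw [pow_succ, pow_succ]; exact ih.mul hρ hf

theorem GaussLE.smul {ρ M : ℝ} (c : N) {f : Laurent N I} (hf : GaussLE ρ M f) :
    GaussLE ρ (‖c‖ * M) (c • f) := fun i => by
  rw [coeff_smul, norm_mul, mul_assoc]
  exact mul_le_mul_of_nonneg_left (hf i) (norm_nonneg _)

theorem eq_zero_of_gaussLE {ρ : ℝ} (hρ : 0 < ρ) {f : Laurent N I} {M : ℕ → ℝ}
    (hM : Tendsto M atTop (𝓝 0)) (h : ∀ n, GaussLE ρ (M n) f) : f = 0 := by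
  ext i
  have h1 : ‖f.coeff i‖ * ρ ^ i ≤ 0 := ge_of_tendsto' hM fun n => h n i
  have h2 : 0 < ρ ^ i := zpow_pos hρ i
  rw [coeff_zero, ← norm_le_zero_iff]
  by_contra hc
  push Not at hc
  exact absurd h1 (not_le.2 (mul_pos hc h2))

/-! Infinite sums of Laurent series -/

/-- The Gauss norms of the family `F` tend to zero at every radius. -/
def LSummable {ι : Type*} (F : ι → Laurent N I) : Prop :=
  ∀ ρ ∈ I.carrier, ∃ M : ι → ℝ, (∀ i, GaussLE ρ (M i) (F i)) ∧ Tendsto M cofinite (𝓝 0)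

theorem LSummable.summable_coeff {ι : Type*} {F : ι → Laurent N I} (h : LSummable F) (n : ℤ) :
    Summable fun i => (F i).coeff n := by
  obtain ⟨ρ, hρ⟩ := I.nonempty
  obtain ⟨M, hM, hM0⟩ := h ρ hρ
  apply NonarchimedeanAddGroup.summable_of_tendsto_cofinite_zero
  have h2 := hM0.mul_const (ρ ^ (-n))
  rw [zero_mul] at h2
  exact squeeze_zero_norm (fun i => (hM i).norm_coeff_le (I.pos ρ hρ) n) h2

/-- The sum of a family of Laurent series whose Gauss norms tend to zero. -/
def lsum {ι : Type*} (F : ι → Laurent N I) (h : LSummable F) : Laurent N I where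
  coeff n := ∑' i, (F i).coeff n
  tendsto' ρ hρ := by
    obtain ⟨M, hM, hM0⟩ := h ρ hρ
    have hρ0 := I.pos ρ hρ
    refine tendsto_zero_of_uniform_bound (a := fun i n => ‖(F i).coeff n‖ * ρ ^ n)
      (fun n => by positivity) (fun n ε hε hn => ?_) (fun ε hε => ?_) fun i => (F i).tendsto' ρ hρ
    · have h0 : ρ ^ (-n) * ρ ^ n = 1 := by rw [← zpow_add₀ hρ0.ne']; simp
      have : ‖∑' i, (F i).coeff n‖ ≤ ε * ρ ^ (-n) := by
        refine IsUltrametricDist.norm_tsum_le_of_forall_le_of_nonneg (by positivity) fun i => ?_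
        rw [zpow_neg, ← div_eq_mul_inv, le_div_iff₀ (zpow_pos hρ0 n)]
        exact hn i
      calc _ ≤ ε * ρ ^ (-n) * ρ ^ n := by gcongr
        _ = ε := by rw [mul_assoc, h0, mul_one]
    · refine ⟨{i | ¬ M i < ε}, ?_, fun i hi n => ?_⟩
      · exact Filter.eventually_cofinite.1 (hM0.eventually (gt_mem_nhds hε))
      · simp only [Set.mem_ofPred_eq, not_not] at hi
        exact (hM i n).trans hi.le

@[simp] theorem coeff_lsum {ι : Type*} (F : ι → Laurent N I) (h : LSummable F) (n : ℤ) :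
    (lsum F h).coeff n = ∑' i, (F i).coeff n := rfl

theorem LSummable.mul_right {ι : Type*} {F : ι → Laurent N I} (h : LSummable F)
    (g : Laurent N I) : LSummable fun i => F i * g := fun ρ hρ => by
  obtain ⟨M, hM, hM0⟩ := h ρ hρ
  obtain ⟨M', -, hM'⟩ := exists_gaussLE hρ g
  refine ⟨fun i => M i * M', fun i => (hM i).mul (I.pos ρ hρ) hM', ?_⟩
  simpa using hM0.mul_const M'

theorem lsum_mul {ι : Type*} {F : ι → Laurent N I} (h : LSummable F) (g : Laurent N I) :
    lsum F h * g = lsum (fun i => F i * g) (h.mul_right g) := by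
  obtain ⟨ρ, hρ⟩ := I.nonempty
  obtain ⟨M, hM, hM0⟩ := h ρ hρ
  have hρ0 := I.pos ρ hρ
  ext n
  simp only [coeff_mul, coeff_lsum]
  simp_rw [← tsum_mul_right]
  have hS : Summable (fun x : ℤ × ι => (F x.2).coeff x.1 * g.coeff (n - x.1)) := by
    apply NonarchimedeanAddGroup.summable_of_tendsto_cofinite_zero
    have h1 : Tendsto (fun m : ℤ => ‖g.coeff (n - m)‖ * ρ ^ (n - m)) cofinite (𝓝 0) :=
      (g.tendsto' ρ hρ).comp (Function.Injective.tendsto_cofinite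
        (f := fun m : ℤ => n - m) fun a b hab => by simpa using hab)
    have h2 := (tendsto_mul_cofinite_nhds_zero h1 hM0).mul_const (ρ ^ (-n))
    rw [zero_mul] at h2
    refine squeeze_zero_norm (fun x => ?_) h2
    rw [norm_mul]
    have h0 : ρ ^ (n - x.1) * ρ ^ (-n) = ρ ^ (-x.1) := by
      rw [← zpow_add₀ hρ0.ne']; congr 1; ring
    calc ‖(F x.2).coeff x.1‖ * ‖g.coeff (n - x.1)‖
        ≤ (M x.2 * ρ ^ (-x.1)) * ‖g.coeff (n - x.1)‖ := by
          have := (hM x.2).norm_coeff_le hρ0 x.1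
          gcongr
      _ = _ := by rw [← h0]; ring
  exact (Summable.tsum_comm (f := fun m i => (F i).coeff m * g.coeff (n - m)) hS).symm

theorem mul_lsum {ι : Type*} {F : ι → Laurent N I} (h : LSummable F) (g : Laurent N I) :
    ∃ h' : LSummable fun i => g * F i, g * lsum F h = lsum (fun i => g * F i) h' := by
  have e : (fun i => g * F i) = fun i => F i * g := funext fun i => mul_comm _ _
  rw [mul_comm, lsum_mul, e]
  exact ⟨h.mul_right g, rfl⟩

theorem LSummable.deriv {ι : Type*} {F : ι → Laurent N I} (h : LSummable F) :
    LSummable fun i => Laurent.deriv (F i) := fun ρ hρ => by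
  obtain ⟨M, hM, hM0⟩ := h ρ hρ
  have hρ0 := I.pos ρ hρ
  refine ⟨fun i => M i * ρ⁻¹, fun i => ?_, by simpa using hM0.mul_const ρ⁻¹⟩
  refine gaussLE_of_norm_coeff_le hρ0 fun n => ?_
  show ‖((n + 1 : ℤ) : N) * (F i).coeff (n + 1)‖ ≤ _
  rw [norm_mul]
  have h1 : ‖((n + 1 : ℤ) : N)‖ ≤ 1 := IsUltrametricDist.norm_intCast_le_one N _
  calc ‖((n + 1 : ℤ) : N)‖ * ‖(F i).coeff (n + 1)‖ ≤ 1 * (M i * ρ ^ (-(n + 1))) :=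
        mul_le_mul h1 ((hM i).norm_coeff_le hρ0 _) (norm_nonneg _) zero_le_one
    _ = M i * ρ⁻¹ * ρ ^ (-n) := by
      rw [neg_add, zpow_add₀ hρ0.ne', zpow_neg_one]; ring

theorem deriv_lsum {ι : Type*} {F : ι → Laurent N I} (h : LSummable F) :
    Laurent.deriv (lsum F h) = lsum (fun i => Laurent.deriv (F i)) h.deriv := by
  ext n
  show ((n + 1 : ℤ) : N) * ∑' i, (F i).coeff (n + 1) = ∑' i, ((n + 1 : ℤ) : N) * (F i).coeff (n + 1)
  rw [tsum_mul_left]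

/-- A contraction of a nonempty closed set of Laurent series has a fixed point. -/
theorem exists_fixed_point {D : Laurent N I → Prop} (Φ : Laurent N I → Laurent N I)
    (hclosed : ∀ (x : ℕ → Laurent N I) (y : Laurent N I), (∀ k, D (x k)) →
      (∀ n, Tendsto (fun k => (x k).coeff n) atTop (𝓝 (y.coeff n))) → D y)
    (y₀ : Laurent N I) (h₀ : D y₀) (hΦ : ∀ y, D y → D (Φ y))
    (hc : ∀ ρ ∈ I.carrier, ∃ c : ℝ, 0 ≤ c ∧ c < 1 ∧ ∀ x y, D x → D y → ∀ t, GaussLE ρ t (x - y) →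
      GaussLE ρ (c * t) (Φ x - Φ y)) : ∃ y, D y ∧ Φ y = y := by
  let x : ℕ → Laurent N I := fun k => Φ^[k] y₀
  have hx : ∀ k, x (k + 1) = Φ (x k) := fun k => Function.iterate_succ_apply' _ _ _
  have hxD : ∀ k, D (x k) := fun k => by
    induction k with
    | zero => exact h₀
    | succ k ih => rw [hx]; exact hΦ _ ih
  have hb : ∀ ρ ∈ I.carrier, ∃ c M : ℝ, 0 ≤ c ∧ c < 1 ∧ 0 ≤ M ∧
      (∀ k, GaussLE ρ (c ^ k * M) (x (k + 1) - x k)) ∧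
      (∀ x y, D x → D y → ∀ t, GaussLE ρ t (x - y) → GaussLE ρ (c * t) (Φ x - Φ y)) := by
    intro ρ hρ
    obtain ⟨c, hc0, hc1, hc⟩ := hc ρ hρ
    obtain ⟨M, hM0, hM⟩ := exists_gaussLE hρ (x 1 - x 0)
    refine ⟨c, M, hc0, hc1, hM0.le, fun k => ?_, hc⟩
    induction k with
    | zero => simpa using hM
    | succ k ih =>
      have := hc _ _ (hxD (k + 1)) (hxD k) _ ih
      rwa [← hx, ← hx, ← mul_assoc, ← pow_succ'] at this
  have hsum : LSummable fun k => x (k + 1) - x k := by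
    intro ρ hρ
    obtain ⟨c, M, hc0, hc1, hM0, hM, -⟩ := hb ρ hρ
    refine ⟨fun k => c ^ k * M, hM, ?_⟩
    rw [Nat.cofinite_eq_atTop]
    simpa using (tendsto_pow_atTop_nhds_zero_of_lt_one hc0 hc1).mul_const M
  let y : Laurent N I := y₀ + lsum _ hsum
  have hlim : ∀ n, Tendsto (fun k => (x k).coeff n) atTop (𝓝 (y.coeff n)) := by
    intro n
    have h1 := (hsum.summable_coeff n).hasSum.tendsto_sum_nat
    have h2 : ∀ k, ∑ i ∈ Finset.range k, (x (i + 1) - x i).coeff n =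
        (x k).coeff n - y₀.coeff n := by
      intro k
      have : ∀ i, (x (i + 1) - x i).coeff n = (x (i + 1)).coeff n - (x i).coeff n := fun i => by
        rw [sub_eq_add_neg, coeff_add, coeff_neg, sub_eq_add_neg]
      simp_rw [this]
      exact Finset.sum_range_sub (fun i => (x i).coeff n) k
    simp_rw [h2] at h1
    have h3 := h1.const_add (y₀.coeff n)
    simp only [add_sub_cancel] at h3
    exact h3
  have hyD : D y := hclosed x y hxD hlim
  refine ⟨y, hyD, ?_⟩
  -- A series is determined by its coefficients, so the fixed point equation may be checked at a
  -- single radius.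
  obtain ⟨ρ, hρ⟩ := I.nonempty
  have hρ0 := I.pos ρ hρ
  obtain ⟨c, M, hc0, hc1, hM0, hM, hcon⟩ := hb ρ hρ
  have hyx : ∀ k, GaussLE ρ (c ^ k * M) (y - x k) := by
    intro k
    have hkm : ∀ m, GaussLE ρ (c ^ k * M) (x (k + m) - x k) := by
      intro m
      induction m with
      | zero => simpa using gaussLE_zero (by positivity)
      | succ m ih =>
        have e : x (k + (m + 1)) - x k = (x (k + m + 1) - x (k + m)) + (x (k + m) - x k) := by
          rw [← add_assoc]; ring
        rw [e]
        refine GaussLE.add hρ0 ((hM (k + m)).mono ?_) ih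
        exact mul_le_mul_of_nonneg_right (pow_le_pow_of_le_one hc0 hc1.le (by omega)) hM0
    intro n
    have h1 : Tendsto (fun m => ‖(x (k + m) - x k).coeff n‖ * ρ ^ n) atTop
        (𝓝 (‖(y - x k).coeff n‖ * ρ ^ n)) := by
      refine Tendsto.mul_const _ (Tendsto.norm ?_)
      simp only [sub_eq_add_neg, coeff_add, coeff_neg]
      refine Tendsto.add_const _ ?_
      have := (tendsto_add_atTop_iff_nat k).2 (hlim n)
      simpa [add_comm k] using this
    exact le_of_tendsto' h1 fun m => hkm m n
  rw [← sub_eq_zero]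
  refine eq_zero_of_gaussLE hρ0 (M := fun k => c ^ (k + 1) * M) ?_ fun k => ?_
  · have := (tendsto_pow_atTop_nhds_zero_of_lt_one hc0 hc1).mul_const M
    rw [zero_mul] at this
    exact (tendsto_add_atTop_iff_nat 1).2 this
  · have e : Φ y - y = (Φ y - Φ (x k)) - (y - x (k + 1)) := by rw [hx]; ring
    rw [e]
    refine GaussLE.sub hρ0 ?_ (hyx (k + 1))
    rw [pow_succ', mul_assoc]
    exact hcon _ _ hyD (hxD k) _ (hyx k)

end Laurent

end

end PadicDE

/-! ### Ramified substitutions `t = u^e v(u)` -/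

namespace PadicDE

noncomputable section

/-- The valuation ring of an ultrametric normed field. -/
abbrev IntRing (N : Type u) [NormedField N] [IsUltrametricDist N] : ValuationSubring N :=
  (NormedField.valuation (K := N)).valuationSubring

theorem IntRing.norm_le {N : Type u} [NormedField N] [IsUltrametricDist N] (x : IntRing N) :
    ‖(x : N)‖ ≤ 1 := x.2

theorem IntRing.norm_unit {N : Type u} [NormedField N] [IsUltrametricDist N] (x : (IntRing N)ˣ) :
    ‖((x : IntRing N) : N)‖ = 1 := by
  refine le_antisymm (IntRing.norm_le _) ?_
  have h : ((x : IntRing N) : N) * ((x⁻¹ : (IntRing N)ˣ) : IntRing N) = 1 := by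
    exact_mod_cast congrArg (Subtype.val) (x.mul_inv)
  have h2 := congrArg norm h
  rw [norm_mul, norm_one] at h2
  have := IntRing.norm_le ((x⁻¹ : (IntRing N)ˣ) : IntRing N)
  nlinarith [norm_nonneg ((x : IntRing N) : N)]

/-- The annulus lies in the open unit disc. -/
class Radii.InDisc (I : Radii) : Prop where
  lt_one : ∀ ρ ∈ I.carrier, ρ < 1

/-- The preimage of `I` under `ρ ↦ ρ ^ e`. -/
def Radii.root (e : ℕ) [NeZero e] (I : Radii) : Radii where
  carrier := {ρ | 0 < ρ ∧ ρ ^ e ∈ I.carrier}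
  nonempty := by
    obtain ⟨ρ, hρ⟩ := I.nonempty
    have h0 := I.pos ρ hρ
    refine ⟨ρ ^ ((e : ℝ)⁻¹), Real.rpow_pos_of_pos h0 _, ?_⟩
    rwa [Real.rpow_inv_natCast_pow h0.le (NeZero.ne e)]
  pos _ hρ := hρ.1

theorem Radii.exists_root {e : ℕ} [NeZero e] {I : Radii} {ρ : ℝ} (hρ : ρ ∈ I.carrier) :
    ∃ σ ∈ (I.root e).carrier, σ ^ e = ρ := by
  have h0 := I.pos ρ hρ
  have h := Real.rpow_inv_natCast_pow h0.le (NeZero.ne e)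
  exact ⟨ρ ^ ((e : ℝ)⁻¹), ⟨Real.rpow_pos_of_pos h0 _, by rwa [h]⟩, h⟩

instance {e : ℕ} [NeZero e] {I : Radii} [hI : I.InDisc] : (I.root e).InDisc where
  lt_one _ hρ := (pow_lt_one_iff_of_nonneg hρ.1.le (NeZero.ne e)).1 (hI.lt_one _ hρ.2)

instance {K : Type u} [NormedField K] (r : Radius K) : r.halfOpen.InDisc where
  lt_one _ hρ := hρ.2

instance {K : Type u} [NormedField K] {r : Radius K} (J : ClosedInterval r) : J.radii.InDisc where
  lt_one _ hρ := lt_of_le_of_lt hρ.2 J.hi.2.2.1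

theorem Radii.root_subset {e : ℕ} [NeZero e] {I I' : Radii} (h : I'.carrier ⊆ I.carrier) :
    (I'.root e).carrier ⊆ (I.root e).carrier := fun _ hρ => ⟨hρ.1, h hρ.2⟩

theorem tendsto_zpow_cofinite_of_bddBelow {N : Type u} [NormedField N] {c : ℤ → N} {k : ℤ}
    (h0 : ∀ i < k, c i = 0) {M : ℝ} (hM : ∀ i, ‖c i‖ ≤ M) {ρ : ℝ} (hρ : 0 < ρ) (hρ1 : ρ < 1) :
    Tendsto (fun i : ℤ => ‖c i‖ * ρ ^ i) cofinite (𝓝 0) := by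
  rw [Int.cofinite_eq]
  refine Tendsto.sup ?_ ?_
  · refine Tendsto.congr' ?_ tendsto_const_nhds
    filter_upwards [eventually_lt_atBot k] with i hi
    simp [h0 i hi]
  · have h1 : Tendsto (fun i : ℤ => ρ ^ i) atTop (𝓝 0) := by
      have h2 : Tendsto (fun i : ℤ => i.toNat) atTop atTop :=
        tendsto_atTop.2 fun b => (eventually_ge_atTop (b : ℤ)).mono fun i hi => by omega
      refine ((tendsto_pow_atTop_nhds_zero_of_lt_one hρ.le hρ1).comp h2).congr' ?_
      filter_upwards [eventually_ge_atTop (0 : ℤ)] with i hi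
      simp only [Function.comp]
      rw [← zpow_natCast, Int.toNat_of_nonneg hi]
    have h3 := h1.const_mul M
    rw [mul_zero] at h3
    exact squeeze_zero (fun i => by positivity) (fun i => by
      have := hM i
      gcongr) h3

namespace Laurent

variable {N : Type u} [NormedField N] [IsUltrametricDist N] [CompleteSpace N] {I : Radii}

/-- The monomial `c t^n`. -/
def mono (c : N) (n : ℤ) : Laurent N I where
  coeff := Pi.single n c
  tendsto' ρ _ := by
    refine Tendsto.congr' ?_ tendsto_const_nhds
    rw [Filter.EventuallyEq, Filter.eventually_cofinite]
    refine (Set.finite_singleton n).subset fun i hi => ?_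
    by_contra h
    apply hi
    have : i ≠ n := h
    simp [Pi.single_eq_of_ne this]

theorem coeff_mono (c : N) (n : ℤ) : (mono c n : Laurent N I).coeff = Pi.single n c := rfl

theorem coeff_mono_mul (c : N) (n : ℤ) (f : Laurent N I) (m : ℤ) :
    (mono c n * f).coeff m = c * f.coeff (m - n) := by
  rw [coeff_mul, tsum_eq_single n]
  · simp [coeff_mono]
  · intro i hi
    simp [coeff_mono, Pi.single_eq_of_ne hi]

theorem mono_mul_mono (c d : N) (n m : ℤ) :
    (mono c n : Laurent N I) * mono d m = mono (c * d) (n + m) := by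
  ext k
  rw [coeff_mono_mul, coeff_mono, coeff_mono]
  by_cases hk : k = n + m
  · subst hk; simp
  · rw [Pi.single_eq_of_ne hk, Pi.single_eq_of_ne (by omega), mul_zero]

theorem mono_zero_eq_one : (mono 1 0 : Laurent N I) = 1 := rfl

theorem gaussLE_mono {ρ : ℝ} (hρ : 0 < ρ) (c : N) (n : ℤ) :
    GaussLE ρ (‖c‖ * ρ ^ n) (mono c n : Laurent N I) := fun i => by
  rw [coeff_mono]
  by_cases hi : i = n
  · subst hi; simp
  · rw [Pi.single_eq_of_ne hi]; simp; positivity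

theorem smul_eq_mono_mul (c : N) (f : Laurent N I) : c • f = mono c 0 * f := by
  ext n; rw [coeff_mono_mul]; simp

theorem coeff_sub (f g : Laurent N I) (i : ℤ) : (f - g).coeff i = f.coeff i - g.coeff i := by
  rw [sub_eq_add_neg, coeff_add, coeff_neg, sub_eq_add_neg]

/-- The additive map sending a Laurent series to its `n`-th coefficient. -/
def coeffHom (n : ℤ) : Laurent N I →ₗ[N] N where
  toFun f := f.coeff n
  map_add' _ _ := rfl
  map_smul' _ _ := rfl

theorem coeff_sum {ι : Type*} (s : Finset ι) (f : ι → Laurent N I) (n : ℤ) :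
    (∑ i ∈ s, f i).coeff n = ∑ i ∈ s, (f i).coeff n := map_sum (coeffHom n) f s

@[simp] theorem coeff_deriv (f : Laurent N I) (i : ℤ) :
    (Laurent.deriv f).coeff i = ((i + 1 : ℤ) : N) * f.coeff (i + 1) := rfl

theorem deriv_restrict {I' : Radii} (h : I'.carrier ⊆ I.carrier) (f : Laurent N I) :
    Laurent.deriv (restrict h f) = restrict h (Laurent.deriv f) := rfl

theorem restrict_mono {I' : Radii} (h : I'.carrier ⊆ I.carrier) (c : N) (n : ℤ) :
    restrict h (mono c n : Laurent N I) = mono c n := rfl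

theorem coeff_eq_of_restrict {I' : Radii} (h : I'.carrier ⊆ I.carrier) {f g : Laurent N I}
    (e : restrict h f = restrict h g) : f = g := by
  ext i; exact congrFun (congrArg coeff e) i

/-- The extension of a sequence of coefficients by zero. -/
def psCoeff (F : PowerSeries (IntRing N)) (i : ℤ) : N :=
  if 0 ≤ i then ((PowerSeries.coeff i.toNat F : IntRing N) : N) else 0

theorem psCoeff_natCast (F : PowerSeries (IntRing N)) (i : ℕ) :
    psCoeff F i = ((PowerSeries.coeff i F : IntRing N) : N) := by simp [psCoeff]

theorem psCoeff_of_neg (F : PowerSeries (IntRing N)) {i : ℤ} (hi : i < 0) :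
    psCoeff F i = 0 := by simp [psCoeff, hi]

theorem norm_psCoeff_le (F : PowerSeries (IntRing N)) (i : ℤ) : ‖psCoeff F i‖ ≤ 1 := by
  unfold psCoeff
  split_ifs
  · exact IntRing.norm_le _
  · simp

theorem psCoeff_mul (F G : PowerSeries (IntRing N)) (n : ℤ) :
    psCoeff (F * G) n = ∑' i : ℤ, psCoeff F i * psCoeff G (n - i) := by
  rcases lt_or_ge n 0 with hn | hn
  · rw [psCoeff_of_neg _ hn]
    symm
    convert tsum_zero with i
    rcases lt_or_ge i 0 with hi | hi
    · rw [psCoeff_of_neg _ hi, zero_mul]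
    · rw [psCoeff_of_neg G (by omega), mul_zero]
  · obtain ⟨m, rfl⟩ := Int.eq_ofNat_of_zero_le hn
    rw [psCoeff_natCast, PowerSeries.coeff_mul,
      tsum_eq_sum (s := (Finset.range (m + 1)).map Nat.castEmbedding),
      Finset.sum_map, Finset.Nat.sum_antidiagonal_eq_sum_range_succ_mk]
    · push_cast
      refine Finset.sum_congr rfl fun i hi => ?_
      have : i ≤ m := by simpa [Nat.lt_succ_iff] using hi
      simp only [Nat.castEmbedding_apply]
      rw [psCoeff_natCast, ← Nat.cast_sub this, psCoeff_natCast]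
    · intro i hi
      rcases lt_or_ge i 0 with hi0 | hi0
      · rw [psCoeff_of_neg _ hi0, zero_mul]
      · rw [psCoeff_of_neg G, mul_zero]
        by_contra hc
        apply hi
        rw [Finset.mem_map]
        exact ⟨i.toNat, by simp; omega, by simp [hi0]⟩

/-- A power series with integral coefficients, as a function on a subannulus of the open disc. -/
def ofPowerSeries [hI : I.InDisc] : PowerSeries (IntRing N) →+* Laurent N I where
  toFun F := ⟨psCoeff F, fun ρ hρ => tendsto_zpow_cofinite_of_bddBelow
    (fun _ hi => psCoeff_of_neg F hi) (norm_psCoeff_le F) (I.pos ρ hρ) (hI.lt_one ρ hρ)⟩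
  map_one' := by
    ext i
    rcases lt_or_ge i 0 with hi | hi
    · rw [coeff_one, Pi.single_eq_of_ne (by omega)]; exact psCoeff_of_neg _ hi
    · obtain ⟨m, rfl⟩ := Int.eq_ofNat_of_zero_le hi
      rw [coeff_one]
      refine (psCoeff_natCast _ m).trans ?_
      rw [PowerSeries.coeff_one]
      by_cases hm : m = 0
      · subst hm; simp
      · rw [Pi.single_eq_of_ne (by omega)]; simp [hm]
  map_mul' F G := by ext n; exact psCoeff_mul F G n
  map_zero' := by ext i; simp [psCoeff]
  map_add' F G := by
    ext i
    show psCoeff (F + G) i = psCoeff F i + psCoeff G i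
    unfold psCoeff
    split_ifs <;> simp

theorem coeff_ofPowerSeries [I.InDisc] (F : PowerSeries (IntRing N)) :
    (ofPowerSeries F : Laurent N I).coeff = psCoeff F := rfl

end Laurent

/-- A ramified change of variable `t = u^e v(u)` with `v` a unit of `o_N⟦u⟧`. -/
structure Ramification (N : Type u) [NormedField N] [IsUltrametricDist N] where
  e : ℕ
  [ne : NeZero e]
  v : (PowerSeries (IntRing N))ˣ

attribute [instance] Ramification.ne

namespace Ramification

open Laurent

variable {N : Type u} [NormedField N] [IsUltrametricDist N] [CompleteSpace N] (Y : Ramification N)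
  {I : Radii}

/-- The `i`-th power of `u^e v(u)`. -/
def pow [I.InDisc] (i : ℤ) : Laurent N I := mono 1 (Y.e * i) * ofPowerSeries ↑(Y.v ^ i)

theorem coeff_pow [I.InDisc] (i n : ℤ) :
    (Y.pow i : Laurent N I).coeff n = psCoeff ↑(Y.v ^ i) (n - Y.e * i) := by
  rw [pow, coeff_mono_mul, one_mul, coeff_ofPowerSeries]

theorem coeff_pow_eq_zero [I.InDisc] {i n : ℤ} (h : n < Y.e * i) :
    (Y.pow i : Laurent N I).coeff n = 0 := by
  rw [coeff_pow, psCoeff_of_neg _ (by omega)]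

theorem norm_coeff_pow_le [I.InDisc] (i n : ℤ) : ‖(Y.pow i : Laurent N I).coeff n‖ ≤ 1 := by
  rw [coeff_pow]; exact norm_psCoeff_le _ _

theorem pow_zero [I.InDisc] : (Y.pow 0 : Laurent N I) = 1 := by
  rw [pow, mul_zero, zpow_zero, Units.val_one, map_one, mul_one]; rfl

theorem pow_add [I.InDisc] (i j : ℤ) : (Y.pow (i + j) : Laurent N I) = Y.pow i * Y.pow j := by
  rw [pow, pow, pow, zpow_add, Units.val_mul, map_mul, mul_add, ← mul_one (1 : N),
    ← mono_mul_mono, mul_one]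
  ring

theorem restrict_pow {I' : Radii} [I.InDisc] [I'.InDisc] (h : I'.carrier ⊆ I.carrier) (i : ℤ) :
    restrict h (Y.pow i) = Y.pow i := by
  ext n; rw [coeff_restrict, coeff_pow, coeff_pow]

theorem gaussLE_pow [I.InDisc] {ρ : ℝ} (hρ : 0 < ρ) (hρ1 : ρ < 1) (i : ℤ) :
    GaussLE ρ ((ρ ^ Y.e) ^ i) (Y.pow i : Laurent N I) := fun n => by
  rcases lt_or_ge n (Y.e * i) with h | h
  · rw [coeff_pow_eq_zero _ h]; simp; positivity
  · calc ‖(Y.pow i : Laurent N I).coeff n‖ * ρ ^ n ≤ 1 * ρ ^ (Y.e * i) := by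
          refine mul_le_mul (Y.norm_coeff_pow_le i n) ?_ (by positivity) zero_le_one
          exact zpow_le_zpow_right_of_le_one₀ hρ hρ1.le h
      _ = _ := by rw [one_mul, zpow_mul, zpow_natCast]

/-- The logarithmic derivative `i ↦ t⁻ⁱ d(tⁱ)` is additive on `ℤ`, hence equal to `i` times its
value at `1`; negative exponents need no separate case. -/
theorem deriv_pow [I.InDisc] (i : ℤ) : Laurent.deriv (Y.pow i : Laurent N I) =
    (i : Laurent N I) * (Y.pow (i - 1) * Laurent.deriv (Y.pow 1)) := by
  let g : ℤ →+ Laurent N I := AddMonoidHom.mk' (fun i => Y.pow (-i) * Laurent.deriv (Y.pow i))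
    (fun i j => by
      rw [pow_add, Derivation.leibniz, smul_eq_mul, smul_eq_mul, neg_add, pow_add]
      have h1 : (Y.pow (-i) : Laurent N I) * Y.pow i = 1 := by
        rw [← pow_add, neg_add_cancel, pow_zero]
      have h2 : (Y.pow (-j) : Laurent N I) * Y.pow j = 1 := by
        rw [← pow_add, neg_add_cancel, pow_zero]
      linear_combination (Y.pow (-j) * Laurent.deriv (Y.pow j : Laurent N I)) * h1 +
        (Y.pow (-i) * Laurent.deriv (Y.pow i : Laurent N I)) * h2)
  have h := map_zsmul g i 1
  rw [show i • (1 : ℤ) = i by simp, zsmul_eq_mul] at h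
  have h' : (Y.pow (-i) : Laurent N I) * Laurent.deriv (Y.pow i) =
    (i : Laurent N I) * (Y.pow (-1) * Laurent.deriv (Y.pow 1)) := h
  have h1 : (Y.pow (-i) : Laurent N I) * Y.pow i = 1 := by
    rw [← pow_add, neg_add_cancel, pow_zero]
  rw [sub_eq_add_neg, pow_add]
  linear_combination (Y.pow i : Laurent N I) * h' -
    (Laurent.deriv (Y.pow i : Laurent N I)) * h1

variable {K : Type u} [NormedField K] [IsUltrametricDist K] [CompleteSpace K] [NormedAlgebra K N]

/-- At radius `ρ` the Gauss norm of `t^i` is at most `(ρ^e)^i`, so convergence of `f` at `ρ^e` gives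
convergence at `ρ`; this is why the target is the annulus `I.root e`. -/
theorem lsummable_pull [I.InDisc] (f : Laurent K I) : LSummable (fun i : ℤ =>
    (mono (algebraMap K N (f.coeff i)) 0 * Y.pow i : Laurent N (I.root Y.e))) := fun ρ hρ => by
  refine ⟨fun i => ‖f.coeff i‖ * (ρ ^ Y.e) ^ i, fun i => ?_, f.tendsto' _ hρ.2⟩
  have h1 := (gaussLE_mono hρ.1 (algebraMap K N (f.coeff i)) 0).mul hρ.1
    (Y.gaussLE_pow (I := I.root Y.e) hρ.1 (Radii.InDisc.lt_one ρ hρ) i)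
  simpa using h1

theorem coeff_pull_aux [I.InDisc] (f : Laurent K I) (n : ℤ) :
    (lsum _ (Y.lsummable_pull f)).coeff n =
      ∑' i : ℤ, algebraMap K N (f.coeff i) * (Y.pow i : Laurent N (I.root Y.e)).coeff n := by
  rw [coeff_lsum]
  exact tsum_congr fun i => by rw [coeff_mono_mul, sub_zero]

theorem map_tsum_algebraMap {ι : Type*} (f : ι → K) (hf : Summable f) :
    algebraMap K N (∑' i, f i) = ∑' i, algebraMap K N (f i) :=
  (algebraMapCLM K N).map_tsum hf

theorem summable_pull_mul [I.InDisc] (f g : Laurent K I) (n : ℤ) :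
    Summable fun x : ℤ × ℤ => algebraMap K N (f.coeff x.1) * algebraMap K N (g.coeff x.2) *
      (Y.pow (x.1 + x.2) : Laurent N (I.root Y.e)).coeff n := by
  obtain ⟨ρ, hρ⟩ := (I.root Y.e).nonempty
  have hρ0 := hρ.1
  apply NonarchimedeanAddGroup.summable_of_tendsto_cofinite_zero
  have h2 := (null_convTerm (f.tendsto' _ hρ.2) (g.tendsto' _ hρ.2)).mul_const (ρ ^ (-n))
  rw [zero_mul] at h2
  refine squeeze_zero_norm (fun x => ?_) h2
  have h3 := (Y.gaussLE_pow (I := I.root Y.e) hρ0 (Radii.InDisc.lt_one ρ hρ)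
    (x.1 + x.2)).norm_coeff_le hρ0 n
  have h4 : (ρ ^ Y.e) ^ x.1 * (ρ ^ Y.e) ^ x.2 = (ρ ^ Y.e) ^ (x.1 + x.2) := by
    rw [← zpow_add₀ (by positivity)]
  rw [norm_mul, norm_mul, norm_algebraMap', norm_algebraMap']
  calc _ ≤ ‖f.coeff x.1‖ * ‖g.coeff x.2‖ * ((ρ ^ Y.e) ^ (x.1 + x.2) * ρ ^ (-n)) := by gcongr
    _ = _ := by rw [← h4]; ring

theorem _root_.PadicDE.tsum_tsum_sub_comm {F : ℤ × ℤ → N} (hF : Summable F) :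
    ∑' m : ℤ, ∑' i : ℤ, F (i, m - i) = ∑' i : ℤ, ∑' j : ℤ, F (i, j) := by
  have hF' : Summable (fun x : ℤ × ℤ => F (x.2, x.1 - x.2)) :=
    hF.comp_injective (i := fun x : ℤ × ℤ => (x.2, x.1 - x.2)) fun x y h => by
      simp only [Prod.mk.injEq] at h
      ext <;> omega
  refine (Summable.tsum_comm (f := fun m i => F (i, m - i)) hF').symm.trans
    (tsum_congr fun i => ?_)
  rw [← (Equiv.addRight i).tsum_eq fun m => F (i, m - i)]
  exact tsum_congr fun j => by rw [Equiv.coe_addRight, add_sub_cancel_right]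

theorem pull_mul_aux [I.InDisc] (f g : Laurent K I) : lsum _ (Y.lsummable_pull (f * g)) =
    lsum _ (Y.lsummable_pull f) * lsum _ (Y.lsummable_pull g) := by
  rw [lsum_mul]
  ext n
  rw [coeff_pull_aux, coeff_lsum]
  have e1 : ∀ m : ℤ, algebraMap K N ((f * g).coeff m) *
      (Y.pow m : Laurent N (I.root Y.e)).coeff n = ∑' i : ℤ, algebraMap K N (f.coeff i) *
        algebraMap K N (g.coeff (m - i)) *
        (Y.pow (i + (m - i)) : Laurent N (I.root Y.e)).coeff n := fun m => by
    rw [coeff_mul, map_tsum_algebraMap _ (summable_mul f g m), ← tsum_mul_right]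
    exact tsum_congr fun i => by rw [map_mul, add_sub_cancel]
  rw [tsum_congr e1]
  refine (tsum_tsum_sub_comm (Y.summable_pull_mul (N := N) f g n)).trans (tsum_congr fun i => ?_)
  obtain ⟨h6, h5⟩ := mul_lsum (Y.lsummable_pull g) (Y.pow i)
  rw [mul_assoc, coeff_mono_mul, sub_zero, h5, coeff_lsum, ← tsum_mul_left]
  refine tsum_congr fun j => ?_
  rw [pow_add, mul_left_comm, coeff_mono_mul, sub_zero, mul_assoc]

/-- The substitution `f ↦ f(u^e v(u))`. -/
def pull [I.InDisc] : Laurent K I →+* Laurent N (I.root Y.e) where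
  toFun f := lsum _ (Y.lsummable_pull f)
  map_one' := by
    ext n
    rw [coeff_pull_aux, tsum_eq_single 0]
    · simp [Y.pow_zero]
    · intro i hi; simp [Pi.single_eq_of_ne hi]
  map_zero' := by ext n; rw [coeff_pull_aux]; simp
  map_add' f g := by
    ext n
    have hs : ∀ f : Laurent K I, Summable fun i : ℤ =>
        algebraMap K N (f.coeff i) * (Y.pow i : Laurent N (I.root Y.e)).coeff n := fun f => by
      have := (Y.lsummable_pull f).summable_coeff n
      simpa only [coeff_mono_mul, sub_zero] using this
    rw [coeff_add, coeff_pull_aux, coeff_pull_aux, coeff_pull_aux, ← (hs f).tsum_add (hs g)]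
    exact tsum_congr fun i => by rw [coeff_add, map_add, add_mul]
  map_mul' := Y.pull_mul_aux

theorem pull_eq [I.InDisc] (f : Laurent K I) :
    (Y.pull f : Laurent N (I.root Y.e)) = lsum _ (Y.lsummable_pull f) := rfl

theorem coeff_pull [I.InDisc] (f : Laurent K I) (n : ℤ) :
    (Y.pull f : Laurent N (I.root Y.e)).coeff n =
      ∑' i : ℤ, algebraMap K N (f.coeff i) * (Y.pow i : Laurent N (I.root Y.e)).coeff n :=
  Y.coeff_pull_aux f n

theorem restrict_pull {I' : Radii} [I.InDisc] [I'.InDisc] (h : I'.carrier ⊆ I.carrier)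
    (f : Laurent K I) :
    restrict (Radii.root_subset h) (Y.pull f : Laurent N (I.root Y.e)) =
      Y.pull (restrict h f) := by
  ext n
  rw [coeff_restrict, coeff_pull, coeff_pull]
  refine tsum_congr fun i => ?_
  rw [coeff_restrict, coeff_pow, coeff_pow]

theorem pull_mono [I.InDisc] (c : K) (k : ℤ) :
    (Y.pull (mono c k : Laurent K I) : Laurent N (I.root Y.e)) =
      mono (algebraMap K N c) 0 * Y.pow k := by
  ext n
  rw [coeff_pull, tsum_eq_single k, coeff_mono_mul, sub_zero, coeff_mono, Pi.single_eq_same]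
  intro i hi
  rw [coeff_mono, Pi.single_eq_of_ne hi, map_zero, zero_mul]

/-- The derivative of `u^e v(u)`. -/
def jac [I.InDisc] : Laurent N I := Laurent.deriv (Y.pow 1)

theorem restrict_jac {I' : Radii} [I.InDisc] [I'.InDisc] (h : I'.carrier ⊆ I.carrier) :
    restrict h (Y.jac : Laurent N I) = Y.jac := by
  rw [jac, ← deriv_restrict, restrict_pow]; rfl

theorem deriv_pull [I.InDisc] (f : Laurent K I) :
    Laurent.deriv (Y.pull f : Laurent N (I.root Y.e)) = Y.jac * Y.pull (Laurent.deriv f) := by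
  rw [pull_eq, deriv_lsum, pull_eq]
  obtain ⟨h, e⟩ := mul_lsum (Y.lsummable_pull (Laurent.deriv f)) (Y.jac (I := I.root Y.e))
  rw [e]
  ext n
  rw [coeff_lsum, coeff_lsum, ← (Equiv.addRight (1 : ℤ)).tsum_eq]
  refine tsum_congr fun i => ?_
  rw [Equiv.coe_addRight, ← smul_eq_mono_mul, ← smul_eq_mono_mul, Derivation.map_smul, deriv_pow,
    coeff_deriv, add_sub_cancel_right, map_mul, map_intCast]
  congr 1
  rw [jac, smul_eq_mono_mul, smul_eq_mono_mul, mul_comm (Laurent.deriv _), mul_comm ((i + 1 : ℤ) : N),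
    ← mul_one (0 : ℤ), mul_one, ← add_zero (0 : ℤ), ← mono_mul_mono, add_zero]
  have : (mono ((i + 1 : ℤ) : N) 0 : Laurent N (I.root Y.e)) = ((i + 1 : ℤ) : Laurent N _) := by
    have := map_intCast (algebraMap N (Laurent N (I.root Y.e))) (i + 1)
    exact this
  rw [this]; ring

end Ramification

end

end PadicDE

/-! ### Primitives, vanishing of the first derived limit, traces of differential forms -/

namespace PadicDE

noncomputable section

namespace Laurent

variable {N : Type u} [NormedField N] [IsUltrametricDist N] [CompleteSpace N] {I : Radii}

theorem tendsto_natAbs_mul_pow {θ : ℝ} (h0 : 0 ≤ θ) (h1 : θ < 1) :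
    Tendsto (fun i : ℤ => (i.natAbs : ℝ) * θ ^ i.natAbs) cofinite (𝓝 0) := by
  have h2 : Tendsto Int.natAbs cofinite atTop := by
    rw [← Nat.cofinite_eq_atTop]
    refine Filter.Tendsto.cofinite_of_finite_preimage_singleton fun y => ?_
    refine (Set.finite_Icc (-(y : ℤ)) y).subset fun i hi => ?_
    have : i.natAbs = y := hi
    constructor <;> omega
  exact (tendsto_self_mul_const_pow_of_lt_one h0 h1).comp h2

/-- A function without residue has a primitive on the interior of the annulus. -/
theorem exists_primitive [CharZero N] (hN : ∀ n : ℕ, n ≠ 0 → 1 ≤ (n : ℝ) * ‖(n : N)‖) {I' : Radii}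
    (hI : ∀ ρ ∈ I'.carrier, ∃ ρ₁ ∈ I.carrier, ∃ ρ₂ ∈ I.carrier, ρ₁ < ρ ∧ ρ < ρ₂)
    (hsub : I'.carrier ⊆ I.carrier) (f : Laurent N I) (hf : f.coeff (-1) = 0) :
    ∃ F : Laurent N I', Laurent.deriv F = restrict hsub f := by
  -- An integration costs at most the factor `|i|`. The gap between `ρ` and the larger annulus turns
  -- this into `|i| θ^|i|` with `θ < 1`, which tends to zero.
  have hinv : ∀ i : ℤ, ‖((i : N))⁻¹‖ ≤ i.natAbs := by
    intro i
    rcases eq_or_ne i 0 with rfl | hi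
    · simp
    · have h1 := hN i.natAbs (by omega)
      have h2 : ‖(i : N)‖ = ‖((i.natAbs : ℕ) : N)‖ := by
        rcases Int.natAbs_eq i with h | h
        · conv_lhs => rw [h]
          simp
        · conv_lhs => rw [h]
          simp
      rw [norm_inv, h2]
      have h3 : 0 < ‖((i.natAbs : ℕ) : N)‖ := by
        rw [norm_pos_iff]; exact_mod_cast Int.natAbs_ne_zero.2 hi
      rw [inv_le_iff_one_le_mul₀ h3]
      exact h1
  refine ⟨⟨fun i => (i : N)⁻¹ * f.coeff (i - 1), fun ρ hρ => ?_⟩, ?_⟩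
  · obtain ⟨ρ₁, hρ₁, ρ₂, hρ₂, h1, h2⟩ := hI ρ hρ
    have p0 := I'.pos ρ hρ
    have p1 := I.pos ρ₁ hρ₁
    have p2 := I.pos ρ₂ hρ₂
    obtain ⟨M₁, hM₁, b1⟩ := exists_gaussLE hρ₁ f
    obtain ⟨M₂, hM₂, b2⟩ := exists_gaussLE hρ₂ f
    have q1 : ρ₁ / ρ < 1 := (div_lt_one p0).2 h1
    have q2 : ρ / ρ₂ < 1 := (div_lt_one p2).2 h2
    have t1 := (tendsto_natAbs_mul_pow (by positivity) q1).const_mul (M₁ * ρ₁)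
    have t2 := (tendsto_natAbs_mul_pow (by positivity) q2).const_mul (M₂ * ρ₂)
    have t := t1.add t2
    rw [mul_zero, mul_zero, add_zero] at t
    have hshift : ∀ {σ : ℝ}, 0 < σ → ∀ i : ℤ, σ ^ (-(i - 1)) = σ * σ ^ (-i) := fun hσ i => by
      rw [← zpow_one_add₀ hσ.ne']; congr 1; ring
    refine squeeze_zero (fun i => by positivity) (fun i => ?_) t
    rw [norm_mul]
    rcases le_total 0 i with hi | hi
    · have e : (ρ / ρ₂) ^ i.natAbs = ρ₂ ^ (-i) * ρ ^ i := by
        rw [div_pow, ← zpow_natCast, ← zpow_natCast, Int.natAbs_of_nonneg hi, zpow_neg,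
          div_eq_mul_inv, mul_comm]
      have h3 := b2.norm_coeff_le p2 (i - 1)
      rw [hshift p2] at h3
      calc ‖(i : N)⁻¹‖ * ‖f.coeff (i - 1)‖ * ρ ^ i
          ≤ i.natAbs * (M₂ * (ρ₂ * ρ₂ ^ (-i))) * ρ ^ i := by
            gcongr
            exact hinv i
        _ = M₂ * ρ₂ * (i.natAbs * (ρ / ρ₂) ^ i.natAbs) := by rw [e]; ring
        _ ≤ _ := le_add_of_nonneg_left (by positivity)
    · have e : (ρ₁ / ρ) ^ i.natAbs = ρ₁ ^ (-i) * ρ ^ i := by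
        have h4 : (i.natAbs : ℤ) = -i := by omega
        rw [div_pow, ← zpow_natCast, ← zpow_natCast, h4, div_eq_mul_inv, ← zpow_neg, neg_neg]
      have h3 := b1.norm_coeff_le p1 (i - 1)
      rw [hshift p1] at h3
      calc ‖(i : N)⁻¹‖ * ‖f.coeff (i - 1)‖ * ρ ^ i
          ≤ i.natAbs * (M₁ * (ρ₁ * ρ₁ ^ (-i))) * ρ ^ i := by
            gcongr
            exact hinv i
        _ = M₁ * ρ₁ * (i.natAbs * (ρ₁ / ρ) ^ i.natAbs) := by rw [e]; ring
        _ ≤ _ := le_add_of_nonneg_right (by positivity)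
  · ext i
    rw [coeff_deriv, coeff_restrict]
    simp only [add_sub_cancel_right]
    rcases eq_or_ne (i + 1) 0 with h | h
    · have : i = -1 := by omega
      subst this
      rw [hf]; simp
    · rw [← mul_assoc, mul_inv_cancel₀ (by exact_mod_cast h), one_mul]

/-- The first derived limit of the functions on the annuli `[α, β n]` vanishes. -/
theorem exists_sub_restrict_eq {I : ℕ → Radii} {α : ℝ} {β : ℕ → ℝ}
    (hI : ∀ n, (I n).carrier = Set.Icc α (β n)) (hα : ∀ n, α ≤ β n) (hβ : Monotone β)
    (hsub : ∀ {m n}, m ≤ n → (I m).carrier ⊆ (I n).carrier)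
    (f : ∀ n, Laurent N (I n)) :
    ∃ g : ∀ n, Laurent N (I n), ∀ n, f n = g n - restrict (hsub n.le_succ) (g (n + 1)) := by
  have memα : ∀ n, α ∈ (I n).carrier := fun n => by rw [hI]; exact ⟨le_rfl, hα n⟩
  have memβ : ∀ n, β n ∈ (I n).carrier := fun n => by rw [hI]; exact ⟨hα n, le_rfl⟩
  have hα0 : 0 < α := (I 0).pos _ (memα 0)
  have hcut : ∀ n, ∃ k : ℤ, 0 ≤ k ∧ ∀ i, k < i → ‖(f n).coeff i‖ * β n ^ i ≤ (1 / 2 : ℝ) ^ n := by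
    intro n
    have h := ((f n).tendsto' _ (memβ n)).eventually (gt_mem_nhds (show (0 : ℝ) < (1 / 2) ^ n by
      positivity))
    rw [Int.cofinite_eq, eventually_sup] at h
    obtain ⟨k, hk⟩ := eventually_atTop.1 h.2
    exact ⟨max k 0, le_max_right _ _, fun i hi => (hk i ((le_max_left _ _).trans hi.le)).le⟩
  choose k hk0 hk using hcut
  -- The part of `f n` of index at most `k n`. Its negative terms are controlled at the common inner
  -- radius `α` and only finitely many others remain, so it converges on every annulus; hence the
  -- second index `m`.
  let H : ∀ n m, Laurent N (I m) := fun n m =>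
    { coeff := fun i => if i ≤ k n then (f n).coeff i else 0
      tendsto' := fun ρ hρ => by
        rw [Int.cofinite_eq]
        have hρ0 := (I m).pos ρ hρ
        refine Tendsto.sup ?_ ?_
        · have h := (f n).tendsto' _ (memα n)
          rw [Int.cofinite_eq] at h
          have h' := h.mono_left le_sup_left
          refine squeeze_zero' (Eventually.of_forall fun i => by positivity) ?_ h'
          filter_upwards [eventually_le_atBot (0 : ℤ)] with i hi
          rw [if_pos (hi.trans (hk0 n))]
          have h3 : α ≤ ρ := by rw [hI] at hρ; exact hρ.1
          have h2 : ρ ^ i ≤ α ^ i := by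
            rw [← neg_neg i, zpow_neg, zpow_neg α]
            exact inv_anti₀ (zpow_pos hα0 _) (zpow_le_zpow_left₀ (by omega) hα0.le h3)
          gcongr
        · refine Tendsto.congr' ?_ tendsto_const_nhds
          filter_upwards [eventually_gt_atTop (k n)] with i hi
          rw [if_neg (by omega)]; simp }
  let τ : ∀ n, Laurent N (I n) := fun n => f n - H n n
  have hτ : ∀ n i, (τ n).coeff i = if i ≤ k n then 0 else (f n).coeff i := fun n i => by
    simp only [τ, coeff_sub, H]
    split_ifs <;> simp
  let G : ∀ n, ℕ → Laurent N (I n) := fun n m =>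
    if h : n ≤ m then restrict (hsub h) (τ m) else 0
  have hG : ∀ n, LSummable (G n) := by
    intro n ρ hρ
    have hρ0 := (I n).pos ρ hρ
    refine ⟨fun m => (1 / 2 : ℝ) ^ m, fun m i => ?_, ?_⟩
    · by_cases h : n ≤ m
      · simp only [G, dif_pos h, coeff_restrict, hτ]
        split_ifs with hi
        · simp
        · have h3 : ρ ≤ β m := by rw [hI] at hρ; exact hρ.2.trans (hβ h)
          have hi' : 0 ≤ i := (hk0 m).trans (by omega)
          have h2 : ρ ^ i ≤ β m ^ i := zpow_le_zpow_left₀ hi' hρ0.le h3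
          refine le_trans ?_ (hk m i (by omega))
          gcongr
      · simp [G, dif_neg h]
    · rw [Nat.cofinite_eq_atTop]
      exact tendsto_pow_atTop_nhds_zero_of_lt_one (by norm_num) (by norm_num)
  -- The tails `τ m` with `m ≥ n` can be summed on `I n`, their Gauss norms being at most `2⁻ᵐ`
  -- there; the heads with `m < n` enter with a minus sign. Passing from `n` to `n + 1` drops `τ n`
  -- and subtracts one more head, a total change of `f n`.
  refine ⟨fun n => lsum (G n) (hG n) - ∑ m ∈ Finset.range n, H m n, fun n => ?_⟩
  ext i
  rw [coeff_sub, coeff_restrict, coeff_sub, coeff_sub, coeff_sum, coeff_sum, coeff_lsum, coeff_lsum,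
    Finset.sum_range_succ]
  have e : ∑' m, (G n m).coeff i = ∑' m, (G (n + 1) m).coeff i + (τ n).coeff i := by
    have e2 : (τ n).coeff i = ∑' m, if m = n then (τ n).coeff i else 0 := by
      rw [tsum_ite_eq]
    rw [e2, ← ((hG (n + 1)).summable_coeff i).tsum_add (summable_of_ne_finset_zero (s := {n})
      fun m hm => by rw [if_neg (by simpa using hm)])]
    refine tsum_congr fun m => ?_
    rcases lt_trichotomy m n with h | h | h
    · simp only [G]
      rw [dif_neg (by omega), dif_neg (by omega), if_neg (by omega)]; simp
    · subst h
      simp only [G]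
      rw [dif_pos le_rfl, dif_neg (by omega)]; simp
    · simp only [G]
      rw [dif_pos (by omega), dif_pos (by omega), if_neg (by omega)]; simp
  rw [e]
  have e3 : (τ n).coeff i = (f n).coeff i - (H n n).coeff i := coeff_sub _ _ _
  have e4 : ∑ m ∈ Finset.range n, (H m n).coeff i = ∑ m ∈ Finset.range n, (H m (n + 1)).coeff i :=
    rfl
  have e5 : (H n n).coeff i = (H n (n + 1)).coeff i := rfl
  rw [e3, e4, e5]
  ring

end Laurent

namespace Ramification

open Laurent

variable {N : Type u} [NormedField N] [IsUltrametricDist N] [CompleteSpace N] (Y : Ramification N)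
  {I : Radii}
variable {K : Type u} [NormedField K] [IsUltrametricDist K] [CompleteSpace K] [NormedAlgebra K N]

variable (N K) in
/-- A bounded `K`-linear form on `N`. -/
structure _root_.PadicDE.BoundedForm extends N →ₗ[K] K where
  bound : ∃ C : ℝ, 0 < C ∧ ∀ x, ‖toFun x‖ ≤ C * ‖x‖

instance : FunLike (BoundedForm N K) N K where
  coe l := l.toFun
  coe_injective := fun l l' h => by
    cases l; cases l'; congr; exact LinearMap.ext fun x => congrFun h x

instance : LinearMapClass (BoundedForm N K) K N K where
  map_add l := l.map_add'
  map_smulₛₗ l := l.map_smul'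

theorem _root_.PadicDE.BoundedForm.norm_le (l : BoundedForm N K) :
    ∃ C : ℝ, 0 < C ∧ ∀ x, ‖l x‖ ≤ C * ‖x‖ := l.bound

theorem _root_.PadicDE.BoundedForm.map_tsum (l : BoundedForm N K) {ι : Type*} {f : ι → N}
    (hf : Summable f) : l (∑' i, f i) = ∑' i, l (f i) := by
  obtain ⟨C, -, hC⟩ := l.norm_le
  exact hf.map_tsum l (AddMonoidHomClass.continuous_of_bound l C hC)

/-- The trace of the differential form `g du`, composed with a `K`-linear form on `N`. -/
def traceForm [I.InDisc] (l : BoundedForm N K) (g : Laurent N (I.root Y.e)) : Laurent K I where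
  coeff n := l ((Y.pow (-n - 1) * g).coeff (-1))
  tendsto' ρ hρ := by
    obtain ⟨σ, hσ, rfl⟩ := Radii.exists_root (e := Y.e) hρ
    have hσ0 := hσ.1
    have hσ1 : σ < 1 := Radii.InDisc.lt_one σ hσ
    obtain ⟨C, hC, hl⟩ := l.norm_le
    -- The residue is a sum over `m` of a coefficient of `t^(-n-1)` times the `m`-th coefficient of
    -- `g`. Outside a finite set of `m` the bound is uniform in `n`, the powers of `σ^e` cancelling
    -- up to one factor. For fixed `m` the terms vanish when `n` is very negative and decay like
    -- `(σ^e)^n` when `n` is large.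
    refine tendsto_zero_of_uniform_bound (a := fun m n : ℤ => C *
      (‖(Y.pow (-n - 1) : Laurent N (I.root Y.e)).coeff (-1 - m)‖ * (σ ^ Y.e) ^ n * ‖g.coeff m‖))
      (fun n => by positivity) (fun n ε hε hn => ?_) (fun ε hε => ?_) (fun m => ?_)
    · have h1 : ‖(Y.pow (-n - 1) * g).coeff (-1)‖ ≤ ε / C * ((σ ^ Y.e) ^ n)⁻¹ := by
        rw [mul_comm (Y.pow _) g, coeff_mul]
        refine IsUltrametricDist.norm_tsum_le_of_forall_le_of_nonneg (by positivity) fun m => ?_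
        rw [← div_eq_mul_inv, le_div_iff₀ (by positivity), le_div_iff₀ hC, norm_mul]
        refine le_trans (le_of_eq ?_) (hn m)
        ring
      calc ‖l ((Y.pow (-n - 1) * g).coeff (-1))‖ * (σ ^ Y.e) ^ n
          ≤ (C * (ε / C * ((σ ^ Y.e) ^ n)⁻¹)) * (σ ^ Y.e) ^ n := by
            gcongr
            refine (hl _).trans ?_
            gcongr
        _ = ε := by
          have : (σ ^ Y.e) ^ n ≠ 0 := by positivity
          field_simp
    · set D : ℝ := C * (σ ^ Y.e)⁻¹ * σ with hD
      have hD0 : 0 < D := by positivity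
      have h := (g.tendsto' σ hσ).eventually (gt_mem_nhds (show 0 < ε / D by positivity))
      refine ⟨_, Filter.eventually_cofinite.1 h, fun m hm n => ?_⟩
      simp only [Set.mem_ofPred_eq, not_not] at hm
      rw [lt_div_iff₀ hD0] at hm
      refine le_trans ?_ hm.le
      have h3 := (Y.gaussLE_pow (I := I.root Y.e) hσ0 hσ1 (-n - 1)).norm_coeff_le hσ0 (-1 - m)
      have e1 : (σ ^ Y.e) ^ (-n - 1) * (σ ^ Y.e) ^ n = (σ ^ Y.e)⁻¹ := by
        rw [← zpow_add₀ (by positivity), ← zpow_neg_one]; congr 1; ring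
      have e2 : σ ^ (-(-1 - m)) = σ * σ ^ m := by
        rw [← zpow_one_add₀ hσ0.ne']; congr 1; ring
      calc C * (‖(Y.pow (-n - 1) : Laurent N (I.root Y.e)).coeff (-1 - m)‖ * (σ ^ Y.e) ^ n *
            ‖g.coeff m‖) ≤ C * (((σ ^ Y.e) ^ (-n - 1) * σ ^ (-(-1 - m))) * (σ ^ Y.e) ^ n *
            ‖g.coeff m‖) := by gcongr
        _ = C * (((σ ^ Y.e) ^ (-n - 1) * (σ ^ Y.e) ^ n) * (σ * σ ^ m) * ‖g.coeff m‖) := by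
            rw [e2]; ring
        _ = ‖g.coeff m‖ * σ ^ m * D := by rw [e1, hD]; ring
    · have h1 : Tendsto (fun n : ℤ => ‖(Y.pow (-n - 1) : Laurent N (I.root Y.e)).coeff (-1 - m)‖ *
          (σ ^ Y.e) ^ n) cofinite (𝓝 0) := by
        refine tendsto_zpow_cofinite_of_bddBelow (k := min 0 m) (fun n hn => ?_)
          (fun n => Y.norm_coeff_pow_le _ _) (by positivity)
          (pow_lt_one₀ hσ0.le hσ1 (NeZero.ne _))
        apply coeff_pow_eq_zero
        have h2 : n < 0 := hn.trans_le (min_le_left _ _)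
        have h3 : n < m := hn.trans_le (min_le_right _ _)
        have h4 : (1 : ℤ) ≤ Y.e := by exact_mod_cast NeZero.one_le
        nlinarith
      have h2 := (h1.mul_const ‖g.coeff m‖).const_mul C
      rw [zero_mul, mul_zero] at h2
      exact h2

theorem coeff_traceForm [I.InDisc] (l : BoundedForm N K) (g : Laurent N (I.root Y.e)) (n : ℤ) :
    (Y.traceForm l g).coeff n = l ((Y.pow (-n - 1) * g).coeff (-1)) := rfl

theorem traceForm_add [I.InDisc] (l : BoundedForm N K) (g h : Laurent N (I.root Y.e)) :
    Y.traceForm l (g + h) = Y.traceForm l g + Y.traceForm l h := by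
  ext n
  rw [coeff_add, coeff_traceForm, coeff_traceForm, coeff_traceForm, mul_add, coeff_add, map_add]

theorem traceForm_pull_mul [I.InDisc] (l : BoundedForm N K) (f : Laurent K I)
    (g : Laurent N (I.root Y.e)) :
    Y.traceForm l (Y.pull f * g) = f * Y.traceForm l g := by
  ext n
  refine Eq.trans ?_ (coeff_mul f _ n).symm
  rw [coeff_traceForm, mul_left_comm, pull_eq, lsum_mul, coeff_lsum,
    l.map_tsum (((Y.lsummable_pull f).mul_right _).summable_coeff _)]
  refine tsum_congr fun i => ?_
  rw [mul_assoc, coeff_mono_mul, sub_zero, ← mul_assoc, ← pow_add, coeff_traceForm,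
    ← Algebra.smul_def, map_smul, smul_eq_mul]
  congr 5
  ring

theorem restrict_traceForm {I' : Radii} [I.InDisc] [I'.InDisc] (h : I'.carrier ⊆ I.carrier)
    (l : BoundedForm N K) (g : Laurent N (I.root Y.e)) :
    restrict h (Y.traceForm l g) = Y.traceForm l (restrict (Radii.root_subset h) g) := by
  ext n
  rw [coeff_restrict, coeff_traceForm, coeff_traceForm, ← restrict_pow Y (Radii.root_subset h),
    ← map_mul, coeff_restrict]

/-- The trace commutes with `d` because the exact form `d(t^(-n-1) g)` has residue zero: the Leibniz
rule relates the `n`-th coefficients of the two sides. The factor `jac` turns the function `g` into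
the form `g dt`, so the left side is the derivative of the trace of `g` as a function. -/
theorem deriv_traceForm [I.InDisc] (l : BoundedForm N K) (g : Laurent N (I.root Y.e)) :
    Laurent.deriv (Y.traceForm l (Y.jac * g)) = Y.traceForm l (Laurent.deriv g) := by
  ext n
  rw [coeff_deriv, coeff_traceForm, coeff_traceForm]
  have h1 : (Laurent.deriv (Y.pow (-n - 1) * g)).coeff (-1) = 0 := by rw [coeff_deriv]; simp
  rw [Derivation.leibniz, smul_eq_mul, smul_eq_mul, deriv_pow, coeff_add, add_comm,
    add_eq_zero_iff_eq_neg, ← coeff_neg] at h1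
  have h2 : g * (((-n - 1 : ℤ) : Laurent N (I.root Y.e)) *
      (Y.pow (-n - 1 - 1) * Laurent.deriv (Y.pow 1))) =
      ((-n - 1 : ℤ) : Laurent N (I.root Y.e)) * (Y.pow (-(n + 1) - 1) * (Y.jac * g)) := by
    rw [jac, show -(n + 1) - 1 = -n - 1 - 1 by ring]; ring
  rw [h2, ← zsmul_eq_mul] at h1
  have h3 : (((-n - 1 : ℤ)) • (Y.pow (-(n + 1) - 1) * (Y.jac * g))).coeff (-1) =
      (-n - 1 : ℤ) • (Y.pow (-(n + 1) - 1) * (Y.jac * g)).coeff (-1) :=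
    map_zsmul (coeffHom (-1)) _ _
  rw [h3] at h1
  have h4 := congrArg l h1
  rw [map_zsmul, coeff_neg, map_neg, zsmul_eq_mul] at h4
  push_cast at h4 ⊢
  linear_combination -h4

theorem residue_traceForm [I.InDisc] (l : BoundedForm N K) (g : Laurent N (I.root Y.e)) :
    (Y.traceForm l g).coeff (-1) = l (g.coeff (-1)) := by
  rw [coeff_traceForm]
  norm_num [pow_zero]

/-- Here `dt/t = e du/u + dv/v`, and `dv/v` has no pole because `v` is a unit. -/
theorem coeff_pow_neg_one_mul_jac [I.InDisc] :
    (Y.pow (-1) * Y.jac : Laurent N I).coeff (-1) = Y.e := by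
  have hd : ∀ F : PowerSeries (IntRing N), Laurent.deriv (ofPowerSeries F : Laurent N I) =
      ofPowerSeries (PowerSeries.derivative _ F) := by
    intro F
    ext i
    rw [coeff_deriv, coeff_ofPowerSeries, coeff_ofPowerSeries]
    rcases lt_trichotomy i (-1) with h | h | h
    · rw [psCoeff_of_neg _ (by omega), psCoeff_of_neg _ (by omega), mul_zero]
    · subst h; simp [psCoeff_of_neg]
    · obtain ⟨m, rfl⟩ := Int.eq_ofNat_of_zero_le (show 0 ≤ i by omega)
      have := psCoeff_natCast F (m + 1)
      push_cast at this
      rw [this]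
      refine Eq.trans ?_ (psCoeff_natCast _ m).symm
      rw [PowerSeries.coeff_derivative]
      push_cast; ring
  have hm : Laurent.deriv (mono 1 (Y.e : ℤ) : Laurent N I) = mono (Y.e : N) ((Y.e : ℤ) - 1) := by
    ext i
    rw [coeff_deriv, coeff_mono, coeff_mono]
    by_cases h : i = (Y.e : ℤ) - 1
    · subst h; simp
    · rw [Pi.single_eq_of_ne h, Pi.single_eq_of_ne (by omega), mul_zero]
  have hv : (ofPowerSeries ((Y.v ^ (-1 : ℤ) : (PowerSeries (IntRing N))ˣ) : PowerSeries (IntRing N)) : Laurent N I) * ofPowerSeries ((Y.v ^ (1 : ℤ) : (PowerSeries (IntRing N))ˣ) : PowerSeries (IntRing N)) = 1 := by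
    rw [← map_mul, ← Units.val_mul, ← zpow_add]; simp
  have key : (Y.pow (-1) * Y.jac : Laurent N I) = mono (Y.e : N) (-1) +
      ofPowerSeries (((Y.v ^ (-1 : ℤ) : (PowerSeries (IntRing N))ˣ) : PowerSeries (IntRing N)) * PowerSeries.derivative _ ((Y.v ^ (1 : ℤ) : (PowerSeries (IntRing N))ˣ) : PowerSeries (IntRing N))) := by
    have m1 : (mono 1 (Y.e * (-1 : ℤ)) : Laurent N I) * mono 1 (Y.e : ℤ) = 1 := by
      rw [mono_mul_mono]; simp [mono_zero_eq_one]
    have m2 : (mono 1 (Y.e * (-1 : ℤ)) : Laurent N I) * mono (Y.e : N) ((Y.e : ℤ) - 1) =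
        mono (Y.e : N) (-1) := by
      rw [mono_mul_mono, one_mul]; congr 1; ring
    rw [jac, pow, pow, mul_one, Derivation.leibniz, smul_eq_mul, smul_eq_mul, hd, hm, map_mul]
    linear_combination (ofPowerSeries ((Y.v ^ (-1 : ℤ) : (PowerSeries (IntRing N))ˣ) : PowerSeries (IntRing N)) *
      ofPowerSeries (PowerSeries.derivative _ ((Y.v ^ (1 : ℤ) : (PowerSeries (IntRing N))ˣ) : PowerSeries (IntRing N))) : Laurent N I) * m1 +
      (ofPowerSeries ((Y.v ^ (-1 : ℤ) : (PowerSeries (IntRing N))ˣ) : PowerSeries (IntRing N)) * ofPowerSeries ((Y.v ^ (1 : ℤ) : (PowerSeries (IntRing N))ˣ) : PowerSeries (IntRing N)) : Laurent N I) * m2 +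
      mono (Y.e : N) (-1) * hv
  rw [key, coeff_add, coeff_ofPowerSeries, psCoeff_of_neg _ (by omega), coeff_mono]
  simp

/-- The trace of `dt`. For `n ≠ 0` the form `t^(-n-1) dt` is exact, up to division by `n`, and has
no residue; for `n = 0` the residue `e` of `dt/t` remains. -/
theorem traceForm_jac [CharZero N] [I.InDisc] (l : BoundedForm N K) :
    Y.traceForm l (Y.jac : Laurent N (I.root Y.e)) = mono (Y.e * l 1) 0 := by
  ext n
  rw [coeff_traceForm, coeff_mono]
  rcases eq_or_ne n 0 with rfl | hn
  · rw [Pi.single_eq_same]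
    norm_num only
    rw [coeff_pow_neg_one_mul_jac, ← nsmul_one, map_nsmul, nsmul_eq_mul]
  · rw [Pi.single_eq_of_ne hn]
    have h1 : (Laurent.deriv (Y.pow (-n) : Laurent N (I.root Y.e))).coeff (-1) = 0 := by
      rw [coeff_deriv]; simp
    rw [deriv_pow, ← zsmul_eq_mul] at h1
    have h3 : ((-n) • (Y.pow (-n - 1) * Laurent.deriv (Y.pow 1 : Laurent N (I.root Y.e)))).coeff
      (-1) = (-n) • (Y.pow (-n - 1) * Laurent.deriv (Y.pow 1 : Laurent N (I.root Y.e))).coeff (-1) :=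
      map_zsmul (coeffHom (-1)) _ _
    rw [h3, smul_eq_zero] at h1
    rw [jac, h1.resolve_left (by omega), map_zero]

end Ramification

end

end PadicDE

/-! ### Functions of `u` as a finite free module over functions of `t` -/

namespace PadicDE

noncomputable section

namespace Ramification

open Laurent

variable {N : Type u} [NormedField N] [IsUltrametricDist N] [CompleteSpace N] (Y : Ramification N)
  {I : Radii}

/-- The leading coefficient of `u^e v(u)`. -/
def lead : N := ((PowerSeries.constantCoeff (Y.v : PowerSeries (IntRing N)) : IntRing N) : N)

theorem norm_lead : ‖Y.lead‖ = 1 :=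
  IntRing.norm_unit (Units.map (PowerSeries.constantCoeff (R := IntRing N)).toMonoidHom Y.v)

theorem lead_ne_zero : Y.lead ≠ 0 := norm_ne_zero_iff.1 (by rw [norm_lead]; exact one_ne_zero)

theorem coeff_pow_self [I.InDisc] (i : ℤ) : (Y.pow i : Laurent N I).coeff (Y.e * i) = Y.lead ^ i := by
  have h := psCoeff_natCast (N := N) ((Y.v ^ i : (PowerSeries (IntRing N))ˣ) :
    PowerSeries (IntRing N)) 0
  rw [Nat.cast_zero] at h
  rw [coeff_pow, sub_self, h, PowerSeries.coeff_zero_eq_constantCoeff_apply]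
  have h2 := map_zpow (Units.map ((algebraMap (IntRing N) N).comp
    (PowerSeries.constantCoeff (R := IntRing N))).toMonoidHom) Y.v i
  exact (congrArg Units.val h2).trans (Units.val_zpow_eq_zpow_val _ _)

/-- The coefficients of the monomials `u^(ei+j)`, normalized by the leading coefficient of
`(u^e v(u))^i`, as a Laurent series in `u^e v(u)`. -/
def digit (j : ℕ) (X : Laurent N (I.root Y.e)) : Laurent N I where
  coeff i := Y.lead ^ (-i) * X.coeff (Y.e * i + j)
  tendsto' ρ hρ := by
    obtain ⟨σ, hσ, rfl⟩ := Radii.exists_root (e := Y.e) hρ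
    have h := ((X.tendsto' σ hσ).comp (Function.Injective.tendsto_cofinite
      (f := fun i : ℤ => (Y.e : ℤ) * i + j) fun a b hab => by
        simpa [NeZero.ne Y.e] using hab)).mul_const ((σ ^ j)⁻¹)
    rw [zero_mul] at h
    refine h.congr fun i => ?_
    have h0 := hσ.1
    rw [norm_mul, norm_zpow, norm_lead, one_zpow, one_mul, Function.comp, zpow_add₀ h0.ne',
      zpow_mul, zpow_natCast, zpow_natCast]
    field_simp

theorem coeff_digit (j : ℕ) (X : Laurent N (I.root Y.e)) (i : ℤ) :
    (Y.digit j X).coeff i = Y.lead ^ (-i) * X.coeff (Y.e * i + j) := rfl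

/-- The function `∑ u^j x_j(u^e v(u))`. -/
def combine [I.InDisc] (x : Fin Y.e → Laurent N I) : Laurent N (I.root Y.e) :=
  ∑ j : Fin Y.e, mono 1 (j : ℕ) * Y.pull (x j)

theorem combine_add [I.InDisc] (x y : Fin Y.e → Laurent N I) :
    Y.combine (x + y) = Y.combine x + Y.combine y := by
  simp only [combine, ← Finset.sum_add_distrib, Pi.add_apply, map_add, mul_add]

theorem combine_sub [I.InDisc] (x y : Fin Y.e → Laurent N I) :
    Y.combine (x - y) = Y.combine x - Y.combine y := by
  simp only [combine, ← Finset.sum_sub_distrib, Pi.sub_apply, map_sub, mul_sub]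

theorem combine_mul [I.InDisc] (f : Laurent N I) (x : Fin Y.e → Laurent N I) :
    Y.combine (fun j => f * x j) = Y.pull f * Y.combine x := by
  simp only [combine, Finset.mul_sum, map_mul]
  exact Finset.sum_congr rfl fun _ _ => mul_left_comm _ _ _

theorem restrict_combine {I' : Radii} [I.InDisc] [I'.InDisc] (h : I'.carrier ⊆ I.carrier)
    (x : Fin Y.e → Laurent N I) :
    restrict (Radii.root_subset h) (Y.combine x) = Y.combine fun j => restrict h (x j) := by
  simp only [combine, map_sum, map_mul, restrict_mono]
  exact Finset.sum_congr rfl fun j _ => by rw [restrict_pull Y h]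

/-- The normalized power `lead^(-i) (u^e v)^i` starts with `u^(ei)` and has integral coefficients.
Replacing `u^(ei+j)` by `u^j` times this power therefore creates only terms of higher degree with no
larger coefficients, and each higher degree gains at least a factor `σ`. -/
theorem gaussLE_sub_combine_digit [I.InDisc] {σ t : ℝ} (hσ : σ ∈ (I.root Y.e).carrier)
    {X : Laurent N (I.root Y.e)} (hX : GaussLE σ t X) :
    GaussLE σ (σ * t) (X - Y.combine fun j => Y.digit j X) := by
  have hσ0 := hσ.1
  have hσ1 : σ < 1 := Radii.InDisc.lt_one σ hσ
  have ht := hX.nonneg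
  refine gaussLE_of_norm_coeff_le hσ0 fun n => ?_
  -- `A j i` is the contribution of the `i`-th digit to the `n`-th coefficient of the recombination,
  -- `B j i` that of its leading monomial. The latter add up to `X.coeff n`, since `n = e i + j` in
  -- exactly one way.
  let A : Fin Y.e → ℤ → N := fun j i =>
    Y.lead ^ (-i) * X.coeff (Y.e * i + j) * (Y.pow i : Laurent N (I.root Y.e)).coeff (n - j)
  let B : Fin Y.e → ℤ → N := fun j i => if Y.e * i = n - j then X.coeff n else 0
  have hA : ∀ j, Summable (A j) := fun j => by
    have := (Y.lsummable_pull (Y.digit j X)).summable_coeff (n - j)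
    simp only [coeff_mono_mul, sub_zero, coeff_digit, Algebra.algebraMap_self_apply] at this
    exact this
  have e0 : (Y.e : ℤ) ≠ 0 := by exact_mod_cast NeZero.ne _
  have hB : ∀ j, Summable (B j) := fun j => by
    refine summable_of_ne_finset_zero (s := {(n - j) / Y.e}) fun i hi => if_neg fun h => hi ?_
    rw [Finset.mem_singleton, ← h, Int.mul_ediv_cancel_left _ e0]
  have eA : (Y.combine fun j => Y.digit j X).coeff n = ∑ j, ∑' i, A j i := by
    rw [combine, coeff_sum]
    refine Finset.sum_congr rfl fun j _ => ?_
    rw [coeff_mono_mul, one_mul, coeff_pull]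
    rfl
  have eB : X.coeff n = ∑ j, ∑' i, B j i := by
    have h1 : 0 ≤ n % Y.e := Int.emod_nonneg _ e0
    have h2 : n % Y.e < Y.e := Int.emod_lt_of_pos _ (by omega)
    have h3 := Int.mul_ediv_add_emod n Y.e
    rw [Finset.sum_eq_single (⟨(n % Y.e).toNat, by omega⟩ : Fin Y.e), tsum_eq_single (n / Y.e)]
    · simp only [B]
      rw [if_pos (by rw [Int.toNat_of_nonneg h1]; omega)]
    · intro i hi
      refine if_neg fun h => hi ?_
      rw [Int.toNat_of_nonneg h1] at h
      exact mul_left_cancel₀ e0 (by omega)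
    · intro j _ hj
      convert tsum_zero with i
      refine if_neg fun h => hj (Fin.ext ?_)
      have h4 : n = j + Y.e * i := by omega
      have : n % Y.e = j := by
        rw [h4, Int.add_mul_emod_self_left]
        exact Int.emod_eq_of_lt (by omega) (by omega)
      simp only
      omega
    · simp
  rw [coeff_sub, eA, eB, ← Finset.sum_sub_distrib]
  refine IsUltrametricDist.norm_sum_le_of_forall_le_of_nonneg (by positivity) fun j _ => ?_
  rw [← (hB j).tsum_sub (hA j)]
  refine IsUltrametricDist.norm_tsum_le_of_forall_le_of_nonneg (by positivity) fun i => ?_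
  rcases lt_trichotomy (n - j : ℤ) (Y.e * i) with h | h | h
  · simp only [A, B]
    rw [if_neg (by omega), coeff_pow_eq_zero _ h, mul_zero, sub_zero, norm_zero]
    positivity
  · simp only [A, B]
    rw [if_pos h.symm, h, coeff_pow_self, mul_right_comm, ← zpow_add₀ Y.lead_ne_zero,
      neg_add_cancel, zpow_zero, one_mul, show (Y.e : ℤ) * i + j = n by omega, sub_self, norm_zero]
    positivity
  · simp only [A, B]
    rw [if_neg (by omega), zero_sub, norm_neg, norm_mul, norm_mul, norm_zpow, norm_lead, one_zpow,
      one_mul]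
    calc ‖X.coeff (Y.e * i + j)‖ * ‖(Y.pow i : Laurent N (I.root Y.e)).coeff (n - j)‖
        ≤ (t * σ ^ (-(Y.e * i + j : ℤ))) * 1 := by
          gcongr
          · exact hX.norm_coeff_le hσ0 _
          · exact Y.norm_coeff_pow_le _ _
      _ ≤ t * σ ^ (1 + -n) := by
          rw [mul_one]
          refine mul_le_mul_of_nonneg_left ?_ ht
          exact zpow_le_zpow_right_of_le_one₀ hσ0 hσ1.le (by omega)
      _ = σ * t * σ ^ (-n) := by rw [zpow_add₀ hσ0.ne', zpow_one]; ring

theorem digit_add (j : ℕ) (X Z : Laurent N (I.root Y.e)) :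
    Y.digit j (X + Z) = Y.digit j X + Y.digit j Z := by
  ext i; simp only [coeff_digit, coeff_add, mul_add]

theorem digit_sub (j : ℕ) (X Z : Laurent N (I.root Y.e)) :
    Y.digit j (X - Z) = Y.digit j X - Y.digit j Z := by
  ext i; simp only [coeff_digit, coeff_sub, mul_sub]

/-- Successive approximation: `Z` minus the recombination of its digits is a contraction at every
radius, so adding `g` to it gives a map with a fixed point, and the digits of that fixed point
represent `g`. -/
theorem combine_surjective [I.InDisc] (g : Laurent N (I.root Y.e)) :
    ∃ x : Fin Y.e → Laurent N I, Y.combine x = g := by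
  obtain ⟨Z, -, hZ⟩ := exists_fixed_point (D := fun _ => True)
    (fun Z : Laurent N (I.root Y.e) => g + (Z - Y.combine fun j => Y.digit j Z))
    (fun _ _ _ _ => trivial) 0 trivial (fun _ _ => trivial) (fun σ hσ =>
      ⟨σ, hσ.1.le, Radii.InDisc.lt_one σ hσ, fun X Z _ _ t h => by
        have h1 := Y.gaussLE_sub_combine_digit hσ h
        have h2 : (fun j : Fin Y.e => Y.digit j (X - Z)) =
          (fun j : Fin Y.e => Y.digit j X) - fun j : Fin Y.e => Y.digit j Z := by
          ext1 j; exact Y.digit_sub _ _ _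
        rw [h2, combine_sub] at h1
        convert h1 using 1
        ring⟩)
  exact ⟨fun j => Y.digit j Z, by linear_combination -hZ⟩

theorem exists_digit_eq (x : Fin Y.e → Laurent N I) [I.InDisc] :
    ∃ X : Laurent N (I.root Y.e), ∀ j : Fin Y.e, Y.digit j X = x j := by
  have e0 : (Y.e : ℤ) ≠ 0 := by exact_mod_cast NeZero.ne _
  have h1 : ∀ n : ℤ, 0 ≤ n % Y.e := fun n => Int.emod_nonneg _ e0
  have h2 : ∀ n : ℤ, n % Y.e < Y.e := fun n => Int.emod_lt_of_pos _ (by have := NeZero.ne Y.e; omega)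
  let d : ℤ → Fin Y.e := fun n => ⟨(n % Y.e).toNat, by have := h1 n; have := h2 n; omega⟩
  refine ⟨⟨fun n => Y.lead ^ (n / Y.e) * (x (d n)).coeff (n / Y.e), fun σ hσ => ?_⟩, fun j => ?_⟩
  · have hσ0 := hσ.1
    have hσ1 : σ < 1 := Radii.InDisc.lt_one σ hσ
    have hdiv : Tendsto (fun n : ℤ => n / Y.e) cofinite cofinite := by
      refine Filter.Tendsto.cofinite_of_finite_preimage_singleton fun b => ?_
      refine (Set.finite_Icc (Y.e * b) (Y.e * b + Y.e)).subset fun n hn => ?_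
      have h3 : n / Y.e = b := hn
      have h4 := Int.mul_ediv_add_emod n Y.e
      have := h1 n; have := h2 n
      rw [h3] at h4
      constructor <;> omega
    have h5 := tendsto_finsetSum Finset.univ
      (fun j (_ : j ∈ Finset.univ) => ((x j).tendsto' _ hσ.2).comp hdiv)
    simp only [Finset.sum_const_zero] at h5
    refine squeeze_zero (fun n => by positivity) (fun n => ?_) h5
    rw [norm_mul, norm_zpow, norm_lead, one_zpow, one_mul]
    refine le_trans ?_ (Finset.single_le_sum (f := fun j => ((fun i : ℤ => ‖(x j).coeff i‖ *
      (σ ^ Y.e) ^ i) ∘ fun n : ℤ => n / Y.e) n) (fun j _ => by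
        simp only [Function.comp]; positivity) (Finset.mem_univ (d n)))
    simp only [Function.comp]
    gcongr
    rw [← zpow_natCast, ← zpow_mul]
    refine zpow_le_zpow_right_of_le_one₀ hσ0 hσ1.le ?_
    have h4 := Int.mul_ediv_add_emod n Y.e
    have := h1 n
    omega
  · ext i
    rw [coeff_digit]
    have h4 : ((Y.e : ℤ) * i + j) / Y.e = i := by
      rw [Int.add_comm, Int.add_mul_ediv_left _ _ e0, Int.ediv_eq_zero_of_lt] <;> omega
    have h5 : d ((Y.e : ℤ) * i + j) = j := by
      apply Fin.ext
      simp only [d]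
      rw [Int.add_comm, Int.add_mul_emod_self_left, Int.emod_eq_of_lt] <;> omega
    simp only [h4, h5]
    rw [← mul_assoc, ← zpow_add₀ Y.lead_ne_zero, neg_add_cancel, zpow_zero, one_mul]

/-- Let `X` be the series whose digits are the difference of two representations. Its recombination
is zero, so the error estimate multiplies the Gauss norm bound of `X` by `σ`; iterating, `X = 0`. -/
theorem combine_injective [I.InDisc] :
    Function.Injective (Y.combine : (Fin Y.e → Laurent N I) → _) := by
  intro x y hxy
  rw [← sub_eq_zero] at hxy ⊢
  rw [← combine_sub] at hxy
  obtain ⟨X, hX⟩ := Y.exists_digit_eq (x - y)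
  have hX' : (fun j : Fin Y.e => Y.digit j X) = x - y := funext hX
  obtain ⟨σ, hσ⟩ := (I.root Y.e).nonempty
  obtain ⟨M, hM0, hM⟩ := exists_gaussLE hσ X
  have h0 : X = 0 := by
    refine eq_zero_of_gaussLE hσ.1 (M := fun k => σ ^ k * M) ?_ fun k => ?_
    · have := (tendsto_pow_atTop_nhds_zero_of_lt_one hσ.1.le (Radii.InDisc.lt_one σ hσ)).mul_const M
      rwa [zero_mul] at this
    · induction k with
      | zero => simpa using hM
      | succ k ih =>
        have := Y.gaussLE_sub_combine_digit hσ ih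
        rwa [hX', hxy, sub_zero, ← mul_assoc, ← pow_succ'] at this
  rw [← hX', h0]
  ext j i
  simp [coeff_digit]

/-- The coordinates with respect to the basis `1, u, …, u^(e-1)` over the functions of
`u^e v(u)`. -/
def coord [I.InDisc] (g : Laurent N (I.root Y.e)) : Fin Y.e → Laurent N I :=
  (Y.combine_surjective g).choose

theorem combine_coord [I.InDisc] (g : Laurent N (I.root Y.e)) : Y.combine (Y.coord g) = g :=
  (Y.combine_surjective g).choose_spec

theorem coord_add [I.InDisc] (g h : Laurent N (I.root Y.e)) :
    Y.coord (g + h) = Y.coord g + Y.coord h :=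
  Y.combine_injective (by rw [combine_add, combine_coord, combine_coord, combine_coord])

theorem coord_pull_mul [I.InDisc] (f : Laurent N I) (g : Laurent N (I.root Y.e)) :
    Y.coord (Y.pull f * g) = fun j => f * Y.coord g j :=
  Y.combine_injective (by rw [combine_mul, combine_coord, combine_coord])

theorem restrict_coord {I' : Radii} [I.InDisc] [I'.InDisc] (h : I'.carrier ⊆ I.carrier)
    (g : Laurent N (I.root Y.e)) (j : Fin Y.e) :
    restrict h (Y.coord g j) = Y.coord (restrict (Radii.root_subset h) g) j :=
  congrFun (Y.combine_injective (I := I') (a₁ := fun j => restrict h (Y.coord g j))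
    (by rw [combine_coord, ← restrict_combine, combine_coord])) j

variable {K : Type u} [NormedField K] [IsUltrametricDist K] [CompleteSpace K] [NormedAlgebra K N]

/-- Application of a bounded form to the coefficients of a Laurent series. -/
def _root_.PadicDE.BoundedForm.map (l : BoundedForm N K) (f : Laurent N I) : Laurent K I where
  coeff i := l (f.coeff i)
  tendsto' ρ hρ := by
    obtain ⟨C, hC, hl⟩ := l.norm_le
    have h := (f.tendsto' ρ hρ).const_mul C
    rw [mul_zero] at h
    have hρ0 := I.pos ρ hρ
    refine squeeze_zero (fun i => by positivity) (fun i => ?_) h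
    rw [← mul_assoc]
    have := hl (f.coeff i)
    gcongr

variable (N K) in
/-- Extension of scalars for Laurent series. -/
def _root_.PadicDE.Laurent.extend (f : Laurent K I) : Laurent N I where
  coeff i := algebraMap K N (f.coeff i)
  tendsto' ρ hρ := by simpa only [norm_algebraMap'] using f.tendsto' ρ hρ

theorem pull_extend [I.InDisc] (f : Laurent K I) : Y.pull (f.extend N K) = Y.pull f := by
  ext n
  rw [coeff_pull, coeff_pull]
  rfl

/-- The coordinate functionals for the finite extension of function rings defined by
`t = u^e v(u)`. -/
def functional [I.InDisc] (l : BoundedForm N K) (j : Fin Y.e) (g : Laurent N (I.root Y.e)) :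
    Laurent K I := l.map (Y.coord g j)

theorem functional_add [I.InDisc] (l : BoundedForm N K) (j : Fin Y.e)
    (g h : Laurent N (I.root Y.e)) :
    Y.functional l j (g + h) = Y.functional l j g + Y.functional l j h := by
  ext i
  show l ((Y.coord (g + h) j).coeff i) = l ((Y.coord g j).coeff i) + l ((Y.coord h j).coeff i)
  rw [coord_add, Pi.add_apply, coeff_add, map_add]

theorem functional_pull_mul [I.InDisc] (l : BoundedForm N K) (j : Fin Y.e) (f : Laurent K I)
    (g : Laurent N (I.root Y.e)) :
    Y.functional l j (Y.pull f * g) = f * Y.functional l j g := by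
  ext n
  rw [← pull_extend, coeff_mul]
  show l ((Y.coord (Y.pull (f.extend N K) * g) j).coeff n) = _
  rw [coord_pull_mul, coeff_mul, l.map_tsum (summable_mul _ _ _)]
  refine tsum_congr fun i => ?_
  show l (algebraMap K N (f.coeff i) * _) = _
  rw [← Algebra.smul_def, map_smul, smul_eq_mul]
  rfl

theorem restrict_functional {I' : Radii} [I.InDisc] [I'.InDisc] (h : I'.carrier ⊆ I.carrier)
    (l : BoundedForm N K) (j : Fin Y.e) (g : Laurent N (I.root Y.e)) :
    restrict h (Y.functional l j g) = Y.functional l j (restrict (Radii.root_subset h) g) := by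
  ext n
  show l ((restrict h (Y.coord g j)).coeff n) = _
  rw [restrict_coord]
  rfl

/-- The functions `β_i u^j` generate over the Laurent series in `t` with coefficients in `K`: expand
in powers of `u` below `e`, then expand the coefficients from `N` over `K`. -/
theorem sum_pull_functional [I.InDisc] {ι : Type*} [Fintype ι] (β : ι → N) (l : ι → BoundedForm N K)
    (hl : ∀ x, ∑ i, l i x • β i = x) (g : Laurent N (I.root Y.e)) :
    ∑ j : Fin Y.e, ∑ i, Y.pull (Y.functional (l i) j g) * mono (β i) (j : ℕ) = g := by
  conv_rhs => rw [← Y.combine_coord g, combine]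
  refine Finset.sum_congr rfl fun j _ => ?_
  have e : Y.coord g j = ∑ i, (Y.functional (l i) j g).extend N K * mono (β i) 0 := by
    ext n
    rw [coeff_sum]
    conv_lhs => rw [← hl ((Y.coord g j).coeff n)]
    refine Finset.sum_congr rfl fun i _ => ?_
    rw [mul_comm, coeff_mono_mul, sub_zero, Algebra.smul_def, mul_comm]
    rfl
  conv_rhs => rw [e, map_sum, Finset.mul_sum]
  refine Finset.sum_congr rfl fun i _ => ?_
  rw [map_mul, pull_extend, pull_mono, Algebra.algebraMap_self_apply, pow_zero, mul_one,
    mul_left_comm, mono_mul_mono, one_mul, add_zero]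

end Ramification

end

end PadicDE

/-! ### Families with connection and the conditions behind dualizability -/

namespace PadicDE

noncomputable section

/-- If the members of a directed system of subspaces can be bounded, modulo `Z`, by a fixed finite
dimension, then their union is spanned modulo `Z` by finitely many elements. -/
theorem exists_span_of_directed {k M P : Type*} [Field k] [AddCommGroup M] [Module k M]
    [LinearOrder P] [Nonempty P] (S : P → Submodule k M) (hS : Monotone S) (Z : Submodule k M)
    {ι : Type*} [Fintype ι]
    (hL : ∀ c, ∃ L : M →ₗ[k] (ι → k), ∀ x ∈ S c, L x = 0 → x ∈ Z) :
    ∃ (n : ℕ) (y : Fin n → M) (c₀ : P), (∀ i, y i ∈ S c₀) ∧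
      ∀ c, ∀ x ∈ S c, ∃ a : Fin n → k, x - ∑ i, a i • y i ∈ Z := by
  classical
  let V : Submodule k M := ⨆ c, S c
  have hV : ∀ x, x ∈ V ↔ ∃ c, x ∈ S c := fun x =>
    Submodule.mem_iSup_of_directed S hS.directed_le
  let W : Submodule k (M ⧸ Z) := V.map Z.mkQ
  have hrep : ∀ w : W, ∃ x c, x ∈ S c ∧ Z.mkQ x = w := fun w => by
    obtain ⟨x, hx, hw⟩ := w.2
    obtain ⟨c, hc⟩ := (hV x).1 hx
    exact ⟨x, c, hc, hw⟩
  choose x c hx hw using hrep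
  have hsup : ∀ t : Finset W, ∃ c₀, ∀ w ∈ t, c w ≤ c₀ := fun t => by
    obtain ⟨c₀, h⟩ := (t.image c).exists_le
    exact ⟨c₀, fun w hw => h _ (Finset.mem_image_of_mem c hw)⟩
  have hrank : Module.rank k W ≤ Fintype.card ι := by
    -- A finite independent family has representatives in a single `S c₀` by directedness. There `L`
    -- kills only elements of `Z`, so the images under `L` stay independent in `ι → k`.
    refine rank_le fun t ht => ?_
    obtain ⟨c₀, hc₀⟩ := hsup t
    obtain ⟨L, hL⟩ := hL c₀
    have hli : LinearIndependent k fun w : t => L (x w.1) := by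
      rw [Fintype.linearIndependent_iff] at ht ⊢
      intro g hg
      apply ht
      have h1 : L (∑ w : t, g w • x w.1) = 0 := by
        rw [map_sum]; simpa only [map_smul] using hg
      have h2 := hL _ (Submodule.sum_mem _ fun w _ =>
        Submodule.smul_mem _ _ (hS (hc₀ w.1 w.2) (hx w.1))) h1
      rw [← Submodule.Quotient.mk_eq_zero, ← Submodule.mkQ_apply, map_sum] at h2
      apply Subtype.ext
      rw [Submodule.coe_zero, ← h2, Submodule.coe_sum]
      exact Finset.sum_congr rfl fun w _ => by
        rw [map_smul, hw, Submodule.coe_smul]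
    have := hli.fintype_card_le_finrank
    rwa [Fintype.card_coe, Module.finrank_fintype_fun_eq_card] at this
  have hfin : Module.Finite k W :=
    Module.rank_lt_aleph0_iff.1 (hrank.trans_lt (Cardinal.natCast_lt_aleph0))
  obtain ⟨n, s, hs⟩ := Module.Finite.exists_fin (R := k) (M := W)
  obtain ⟨c₀, hc₀⟩ := hsup (Finset.univ.image s)
  refine ⟨n, fun i => x (s i), c₀, fun i => hS (hc₀ _ (Finset.mem_image_of_mem s
    (Finset.mem_univ i))) (hx _), fun c' z hz => ?_⟩
  have hz' : (⟨Z.mkQ z, z, (hV z).2 ⟨c', hz⟩, rfl⟩ : W) ∈ Submodule.span k (Set.range s) := by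
    rw [hs]; trivial
  obtain ⟨a, ha⟩ := (Submodule.mem_span_range_iff_exists_fun k).1 hz'
  refine ⟨a, ?_⟩
  rw [← Submodule.Quotient.mk_eq_zero, ← Submodule.mkQ_apply, map_sub, map_sum, sub_eq_zero]
  have h3 := congrArg Subtype.val ha
  rw [Submodule.coe_sum] at h3
  refine h3.symm.trans ?_
  exact Finset.sum_congr rfl fun i _ => by rw [map_smul, hw, Submodule.coe_smul]

variable {K : Type u} [NormedField K] [IsUltrametricDist K] [CompleteSpace K]

/-- A family of modules over the function rings of the closed subannuli of `A[r,1)`, with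
restriction maps and a connection. -/
structure PreNabla (r : Radius K) where
  sec : ClosedInterval r → Type v
  [addCommGroup : ∀ J, AddCommGroup (sec J)]
  [module : ∀ J, Module (Func J) (sec J)]
  res : ∀ {J J' : ClosedInterval r} (h : J' ≤ J), sec J →ₛₗ[resFunc h] sec J'
  res_trans : ∀ {J J' J'' : ClosedInterval r} (h : J' ≤ J) (h' : J'' ≤ J') (v : sec J),
    res h' (res h v) = res (ClosedInterval.le_trans' h h') v
  D : ∀ J, sec J →+ sec J
  leibniz : ∀ J (f : Func J) (v : sec J), D J (f • v) = Laurent.deriv f • v + f • D J v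
  res_D : ∀ {J J' : ClosedInterval r} (h : J' ≤ J) (v : sec J), res h (D J v) = D J' (res h v)

attribute [instance] PreNabla.addCommGroup PreNabla.module

namespace PreNabla

variable {r : Radius K} (X : PreNabla.{u, v} r)

instance (J : ClosedInterval r) : Module K (X.sec J) :=
  Module.compHom _ (algebraMap K (Func J))

instance (J : ClosedInterval r) : IsScalarTower K (Func J) (X.sec J) :=
  IsScalarTower.of_algebraMap_smul fun _ _ => rfl

theorem D_smul (J : ClosedInterval r) (c : K) (v : X.sec J) : X.D J (c • v) = c • X.D J v := by
  rw [← algebraMap_smul (Func J) c v, X.leibniz, Derivation.map_algebraMap, zero_smul, zero_add,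
    algebraMap_smul]

theorem res_smul {J J' : ClosedInterval r} (h : J' ≤ J) (c : K) (v : X.sec J) :
    X.res h (c • v) = c • X.res h v := by
  rw [← algebraMap_smul (Func J) c v, map_smulₛₗ, ← algebraMap_smul (Func J') c]
  rfl

/-- A linear form over `A(J)`. -/
abbrev Form (J : ClosedInterval r) : Type (max u v) := X.sec J →ₗ[Func J] Func J

variable {X}

/-- The members of the family `v` over subannuli of `A[c,1)` form a section over `A[c,1)`. -/
def IsSec (c : Radius K) (v : ∀ J, X.sec J) : Prop :=
  ∀ (J J' : ClosedInterval r) (h : J' ≤ J), c ≤ J.lo → X.res h (v J) = v J'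

/-- The members of the family `φ` over subannuli of `A[c,1)` form a section of the dual. -/
def IsDual (c : Radius K) (φ : ∀ J, X.Form J) : Prop :=
  ∀ (J J' : ClosedInterval r) (h : J' ≤ J), c ≤ J.lo → ∀ v,
    φ J' (X.res h v) = resFunc h (φ J v)

/-- Horizontal sections over `A[c,1)`. -/
def IsHor (c : Radius K) (v : ∀ J, X.sec J) : Prop :=
  IsSec c v ∧ ∀ J : ClosedInterval r, c ≤ J.lo → X.D J (v J) = 0

/-- Horizontal sections of the dual over `A[c,1)`. -/
def IsHorDual (c : Radius K) (φ : ∀ J, X.Form J) : Prop :=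
  IsDual c φ ∧ ∀ J : ClosedInterval r, c ≤ J.lo → ∀ v, Laurent.deriv (φ J v) = φ J (X.D J v)

theorem IsSec.mono {c c' : Radius K} (h : c ≤ c') {v : ∀ J, X.sec J} (hv : IsSec c v) :
    IsSec c' v := fun J J' hJ hc => hv J J' hJ (h.trans hc)

theorem IsDual.mono {c c' : Radius K} (h : c ≤ c') {φ : ∀ J, X.Form J} (hφ : IsDual c φ) :
    IsDual c' φ := fun J J' hJ hc => hφ J J' hJ (h.trans hc)

theorem IsHor.mono {c c' : Radius K} (h : c ≤ c') {v : ∀ J, X.sec J} (hv : IsHor c v) :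
    IsHor c' v := ⟨hv.1.mono h, fun J hJ => hv.2 J (h.trans hJ)⟩

theorem IsHorDual.mono {c c' : Radius K} (h : c ≤ c') {φ : ∀ J, X.Form J} (hφ : IsHorDual c φ) :
    IsHorDual c' φ := ⟨hφ.1.mono h, fun J hJ => hφ.2 J (h.trans hJ)⟩

variable (X) in
/-- The subspace of sections over `A[c,1)`. -/
def secs (c : Radius K) : Submodule K (∀ J, X.sec J) where
  carrier := {v | IsSec c v}
  zero_mem' _ _ h _ := (X.res h).map_zero
  add_mem' hv hw J J' h hc := ((X.res h).map_add _ _).trans (by rw [hv J J' h hc, hw J J' h hc]; rfl)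
  smul_mem' a v hv J J' h hc := (X.res_smul h a _).trans (by rw [hv J J' h hc]; rfl)

variable (X) in
/-- The subspace of sections of the dual over `A[c,1)`. -/
def duals (c : Radius K) : Submodule K (∀ J, X.Form J) where
  carrier := {φ | IsDual c φ}
  zero_mem' _ _ _ _ _ := (map_zero _).symm
  add_mem' hφ hψ J J' h hc v := by
    simp only [Pi.add_apply, LinearMap.add_apply, map_add, hφ J J' h hc v, hψ J J' h hc v]
  smul_mem' c φ hφ J J' h hc v := by
    simp only [Pi.smul_apply, LinearMap.smul_apply, hφ J J' h hc v]
    exact (map_smul (Laurent.restrict (ClosedInterval.radii_subset h)) c (φ J v)).symm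

variable (X) in
/-- The subspace of horizontal sections over `A[c,1)`. -/
def horSecs (c : Radius K) : Submodule K (∀ J, X.sec J) where
  carrier := {v | IsHor c v}
  zero_mem' := ⟨(X.secs c).zero_mem, fun _ _ => map_zero _⟩
  add_mem' hv hw := ⟨(X.secs c).add_mem hv.1 hw.1, fun J h => by
    rw [Pi.add_apply, map_add, hv.2 J h, hw.2 J h, add_zero]⟩
  smul_mem' a v hv := ⟨(X.secs c).smul_mem a hv.1, fun J h => by
    rw [Pi.smul_apply, X.D_smul, hv.2 J h, smul_zero]⟩

variable (X) in
/-- The subspace of horizontal sections of the dual over `A[c,1)`. -/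
def horDuals (c : Radius K) : Submodule K (∀ J, X.Form J) where
  carrier := {φ | IsHorDual c φ}
  zero_mem' := ⟨(X.duals c).zero_mem, fun _ _ _ => map_zero _⟩
  add_mem' hφ hψ := ⟨(X.duals c).add_mem hφ.1 hψ.1, fun J h v => by
    simp only [Pi.add_apply, LinearMap.add_apply, map_add, hφ.2 J h v, hψ.2 J h v]⟩
  smul_mem' a φ hφ := ⟨(X.duals c).smul_mem a hφ.1, fun J h v => by
    simp only [Pi.smul_apply, LinearMap.smul_apply, Derivation.map_smul, hφ.2 J h v]⟩

variable (X) in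
/-- Families of sections vanishing near the outer boundary. -/
def nullSecs : Submodule K (∀ J, X.sec J) where
  carrier := {v | ∃ c : Radius K, r ≤ c ∧ ∀ J : ClosedInterval r, c ≤ J.lo → v J = 0}
  zero_mem' := ⟨r, le_rfl, fun _ _ => rfl⟩
  add_mem' := fun ⟨c, hc, h⟩ ⟨c', _, h'⟩ => ⟨max c c', hc.trans (le_max_left _ _), fun J hJ => by
    rw [Pi.add_apply, h J ((le_max_left _ _).trans hJ), h' J ((le_max_right _ _).trans hJ),
      add_zero]⟩
  smul_mem' a v := fun ⟨c, hc, h⟩ => ⟨c, hc, fun J hJ => by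
    rw [Pi.smul_apply, h J hJ, smul_zero]⟩

variable (X) in
/-- Families of forms vanishing near the outer boundary. -/
def nullForms : Submodule K (∀ J, X.Form J) where
  carrier := {φ | ∃ c : Radius K, r ≤ c ∧ ∀ J : ClosedInterval r, c ≤ J.lo → φ J = 0}
  zero_mem' := ⟨r, le_rfl, fun _ _ => rfl⟩
  add_mem' := fun ⟨c, hc, h⟩ ⟨c', _, h'⟩ => ⟨max c c', hc.trans (le_max_left _ _), fun J hJ => by
    rw [Pi.add_apply, h J ((le_max_left _ _).trans hJ), h' J ((le_max_right _ _).trans hJ),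
      add_zero]⟩
  smul_mem' a v := fun ⟨c, hc, h⟩ => ⟨c, hc, fun J hJ => by
    rw [Pi.smul_apply, h J hJ, smul_zero]⟩

/-- The section `v` over `A[c,1)` has residue zero against all horizontal sections of the dual. -/
def OrthSec (c : Radius K) (v : ∀ J, X.sec J) : Prop :=
  ∀ c', c ≤ c' → ∀ φ, IsHorDual c' φ → ∀ J : ClosedInterval r, c' ≤ J.lo →
    (φ J (v J)).coeff (-1) = 0

/-- The section `φ` of the dual over `A[c,1)` has residue zero against all horizontal sections. -/
def OrthForm (c : Radius K) (φ : ∀ J, X.Form J) : Prop :=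
  ∀ c', c ≤ c' → ∀ v, IsHor c' v → ∀ J : ClosedInterval r, c' ≤ J.lo →
    (φ J (v J)).coeff (-1) = 0

variable (X) in
/-- Over `A[b,1)`, the family is globally a direct summand of a free module of finite rank. -/
def HasDualBasis (b : Radius K) : Prop :=
  ∃ (ι : Type) (_ : Fintype ι) (e : ι → ∀ J, X.sec J) (f : ι → ∀ J, X.Form J),
    (∀ i, IsSec b (e i)) ∧ (∀ i, IsDual b (f i)) ∧
    ∀ J : ClosedInterval r, b ≤ J.lo → ∀ v, ∑ i, f i J v • e i J = v

variable (X) in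
/-- The dualizability conditions, in terms of families: horizontal sections of the dual form a
finite dimensional space, and a section orthogonal to them is a derivative. -/
structure Good (b : Radius K) : Prop where
  le : r ≤ b
  hasDualBasis : X.HasDualBasis b
  finite_duals : ∃ (ι : Type) (_ : Fintype ι), ∀ c, b ≤ c → ∃ L : (∀ J, X.Form J) →ₗ[K] (ι → K),
    ∀ φ, IsHorDual c φ → L φ = 0 → ∀ J : ClosedInterval r, c ≤ J.lo → φ J = 0
  exists_primitive : ∀ c, b ≤ c → ∀ v, IsSec c v → OrthSec c v →
    ∃ c', c ≤ c' ∧ ∃ w, IsSec c' w ∧ ∀ J : ClosedInterval r, c' ≤ J.lo → X.D J (w J) = v J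

variable (X) in
/-- The dualizability conditions for both the family and its dual. -/
structure VeryGood (b : Radius K) : Prop extends X.Good b where
  finite_secs : ∃ (ι : Type) (_ : Fintype ι), ∀ c, b ≤ c → ∃ L : (∀ J, X.sec J) →ₗ[K] (ι → K),
    ∀ v, IsHor c v → L v = 0 → ∀ J : ClosedInterval r, c ≤ J.lo → v J = 0
  exists_primitive_form : ∀ c, b ≤ c → ∀ φ, IsDual c φ → OrthForm c φ →
    ∃ c', c ≤ c' ∧ ∃ η : ∀ J, X.Form J, IsDual c' η ∧
      ∀ J : ClosedInterval r, c' ≤ J.lo → ∀ v, Laurent.deriv (η J v) - η J (X.D J v) = φ J v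

theorem Good.mono {b b' : Radius K} (h : b ≤ b') (H : X.Good b) : X.Good b' where
  le := H.le.trans h
  hasDualBasis := by
    obtain ⟨ι, i, e, f, h1, h2, h3⟩ := H.hasDualBasis
    exact ⟨ι, i, e, f, fun i => (h1 i).mono h, fun i => (h2 i).mono h,
      fun J hJ => h3 J (h.trans hJ)⟩
  finite_duals := by
    obtain ⟨ι, i, h1⟩ := H.finite_duals
    exact ⟨ι, i, fun c hc => h1 c (h.trans hc)⟩
  exists_primitive c hc := H.exists_primitive c (h.trans hc)

theorem VeryGood.mono {b b' : Radius K} (h : b ≤ b') (H : X.VeryGood b) : X.VeryGood b' where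
  toGood := H.toGood.mono h
  finite_secs := by
    obtain ⟨ι, i, h1⟩ := H.finite_secs
    exact ⟨ι, i, fun c hc => h1 c (h.trans hc)⟩
  exists_primitive_form c hc := H.exists_primitive_form c (h.trans hc)

/-- The dimension of the horizontal forms over `A[c,1)` is bounded independently of `c`, so a
spanning family of the direct limit lives on one annulus. Equality with a linear combination is
reached only after further shrinking, hence `c'`. -/
theorem Good.exists_span {b : Radius K} (H : X.Good b) :
    ∃ (n : ℕ) (φ : Fin n → ∀ J, X.Form J) (c₀ : Radius K), b ≤ c₀ ∧ (∀ i, IsHorDual c₀ (φ i)) ∧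
      ∀ c, b ≤ c → ∀ ψ, IsHorDual c ψ → ∃ (a : Fin n → K) (c' : Radius K), c ≤ c' ∧
        ∀ J : ClosedInterval r, c' ≤ J.lo → ψ J = ∑ i, a i • φ i J := by
  obtain ⟨ι, _, hL⟩ := H.finite_duals
  obtain ⟨n, φ, c₀, h1, h2⟩ := exists_span_of_directed (fun c : Set.Ici b => X.horDuals c.1)
    (fun c c' h φ hφ => IsHorDual.mono h hφ) X.nullForms (fun c => by
      obtain ⟨L, hL⟩ := hL c.1 c.2
      exact ⟨L, fun φ hφ h0 => ⟨c.1, H.le.trans c.2, hL φ hφ h0⟩⟩)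
  refine ⟨n, φ, c₀.1, c₀.2, h1, fun c hc ψ hψ => ?_⟩
  obtain ⟨a, c', -, h⟩ := h2 ⟨c, hc⟩ ψ hψ
  refine ⟨a, max c c', le_max_left _ _, fun J hJ => ?_⟩
  have h3 := h J ((le_max_right _ _).trans hJ)
  simpa [sub_eq_zero] using h3

theorem VeryGood.exists_span {b : Radius K} (H : X.VeryGood b) :
    ∃ (n : ℕ) (v : Fin n → ∀ J, X.sec J) (c₀ : Radius K), b ≤ c₀ ∧ (∀ i, IsHor c₀ (v i)) ∧
      ∀ c, b ≤ c → ∀ w, IsHor c w → ∃ (a : Fin n → K) (c' : Radius K), c ≤ c' ∧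
        ∀ J : ClosedInterval r, c' ≤ J.lo → w J = ∑ i, a i • v i J := by
  obtain ⟨ι, _, hL⟩ := H.finite_secs
  obtain ⟨n, φ, c₀, h1, h2⟩ := exists_span_of_directed (fun c : Set.Ici b => X.horSecs c.1)
    (fun c c' h φ hφ => IsHor.mono h hφ) X.nullSecs (fun c => by
      obtain ⟨L, hL⟩ := hL c.1 c.2
      exact ⟨L, fun φ hφ h0 => ⟨c.1, H.le.trans c.2, hL φ hφ h0⟩⟩)
  refine ⟨n, φ, c₀.1, c₀.2, h1, fun c hc ψ hψ => ?_⟩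
  obtain ⟨a, c', -, h⟩ := h2 ⟨c, hc⟩ ψ hψ
  refine ⟨a, max c c', le_max_left _ _, fun J hJ => ?_⟩
  have h3 := h J ((le_max_right _ _).trans hJ)
  simpa [sub_eq_zero] using h3

/-- Residues do not depend on the annulus on which they are computed. -/
theorem coeff_eq_of_isSec {c : Radius K} {φ : ∀ J, X.Form J} {v : ∀ J, X.sec J} (hφ : IsDual c φ)
    (hv : IsSec c v) {J J' : ClosedInterval r} (hJ : c ≤ J.lo) (hJ' : c ≤ J'.lo) (n : ℤ) :
    (φ J (v J)).coeff n = (φ J' (v J')).coeff n := by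
  have key : ∀ (J J' : ClosedInterval r) (_ : J' ≤ J), c ≤ J.lo →
      (φ J' (v J')).coeff n = (φ J (v J)).coeff n := by
    intro J J' h hc
    rw [← hv J J' h hc, hφ J J' h hc]
    rfl
  let J₀ : ClosedInterval r := ⟨min J.lo J'.lo, max J.hi J'.hi, le_min J.le_lo J'.le_lo,
    (min_le_left _ _).trans (J.lo_le_hi.trans (le_max_left _ _))⟩
  have h0 : c ≤ J₀.lo := le_min hJ hJ'
  exact (key J₀ J ⟨min_le_left _ _, le_max_left _ _⟩ h0).trans
    (key J₀ J' ⟨min_le_right _ _, le_max_right _ _⟩ h0).symm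

end PreNabla

/-- The underlying family of a `∇`-module. -/
def NablaModule.toPreNabla {r : Radius K} (E : NablaModule.{u, v} r) : PreNabla.{u, v} r where
  sec := E.sec
  addCommGroup := E.addCommGroup
  module := E.module
  res := E.res
  res_trans := E.res_trans
  D := E.D
  leibniz := E.leibniz
  res_D := E.res_D

end

end PadicDE

/-! ### From `Good` to perfectness of the local duality pairing -/

namespace PadicDE

noncomputable section

theorem finite_of_forall_exists_sum {k M : Type*} [Semiring k] [AddCommMonoid M] [Module k M]
    {n : ℕ} (y : Fin n → M) (h : ∀ x, ∃ a : Fin n → k, x = ∑ i, a i • y i) : Module.Finite k M := by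
  classical
  refine ⟨⟨Finset.univ.image y, eq_top_iff.2 fun x _ => ?_⟩⟩
  obtain ⟨a, rfl⟩ := h x
  exact Submodule.sum_mem _ fun i _ => Submodule.smul_mem _ _
    (Submodule.subset_span (Finset.mem_coe.2 (Finset.mem_image_of_mem y (Finset.mem_univ i))))

namespace NablaModule

variable {K : Type u} [NormedField K] [IsUltrametricDist K] [CompleteSpace K]
  {r s : Radius K} (E : NablaModule.{u, v} r) (h : r ≤ s)

open PreNabla

/-- Extension by zero of a section over `A[a,1)` to a family. -/
def extendSec {a : Radius K} (ha : r ≤ a) (v : (E.restrict ha).sections) :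
    ∀ J, (E.restrict h).toPreNabla.sec J := fun J =>
  if hJ : a ≤ J.lo then v.1 ⟨J.lo, J.hi, hJ, J.lo_le_hi⟩ else 0

/-- Extension by zero of a section of the dual over `A[a,1)` to a family. -/
def extendForm {a : Radius K} (ha : r ≤ a) (φ : (E.restrict ha).dualSections) :
    ∀ J, (E.restrict h).toPreNabla.Form J := fun J =>
  if hJ : a ≤ J.lo then φ.1 ⟨J.lo, J.hi, hJ, J.lo_le_hi⟩ else 0

theorem extendSec_of_le {a : Radius K} (ha : r ≤ a) (v : (E.restrict ha).sections)
    {J : ClosedInterval s} (hJ : a ≤ J.lo) :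
    E.extendSec h ha v J = v.1 ⟨J.lo, J.hi, hJ, J.lo_le_hi⟩ := dif_pos hJ

theorem extendForm_of_le {a : Radius K} (ha : r ≤ a) (φ : (E.restrict ha).dualSections)
    {J : ClosedInterval s} (hJ : a ≤ J.lo) :
    E.extendForm h ha φ J = φ.1 ⟨J.lo, J.hi, hJ, J.lo_le_hi⟩ := dif_pos hJ

theorem isSec_extendSec {a : Radius K} (ha : r ≤ a) (v : (E.restrict ha).sections) :
    IsSec a (E.extendSec h ha v) := fun J J' hJ hc => by
  rw [extendSec_of_le E h ha v hc, extendSec_of_le E h ha v (hc.trans hJ.1)]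
  exact v.2 ⟨J.lo, J.hi, hc, J.lo_le_hi⟩ ⟨J'.lo, J'.hi, hc.trans hJ.1, J'.lo_le_hi⟩ hJ

theorem isHorDual_extendForm {a : Radius K} (ha : r ≤ a) (φ : (E.restrict ha).kerDual) :
    IsHorDual a (E.extendForm h ha φ.1) := by
  refine ⟨fun J J' hJ hc v => ?_, fun J hc v => ?_⟩
  · rw [extendForm_of_le E h ha φ.1 hc, extendForm_of_le E h ha φ.1 (hc.trans hJ.1)]
    exact φ.1.2 ⟨J.lo, J.hi, hc, J.lo_le_hi⟩ ⟨J'.lo, J'.hi, hc.trans hJ.1, J'.lo_le_hi⟩ hJ v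
  · rw [extendForm_of_le E h ha φ.1 hc]
    have h1 : (E.restrict ha).dualD ⟨J.lo, J.hi, hc, J.lo_le_hi⟩
        (φ.1.1 ⟨J.lo, J.hi, hc, J.lo_le_hi⟩) = 0 :=
      congrFun (congrArg Subtype.val (LinearMap.mem_ker.1 φ.2)) _
    exact sub_eq_zero.1 (LinearMap.congr_fun h1 v)

/-- The section over `A[a,1)` defined by a family. -/
def sectionOf {a : Radius K} (ha : s ≤ a) {v : ∀ J, (E.restrict h).toPreNabla.sec J}
    (hv : IsSec a v) : (E.restrict (h.trans ha)).sections :=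
  ⟨fun J => v (J.up ha), fun J J' hJ => hv (J.up ha) (J'.up ha) hJ J.le_lo⟩

/-- The horizontal section of the dual over `A[a,1)` defined by a family. -/
def kerDualOf {a : Radius K} (ha : s ≤ a) {φ : ∀ J, (E.restrict h).toPreNabla.Form J}
    (hφ : IsHorDual a φ) : (E.restrict (h.trans ha)).kerDual :=
  ⟨⟨fun J => φ (J.up ha), fun J J' hJ => hφ.1 (J.up ha) (J'.up ha) hJ J.le_lo⟩,
    LinearMap.mem_ker.2 (Subtype.ext (funext fun J => LinearMap.ext fun v =>
      sub_eq_zero.2 (hφ.2 (J.up ha) J.le_lo v)))⟩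

instance : AddCommGroup E.H0Dual := Module.addCommMonoidToAddCommGroup K

instance : AddCommGroup E.H1 := Module.addCommMonoidToAddCommGroup K

theorem exists_of_kerDual_ge (b : Set.Ici r) (x : E.H0Dual) : ∃ (a : Set.Ici r) (_ : b ≤ a)
    (φ : (E.restrict a.2).kerDual), Module.DirectLimit.of K _ _ E.kerDualMap a φ = x := by
  obtain ⟨a, φ, rfl⟩ := Module.DirectLimit.exists_of x
  exact ⟨max a b, le_max_right _ _, E.kerDualMap a (max a b) (le_max_left _ _) φ,
    Module.DirectLimit.of_f⟩

theorem exists_of_coker_ge (b : Set.Ici r) (x : E.H1) : ∃ (a : Set.Ici r) (_ : b ≤ a)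
    (v : (E.restrict a.2).sections),
      Module.DirectLimit.of K _ _ E.cokerMap a (Submodule.Quotient.mk v) = x := by
  obtain ⟨a, φ, rfl⟩ := Module.DirectLimit.exists_of x
  obtain ⟨v, rfl⟩ := Submodule.Quotient.mk_surjective _ φ
  exact ⟨max a b, le_max_right _ _, E.sectionsMap a.2 (max a b).2 (le_max_left a b) v,
    Module.DirectLimit.of_f (f := E.cokerMap) (hij := le_max_left a b)
      (x := Submodule.Quotient.mk v)⟩

theorem localDuality_of_mk {a b : Set.Ici r} (hab : b ≤ a) (φ : (E.restrict a.2).kerDual)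
    (v : (E.restrict b.2).sections) (J : ClosedInterval a.1) :
    E.localDuality (Module.DirectLimit.of K _ _ E.kerDualMap a φ)
      (Module.DirectLimit.of K _ _ E.cokerMap b (Submodule.Quotient.mk v)) =
      (φ.1.1 J (v.1 (J.up hab))).coeff (-1) := by
  rw [localDuality_of, mixedPairing_eq E a b a le_rfl hab]
  exact (E.restrict a.2).residuePairing_apply φ.1 (E.sectionsMap b.2 a.2 hab v) J

variable {E h}

/-- Among the conditions of `Good` only the dual basis matters. Pairing `φ` with `t^(-1-n) e_i`
reads off the `n`-th coefficient of `φ(e_i)`, so a horizontal form orthogonal to everything vanishes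
on generators. -/
theorem localDuality_injective {b : Radius K} (H : (E.restrict h).toPreNabla.Good b) :
    Function.Injective E.localDuality := by
  rw [injective_iff_map_eq_zero]
  intro x hx
  obtain ⟨a, hba, φ, rfl⟩ := E.exists_of_kerDual_ge ⟨b, h.trans H.le⟩ x
  have hba : b ≤ a.1 := hba
  have hsa : s ≤ a.1 := H.le.trans hba
  obtain ⟨ι, _, e, f, he, -, hef⟩ := H.hasDualBasis
  suffices h0 : φ = 0 by rw [h0]; exact map_zero _
  refine Subtype.ext (Subtype.ext (funext fun J => LinearMap.ext fun v => ?_))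
  have hzero : ∀ i, φ.1.1 J (e i (J.up hsa)) = 0 := fun i => by
    ext n
    have hsec : IsSec a.1 (fun J => (Laurent.mono 1 (-1 - n) : Func J) • e i J) :=
      fun J J' hJ hc => by
        rw [map_smulₛₗ, he i J J' hJ (hba.trans hc)]; rfl
    have h1 := E.localDuality_of_mk le_rfl φ (E.sectionOf h hsa hsec) J
    rw [hx, LinearMap.zero_apply] at h1
    have h2 : φ.1.1 J ((E.sectionOf h hsa hsec).1 (J.up le_rfl)) =
        (Laurent.mono 1 (-1 - n) : Func J) * φ.1.1 J (e i (J.up hsa)) :=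
      (φ.1.1 J).map_smul _ _
    rw [h2, Laurent.coeff_mono_mul, one_mul] at h1
    rw [← show (-1 : ℤ) - (-1 - n) = n by ring, ← h1]
    rfl
  have h3 := hef (J.up hsa) (hba.trans J.le_lo) v
  have h4 : φ.1.1 J (∑ i, f i (J.up hsa) v • e i (J.up hsa)) = 0 := by
    refine (map_sum (φ.1.1 J) _ _).trans (Finset.sum_eq_zero fun i _ => ?_)
    refine ((φ.1.1 J).map_smul _ _).trans ?_
    rw [hzero i]
    exact smul_zero _
  exact (congrArg (φ.1.1 J) h3).symm.trans h4

/-- Orthogonality to `H⁰(E^∨)` is the hypothesis under which `Good` supplies a primitive, so the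
class dies on a smaller annulus. -/
theorem localDuality_flip_injective {b : Radius K} (H : (E.restrict h).toPreNabla.Good b) :
    Function.Injective E.localDuality.flip := by
  rw [injective_iff_map_eq_zero]
  intro y hy
  obtain ⟨a, hba, v, rfl⟩ := E.exists_of_coker_ge ⟨b, h.trans H.le⟩ y
  have hba : b ≤ a.1 := hba
  have hsa : s ≤ a.1 := H.le.trans hba
  obtain ⟨c, hc, w, hw, hwv⟩ := H.exists_primitive a.1 hba (E.extendSec h a.2 v)
    (E.isSec_extendSec h a.2 v) (fun c hc φ hφ J hJ => by
      have hsc : s ≤ c := hsa.trans hc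
      have h1 := E.localDuality_of_mk (a := ⟨c, h.trans hsc⟩) (b := a) hc (E.kerDualOf h hsc hφ) v
        ⟨J.lo, J.hi, hJ, J.lo_le_hi⟩
      have h2 := LinearMap.congr_fun hy
        (Module.DirectLimit.of K _ _ E.kerDualMap ⟨c, h.trans hsc⟩ (E.kerDualOf h hsc hφ))
      rw [extendSec_of_le E h a.2 v (hc.trans hJ)]
      exact h1.symm.trans h2)
  have hsc : s ≤ c := hsa.trans hc
  have h1 : E.cokerMap a ⟨c, h.trans hsc⟩ hc (Submodule.Quotient.mk v) = 0 := by
    refine (Submodule.Quotient.mk_eq_zero _).2 ⟨E.sectionOf h hsc hw, ?_⟩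
    refine Subtype.ext (funext fun J => ?_)
    refine (hwv (J.up hsc) J.le_lo).trans ?_
    exact extendSec_of_le E h a.2 v (J := J.up hsc) (hc.trans J.le_lo)
  have hac : a ≤ ⟨c, h.trans hsc⟩ := hc
  rw [← Module.DirectLimit.of_f (f := E.cokerMap) (hij := hac), h1, map_zero]

theorem directLimit_of_eq_sum {ι : Type*} [Preorder ι] [DecidableEq ι] {G : ι → Type*}
    [∀ i, AddCommMonoid (G i)] [∀ i, Module K (G i)] {f : ∀ i j, i ≤ j → G i →ₗ[K] G j} {a b c : ι}
    (hac : a ≤ c) (hbc : b ≤ c) {n : ℕ} {α : Fin n → K} {x : G a} {y : Fin n → G b}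
    (h : f a c hac x = ∑ i, α i • f b c hbc (y i)) :
    Module.DirectLimit.of K ι G f a x = ∑ i, α i • Module.DirectLimit.of K ι G f b (y i) := by
  rw [← Module.DirectLimit.of_f (hij := hac), h, map_sum]
  exact Finset.sum_congr rfl fun i _ => by rw [map_smul, Module.DirectLimit.of_f]

theorem finite_H0Dual {b : Radius K} (H : (E.restrict h).toPreNabla.Good b) :
    Module.Finite K E.H0Dual := by
  obtain ⟨n, φ, c₀, hbc, hφ, hspan⟩ := H.exists_span
  have hsc : s ≤ c₀ := H.le.trans hbc
  let c₀' : Set.Ici r := ⟨c₀, h.trans hsc⟩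
  let y : Fin n → E.H0Dual := fun i =>
    Module.DirectLimit.of K _ _ E.kerDualMap c₀' (E.kerDualOf h hsc (hφ i))
  refine finite_of_forall_exists_sum y fun x => ?_
  obtain ⟨a, hba, ψ, rfl⟩ := E.exists_of_kerDual_ge ⟨b, h.trans H.le⟩ x
  have hba : b ≤ a.1 := hba
  obtain ⟨α, c, hac, hα⟩ := hspan a.1 hba _ (E.isHorDual_extendForm h a.2 ψ)
  let c' : Set.Ici r := ⟨max c c₀, h.trans (hsc.trans (le_max_right _ _))⟩
  have hac' : a ≤ c' := hac.trans (le_max_left c c₀)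
  have hcc' : c₀' ≤ c' := le_max_right c c₀
  have h1 : E.kerDualMap a c' hac' ψ =
      ∑ i, α i • E.kerDualMap c₀' c' hcc' (E.kerDualOf h hsc (hφ i)) := by
    let P := (E.restrict c'.2).dualSections.subtype ∘ₗ (E.restrict c'.2).kerDual.subtype
    have hP : Function.Injective P :=
      (Submodule.injective_subtype _).comp (Submodule.injective_subtype _)
    apply hP
    rw [map_sum]
    refine funext fun J => ?_
    have hJ : a.1 ≤ J.lo := le_trans (show a.1 ≤ c'.1 from hac') J.le_lo
    have h2 := hα (J.up (hsc.trans hcc')) ((le_max_left c c₀).trans J.le_lo)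
    rw [extendForm_of_le E h a.2 ψ.1 (J := J.up (hsc.trans hcc')) hJ] at h2
    rw [Finset.sum_apply]
    exact h2
  exact ⟨α, directLimit_of_eq_sum (f := E.kerDualMap) hac' hcc' h1⟩

/-- A pairing of vector spaces that is injective on both sides is perfect as soon as one side is
finite dimensional. -/
theorem isDualizable_of_good {b : Radius K} (H : (E.restrict h).toPreNabla.Good b) :
    E.IsDualizable := by
  have := finite_H0Dual H
  have h1 := LinearMap.IsPerfPair.of_injective (p := E.localDuality) (localDuality_injective H)
    (localDuality_flip_injective H)
  exact ⟨h1.bijective_left, h1.bijective_right⟩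

end NablaModule

end

end PadicDE

/-! ### Extensions: splittings, connecting maps and stability of `Good` -/

namespace PadicDE

noncomputable section

/-- The Fredholm alternative: a vector outside the span of the columns is detected by a linear
functional that kills the columns. -/
theorem exists_sum_mul_eq_of_forall {k : Type*} [Field k] {n m : ℕ} (δ : Fin n → Fin m → k)
    (f : Fin n → k)
    (h : ∀ y : Fin n → k, (∀ j, ∑ i, y i * δ i j = 0) → ∑ i, y i * f i = 0) :
    ∃ x : Fin m → k, ∀ i, ∑ j, x j * δ i j = f i := by
  classical
  let p : Submodule k (Fin n → k) := Submodule.span k (Set.range fun j i => δ i j)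
  by_cases hf : f ∈ p
  · obtain ⟨x, hx⟩ := (Submodule.mem_span_range_iff_exists_fun k).1 hf
    refine ⟨x, fun i => ?_⟩
    rw [← hx, Finset.sum_apply]
    rfl
  · exfalso
    obtain ⟨g, hg, hp⟩ := Submodule.exists_dual_map_eq_bot_of_notMem hf inferInstance
    have hsum : ∀ z : Fin n → k, g z = ∑ i, g (Pi.single i 1) * z i := fun z => by
      conv_lhs => rw [pi_eq_sum_univ' z]
      rw [map_sum]
      refine Finset.sum_congr rfl fun i _ => ?_
      rw [map_smul, smul_eq_mul, mul_comm]
    apply hg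
    rw [hsum]
    refine h (fun i => g (Pi.single i 1)) fun j => ?_
    rw [← hsum fun i => δ i j]
    have : g (fun i => δ i j) ∈ p.map g :=
      Submodule.mem_map_of_mem (Submodule.subset_span ⟨j, rfl⟩)
    rw [hp] at this
    exact this

variable {K : Type u} [NormedField K] [IsUltrametricDist K] [CompleteSpace K]

variable (K) in
/-- The radii in the divisible closure of the value group accumulate at `1`. -/
def Radius.Cofinal : Prop := ∃ β : ℕ → Radius K, Monotone β ∧ ∀ c : Radius K, ∃ n, c ≤ β n

/-- The radii `p^(-1/(n+1))` increase to `1`, and the `(n+1)`-st power of each is `|p|`. -/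
theorem Radius.cofinal {p : ℕ} [Fact p.Prime] (hp : ‖(p : K)‖ = (p : ℝ)⁻¹) :
    Radius.Cofinal K := by
  have hp1 : (1 : ℝ) < p := by exact_mod_cast (Fact.out : p.Prime).one_lt
  have hp0 : (0 : ℝ) < (p : ℝ)⁻¹ := by positivity
  have hpi : (p : ℝ)⁻¹ < 1 := inv_lt_one_of_one_lt₀ hp1
  have hpow : ∀ n : ℕ, (((p : ℝ)⁻¹) ^ (((n + 1 : ℕ) : ℝ)⁻¹)) ^ (n + 1) = (p : ℝ)⁻¹ := fun n =>
    Real.rpow_inv_natCast_pow hp0.le n.succ_ne_zero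
  refine ⟨fun n => ⟨((p : ℝ)⁻¹) ^ (((n + 1 : ℕ) : ℝ)⁻¹), Real.rpow_pos_of_pos hp0 _,
    Real.rpow_lt_one hp0.le hpi (by positivity), n + 1, n.succ_pos, (p : K), ?_, ?_⟩, ?_, ?_⟩
  · rw [← norm_pos_iff, hp]; exact hp0
  · rw [hp]; exact hpow n
  · intro m n h
    refine Real.rpow_le_rpow_of_exponent_ge hp0 hpi.le ?_
    have : ((m + 1 : ℕ) : ℝ) ≤ ((n + 1 : ℕ) : ℝ) := by exact_mod_cast Nat.succ_le_succ h
    exact inv_anti₀ (by positivity) this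
  · intro c
    obtain ⟨n, hn⟩ := exists_pow_lt_of_lt_one hp0 c.2.2.1
    refine ⟨n, ?_⟩
    show c.1 ≤ ((p : ℝ)⁻¹) ^ (((n + 1 : ℕ) : ℝ)⁻¹)
    refine le_of_pow_le_pow_left₀ n.succ_ne_zero (Real.rpow_nonneg hp0.le _) ?_
    rw [hpow]
    exact (pow_le_pow_of_le_one c.2.1.le c.2.2.1.le n.le_succ).trans hn.le

namespace PreNabla

variable {r : Radius K} {X' X X'' : PreNabla.{u, v} r}

variable (X' X X'') in
/-- A short exact sequence of families. -/
structure ShortExact where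
  i : ∀ J, X'.sec J →ₗ[Func J] X.sec J
  q : ∀ J, X.sec J →ₗ[Func J] X''.sec J
  i_injective : ∀ J, Function.Injective (i J)
  q_surjective : ∀ J, Function.Surjective (q J)
  q_i : ∀ J y, q J (i J y) = 0
  exact : ∀ J x, q J x = 0 → ∃ y, i J y = x
  i_res : ∀ {J J' : ClosedInterval r} (h : J' ≤ J) (y : X'.sec J),
    i J' (X'.res h y) = X.res h (i J y)
  q_res : ∀ {J J' : ClosedInterval r} (h : J' ≤ J) (x : X.sec J),
    q J' (X.res h x) = X''.res h (q J x)
  i_D : ∀ J y, i J (X'.D J y) = X.D J (i J y)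
  q_D : ∀ J x, q J (X.D J x) = X''.D J (q J x)

namespace ShortExact

/-- Sections of the quotient lift to sections. -/
theorem exists_lift (S : ShortExact X' X X'') (hK : Radius.Cofinal K) {b c : Radius K} (hrb : r ≤ b)
    (hb : X'.HasDualBasis b) (hc : b ≤ c) {w : ∀ J, X''.sec J} (hw : IsSec c w) :
    ∃ v, IsSec c v ∧ ∀ J : ClosedInterval r, c ≤ J.lo → S.q J (v J) = w J := by
  obtain ⟨β, hβ, hcof⟩ := hK
  obtain ⟨ι, _, e, f, he, hf, hef⟩ := hb
  -- Closed annuli with fixed inner radius `c` that exhaust `A[c,1)`. Over each of them a lift `x n`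
  -- exists, and consecutive lifts differ by a section `d n` of `X'`.
  let T : ℕ → ClosedInterval r := fun n => ⟨c, max c (β n), hrb.trans hc, le_max_left _ _⟩
  have hT : ∀ {m n}, m ≤ n → T m ≤ T n := fun h => ⟨le_rfl, max_le_max le_rfl (hβ h)⟩
  choose x hx using fun n => S.q_surjective (T n) (w (T n))
  have hd : ∀ n, ∃ d, S.i (T n) d = x n - X.res (hT n.le_succ) (x (n + 1)) := fun n => by
    refine S.exact _ _ ?_
    rw [map_sub, S.q_res, hx, hx, hw _ _ _ le_rfl, sub_self]
  choose d hd using hd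
  -- The dual basis of `X'` turns the discrepancies `d n` into finitely many sequences of functions,
  -- for which the first derived limit vanishes; the resulting `g` correct the local lifts to
  -- compatible ones.
  have hg : ∀ a : ι, ∃ g : ∀ n, Func (T n), ∀ n, f a (T n) (d n) =
      g n - Laurent.restrict (ClosedInterval.radii_subset (hT n.le_succ)) (g (n + 1)) := fun a =>
    Laurent.exists_sub_restrict_eq (I := fun n => (T n).radii) (α := c.1)
      (β := fun n => (max c (β n)).1) (fun n => rfl) (fun n => le_max_left c (β n))
      (fun m n h => (max_le_max le_rfl (hβ h) : max c (β m) ≤ max c (β n)))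
      (fun h => ClosedInterval.radii_subset (hT h)) _
  choose g hg using hg
  let y : ∀ n, X.sec (T n) := fun n => x n - S.i (T n) (∑ a, g a n • e a (T n))
  have hy1 : ∀ n, X.res (hT n.le_succ) (y (n + 1)) = y n := fun n => by
    have h1 : X'.res (hT n.le_succ) (∑ a, g a (n + 1) • e a (T (n + 1))) =
        ∑ a, g a n • e a (T n) - d n := by
      rw [map_sum]
      conv_rhs => rw [← hef (T n) hc (d n)]
      rw [← Finset.sum_sub_distrib]
      refine Finset.sum_congr rfl fun a _ => ?_
      rw [map_smulₛₗ, he a _ _ _ hc, ← sub_smul, hg a n, sub_sub_cancel]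
      rfl
    simp only [y]
    rw [map_sub, ← S.i_res, h1, map_sub, hd]
    abel
  have hy : ∀ m n (h : m ≤ n), X.res (hT h) (y n) = y m := by
    intro m n h
    induction n, h using Nat.le_induction with
    | base => rw [← hy1 m, X.res_trans]
    | succ n h ih => rw [← ih, ← hy1 n, X.res_trans]
  have hqy : ∀ n, S.q _ (y n) = w (T n) := fun n => by
    simp only [y]
    rw [map_sub, S.q_i, sub_zero, hx]
  choose k hk using hcof
  have hJ : ∀ J : ClosedInterval r, c ≤ J.lo → J ≤ T (k J.hi) := fun J h =>
    ⟨h, (hk J.hi).trans (le_max_right _ _)⟩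
  refine ⟨fun J => if h : c ≤ J.lo then X.res (hJ J h) (y _) else 0, fun J J' h hcJ => ?_,
    fun J hcJ => ?_⟩
  · simp only
    rw [dif_pos hcJ, dif_pos (hcJ.trans h.1), X.res_trans]
    rcases le_total (k J.hi) (k J'.hi) with h' | h'
    · rw [← hy _ _ h', X.res_trans]
    · rw [← hy _ _ h', X.res_trans]
  · simp only
    rw [dif_pos hcJ, S.q_res, hqy, hw _ _ _ le_rfl]

/-- A splitting over `A[b,1)`, not compatible with the connections. -/
structure Splitting (S : ShortExact X' X X'') (b : Radius K) where
  σ : ∀ J, X''.sec J →ₗ[Func J] X.sec J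
  ρ : ∀ J, X.sec J →ₗ[Func J] X'.sec J
  q_σ : ∀ J : ClosedInterval r, b ≤ J.lo → ∀ x, S.q J (σ J x) = x
  add_eq : ∀ J : ClosedInterval r, b ≤ J.lo → ∀ x, S.i J (ρ J x) + σ J (S.q J x) = x
  σ_res : ∀ {J J' : ClosedInterval r} (h : J' ≤ J), b ≤ J.lo → ∀ x,
    σ J' (X''.res h x) = X.res h (σ J x)
  ρ_res : ∀ {J J' : ClosedInterval r} (h : J' ≤ J), b ≤ J.lo → ∀ x,
    ρ J' (X.res h x) = X'.res h (ρ J x)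

/-- Lifting the finitely many sections `e_a` of a dual basis of `X''` to sections `v_a` of `X` over
`A[b,1)` gives `σ x = ∑ f_a(x) v_a`. The retraction `ρ` is then forced by exactness. -/
theorem nonempty_splitting (S : ShortExact X' X X'') (hK : Radius.Cofinal K) {b : Radius K}
    (hrb : r ≤ b) (hb' : X'.HasDualBasis b) (hb : X''.HasDualBasis b) :
    Nonempty (S.Splitting b) := by
  obtain ⟨ι, _, e, f, he, hf, hef⟩ := hb
  choose v hv hqv using fun a => S.exists_lift hK hrb hb' le_rfl (he a)
  let σ : ∀ J, X''.sec J →ₗ[Func J] X.sec J := fun J =>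
    ∑ a, (LinearMap.toSpanSingleton (Func J) (X.sec J) (v a J)) ∘ₗ f a J
  have hσ : ∀ J x, σ J x = ∑ a, f a J x • v a J := fun J x => by
    simp only [σ, LinearMap.sum_apply, LinearMap.comp_apply, LinearMap.toSpanSingleton_apply]
  have hqσ : ∀ J : ClosedInterval r, b ≤ J.lo → ∀ x, S.q J (σ J x) = x := fun J hJ x => by
    rw [hσ, map_sum]
    conv_rhs => rw [← hef J hJ x]
    exact Finset.sum_congr rfl fun a _ => by rw [map_smul, hqv a J hJ]
  have hρ : ∀ J, ∃ ρ : X.sec J →ₗ[Func J] X'.sec J,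
      b ≤ J.lo → ∀ x, S.i J (ρ x) + σ J (S.q J x) = x := fun J => by
    by_cases hJ : b ≤ J.lo
    · have h1 : ∀ x, ∃ y, S.i J y + σ J (S.q J x) = x := fun x => by
        obtain ⟨y, hy⟩ := S.exact J (x - σ J (S.q J x)) (by rw [map_sub, hqσ J hJ, sub_self])
        exact ⟨y, by rw [hy]; abel⟩
      choose ρ hρ using h1
      refine ⟨⟨⟨ρ, fun x y => S.i_injective J ?_⟩, fun a x => S.i_injective J ?_⟩, fun _ => hρ⟩
      · have h1 := hρ (x + y)
        conv_rhs at h1 => rw [← hρ x, ← hρ y]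
        rw [map_add, map_add] at h1
        rw [map_add]
        have h2 : S.i J (ρ (x + y)) + (σ J (S.q J x) + σ J (S.q J y)) =
          S.i J (ρ x) + S.i J (ρ y) + (σ J (S.q J x) + σ J (S.q J y)) := by rw [h1]; abel
        exact add_right_cancel h2
      · have h1 := hρ (a • x)
        conv_rhs at h1 => rw [← hρ x, smul_add]
        rw [map_smul, map_smul] at h1
        rw [RingHom.id_apply, map_smul]
        exact add_right_cancel h1
    · exact ⟨0, fun h => absurd h hJ⟩
  choose ρ hρ using hρ
  have hσres : ∀ {J J' : ClosedInterval r} (h : J' ≤ J), b ≤ J.lo → ∀ x,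
      σ J' (X''.res h x) = X.res h (σ J x) := fun {J J'} h hJ x => by
    rw [hσ, hσ, map_sum]
    refine Finset.sum_congr rfl fun a _ => ?_
    rw [map_smulₛₗ, hf a J J' h hJ, hv a J J' h hJ]
  refine ⟨⟨σ, ρ, hqσ, hρ, hσres, fun {J J'} h hJ x => S.i_injective J' ?_⟩⟩
  have h1 := hρ J' (hJ.trans h.1) (X.res h x)
  rw [S.q_res, hσres h hJ] at h1
  have h2 := congrArg (X.res h) (hρ J hJ x)
  rw [map_add, ← S.i_res] at h2
  exact add_right_cancel (h1.trans h2.symm)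

namespace Splitting

variable {S : ShortExact X' X X''} {b : Radius K} (P : S.Splitting b)

theorem ρ_i {J : ClosedInterval r} (hJ : b ≤ J.lo) (y : X'.sec J) : P.ρ J (S.i J y) = y := by
  have h := P.add_eq J hJ (S.i J y)
  rw [S.q_i, map_zero, add_zero] at h
  exact S.i_injective J h

theorem ρ_σ {J : ClosedInterval r} (hJ : b ≤ J.lo) (x : X''.sec J) : P.ρ J (P.σ J x) = 0 := by
  have h := P.add_eq J hJ (P.σ J x)
  rw [P.q_σ J hJ, add_eq_right] at h
  exact S.i_injective J (h.trans (map_zero _).symm)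

theorem i_ρ_D_σ {J : ClosedInterval r} (hJ : b ≤ J.lo) (x : X''.sec J) :
    S.i J (P.ρ J (X.D J (P.σ J x))) = X.D J (P.σ J x) - P.σ J (X''.D J x) := by
  have h := P.add_eq J hJ (X.D J (P.σ J x))
  rw [S.q_D, P.q_σ J hJ] at h
  exact eq_sub_of_add_eq h

theorem ρ_D {J : ClosedInterval r} (hJ : b ≤ J.lo) (x : X.sec J) :
    P.ρ J (X.D J x) = X'.D J (P.ρ J x) + P.ρ J (X.D J (P.σ J (S.q J x))) := by
  conv_lhs => rw [← P.add_eq J hJ x, map_add, ← S.i_D, map_add, P.ρ_i hJ]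

/-- The Leibniz term `df • σ x` is killed by `ρ`. Hence `ρ D σ`, which measures how far the
splitting is from being horizontal, is linear over functions. -/
theorem ρ_D_σ_smul {J : ClosedInterval r} (hJ : b ≤ J.lo) (f : Func J) (x : X''.sec J) :
    P.ρ J (X.D J (P.σ J (f • x))) = f • P.ρ J (X.D J (P.σ J x)) := by
  rw [map_smul, X.leibniz, map_add, map_smul, P.ρ_σ hJ, smul_zero, zero_add, map_smul]

theorem hasDualBasis (P : S.Splitting b) (h' : X'.HasDualBasis b) (h'' : X''.HasDualBasis b) : X.HasDualBasis b := by
  obtain ⟨ι, _, e, f, he, hf, hef⟩ := h'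
  obtain ⟨κ, _, e₂, f₂, he₂, hf₂, hef₂⟩ := h''
  refine ⟨ι ⊕ κ, inferInstance,
    fun a J => Sum.elim (fun a => S.i J (e a J)) (fun a => P.σ J (e₂ a J)) a,
    fun a J => Sum.elim (fun a => f a J ∘ₗ P.ρ J) (fun a => f₂ a J ∘ₗ S.q J) a, ?_, ?_, ?_⟩
  · rintro (a | a) J J' h hJ
    · simp only [Sum.elim_inl]
      rw [← S.i_res, he a J J' h hJ]
    · simp only [Sum.elim_inr]
      rw [← P.σ_res h hJ, he₂ a J J' h hJ]
  · rintro (a | a) J J' h hJ v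
    · simp only [Sum.elim_inl, LinearMap.comp_apply]
      rw [P.ρ_res h hJ, hf a J J' h hJ]
    · simp only [Sum.elim_inr, LinearMap.comp_apply]
      rw [S.q_res, hf₂ a J J' h hJ]
  · intro J hJ v
    rw [Fintype.sum_sum_type]
    simp only [Sum.elim_inl, Sum.elim_inr, LinearMap.comp_apply, ← map_smul, ← map_sum]
    rw [hef J hJ, hef₂ J hJ, P.add_eq J hJ]

theorem isHorDual_comp_i {c : Radius K} {φ : ∀ J, X.Form J} (hφ : IsHorDual c φ) :
    IsHorDual c fun J => φ J ∘ₗ S.i J :=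
  ⟨fun J J' h hJ v => by
    rw [LinearMap.comp_apply, LinearMap.comp_apply, S.i_res, hφ.1 J J' h hJ],
  fun J hJ v => by rw [LinearMap.comp_apply, LinearMap.comp_apply, S.i_D, hφ.2 J hJ]⟩

theorem isHorDual_comp_q {c : Radius K} {φ : ∀ J, X''.Form J} (hφ : IsHorDual c φ) :
    IsHorDual c fun J => φ J ∘ₗ S.q J :=
  ⟨fun J J' h hJ v => by
    rw [LinearMap.comp_apply, LinearMap.comp_apply, S.q_res, hφ.1 J J' h hJ],
  fun J hJ v => by rw [LinearMap.comp_apply, LinearMap.comp_apply, S.q_D, hφ.2 J hJ]⟩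

/-- The restriction `φ ∘ i` is horizontal. If it vanishes then `φ` factors through `X''`, and `φ ∘
σ` is horizontal although `σ` does not commute with `D`. So the bounds for `X'` and `X''` add up. -/
theorem finite_duals (P : S.Splitting b) (H' : X'.Good b) (H'' : X''.Good b) : ∃ (ι : Type) (_ : Fintype ι),
    ∀ c, b ≤ c → ∃ L : (∀ J, X.Form J) →ₗ[K] (ι → K),
      ∀ φ, IsHorDual c φ → L φ = 0 → ∀ J : ClosedInterval r, c ≤ J.lo → φ J = 0 := by
  obtain ⟨ι, _, h1⟩ := H'.finite_duals
  obtain ⟨κ, _, h2⟩ := H''.finite_duals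
  refine ⟨ι ⊕ κ, inferInstance, fun c hc => ?_⟩
  obtain ⟨L₁, hL₁⟩ := h1 c hc
  obtain ⟨L₂, hL₂⟩ := h2 c hc
  refine ⟨{ toFun := fun φ => Sum.elim (L₁ fun J => φ J ∘ₗ S.i J) (L₂ fun J => φ J ∘ₗ P.σ J)
            map_add' := fun φ ψ => ?_
            map_smul' := fun a φ => ?_ }, fun φ hφ h0 J hJ => ?_⟩
  · have e1 : (fun J => (φ + ψ) J ∘ₗ S.i J) =
      (fun J => φ J ∘ₗ S.i J) + fun J => ψ J ∘ₗ S.i J := rfl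
    have e2 : (fun J => (φ + ψ) J ∘ₗ P.σ J) =
      (fun J => φ J ∘ₗ P.σ J) + fun J => ψ J ∘ₗ P.σ J := rfl
    rw [e1, e2, map_add, map_add]
    ext (i | i) <;> rfl
  · have e1 : (fun J => (a • φ) J ∘ₗ S.i J) = a • fun J => φ J ∘ₗ S.i J := rfl
    have e2 : (fun J => (a • φ) J ∘ₗ P.σ J) = a • fun J => φ J ∘ₗ P.σ J := rfl
    rw [e1, e2, map_smul, map_smul]
    ext (i | i) <;> rfl
  · have z1 := hL₁ _ (isHorDual_comp_i hφ) (funext fun i => congrFun h0 (Sum.inl i))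
    have z1' : ∀ J : ClosedInterval r, c ≤ J.lo → ∀ x, S.q J x = 0 → φ J x = 0 := by
      intro J hJ x hx
      obtain ⟨y, rfl⟩ := S.exact J x hx
      exact LinearMap.congr_fun (z1 J hJ) y
    have hσ : IsHorDual c fun J => φ J ∘ₗ P.σ J := by
      refine ⟨fun J J' h hJ v => ?_, fun J hJ v => ?_⟩
      · rw [LinearMap.comp_apply, LinearMap.comp_apply, P.σ_res h (hc.trans hJ), hφ.1 J J' h hJ]
      · rw [LinearMap.comp_apply, LinearMap.comp_apply, hφ.2 J hJ, ← sub_eq_zero, ← map_sub]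
        refine z1' J hJ _ ?_
        rw [map_sub, S.q_D, P.q_σ J (hc.trans hJ), P.q_σ J (hc.trans hJ), sub_self]
    have z2 := hL₂ _ hσ (funext fun i => congrFun h0 (Sum.inr i))
    ext1 x
    rw [← P.add_eq J (hc.trans hJ) x, map_add, z1' J hJ _ (S.q_i J _), zero_add]
    exact LinearMap.congr_fun (z2 J hJ) _

/-- The form `φ ∘ ρ` extends `φ` but fails to be horizontal by the form `ω = φ ∘ ρ D σ` on `X''`.
Orthogonality of `ω` to horizontal sections provides `η` with derivative `ω`, and `φ ∘ ρ + η ∘ q` is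
horizontal. This is where primitives of forms, the dual half of `VeryGood`, enter. -/
theorem exists_extension (H'' : X''.VeryGood b) {c : Radius K} (hc : b ≤ c)
    {φ : ∀ J, X'.Form J} (hφ : IsHorDual c φ)
    (horth : ∀ c', c ≤ c' → ∀ h, IsHor c' h → ∀ J : ClosedInterval r, c' ≤ J.lo →
      (φ J (P.ρ J (X.D J (P.σ J (h J))))).coeff (-1) = 0) :
    ∃ c', c ≤ c' ∧ ∃ ψ : ∀ J, X.Form J, IsHorDual c' ψ ∧
      ∀ J : ClosedInterval r, c' ≤ J.lo → ∀ y, ψ J (S.i J y) = φ J y := by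
  have hω : ∀ J, ∃ ω : X''.Form J, b ≤ J.lo → ∀ x, ω x = φ J (P.ρ J (X.D J (P.σ J x))) := by
    intro J
    by_cases hJ : b ≤ J.lo
    · exact ⟨⟨⟨fun x => φ J (P.ρ J (X.D J (P.σ J x))), fun x y => by simp only [map_add]⟩,
        fun f x => by rw [RingHom.id_apply, ← map_smul, ← P.ρ_D_σ_smul hJ]⟩, fun _ _ => rfl⟩
    · exact ⟨0, fun h => absurd h hJ⟩
  choose ω hω using hω
  have hωd : IsDual c ω := fun J J' h hJ x => by
    rw [hω J (hc.trans hJ), hω J' ((hc.trans hJ).trans h.1), P.σ_res h (hc.trans hJ), ← X.res_D,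
      P.ρ_res h (hc.trans hJ), hφ.1 J J' h hJ]
  obtain ⟨c', hc', η, hη, hηω⟩ := H''.exists_primitive_form c hc ω hωd (fun c' hc' h hh J hJ => by
    rw [hω J (hc.trans (hc'.trans hJ))]
    exact horth c' hc' h hh J hJ)
  refine ⟨c', hc', fun J => φ J ∘ₗ P.ρ J + η J ∘ₗ S.q J, ⟨fun J J' h hJ x => ?_, fun J hJ x => ?_⟩,
    fun J hJ y => ?_⟩
  · have hbJ := hc.trans (hc'.trans hJ)
    simp only [LinearMap.add_apply, LinearMap.comp_apply, map_add]
    rw [P.ρ_res h hbJ, hφ.1 J J' h (hc'.trans hJ), S.q_res, hη J J' h hJ]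
  · have hbJ := hc.trans (hc'.trans hJ)
    simp only [LinearMap.add_apply, LinearMap.comp_apply, map_add]
    rw [hφ.2 J (hc'.trans hJ), P.ρ_D hbJ, map_add, S.q_D, ← hω J hbJ, ← hηω J hJ]
    abel
  · have hbJ := hc.trans (hc'.trans hJ)
    simp only [LinearMap.add_apply, LinearMap.comp_apply]
    rw [P.ρ_i hbJ, S.q_i, map_zero, add_zero]

/-- Integrating the image in `X''` leaves a section `v₁` with values in `X'`. It may still be
changed by `ρ D σ h` with `h` horizontal in `X''`, and a suitable `h` makes it orthogonal to the
horizontal forms of `X'`. The linear system for `h` is finite, both horizontal spaces being finite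
dimensional, and solvable: a horizontal form of `X'` annihilating all `ρ D σ h` extends to `X`,
where orthogonality is known. -/
theorem exists_primitive (P : S.Splitting b) (H' : X'.Good b) (H'' : X''.VeryGood b) {c : Radius K} (hc : b ≤ c)
    {v : ∀ J, X.sec J} (hv : IsSec c v) (ho : OrthSec c v) :
    ∃ c', c ≤ c' ∧ ∃ w, IsSec c' w ∧
      ∀ J : ClosedInterval r, c' ≤ J.lo → X.D J (w J) = v J := by
  obtain ⟨c₁, hc₁, w₁, hw₁, hwv⟩ := H''.exists_primitive c hc (fun J => S.q J (v J))
    (fun J J' h hJ => by rw [← S.q_res, hv J J' h hJ])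
    (fun c' hc' φ hφ J hJ => ho c' hc' _ (isHorDual_comp_q (S := S) hφ) J hJ)
  have hbc₁ := hc.trans hc₁
  let v₁ : ∀ J, X.sec J := fun J => v J - X.D J (P.σ J (w₁ J))
  have hv₁ : IsSec c₁ v₁ := fun J J' h hJ => by
    simp only [v₁]
    rw [map_sub, hv J J' h (hc₁.trans hJ), X.res_D, ← P.σ_res h (hbc₁.trans hJ), hw₁ J J' h hJ]
  have hqv₁ : ∀ J : ClosedInterval r, c₁ ≤ J.lo → S.q J (v₁ J) = 0 := fun J hJ => by
    simp only [v₁]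
    rw [map_sub, S.q_D, P.q_σ J (hbc₁.trans hJ), hwv J hJ, sub_self]
  have hiρ : ∀ J : ClosedInterval r, c₁ ≤ J.lo → S.i J (P.ρ J (v₁ J)) = v₁ J := fun J hJ => by
    have h := P.add_eq J (hbc₁.trans hJ) (v₁ J)
    rwa [hqv₁ J hJ, map_zero, add_zero] at h
  have ho₁ : OrthSec c₁ v₁ := fun c' hc' φ hφ J hJ => by
    simp only [v₁]
    rw [map_sub, ← hφ.2 J hJ, Laurent.coeff_sub, ho c' (hc₁.trans hc') φ hφ J hJ,
      Laurent.coeff_deriv]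
    simp
  obtain ⟨n, φ, cφ, hbφ, hφ, hφspan⟩ := H'.exists_span
  obtain ⟨m, y, cy, hby, hy, hyspan⟩ := H''.exists_span
  let c₂ := max c₁ (max cφ cy)
  have h12 : c₁ ≤ c₂ := le_max_left _ _
  have hφ2 : cφ ≤ c₂ := (le_max_left _ _).trans (le_max_right _ _)
  have hy2 : cy ≤ c₂ := (le_max_right _ _).trans (le_max_right _ _)
  have hb2 : b ≤ c₂ := hbc₁.trans h12
  let J₂ : ClosedInterval r := .point c₂ (H'.le.trans hb2)
  have hδsec : ∀ {c'} (_ : b ≤ c') {h : ∀ J, X''.sec J}, IsSec c' h →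
      IsSec c' fun J => P.ρ J (X.D J (P.σ J (h J))) := fun hb' h hh J J' hJ hcJ => by
    rw [← P.ρ_res hJ (hb'.trans hcJ), X.res_D, ← P.σ_res hJ (hb'.trans hcJ), hh J J' hJ hcJ]
  have hρsec : IsSec c₁ fun J => P.ρ J (v₁ J) := fun J J' h hJ => by
    rw [← P.ρ_res h (hbc₁.trans hJ), hv₁ J J' h hJ]
  -- All residues of the system are computed on the circle `|t| = c₂`, where both spanning families
  -- are defined and horizontal.
  obtain ⟨x, hx⟩ := exists_sum_mul_eq_of_forall
    (fun i j => (φ i J₂ (P.ρ J₂ (X.D J₂ (P.σ J₂ (y j J₂))))).coeff (-1))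
    (fun i => (φ i J₂ (P.ρ J₂ (v₁ J₂))).coeff (-1)) (fun a ha => by
      let ψ : ∀ J, X'.Form J := ∑ i, a i • φ i
      have hψ : IsHorDual c₂ ψ := (X'.horDuals c₂).sum_mem fun i _ =>
        (X'.horDuals c₂).smul_mem _ ((hφ i).mono hφ2)
      have hψv : ∀ J (z : X'.sec J), (ψ J z).coeff (-1) = ∑ i, a i * (φ i J z).coeff (-1) := by
        intro J z
        simp only [ψ, Finset.sum_apply, LinearMap.sum_apply, Pi.smul_apply, LinearMap.smul_apply,
          Laurent.coeff_sum, Laurent.coeff_smul]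
      -- By the choice of `a` the form `ψ` annihilates every `ρ D σ y_j`, hence `ρ D σ h` for every
      -- horizontal `h`, which near the boundary is a combination of the `y_j`. So `ψ` extends to a
      -- horizontal form on `X`.
      obtain ⟨c₃, hc₃, Ψ, hΨ, hΨψ⟩ := P.exists_extension H'' hb2 hψ (fun c' hc' h hh J hJ => by
        obtain ⟨s, c'', hc'', hs⟩ := hyspan c' (hb2.trans hc') h hh
        let J' : ClosedInterval r := .point c'' (H'.le.trans (hb2.trans (hc'.trans hc'')))
        have e1 := coeff_eq_of_isSec (hψ.1.mono hc') (hδsec (hb2.trans hc') hh.1) hJ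
          (J' := J') hc'' (-1)
        refine e1.trans ?_
        rw [hs J' le_rfl, map_sum, map_sum, map_sum, map_sum, Laurent.coeff_sum]
        refine Finset.sum_eq_zero fun j _ => ?_
        rw [← algebraMap_smul (Func J') (s j), P.ρ_D_σ_smul (hb2.trans (hc'.trans hc'')),
          algebraMap_smul, LinearMap.map_smul_of_tower]
        have e2 := coeff_eq_of_isSec (J' := J') (J := J₂) hψ.1
          (hδsec hb2 ((hy j).1.mono hy2)) le_rfl (hc'.trans hc'') (-1)
        rw [Laurent.coeff_smul, ← e2, hψv, ha, mul_zero])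
      rw [← hψv]
      let J₃ : ClosedInterval r := .point c₃ (H'.le.trans (hb2.trans hc₃))
      have e3 := coeff_eq_of_isSec (J := J₂) (J' := J₃) hψ.1 (hρsec.mono h12) le_rfl hc₃ (-1)
      rw [e3, ← hΨψ J₃ le_rfl, hiρ J₃ (h12.trans hc₃)]
      exact ho₁ c₃ (h12.trans hc₃) Ψ hΨ J₃ le_rfl)
  let h : ∀ J, X''.sec J := ∑ j, x j • y j
  have hh : IsHor c₂ h := (X''.horSecs c₂).sum_mem fun i _ =>
    (X''.horSecs c₂).smul_mem _ ((hy i).mono hy2)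
  let v₂ : ∀ J, X'.sec J := fun J => P.ρ J (v₁ J) - P.ρ J (X.D J (P.σ J (h J)))
  have hv₂ : IsSec c₂ v₂ := (X'.secs c₂).sub_mem (hρsec.mono h12) (hδsec hb2 hh.1)
  have hφv₂ : ∀ i, (φ i J₂ (v₂ J₂)).coeff (-1) = 0 := fun i => by
    simp only [v₂]
    rw [map_sub, Laurent.coeff_sub, sub_eq_zero, ← hx i]
    have e4 : h J₂ = ∑ j, x j • y j J₂ := by simp only [h, Finset.sum_apply, Pi.smul_apply]
    rw [e4, map_sum, map_sum, map_sum, map_sum, Laurent.coeff_sum]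
    refine Finset.sum_congr rfl fun j _ => ?_
    rw [← algebraMap_smul (Func J₂) (x j), P.ρ_D_σ_smul hb2, algebraMap_smul, LinearMap.map_smul_of_tower,
      Laurent.coeff_smul]
  obtain ⟨c₄, hc₄, w₂, hw₂, hwv₂⟩ := H'.exists_primitive c₂ hb2 v₂ hv₂ (fun c' hc' ψ hψ J hJ => by
    obtain ⟨s, c'', hc'', hs⟩ := hφspan c' (hb2.trans hc') ψ hψ
    let J' : ClosedInterval r := .point c'' (H'.le.trans (hb2.trans (hc'.trans hc'')))
    rw [coeff_eq_of_isSec (J' := J') hψ.1 (hv₂.mono hc') hJ hc'' (-1), hs J' le_rfl,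
      LinearMap.sum_apply, Laurent.coeff_sum]
    refine Finset.sum_eq_zero fun i _ => ?_
    rw [LinearMap.smul_apply, Laurent.coeff_smul, ← coeff_eq_of_isSec (J := J₂) (J' := J')
      ((hφ i).1.mono hφ2) hv₂ le_rfl (hc'.trans hc'') (-1), hφv₂, mul_zero])
  have h14 : c₁ ≤ c₄ := h12.trans hc₄
  refine ⟨c₄, hc₁.trans h14, fun J => S.i J (w₂ J) + P.σ J (h J) + P.σ J (w₁ J),
    fun J J' hJ hcJ => ?_, fun J hcJ => ?_⟩
  · have hbJ := hbc₁.trans (h14.trans hcJ)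
    rw [map_add, map_add, ← S.i_res, hw₂ J J' hJ hcJ, ← P.σ_res hJ hbJ, ← P.σ_res hJ hbJ,
      hw₁ J J' hJ (h14.trans hcJ), hh.1 J J' hJ (hc₄.trans hcJ)]
  · have hbJ := hbc₁.trans (h14.trans hcJ)
    have e5 := P.i_ρ_D_σ hbJ (h J)
    rw [hh.2 J (hc₄.trans hcJ), map_zero, sub_zero] at e5
    rw [map_add, map_add, ← S.i_D, hwv₂ J hcJ]
    simp only [v₂]
    rw [map_sub, e5, hiρ J (h14.trans hcJ)]
    simp only [v₁]
    abel

end Splitting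

/-- An extension of a very good family by a good family is good. -/
theorem good (S : ShortExact X' X X'') (hK : Radius.Cofinal K) {b : Radius K} (H' : X'.Good b)
    (H'' : X''.VeryGood b) : X.Good b := by
  obtain ⟨P⟩ := S.nonempty_splitting hK H'.le H'.hasDualBasis H''.hasDualBasis
  exact ⟨H'.le, P.hasDualBasis H'.hasDualBasis H''.hasDualBasis, P.finite_duals H' H''.toGood,
    fun c hc v hv ho => P.exists_primitive H' H'' hc hv ho⟩

end ShortExact

end PreNabla

end

end PadicDE

/-! ### Filtrations, and passage to a smaller annulus -/

namespace PadicDE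

noncomputable section

variable {K : Type u} [NormedField K] [IsUltrametricDist K] [CompleteSpace K]

namespace PreNabla

variable {r : Radius K}

theorem veryGood_of_subsingleton {X : PreNabla.{u, v} r} (h : ∀ J, Subsingleton (X.sec J))
    {b : Radius K} (hb : r ≤ b) : X.VeryGood b where
  le := hb
  hasDualBasis := ⟨Empty, inferInstance, fun a => a.elim, fun a => a.elim, fun a => a.elim,
    fun a => a.elim, fun J _ v => Subsingleton.elim _ _⟩
  finite_duals := ⟨Empty, inferInstance, fun c _ => ⟨0, fun φ _ _ J _ =>
    LinearMap.ext fun v => by rw [Subsingleton.elim v 0, map_zero, map_zero]⟩⟩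
  exists_primitive c _ v hv _ := ⟨c, le_rfl, v, hv, fun _ _ => Subsingleton.elim _ _⟩
  finite_secs := ⟨Empty, inferInstance, fun c _ => ⟨0, fun _ _ _ _ _ => Subsingleton.elim _ _⟩⟩
  exists_primitive_form c _ φ hφ _ := ⟨c, le_rfl, φ, hφ, fun J _ v => by
    simp only [Subsingleton.elim v 0, map_zero, sub_zero]⟩

/-- A family of submodules that is stable under restriction and the connection. -/
def sub (X : PreNabla.{u, v} r) (F : ∀ J, Submodule (Func J) (X.sec J))
    (hD : ∀ J, ∀ v ∈ F J, X.D J v ∈ F J)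
    (hres : ∀ (J J' : ClosedInterval r) (h : J' ≤ J), ∀ v ∈ F J, X.res h v ∈ F J') :
    PreNabla.{u, v} r where
  sec J := F J
  addCommGroup _ := inferInstance
  module _ := inferInstance
  res {J J'} h :=
    { toFun := fun v => ⟨X.res h v.1, hres J J' h v.1 v.2⟩
      map_add' := fun v w => Subtype.ext (map_add (X.res h) v.1 w.1)
      map_smul' := fun a v => Subtype.ext ((X.res h).map_smulₛₗ a v.1) }
  res_trans h h' v := Subtype.ext (X.res_trans h h' v.1)
  D J := AddMonoidHom.mk' (fun v => ⟨X.D J v.1, hD J v.1 v.2⟩)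
    fun v w => Subtype.ext (map_add (X.D J) v.1 w.1)
  leibniz J f v := Subtype.ext (X.leibniz J f v.1)
  res_D h v := Subtype.ext (X.res_D h v.1)

variable (r) in
/-- The zero family. -/
def zero : PreNabla.{u, v} r where
  sec _ := PUnit
  addCommGroup _ := inferInstance
  module _ := inferInstance
  res _ := 0
  res_trans _ _ _ := rfl
  D _ := 0
  leibniz _ _ _ := rfl
  res_D _ _ := rfl

end PreNabla

namespace NablaModule

open PreNabla

/-- Induction along the filtration by `ShortExact.good`. The members `F i` are not assumed locally
free, so they are treated as bare families `PreNabla`; their dual bases are produced along the way.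
-/
theorem isDualizable_of_filtration (hK : Radius.Cofinal K) {r : Radius K}
    (hqc : ∀ (s : Radius K) (Q : NablaModule.{u, v} s), Q.IsQuasiConstant →
      ∃ b, Q.toPreNabla.VeryGood b)
    (E : NablaModule.{u, v} r) (hE : E.HasQuasiConstantFiltration) : E.IsDualizable := by
  obtain ⟨s, h, l, F, Q, π, hF0, hFl, hmono, hFD, hFres, hπ, hπ0, hπD, hπres, hQ⟩ := hE
  choose b hb using fun i => hqc s (Q i) (hQ i)
  obtain ⟨c, hc⟩ : ∃ c : Radius K, s ≤ c ∧ ∀ i, b i ≤ c := by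
    have : Nonempty (Radius K) := ⟨s⟩
    obtain ⟨c, hc⟩ := (Finset.univ.image b).exists_le
    exact ⟨max s c, le_max_left _ _, fun i =>
      (hc _ (Finset.mem_image_of_mem b (Finset.mem_univ i))).trans (le_max_right _ _)⟩
  let X : Fin (l + 1) → PreNabla.{u, v} s := fun i =>
    (E.restrict h).toPreNabla.sub (F i) (hFD i) (hFres i)
  have hX : ∀ i : Fin (l + 1), (X i).Good c := by
    intro i
    induction i using Fin.induction with
    | zero =>
      refine (veryGood_of_subsingleton (fun J => ?_) hc.1).toGood
      refine ⟨fun x y => Subtype.ext ?_⟩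
      exact ((Submodule.mem_bot _).1 ((hF0 J).le x.2)).trans
        ((Submodule.mem_bot _).1 ((hF0 J).le y.2)).symm
    | succ i ih =>
      let S : ShortExact (X i.castSucc) (X i.succ) (Q i).toPreNabla :=
        { i := fun J => (Submodule.inclusion (hmono i J) : F i.castSucc J →ₗ[Func J] F i.succ J)
          q := π i
          i_injective := fun J => Submodule.inclusion_injective (hmono i J)
          q_surjective := hπ i
          q_i := fun J y => (hπ0 i J _).2 y.2
          exact := fun J x hx => ⟨⟨x.1, (hπ0 i J x).1 hx⟩, rfl⟩
          i_res := fun _ _ => rfl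
          q_res := fun {J J'} h x => hπres i J J' h x _ rfl
          i_D := fun _ _ => rfl
          q_D := fun J x => hπD i J x _ rfl }
      exact S.good hK ih ((hb i).mono (hc.2 i))
  -- The last member is a submodule equal to `⊤`, not `E` itself; an extension with zero quotient
  -- transports `Good` from one to the other.
  let S : ShortExact (X (Fin.last l)) (E.restrict h).toPreNabla (PreNabla.zero s) :=
    { i := fun J => (F (Fin.last l) J).subtype
      q := fun J => 0
      i_injective := fun J => Submodule.injective_subtype _
      q_surjective := fun J x => ⟨0, rfl⟩
      q_i := fun _ _ => rfl
      exact := fun J x _ => ⟨⟨x, by rw [hFl]; trivial⟩, rfl⟩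
      i_res := fun _ _ => rfl
      q_res := fun _ _ => rfl
      i_D := fun _ _ => rfl
      q_D := fun _ _ => rfl }
  exact isDualizable_of_good (S.good hK (hX _)
    (veryGood_of_subsingleton (fun J => inferInstanceAs (Subsingleton PUnit)) hc.1))

section Up

variable {r s : Radius K} {E : NablaModule.{u, v} r} {h : r ≤ s}

/-- Extension by zero of a family of sections. -/
def upSec (v : ∀ J, (E.restrict h).toPreNabla.sec J) : ∀ J, E.toPreNabla.sec J := fun J =>
  if hJ : s ≤ J.lo then v ⟨J.lo, J.hi, hJ, J.lo_le_hi⟩ else 0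

/-- Extension by zero of a family of forms. -/
def upForm (φ : ∀ J, (E.restrict h).toPreNabla.Form J) : ∀ J, E.toPreNabla.Form J := fun J =>
  if hJ : s ≤ J.lo then φ ⟨J.lo, J.hi, hJ, J.lo_le_hi⟩ else 0

theorem upSec_of_le (v : ∀ J, (E.restrict h).toPreNabla.sec J) {J : ClosedInterval r}
    (hJ : s ≤ J.lo) : upSec v J = v ⟨J.lo, J.hi, hJ, J.lo_le_hi⟩ := dif_pos hJ

theorem upForm_of_le (φ : ∀ J, (E.restrict h).toPreNabla.Form J) {J : ClosedInterval r}
    (hJ : s ≤ J.lo) : upForm φ J = φ ⟨J.lo, J.hi, hJ, J.lo_le_hi⟩ := dif_pos hJ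

theorem isSec_upSec {c : Radius K} (hc : s ≤ c) {v : ∀ J, (E.restrict h).toPreNabla.sec J}
    (hv : IsSec c v) : IsSec c (upSec v) := fun J J' hJ hcJ => by
  rw [upSec_of_le v (hc.trans hcJ), upSec_of_le v (hc.trans (hcJ.trans hJ.1))]
  exact hv ⟨J.lo, J.hi, hc.trans hcJ, J.lo_le_hi⟩
    ⟨J'.lo, J'.hi, hc.trans (hcJ.trans hJ.1), J'.lo_le_hi⟩ hJ hcJ

theorem isDual_upForm {c : Radius K} (hc : s ≤ c) {φ : ∀ J, (E.restrict h).toPreNabla.Form J}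
    (hφ : IsDual c φ) : IsDual c (upForm φ) := fun J J' hJ hcJ v => by
  rw [upForm_of_le φ (hc.trans hcJ), upForm_of_le φ (hc.trans (hcJ.trans hJ.1))]
  exact hφ ⟨J.lo, J.hi, hc.trans hcJ, J.lo_le_hi⟩
    ⟨J'.lo, J'.hi, hc.trans (hcJ.trans hJ.1), J'.lo_le_hi⟩ hJ hcJ v

/-- Restriction of a family of sections to a smaller annulus. -/
def downSec : (∀ J, E.toPreNabla.sec J) →ₗ[K] ∀ J, (E.restrict h).toPreNabla.sec J where
  toFun v J := v (J.up h)
  map_add' _ _ := rfl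
  map_smul' _ _ := rfl

/-- Restriction of a family of forms to a smaller annulus. -/
def downForm : (∀ J, E.toPreNabla.Form J) →ₗ[K] ∀ J, (E.restrict h).toPreNabla.Form J where
  toFun v J := v (J.up h)
  map_add' _ _ := rfl
  map_smul' _ _ := rfl

/-- All conditions concern annuli near the outer boundary only, so families over the smaller annulus
may be extended by zero. -/
theorem veryGood_of_restrict {b : Radius K} (H : (E.restrict h).toPreNabla.VeryGood b) :
    E.toPreNabla.VeryGood b where
  le := h.trans H.le
  hasDualBasis := by
    obtain ⟨ι, i, e, f, he, hf, hef⟩ := H.hasDualBasis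
    refine ⟨ι, i, fun a => upSec (e a), fun a => upForm (f a), fun a => isSec_upSec H.le (he a),
      fun a => isDual_upForm H.le (hf a), fun J hJ v => ?_⟩
    refine Eq.trans ?_ (hef ⟨J.lo, J.hi, H.le.trans hJ, J.lo_le_hi⟩ hJ v)
    refine Finset.sum_congr rfl fun a _ => ?_
    exact congrArg₂ (· • ·) (LinearMap.congr_fun (upForm_of_le (f a) (H.le.trans hJ)) v)
      (upSec_of_le (e a) (H.le.trans hJ))
  finite_duals := by
    obtain ⟨ι, i, hL⟩ := H.finite_duals
    refine ⟨ι, i, fun c hc => ?_⟩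
    obtain ⟨L, hL⟩ := hL c hc
    refine ⟨L ∘ₗ downForm, fun φ hφ h0 J hJ => ?_⟩
    exact hL (downForm φ) ⟨fun J J' => hφ.1 (J.up h) (J'.up h), fun J => hφ.2 (J.up h)⟩ h0
      ⟨J.lo, J.hi, H.le.trans (hc.trans hJ), J.lo_le_hi⟩ hJ
  exists_primitive c hc v hv ho := by
    obtain ⟨c', hc', w, hw, hwv⟩ := H.exists_primitive c hc (downSec v)
      (fun J J' => hv (J.up h) (J'.up h)) (fun c' hc' φ hφ J hJ => by
        have hs : s ≤ c' := H.le.trans (hc.trans hc')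
        have := ho c' hc' (upForm φ) ⟨isDual_upForm hs hφ.1, fun J hJ v => by
          rw [upForm_of_le φ (hs.trans hJ)]
          exact hφ.2 ⟨J.lo, J.hi, hs.trans hJ, J.lo_le_hi⟩ hJ v⟩ (J.up h) hJ
        rwa [upForm_of_le φ (J := J.up h) (hs.trans hJ)] at this)
    have hs : s ≤ c' := H.le.trans (hc.trans hc')
    refine ⟨c', hc', upSec w, isSec_upSec hs hw, fun J hJ => ?_⟩
    rw [upSec_of_le w (hs.trans hJ)]
    exact hwv ⟨J.lo, J.hi, hs.trans hJ, J.lo_le_hi⟩ hJ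
  finite_secs := by
    obtain ⟨ι, i, hL⟩ := H.finite_secs
    refine ⟨ι, i, fun c hc => ?_⟩
    obtain ⟨L, hL⟩ := hL c hc
    refine ⟨L ∘ₗ downSec, fun φ hφ h0 J hJ => ?_⟩
    exact hL (downSec φ) ⟨fun J J' => hφ.1 (J.up h) (J'.up h), fun J => hφ.2 (J.up h)⟩ h0
      ⟨J.lo, J.hi, H.le.trans (hc.trans hJ), J.lo_le_hi⟩ hJ
  exists_primitive_form c hc φ hφ ho := by
    obtain ⟨c', hc', w, hw, hwv⟩ := H.exists_primitive_form c hc (downForm φ)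
      (fun J J' => hφ (J.up h) (J'.up h)) (fun c' hc' v hv J hJ => by
        have hs : s ≤ c' := H.le.trans (hc.trans hc')
        have := ho c' hc' (upSec v) ⟨isSec_upSec hs hv.1, fun J hJ => by
          rw [upSec_of_le v (hs.trans hJ)]
          exact hv.2 ⟨J.lo, J.hi, hs.trans hJ, J.lo_le_hi⟩ hJ⟩ (J.up h) hJ
        rwa [upSec_of_le v (J := J.up h) (hs.trans hJ)] at this)
    have hs : s ≤ c' := H.le.trans (hc.trans hc')
    refine ⟨c', hc', upForm w, isDual_upForm hs hw, fun J hJ v => ?_⟩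
    rw [upForm_of_le w (hs.trans hJ)]
    exact hwv ⟨J.lo, J.hi, hs.trans hJ, J.lo_le_hi⟩ hJ v

end Up

end NablaModule

end

end PadicDE

/-! ### Pullback to the ramified annulus and descent by traces -/

namespace PadicDE

noncomputable section

namespace Laurent

variable {N : Type u} [NormedField N] [IsUltrametricDist N] [CompleteSpace N] {I : Radii}

theorem eq_of_deriv_eq [CharZero N] {f g : Laurent N I} (h : Laurent.deriv f = Laurent.deriv g)
    (h0 : f.coeff 0 = g.coeff 0) : f = g := by
  ext i
  rcases eq_or_ne i 0 with rfl | hi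
  · exact h0
  · have h1 := congrFun (congrArg coeff h) (i - 1)
    rw [coeff_deriv, coeff_deriv, sub_add_cancel] at h1
    exact mul_left_cancel₀ (by exact_mod_cast hi) h1

theorem exists_normalized_primitive [CharZero N]
    (hN : ∀ n : ℕ, n ≠ 0 → 1 ≤ (n : ℝ) * ‖(n : N)‖) {I' : Radii}
    (hI : ∀ ρ ∈ I'.carrier, ∃ ρ₁ ∈ I.carrier, ∃ ρ₂ ∈ I.carrier, ρ₁ < ρ ∧ ρ < ρ₂)
    (hsub : I'.carrier ⊆ I.carrier) (f : Laurent N I) (hf : f.coeff (-1) = 0) :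
    ∃ F : Laurent N I', Laurent.deriv F = restrict hsub f ∧ F.coeff 0 = 0 := by
  obtain ⟨F, hF⟩ := exists_primitive hN hI hsub f hf
  refine ⟨F - algebraMap N _ (F.coeff 0), ?_, ?_⟩
  · rw [map_sub, hF, Derivation.map_algebraMap, sub_zero]
  · rw [coeff_sub]
    show F.coeff 0 - (Pi.single 0 (F.coeff 0) : ℤ → N) 0 = 0
    rw [Pi.single_eq_same, sub_self]

end Laurent

/-- Coordinates with respect to a basis of `N` over `K` which are bounded. -/
structure BoundedBasis (N K : Type u) [NormedField N] [IsUltrametricDist N] [CompleteSpace N]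
    [NormedField K] [IsUltrametricDist K] [CompleteSpace K] [NormedAlgebra K N] (κ : Type)
    [Fintype κ] where
  β : κ → N
  l : κ → BoundedForm N K
  sum_eq : ∀ x, ∑ i, l i x • β i = x

variable {N : Type u} [NormedField N] [IsUltrametricDist N] [CompleteSpace N]
variable {K : Type u} [NormedField K] [IsUltrametricDist K] [CompleteSpace K] [NormedAlgebra K N]

theorem BoundedBasis.eq_zero {κ : Type} [Fintype κ] (B : BoundedBasis N K κ) {x : N}
    (h : ∀ i, B.l i x = 0) : x = 0 := by
  rw [← B.sum_eq x]
  exact Finset.sum_eq_zero fun i _ => by rw [h, zero_smul]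

/-- Normalizes the trace: with `c = e` the trace of the function `1` is `1`, so that the trace
splits the pullback. -/
theorem BoundedBasis.exists_form {κ : Type} [Fintype κ] (B : BoundedBasis N K κ) {c : K}
    (hc : c ≠ 0) : ∃ l : BoundedForm N K, c * l 1 = 1 := by
  obtain ⟨i, hi⟩ : ∃ i, B.l i 1 ≠ 0 := by
    by_contra h
    push Not at h
    exact one_ne_zero (B.eq_zero h)
  obtain ⟨C, hC, hl⟩ := (B.l i).norm_le
  have ha : (c * B.l i 1)⁻¹ ≠ 0 := inv_ne_zero (mul_ne_zero hc hi)
  refine ⟨⟨(c * B.l i 1)⁻¹ • (B.l i).toLinearMap, ‖(c * B.l i 1)⁻¹‖ * C,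
    mul_pos (norm_pos_iff.2 ha) hC, fun x => ?_⟩, ?_⟩
  · show ‖(c * B.l i 1)⁻¹ * B.l i x‖ ≤ _
    rw [norm_mul, mul_assoc]
    exact mul_le_mul_of_nonneg_left (hl x) (norm_nonneg _)
  · show c * ((c * B.l i 1)⁻¹ * B.l i 1) = 1
    field_simp

section Cover

open Laurent

instance Ramification.algebra (Y : Ramification N) {I : Radii} [I.InDisc] :
    Algebra (Laurent K I) (Laurent N (I.root Y.e)) := (Y.pull).toAlgebra

theorem Ramification.smul_def (Y : Ramification N) {I : Radii} [I.InDisc] (f : Laurent K I)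
    (g : Laurent N (I.root Y.e)) : f • g = Y.pull f * g := rfl

theorem Ramification.algebraMap_def (Y : Ramification N) {I : Radii} [I.InDisc]
    (f : Laurent K I) : algebraMap (Laurent K I) (Laurent N (I.root Y.e)) f = Y.pull f := rfl

/-- The trace of differential forms, as a linear map on functions. -/
def Ramification.formTrace (Y : Ramification N) {I : Radii} [I.InDisc] (l : BoundedForm N K) :
    Laurent N (I.root Y.e) →ₗ[Laurent K I] Laurent K I where
  toFun := Y.traceForm l
  map_add' := Y.traceForm_add l
  map_smul' f g := Y.traceForm_pull_mul l f g

/-- The trace of functions. -/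
def Ramification.funcTrace (Y : Ramification N) {I : Radii} [I.InDisc] (l : BoundedForm N K) :
    Laurent N (I.root Y.e) →ₗ[Laurent K I] Laurent K I where
  toFun g := Y.traceForm l (Y.jac * g)
  map_add' g h := by rw [mul_add, Y.traceForm_add]
  map_smul' f g := by
    rw [Y.smul_def, mul_left_comm, Y.traceForm_pull_mul]; rfl

theorem Ramification.formTrace_apply (Y : Ramification N) {I : Radii} [I.InDisc]
    (l : BoundedForm N K) (g : Laurent N (I.root Y.e)) :
    Y.formTrace l g = Y.traceForm l g := rfl

theorem Ramification.funcTrace_apply (Y : Ramification N) {I : Radii} [I.InDisc]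
    (l : BoundedForm N K) (g : Laurent N (I.root Y.e)) :
    Y.funcTrace l g = Y.traceForm l (Y.jac * g) := rfl

theorem Ramification.funcTrace_one [CharZero N] (Y : Ramification N) {I : Radii} [I.InDisc]
    {l : BoundedForm N K} (hl : (Y.e : K) * l 1 = 1) :
    Y.funcTrace l (1 : Laurent N (I.root Y.e)) = 1 := by
  rw [Y.funcTrace_apply, mul_one, Y.traceForm_jac, hl, mono_zero_eq_one]

/-- The normalized trace is a left inverse of the substitution. -/
theorem Ramification.pull_injective [CharZero N] (Y : Ramification N) {I : Radii} [I.InDisc]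
    {l : BoundedForm N K} (hl : (Y.e : K) * l 1 = 1) :
    Function.Injective (Y.pull : Laurent K I → Laurent N (I.root Y.e)) := by
  have h : ∀ f : Laurent K I, Y.funcTrace l (Y.pull f) = f := fun f => by
    have := (Y.funcTrace l).map_smul f (1 : Laurent N (I.root Y.e))
    rwa [Y.funcTrace_one hl, Y.smul_def, mul_one, smul_eq_mul, mul_one] at this
  intro f g hfg
  rw [← h f, ← h g, hfg]

namespace PreNabla

variable {r : Radius K} (X : PreNabla.{u, v} r) (Y : Ramification N)

/-- The functions on the preimage of `A(J)`. -/
abbrev CovFunc (J : ClosedInterval r) : Type u := Laurent N (J.radii.root Y.e)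

/-- The pullback of `X` to the preimage of `A(J)`. -/
abbrev Cov (J : ClosedInterval r) : Type (max u v) := CovFunc Y J ⊗[Func J] X.sec J

/-- The pulled back connection, with respect to the parameter `u`. -/
def covD (J : ClosedInterval r) : X.Cov Y J →+ X.Cov Y J :=
  TensorProduct.liftAddHom
    (AddMonoidHom.mk' (fun g => AddMonoidHom.mk'
        (fun v => Laurent.deriv g ⊗ₜ[Func J] v + (g * Y.jac) ⊗ₜ[Func J] X.D J v)
        (fun v w => by simp only [map_add, TensorProduct.tmul_add]; abel))
      (fun g g' => by
        ext v
        simp only [AddMonoidHom.mk'_apply, AddMonoidHom.add_apply, map_add, add_mul,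
          TensorProduct.add_tmul]
        abel))
    (fun f g v => by
      simp only [AddMonoidHom.mk'_apply]
      rw [X.leibniz, TensorProduct.tmul_add, ← TensorProduct.smul_tmul (Laurent.deriv f),
        ← TensorProduct.smul_tmul f, ← TensorProduct.smul_tmul f, ← add_assoc,
        ← TensorProduct.add_tmul, Y.smul_def, Y.smul_def, Y.smul_def, Y.smul_def,
        Derivation.leibniz, Y.deriv_pull, smul_eq_mul, smul_eq_mul, mul_assoc]
      congr 2
      ring)

theorem covD_tmul (J : ClosedInterval r) (g : CovFunc Y J) (v : X.sec J) :
    X.covD Y J (g ⊗ₜ v) = Laurent.deriv g ⊗ₜ v + (g * Y.jac) ⊗ₜ X.D J v := rfl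

theorem covD_smul (J : ClosedInterval r) (g : CovFunc Y J) (x : X.Cov Y J) :
    X.covD Y J (g • x) = Laurent.deriv g • x + g • X.covD Y J x := by
  induction x using TensorProduct.induction_on with
  | zero => simp
  | tmul g' v =>
    rw [TensorProduct.smul_tmul', smul_eq_mul, covD_tmul, covD_tmul, smul_add,
      TensorProduct.smul_tmul', TensorProduct.smul_tmul', TensorProduct.smul_tmul',
      Derivation.leibniz, TensorProduct.add_tmul]
    simp only [smul_eq_mul]
    rw [mul_comm g' (Laurent.deriv g), mul_assoc]
    abel
  | add x y hx hy =>
    rw [smul_add, map_add, hx, hy, map_add, smul_add, smul_add]; abel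

/-- Restriction maps of the pullback. -/
def covRes {J J' : ClosedInterval r} (h : J' ≤ J) : X.Cov Y J →+ X.Cov Y J' :=
  TensorProduct.liftAddHom
    (AddMonoidHom.mk' (fun g => AddMonoidHom.mk'
        (fun v => restrict (Radii.root_subset (ClosedInterval.radii_subset h)) g ⊗ₜ[Func J']
          X.res h v)
        (fun v w => by rw [map_add, TensorProduct.tmul_add]))
      (fun g g' => by
        ext v
        simp only [AddMonoidHom.mk'_apply, AddMonoidHom.add_apply, map_add,
          TensorProduct.add_tmul]))
    (fun f g v => by
      simp only [AddMonoidHom.mk'_apply]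
      rw [(X.res h).map_smulₛₗ, ← TensorProduct.smul_tmul, Y.smul_def, Y.smul_def, map_mul,
        Y.restrict_pull]
      rfl)

theorem covRes_tmul {J J' : ClosedInterval r} (h : J' ≤ J) (g : CovFunc Y J) (v : X.sec J) :
    X.covRes Y h (g ⊗ₜ v) =
      restrict (Radii.root_subset (ClosedInterval.radii_subset h)) g ⊗ₜ X.res h v := rfl

theorem covRes_smul {J J' : ClosedInterval r} (h : J' ≤ J) (g : CovFunc Y J) (x : X.Cov Y J) :
    X.covRes Y h (g • x) =
      restrict (Radii.root_subset (ClosedInterval.radii_subset h)) g • X.covRes Y h x := by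
  induction x using TensorProduct.induction_on with
  | zero => simp
  | tmul g' v =>
    rw [TensorProduct.smul_tmul', smul_eq_mul, covRes_tmul, covRes_tmul, map_mul,
      TensorProduct.smul_tmul', smul_eq_mul]
  | add x y hx hy => rw [smul_add, map_add, hx, hy, map_add, smul_add]

variable {X}

/-- The pullback of a linear form. -/
def covForm {J : ClosedInterval r} (φ : X.Form J) : X.Cov Y J →ₗ[CovFunc Y J] CovFunc Y J :=
  LinearMap.liftBaseChange (CovFunc Y J) (Algebra.linearMap (Func J) (CovFunc Y J) ∘ₗ φ)

theorem covForm_tmul {J : ClosedInterval r} (φ : X.Form J) (g : CovFunc Y J) (v : X.sec J) :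
    covForm Y φ (g ⊗ₜ v) = g * Y.pull (φ v) := by
  rw [covForm, LinearMap.liftBaseChange_tmul]; rfl

theorem covForm_add {J : ClosedInterval r} (φ φ' : X.Form J) (x : X.Cov Y J) :
    covForm Y (φ + φ') x = covForm Y φ x + covForm Y φ' x := by
  induction x using TensorProduct.induction_on with
  | zero => simp
  | tmul g v => rw [covForm_tmul, covForm_tmul, covForm_tmul, LinearMap.add_apply, map_add, mul_add]
  | add x y hx hy => rw [map_add, hx, hy, map_add, map_add]; abel

theorem covForm_smul {J : ClosedInterval r} (c : K) (φ : X.Form J) (x : X.Cov Y J) :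
    covForm Y (c • φ) x = mono (algebraMap K N c) 0 * covForm Y φ x := by
  induction x using TensorProduct.induction_on with
  | zero => simp
  | tmul g v =>
    rw [covForm_tmul, covForm_tmul, LinearMap.smul_apply, smul_eq_mono_mul, map_mul, Y.pull_mono,
      Y.pow_zero, mul_one]
    ring
  | add x y hx hy => rw [map_add, hx, hy, map_add, mul_add]

theorem covForm_res {J J' : ClosedInterval r} (h : J' ≤ J) {φ : X.Form J} {φ' : X.Form J'}
    (hφ : ∀ v, φ' (X.res h v) = resFunc h (φ v)) (x : X.Cov Y J) :
    covForm Y φ' (X.covRes Y h x) =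
      restrict (Radii.root_subset (ClosedInterval.radii_subset h)) (covForm Y φ x) := by
  induction x using TensorProduct.induction_on with
  | zero => simp
  | tmul g v =>
    rw [covRes_tmul, covForm_tmul, covForm_tmul, hφ, map_mul, Y.restrict_pull]; rfl
  | add x y hx hy => rw [map_add, map_add, hx, hy, map_add, map_add]

theorem deriv_covForm {J : ClosedInterval r} {φ : X.Form J}
    (hφ : ∀ v, Laurent.deriv (φ v) = φ (X.D J v)) (x : X.Cov Y J) :
    Laurent.deriv (covForm Y φ x) = covForm Y φ (X.covD Y J x) := by
  induction x using TensorProduct.induction_on with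
  | zero => simp
  | tmul g v =>
    rw [covD_tmul, map_add, covForm_tmul, covForm_tmul, covForm_tmul, Derivation.leibniz,
      Y.deriv_pull, hφ, smul_eq_mul, smul_eq_mul]
    ring
  | add x y hx hy => simp only [map_add, hx, hy]

/-- The extension of a trace map to the pullback. -/
def covTrace {J : ClosedInterval r} (θ : CovFunc Y J →ₗ[Func J] Func J) :
    X.Cov Y J →ₗ[Func J] X.sec J :=
  (TensorProduct.lid (Func J) (X.sec J)).toLinearMap ∘ₗ θ.rTensor (X.sec J)

theorem covTrace_tmul {J : ClosedInterval r} (θ : CovFunc Y J →ₗ[Func J] Func J) (g : CovFunc Y J)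
    (v : X.sec J) : covTrace Y θ (g ⊗ₜ[Func J] v) = θ g • v := by
  rw [covTrace, LinearMap.comp_apply, LinearMap.rTensor_tmul]
  exact TensorProduct.lid_tmul _ _

theorem form_covTrace {J : ClosedInterval r} (θ : CovFunc Y J →ₗ[Func J] Func J) (φ : X.Form J)
    (x : X.Cov Y J) : φ (covTrace Y θ x) = θ (covForm Y φ x) := by
  induction x using TensorProduct.induction_on with
  | zero => simp
  | tmul g v =>
    rw [covTrace_tmul, covForm_tmul, map_smul, mul_comm g, ← Y.smul_def, map_smul, smul_eq_mul,
      smul_eq_mul, mul_comm]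
  | add x y hx hy => simp only [map_add, hx, hy]

/-- Two traces occur because `d/du` turns functions into coefficients of `du`: on the left `g`
stands for the form `g dt`, on the right the derivative is already the coefficient of a form in `u`.
The identity is `deriv_traceForm` together with the Leibniz rule. -/
theorem D_covTrace {J : ClosedInterval r} (l : BoundedForm N K) (x : X.Cov Y J) :
    X.D J (covTrace Y (Y.funcTrace l) x) = covTrace Y (Y.formTrace l) (X.covD Y J x) := by
  induction x using TensorProduct.induction_on with
  | zero => simp
  | tmul g v =>
    rw [covTrace_tmul, X.leibniz, covD_tmul, map_add, covTrace_tmul, covTrace_tmul,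
      Y.funcTrace_apply, Y.formTrace_apply, Y.formTrace_apply, Y.deriv_traceForm, mul_comm g]
  | add x y hx hy => simp only [map_add, hx, hy]

theorem covTrace_res {J J' : ClosedInterval r} (h : J' ≤ J) (l : BoundedForm N K) (x : X.Cov Y J) :
    X.res h (covTrace Y (Y.funcTrace l) x) = covTrace Y (Y.funcTrace l) (X.covRes Y h x) := by
  induction x using TensorProduct.induction_on with
  | zero => simp only [map_zero]
  | tmul g v =>
    rw [covTrace_tmul, map_smulₛₗ, covRes_tmul, covTrace_tmul, Y.funcTrace_apply,
      Y.funcTrace_apply]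
    congr 1
  | add x y hx hy => simp only [map_add, hx, hy]

end PreNabla

end Cover

end

end PadicDE

/-! ### A horizontal basis upstairs makes a family very good -/

namespace PadicDE

noncomputable section

open Laurent

variable {N : Type u} [NormedField N] [IsUltrametricDist N] [CompleteSpace N]
variable {K : Type u} [NormedField K] [IsUltrametricDist K] [CompleteSpace K] [NormedAlgebra K N]

theorem Radius.exists_gt (ρ : Radius K) : ∃ ρ' : Radius K, ρ < ρ' := by
  obtain ⟨n, hn, x, hx, e⟩ := ρ.2.2.2
  have h0 := ρ.2.1
  have h1 := ρ.2.2.1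
  have hs := Real.sq_sqrt h0.le
  have hs0 : 0 < Real.sqrt ρ.1 := Real.sqrt_pos.2 h0
  have hs1 : Real.sqrt ρ.1 < 1 := by nlinarith
  exact ⟨⟨Real.sqrt ρ.1, hs0, hs1, 2 * n, by omega, x, hx, by rw [pow_mul, hs, e]⟩,
    show ρ.1 < Real.sqrt ρ.1 by nlinarith⟩

namespace PreNabla

variable {r : Radius K} (X : PreNabla.{u, v} r) (Y : Ramification N)

/-- Integration needs room on both sides: inside it is provided by `c' > c`, outside by a radius
beyond `J.hi`, which exists since the boundary `|t| = 1` is excluded. Requiring the constant term to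
vanish makes primitives unique, so those on different annuli agree. -/
theorem exists_primitive_family [CharZero N] (hN : ∀ n : ℕ, n ≠ 0 → 1 ≤ (n : ℝ) * ‖(n : N)‖)
    {c : Radius K} (hrc : r ≤ c) (f : ∀ J : ClosedInterval r, CovFunc Y J)
    (hf : ∀ (J J' : ClosedInterval r) (h : J' ≤ J), c ≤ J.lo →
      restrict (Radii.root_subset (ClosedInterval.radii_subset h)) (f J) = f J')
    (h0 : ∀ J : ClosedInterval r, c ≤ J.lo → (f J).coeff (-1) = 0) :
    ∃ c', c ≤ c' ∧ ∃ F : ∀ J : ClosedInterval r, CovFunc Y J,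
      (∀ (J J' : ClosedInterval r) (h : J' ≤ J), c' ≤ J.lo →
        restrict (Radii.root_subset (ClosedInterval.radii_subset h)) (F J) = F J') ∧
      ∀ J : ClosedInterval r, c' ≤ J.lo → Laurent.deriv (F J) = f J := by
  obtain ⟨c', hc'⟩ := c.exists_gt
  have key : ∀ J : ClosedInterval r, ∃ F : CovFunc Y J, c' ≤ J.lo →
      Laurent.deriv F = f J ∧ F.coeff 0 = 0 := by
    intro J
    by_cases hJ : c' ≤ J.lo
    · obtain ⟨d, hd⟩ := J.hi.exists_gt
      let J₁ : ClosedInterval r := ⟨c, d, hrc, hc'.le.trans (hJ.trans (J.lo_le_hi.trans hd.le))⟩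
      have hJ₁ : J ≤ J₁ := ⟨hc'.le.trans hJ, hd.le⟩
      have hI : ∀ ρ ∈ (J.radii.root Y.e).carrier, ∃ ρ₁ ∈ (J₁.radii.root Y.e).carrier,
          ∃ ρ₂ ∈ (J₁.radii.root Y.e).carrier, ρ₁ < ρ ∧ ρ < ρ₂ := by
        intro ρ hρ
        obtain ⟨ρ₁, h₁, e₁⟩ := Radii.exists_root (e := Y.e) (I := J₁.radii) (ρ := c.1)
          ⟨le_rfl, J₁.lo_le_hi⟩
        obtain ⟨ρ₂, h₂, e₂⟩ := Radii.exists_root (e := Y.e) (I := J₁.radii) (ρ := d.1)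
          ⟨J₁.lo_le_hi, le_rfl⟩
        refine ⟨ρ₁, h₁, ρ₂, h₂, lt_of_pow_lt_pow_left₀ Y.e hρ.1.le ?_,
          lt_of_pow_lt_pow_left₀ Y.e h₂.1.le ?_⟩
        · rw [e₁]
          exact lt_of_lt_of_le (show c.1 < J.lo.1 from lt_of_lt_of_le hc' hJ) hρ.2.1
        · rw [e₂]
          exact lt_of_le_of_lt hρ.2.2 hd
      obtain ⟨F, hF, hF0⟩ := exists_normalized_primitive hN hI
        (Radii.root_subset (ClosedInterval.radii_subset hJ₁)) (f J₁) (h0 J₁ le_rfl)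
      exact ⟨F, fun _ => ⟨hF.trans (hf J₁ J hJ₁ le_rfl), hF0⟩⟩
    · exact ⟨0, fun h => absurd h hJ⟩
  choose F hF using key
  refine ⟨c', hc'.le, F, fun J J' h hJ => ?_, fun J hJ => (hF J hJ).1⟩
  refine eq_of_deriv_eq ?_ ?_
  · rw [deriv_restrict, (hF J hJ).1, (hF J' (hJ.trans h.1)).1, hf J J' h (hc'.le.trans hJ)]
  · rw [(hF J' (hJ.trans h.1)).2]
    exact (hF J hJ).2

/-- A basis of horizontal sections of the pullback of `X` along `t = u^e v(u)`, over `A[b,1)`. -/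
structure CoverBasis (b : Radius K) (ι : Type) [Fintype ι] where
  W : ι → ∀ J, X.Cov Y J
  ψ : ι → ∀ J, X.sec J →ₗ[Func J] CovFunc Y J
  sum_eq : ∀ J : ClosedInterval r, b ≤ J.lo → ∀ v,
    ∑ i, ψ i J v • W i J = (1 : CovFunc Y J) ⊗ₜ[Func J] v
  W_res : ∀ i (J J' : ClosedInterval r) (h : J' ≤ J), b ≤ J.lo → X.covRes Y h (W i J) = W i J'
  W_D : ∀ i (J : ClosedInterval r), b ≤ J.lo → X.covD Y J (W i J) = 0
  ψ_res : ∀ i (J J' : ClosedInterval r) (h : J' ≤ J), b ≤ J.lo → ∀ v,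
    ψ i J' (X.res h v) = restrict (Radii.root_subset (ClosedInterval.radii_subset h)) (ψ i J v)
  ψ_D : ∀ i (J : ClosedInterval r), b ≤ J.lo → ∀ v,
    Laurent.deriv (ψ i J v) = Y.jac * ψ i J (X.D J v)

namespace CoverBasis

variable {X Y} {b : Radius K} {ι κ : Type} [Fintype ι] [Fintype κ] (C : X.CoverBasis Y b ι)

theorem sum_covTrace [CharZero N] {l : BoundedForm N K} (hl : (Y.e : K) * l 1 = 1)
    {J : ClosedInterval r} (hJ : b ≤ J.lo) (v : X.sec J) :
    covTrace Y (Y.funcTrace l) (∑ i, C.ψ i J v • C.W i J) = v := by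
  rw [C.sum_eq J hJ, covTrace_tmul, Y.funcTrace_one hl, one_smul]

theorem sum_covForm {J : ClosedInterval r} (hJ : b ≤ J.lo) (φ : X.Form J) (v : X.sec J) :
    ∑ i, C.ψ i J v * covForm Y φ (C.W i J) = Y.pull (φ v) := by
  have h := congrArg (covForm Y φ) (C.sum_eq J hJ v)
  rw [map_sum, covForm_tmul, one_mul] at h
  rw [← h]
  exact Finset.sum_congr rfl fun i _ => by rw [map_smul, smul_eq_mul]

/-- The horizontal section of the dual defined by a coordinate and a form on the constants. -/
def traceDual (l : BoundedForm N K) (i : ι) (J : ClosedInterval r) : X.Form J :=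
  Y.funcTrace l ∘ₗ C.ψ i J

theorem traceDual_apply (l : BoundedForm N K) (i : ι) (J : ClosedInterval r) (v : X.sec J) :
    C.traceDual l i J v = Y.traceForm l (Y.jac * C.ψ i J v) := rfl

theorem isHorDual_traceDual (l : BoundedForm N K) (i : ι) : IsHorDual b (C.traceDual l i) :=
  ⟨fun J J' h hJ v => by
    rw [traceDual_apply, traceDual_apply, C.ψ_res i J J' h hJ, ← Y.restrict_jac
      (Radii.root_subset (ClosedInterval.radii_subset h)), ← map_mul]
    exact (Y.restrict_traceForm (ClosedInterval.radii_subset h) l _).symm,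
  fun J hJ v => by
    rw [traceDual_apply, traceDual_apply, Y.deriv_traceForm, C.ψ_D i J hJ]⟩

/-- The normalized trace of `∑ ψ_i(v) W_i = 1 ⊗ v` is `v`. Expanding each `ψ_i(v)` in the generators
`β_k u^j` writes `v` as a combination of the traces of `β_k u^j W_i`. -/
theorem hasDualBasis [CharZero N] (C : X.CoverBasis Y b ι) (B : BoundedBasis N K κ) {l : BoundedForm N K} (hl : (Y.e : K) * l 1 = 1) :
    X.HasDualBasis b := by
  let tr : ∀ J, X.Cov Y J →ₗ[Func J] X.sec J := fun J => covTrace Y (Y.funcTrace l)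
  refine ⟨ι × Fin Y.e × κ, inferInstance,
    fun a J => tr J ((mono (B.β a.2.2) (a.2.1 : ℕ) : CovFunc Y J) • C.W a.1 J),
    fun a J => (({ toFun := Y.functional (B.l a.2.2) a.2.1
                   map_add' := Y.functional_add (B.l a.2.2) a.2.1
                   map_smul' := Y.functional_pull_mul (B.l a.2.2) a.2.1 } :
      CovFunc Y J →ₗ[Func J] Func J) ∘ₗ C.ψ a.1 J), fun a J J' h hJ => ?_, fun a J J' h hJ v => ?_,
    fun J hJ v => ?_⟩
  · simp only [tr]
    rw [covTrace_res, covRes_smul, C.W_res a.1 J J' h hJ]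
    rfl
  · show Y.functional (B.l a.2.2) a.2.1 (C.ψ a.1 J' (X.res h v)) =
      restrict (ClosedInterval.radii_subset h) (Y.functional (B.l a.2.2) a.2.1 (C.ψ a.1 J v))
    rw [C.ψ_res a.1 J J' h hJ, Y.restrict_functional]
  · show ∑ a : ι × Fin Y.e × κ, Y.functional (B.l a.2.2) a.2.1 (C.ψ a.1 J v) •
      tr J ((mono (B.β a.2.2) (a.2.1 : ℕ) : CovFunc Y J) • C.W a.1 J) = v
    refine Eq.trans ?_ (C.sum_covTrace hl hJ v)
    rw [Fintype.sum_prod_type, map_sum]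
    refine Finset.sum_congr rfl fun i _ => ?_
    conv_rhs => rw [← Y.sum_pull_functional B.β B.l B.sum_eq (C.ψ i J v)]
    rw [Fintype.sum_prod_type, Finset.sum_smul, map_sum]
    refine Finset.sum_congr rfl fun j _ => ?_
    rw [Finset.sum_smul, map_sum]
    refine Finset.sum_congr rfl fun k _ => ?_
    rw [← map_smul, ← Y.smul_def, smul_assoc]

theorem coeff_covForm_eq {c : Radius K} (hbc : b ≤ c) {φ : ∀ J, X.Form J} (hφ : IsDual c φ)
    {J J' : ClosedInterval r} (hJ : c ≤ J.lo) (hJ' : c ≤ J'.lo) (i : ι) (n : ℤ) :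
    (covForm Y (φ J) (C.W i J)).coeff n = (covForm Y (φ J') (C.W i J')).coeff n := by
  have key : ∀ (J J' : ClosedInterval r) (_ : J' ≤ J), c ≤ J.lo →
      (covForm Y (φ J') (C.W i J')).coeff n = (covForm Y (φ J) (C.W i J)).coeff n := by
    intro J J' h hc
    rw [← C.W_res i J J' h (hbc.trans hc), covForm_res Y h (hφ J J' h hc)]
    rfl
  let J₀ : ClosedInterval r := ⟨min J.lo J'.lo, max J.hi J'.hi, le_min J.le_lo J'.le_lo,
    (min_le_left _ _).trans (J.lo_le_hi.trans (le_max_left _ _))⟩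
  have h0 : c ≤ J₀.lo := le_min hJ hJ'
  exact (key J₀ J ⟨min_le_left _ _, le_max_left _ _⟩ h0).trans
    (key J₀ J' ⟨min_le_right _ _, le_max_right _ _⟩ h0).symm

theorem coeff_ψ_eq {c : Radius K} (hbc : b ≤ c) {v : ∀ J, X.sec J} (hv : IsSec c v)
    {J J' : ClosedInterval r} (hJ : c ≤ J.lo) (hJ' : c ≤ J'.lo) (i : ι) (n : ℤ) :
    (C.ψ i J (v J)).coeff n = (C.ψ i J' (v J')).coeff n := by
  have key : ∀ (J J' : ClosedInterval r) (_ : J' ≤ J), c ≤ J.lo →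
      (C.ψ i J' (v J')).coeff n = (C.ψ i J (v J)).coeff n := by
    intro J J' h hc
    rw [← hv J J' h hc, C.ψ_res i J J' h (hbc.trans hc)]
    rfl
  let J₀ : ClosedInterval r := ⟨min J.lo J'.lo, max J.hi J'.hi, le_min J.le_lo J'.le_lo,
    (min_le_left _ _).trans (J.lo_le_hi.trans (le_max_left _ _))⟩
  have h0 : c ≤ J₀.lo := le_min hJ hJ'
  exact (key J₀ J ⟨min_le_left _ _, le_max_left _ _⟩ h0).trans
    (key J₀ J' ⟨min_le_right _ _, le_max_right _ _⟩ h0).symm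

/-- A horizontal form sends the `W_i` to functions with zero derivative, that is, to constants of
`N`; these constants determine the form. -/
theorem finite_duals [CharZero N] (C : X.CoverBasis Y b ι) (B : BoundedBasis N K κ) (hrb : r ≤ b) {l : BoundedForm N K} (hl : (Y.e : K) * l 1 = 1)
    {c : Radius K} (hc : b ≤ c) : ∃ L : (∀ J, X.Form J) →ₗ[K] (ι × κ → K),
    ∀ φ, IsHorDual c φ → L φ = 0 → ∀ J : ClosedInterval r, c ≤ J.lo → φ J = 0 := by
  let J₀ : ClosedInterval r := .point c (hrb.trans hc)
  refine ⟨{ toFun := fun φ a => B.l a.2 ((covForm Y (φ J₀) (C.W a.1 J₀)).coeff 0)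
            map_add' := fun φ φ' => funext fun a => ?_
            map_smul' := fun s φ => funext fun a => ?_ }, fun φ hφ h0 J hJ => ?_⟩
  · rw [Pi.add_apply φ, covForm_add, coeff_add, map_add, Pi.add_apply]
  · rw [Pi.smul_apply s φ, covForm_smul, coeff_mono_mul, sub_zero, ← Algebra.smul_def, map_smul]
    rfl
  · have hz : ∀ i, covForm Y (φ J) (C.W i J) = 0 := fun i => by
      refine eq_of_deriv_eq ?_ ?_
      · rw [deriv_covForm Y (hφ.2 J hJ), C.W_D i J (hc.trans hJ), map_zero, map_zero]
      · rw [C.coeff_covForm_eq hc hφ.1 hJ (J' := J₀) le_rfl, coeff_zero]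
        exact B.eq_zero fun k => congrFun h0 (i, k)
    ext1 v
    apply Y.pull_injective hl
    rw [← C.sum_covForm (hc.trans hJ), LinearMap.zero_apply, map_zero]
    exact Finset.sum_eq_zero fun i _ => by rw [hz, mul_zero]

/-- The coordinates `ψ_i(v)` of a horizontal section are constants of `N`, and they determine the
section. -/
theorem finite_secs [CharZero N] (C : X.CoverBasis Y b ι) (B : BoundedBasis N K κ) (hrb : r ≤ b) {l : BoundedForm N K} (hl : (Y.e : K) * l 1 = 1)
    {c : Radius K} (hc : b ≤ c) : ∃ L : (∀ J, X.sec J) →ₗ[K] (ι × κ → K),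
    ∀ v, IsHor c v → L v = 0 → ∀ J : ClosedInterval r, c ≤ J.lo → v J = 0 := by
  let J₀ : ClosedInterval r := .point c (hrb.trans hc)
  refine ⟨{ toFun := fun v a => B.l a.2 ((C.ψ a.1 J₀ (v J₀)).coeff 0)
            map_add' := fun φ φ' => funext fun a => ?_
            map_smul' := fun s φ => funext fun a => ?_ }, fun v hv h0 J hJ => ?_⟩
  · rw [Pi.add_apply φ, map_add, coeff_add, map_add, Pi.add_apply]
  · rw [Pi.smul_apply s φ, ← algebraMap_smul (Func J₀) s, map_smul, Y.smul_def]
    have e : Y.pull (algebraMap K (Func J₀) s) = mono (algebraMap K N s) 0 := by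
      have := Y.pull_mono (I := J₀.radii) s 0
      rwa [Y.pow_zero, mul_one] at this
    rw [e, coeff_mono_mul, sub_zero, ← Algebra.smul_def, map_smul]
    rfl
  · have hz : ∀ i, C.ψ i J (v J) = 0 := fun i => by
      refine eq_of_deriv_eq ?_ ?_
      · rw [C.ψ_D i J (hc.trans hJ), hv.2 J hJ, map_zero, mul_zero, map_zero]
      · rw [C.coeff_ψ_eq hc hv.1 hJ (J' := J₀) le_rfl, coeff_zero]
        exact B.eq_zero fun k => congrFun h0 (i, k)
    rw [← C.sum_covTrace hl (hc.trans hJ) (v J)]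
    simp only [hz, zero_smul, Finset.sum_const_zero, map_zero]

/-- Orthogonality to the forms `traceDual` says that each `ψ_i(v) dt`, as a form in `u`, has residue
zero, so it has a primitive `F_i`. The trace of `∑ F_i W_i` is a primitive of the trace of `1 ⊗ v`,
which is `v`. -/
theorem exists_primitive [CharZero N] (C : X.CoverBasis Y b ι) (hN : ∀ n : ℕ, n ≠ 0 → 1 ≤ (n : ℝ) * ‖(n : N)‖)
    (hrb : r ≤ b) (B : BoundedBasis N K κ) {l : BoundedForm N K} (hl : (Y.e : K) * l 1 = 1)
    {c : Radius K} (hc : b ≤ c) {v : ∀ J, X.sec J} (hv : IsSec c v) (ho : OrthSec c v) :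
    ∃ c', c ≤ c' ∧ ∃ w, IsSec c' w ∧ ∀ J : ClosedInterval r, c' ≤ J.lo → X.D J (w J) = v J := by
  have hF := fun i => exists_primitive_family Y hN (hrb.trans hc)
    (fun J => Y.jac * C.ψ i J (v J)) (fun J J' h hJ => by
      rw [map_mul, Y.restrict_jac, ← C.ψ_res i J J' h (hc.trans hJ), hv J J' h hJ])
    (fun J hJ => B.eq_zero fun k => by
      have := ho c le_rfl _ ((C.isHorDual_traceDual (B.l k) i).mono hc) J hJ
      rwa [traceDual_apply, Y.residue_traceForm] at this)
  choose d hd F hF hFD using hF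
  have : Nonempty (Radius K) := ⟨r⟩
  obtain ⟨c'', hc''⟩ := (Finset.univ.image d).exists_le
  have hdc : ∀ i, d i ≤ max c c'' := fun i =>
    (hc'' _ (Finset.mem_image_of_mem d (Finset.mem_univ i))).trans (le_max_right _ _)
  have hcc : c ≤ max c c'' := le_max_left _ _
  refine ⟨max c c'', hcc, fun J => covTrace Y (Y.funcTrace l) (∑ i, F i J • C.W i J),
    fun J J' h hJ => ?_, fun J hJ => ?_⟩
  · rw [covTrace_res, map_sum]
    congr 1
    refine Finset.sum_congr rfl fun i _ => ?_
    rw [covRes_smul, hF i J J' h ((hdc i).trans hJ), C.W_res i J J' h (hc.trans (hcc.trans hJ))]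
  · have hbJ := hc.trans (hcc.trans hJ)
    rw [D_covTrace, map_sum]
    have e : ∑ i, X.covD Y J (F i J • C.W i J) = (Y.jac : CovFunc Y J) ⊗ₜ[Func J] v J := by
      have h1 := congrArg ((Y.jac : CovFunc Y J) • ·) (C.sum_eq J hbJ (v J))
      simp only [Finset.smul_sum, TensorProduct.smul_tmul', smul_eq_mul, mul_one] at h1
      rw [← h1]
      refine Finset.sum_congr rfl fun i _ => ?_
      rw [covD_smul, C.W_D i J hbJ, smul_zero, add_zero, hFD i J ((hdc i).trans hJ), mul_smul]
    rw [e, covTrace_tmul, Y.formTrace_apply, Y.traceForm_jac, hl, mono_zero_eq_one, one_smul]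

/-- The trace of a horizontal section of the pullback. -/
def traceSec (l : BoundedForm N K) (i : ι) (J : ClosedInterval r) : X.sec J :=
  covTrace Y (Y.funcTrace l) (C.W i J)

theorem isHor_traceSec (l : BoundedForm N K) (i : ι) : IsHor b (C.traceSec l i) :=
  ⟨fun J J' h hJ => by rw [traceSec, covTrace_res, C.W_res i J J' h hJ]; rfl,
  fun J hJ => by rw [traceSec, D_covTrace, C.W_D i J hJ, map_zero]⟩

/-- The dual argument: testing `φ` on the traces of the `W_i` shows that the values of its pullback
on the `W_i`, multiplied by `dt`, have primitives `F_i`; the trace of the form `∑ F_i ψ_i` is the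
required one. -/
theorem exists_primitive_form [CharZero N] (C : X.CoverBasis Y b ι) (hN : ∀ n : ℕ, n ≠ 0 → 1 ≤ (n : ℝ) * ‖(n : N)‖)
    (hrb : r ≤ b) (B : BoundedBasis N K κ) {l : BoundedForm N K} (hl : (Y.e : K) * l 1 = 1)
    {c : Radius K} (hc : b ≤ c) {φ : ∀ J, X.Form J} (hφ : IsDual c φ) (ho : OrthForm c φ) :
    ∃ c', c ≤ c' ∧ ∃ η : ∀ J, X.Form J, IsDual c' η ∧ ∀ J : ClosedInterval r, c' ≤ J.lo →
      ∀ v, Laurent.deriv (η J v) - η J (X.D J v) = φ J v := by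
  have hF := fun i => exists_primitive_family Y hN (hrb.trans hc)
    (fun J => Y.jac * covForm Y (φ J) (C.W i J)) (fun J J' h hJ => by
      rw [map_mul, Y.restrict_jac, ← C.W_res i J J' h (hc.trans hJ),
        covForm_res Y h (hφ J J' h hJ)])
    (fun J hJ => B.eq_zero fun k => by
      have := ho c le_rfl _ ((C.isHor_traceSec (B.l k) i).mono hc) J hJ
      rwa [traceSec, form_covTrace, Y.funcTrace_apply, Y.residue_traceForm] at this)
  choose d hd F hF hFD using hF
  have : Nonempty (Radius K) := ⟨r⟩
  obtain ⟨c'', hc''⟩ := (Finset.univ.image d).exists_le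
  have hdc : ∀ i, d i ≤ max c c'' := fun i =>
    (hc'' _ (Finset.mem_image_of_mem d (Finset.mem_univ i))).trans (le_max_right _ _)
  have hcc : c ≤ max c c'' := le_max_left _ _
  let P : ∀ J, X.sec J →ₗ[Func J] CovFunc Y J := fun J =>
    ∑ i, (LinearMap.mulLeft (Func J) (F i J)) ∘ₗ C.ψ i J
  have hP : ∀ J v, P J v = ∑ i, F i J * C.ψ i J v := fun J v => by
    simp only [P, LinearMap.sum_apply, LinearMap.comp_apply, LinearMap.mulLeft_apply]
  refine ⟨max c c'', hcc, fun J => Y.funcTrace l ∘ₗ P J, fun J J' h hJ v => ?_, fun J hJ v => ?_⟩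
  · have e : P J' (X.res h v) =
        restrict (Radii.root_subset (ClosedInterval.radii_subset h)) (P J v) := by
      rw [hP, hP, map_sum]
      refine Finset.sum_congr rfl fun i _ => ?_
      rw [map_mul, hF i J J' h ((hdc i).trans hJ), C.ψ_res i J J' h (hc.trans (hcc.trans hJ))]
    rw [LinearMap.comp_apply, LinearMap.comp_apply, e, Y.funcTrace_apply, Y.funcTrace_apply,
      ← Y.restrict_jac (Radii.root_subset (ClosedInterval.radii_subset h)), ← map_mul]
    exact (Y.restrict_traceForm (ClosedInterval.radii_subset h) l _).symm
  · have hbJ := hc.trans (hcc.trans hJ)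
    have e : Laurent.deriv (P J v) = Y.jac * (Y.pull (φ J v) + P J (X.D J v)) := by
      rw [hP, hP, map_sum, ← C.sum_covForm hbJ, ← Finset.sum_add_distrib, Finset.mul_sum]
      refine Finset.sum_congr rfl fun i _ => ?_
      rw [Derivation.leibniz, hFD i J ((hdc i).trans hJ), C.ψ_D i J hbJ, smul_eq_mul, smul_eq_mul]
      ring
    rw [LinearMap.comp_apply, LinearMap.comp_apply, Y.funcTrace_apply, Y.deriv_traceForm, e,
      ← Y.funcTrace_apply, map_add, add_sub_cancel_right]
    have e2 := (Y.funcTrace l).map_smul (φ J v) (1 : CovFunc Y J)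
    rwa [Y.funcTrace_one hl, Y.smul_def, mul_one, smul_eq_mul, mul_one] at e2

theorem veryGood [CharZero N] (hN : ∀ n : ℕ, n ≠ 0 → 1 ≤ (n : ℝ) * ‖(n : N)‖) [CharZero K]
    (C : X.CoverBasis Y b ι) (B : BoundedBasis N K κ) (hrb : r ≤ b) : X.VeryGood b := by
  obtain ⟨l, hl⟩ := B.exists_form (c := (Y.e : K)) (by exact_mod_cast NeZero.ne _)
  exact
  { le := hrb
    hasDualBasis := C.hasDualBasis B hl
    finite_duals := ⟨ι × κ, inferInstance, fun c hc => C.finite_duals B hrb hl hc⟩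
    exists_primitive := fun c hc v hv ho => C.exists_primitive hN hrb B hl hc hv ho
    finite_secs := ⟨ι × κ, inferInstance, fun c hc => C.finite_secs B hrb hl hc⟩
    exists_primitive_form := fun c hc φ hφ ho => C.exists_primitive_form hN hrb B hl hc hφ ho }

end CoverBasis

end PreNabla

end

end PadicDE

/-! ### From horizontal generators to a horizontal basis -/

namespace PadicDE

noncomputable section

open Laurent

theorem factorial_dvd_prod_add (n : ℕ) (x : ℤ) :
    ((n.factorial : ℕ) : ℤ) ∣ ∏ m ∈ Finset.range n, (x + m) := by
  refine ⟨Ring.multichoose x n, ?_⟩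
  rw [← nsmul_eq_mul, Ring.factorial_nsmul_multichoose_eq_ascPochhammer,
    Polynomial.ascPochhammer_smeval_eq_eval]
  induction n with
  | zero => simp
  | succ n ih => rw [Finset.prod_range_succ, ih, ascPochhammer_succ_eval]

/-- The factor `(m+1)² - j²` splits as `(m+1+j)(m+1-j)`, which gives two products of `n` consecutive
integers. -/
theorem factorial_sq_dvd_prod (n : ℕ) (j : ℤ) :
    ((n.factorial : ℕ) : ℤ) ^ 2 ∣ ∏ m ∈ Finset.range n, (((m : ℤ) + 1) ^ 2 - j ^ 2) := by
  have e : ∏ m ∈ Finset.range n, (((m : ℤ) + 1) ^ 2 - j ^ 2) =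
      (∏ m ∈ Finset.range n, ((1 + j) + m)) * ∏ m ∈ Finset.range n, ((1 - j) + m) := by
    rw [← Finset.prod_mul_distrib]
    exact Finset.prod_congr rfl fun m _ => by ring
  rw [e, sq]
  exact mul_dvd_mul (factorial_dvd_prod_add n _) (factorial_dvd_prod_add n _)

theorem prod_range_sq_sub_eq_zero {n : ℕ} {j : ℤ} (h0 : j ≠ 0) (hj : j.natAbs ≤ n) :
    ∏ m ∈ Finset.range n, (((m : ℤ) + 1) ^ 2 - j ^ 2) = 0 := by
  refine Finset.prod_eq_zero (i := j.natAbs - 1) (Finset.mem_range.2 (by omega)) ?_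
  rw [← Int.natAbs_sq j, Nat.cast_sub (by omega)]
  push_cast
  ring

theorem prod_range_sq (n : ℕ) :
    ∏ m ∈ Finset.range n, (((m : ℤ) + 1) ^ 2 - 0 ^ 2) = ((n.factorial : ℕ) : ℤ) ^ 2 := by
  rw [← Finset.prod_range_add_one_eq_factorial]
  push_cast
  rw [← Finset.prod_pow]
  exact Finset.prod_congr rfl fun m _ => by ring

variable {N : Type u} [NormedField N] [IsUltrametricDist N] [CompleteSpace N]

theorem Laurent.exists_tail {I : Radii} {ρ : ℝ} (hρ : ρ ∈ I.carrier) (f : Laurent N I) {ε : ℝ}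
    (hε : 0 < ε) : ∃ n : ℕ, ∀ n' ≥ n, ∀ j : ℤ, n' < j.natAbs → ‖f.coeff j‖ * ρ ^ j ≤ ε := by
  have h := (f.tendsto' ρ hρ).eventually (gt_mem_nhds hε)
  rw [Filter.eventually_cofinite] at h
  obtain ⟨n, hn⟩ := (h.image Int.natAbs).bddAbove
  refine ⟨n, fun n' hn' j hj => ?_⟩
  by_contra hc
  have := hn ⟨j, fun h' => hc h'.le, rfl⟩
  omega

variable {K : Type u} [NormedField K] [IsUltrametricDist K] [CompleteSpace K] [NormedAlgebra K N]

namespace PreNabla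

variable {r : Radius K} (X : PreNabla.{u, v} r) (Y : Ramification N)

/-- Linear forms separate the points of the pullback. -/
def Separated (J : ClosedInterval r) : Prop :=
  ∀ x : X.Cov Y J, (∀ φ : X.Form J, covForm Y φ x = 0) → x = 0

variable {X Y}

theorem cov_sub_smul {J : ClosedInterval r} (f g : CovFunc Y J) (x : X.Cov Y J) :
    (f - g) • x = f • x - g • x := sub_smul f g x

/-- Since the `W_i` are horizontal, the operator `θ = u d/du` sends relations to relations,
multiplying the coefficient of `u^j` by `j`. Applying `∏ (k² - θ²)` for `1 ≤ k ≤ m` kills the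
coefficients with `1 ≤ |j| ≤ m` and multiplies the constant ones by `m!²`. -/
theorem exists_euler_relation {n : ℕ} {J : ClosedInterval r} {W : Fin n → X.Cov Y J}
    (hD : ∀ i, X.covD Y J (W i) = 0) {g : Fin n → CovFunc Y J} (hg : ∑ i, g i • W i = 0) (m : ℕ) :
    ∃ G : Fin n → CovFunc Y J, ∑ i, G i • W i = 0 ∧ ∀ i j, (G i).coeff j =
      ((∏ k ∈ Finset.range m, (((k : ℤ) + 1) ^ 2 - j ^ 2) : ℤ) : N) * (g i).coeff j := by
  have hθ : ∀ {g : Fin n → CovFunc Y J}, ∑ i, g i • W i = 0 →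
      ∑ i, (mono 1 1 * Laurent.deriv (g i)) • W i = 0 := fun {g} hg => by
    have h := congrArg (fun x => (mono 1 1 : CovFunc Y J) • X.covD Y J x) hg
    simp only [map_zero, smul_zero, map_sum, Finset.smul_sum] at h
    rw [← h]
    exact Finset.sum_congr rfl fun i _ => by rw [covD_smul, hD, smul_zero, add_zero, mul_smul]
  induction m with
  | zero => exact ⟨g, hg, fun i j => by simp⟩
  | succ m ih =>
    obtain ⟨G, hG, hc⟩ := ih
    refine ⟨fun i => mono (((m : ℤ) + 1 : ℤ) ^ 2 : N) 0 * G i -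
      mono 1 1 * Laurent.deriv (mono 1 1 * Laurent.deriv (G i)), ?_, fun i j => ?_⟩
    · simp only [cov_sub_smul]
      rw [Finset.sum_sub_distrib, hθ (hθ hG), sub_zero]
      simp only [mul_smul]
      rw [← Finset.smul_sum, hG, smul_zero]
    · rw [coeff_sub, coeff_mono_mul, coeff_mono_mul, coeff_deriv, coeff_mono_mul, coeff_deriv,
        sub_zero, sub_add_cancel, sub_add_cancel, hc, Finset.prod_range_succ]
      push_cast
      ring

/-- The constant terms of a relation between horizontal sections form a relation. -/
theorem const_relation [CharZero N] {n : ℕ} {J : ClosedInterval r} (hX : X.Separated Y J)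
    {W : Fin n → X.Cov Y J}
    (hD : ∀ i, X.covD Y J (W i) = 0) {g : Fin n → CovFunc Y J} (hg : ∑ i, g i • W i = 0) :
    ∑ i, (mono ((g i).coeff 0) 0 : CovFunc Y J) • W i = 0 := by
  refine hX _ fun φ => ?_
  obtain ⟨ρ, hρ⟩ := (J.radii.root Y.e).nonempty
  have hρ0 := hρ.1
  have hM : ∃ M, 0 < M ∧ ∀ i, GaussLE ρ M (covForm Y φ (W i)) := by
    choose M hM0 hM using fun i => exists_gaussLE hρ (covForm Y φ (W i))
    refine ⟨1 + ∑ i, M i, by have := Finset.sum_nonneg fun i (_ : i ∈ Finset.univ) => (hM0 i).le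
                             positivity, fun i => (hM i).mono ?_⟩
    have := Finset.single_le_sum (fun i _ => (hM0 i).le) (Finset.mem_univ i)
    linarith
  obtain ⟨M, hM0, hM⟩ := hM
  have hε : ∀ ε : ℝ, 0 < ε → GaussLE ρ (ε * M)
      (covForm Y φ (∑ i, (mono ((g i).coeff 0) 0 : CovFunc Y J) • W i)) := by
    intro ε hε
    choose m hm using fun i => exists_tail hρ (g i) hε
    obtain ⟨m', hm'⟩ : ∃ m', ∀ i, m i ≤ m' := ⟨∑ i, m i, fun i =>
      Finset.single_le_sum (fun i _ => Nat.zero_le _) (Finset.mem_univ i)⟩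
    -- Divided by `m'!²`, this relation keeps the constant terms, has no term of index `1 ≤ |j| ≤
    -- m'`, and its other terms have not grown, because `m'!²` divides their multipliers in `ℤ`. So
    -- the constant terms form a relation up to an error as small as the tails of the `g i`.
    obtain ⟨G, hG, hc⟩ := exists_euler_relation hD hg m'
    have hf : ((m'.factorial : ℕ) : N) ≠ 0 := by exact_mod_cast m'.factorial_ne_zero
    have e : ((m'.factorial : ℕ) : N) ^ 2 •
        covForm Y φ (∑ i, (mono ((g i).coeff 0) 0 : CovFunc Y J) • W i) =
        ∑ i, (mono (((m'.factorial : ℕ) : N) ^ 2 * (g i).coeff 0) 0 - G i) *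
          covForm Y φ (W i) := by
      have h := congrArg (covForm Y φ) hG
      rw [map_sum, map_zero] at h
      simp only [map_smul, smul_eq_mul] at h
      simp only [sub_mul, Finset.sum_sub_distrib]
      rw [h, sub_zero, map_sum, Finset.smul_sum]
      refine Finset.sum_congr rfl fun i _ => ?_
      rw [map_smul, smul_eq_mono_mul, smul_eq_mul, ← mul_assoc, mono_mul_mono, add_zero]
    have h1 : GaussLE ρ (‖((m'.factorial : ℕ) : N) ^ 2‖ * ε * M)
        (((m'.factorial : ℕ) : N) ^ 2 •
        covForm Y φ (∑ i, (mono ((g i).coeff 0) 0 : CovFunc Y J) • W i)) := by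
      rw [e]
      refine GaussLE.sum hρ0 (by positivity) _ fun i _ => GaussLE.mul hρ0 (fun j => ?_) (hM i)
      rw [coeff_sub, coeff_mono, hc]
      rcases eq_or_ne j 0 with rfl | hj
      · rw [Pi.single_eq_same, prod_range_sq]
        push_cast
        rw [sub_self, norm_zero, zero_mul]
        positivity
      · rw [Pi.single_eq_of_ne hj, zero_sub, norm_neg]
        by_cases hjm : j.natAbs ≤ m'
        · rw [prod_range_sq_sub_eq_zero hj hjm, Int.cast_zero, zero_mul, norm_zero, zero_mul]
          positivity
        · obtain ⟨q, hq⟩ := factorial_sq_dvd_prod m' j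
          rw [hq]
          push_cast
          rw [norm_mul, norm_mul, mul_assoc, mul_assoc]
          refine mul_le_mul_of_nonneg_left ?_ (norm_nonneg _)
          have h2 : ‖(q : N)‖ ≤ 1 := IsUltrametricDist.norm_intCast_le_one N q
          have h3 := hm i m' (hm' i) j (by omega)
          have h4 : 0 ≤ ‖(g i).coeff j‖ * ρ ^ j := by positivity
          nlinarith
    have h5 := h1.smul (((m'.factorial : ℕ) : N) ^ 2)⁻¹
    rw [smul_smul, inv_mul_cancel₀ (pow_ne_zero 2 hf), one_smul, norm_inv] at h5
    refine h5.mono (le_of_eq ?_)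
    have : ‖((m'.factorial : ℕ) : N) ^ 2‖ ≠ 0 := norm_ne_zero_iff.2 (pow_ne_zero 2 hf)
    field_simp
  refine eq_zero_of_gaussLE (M := fun k : ℕ => 1 / ((k : ℝ) + 1) * M) hρ0 ?_ fun k =>
    hε _ (by positivity)
  have := tendsto_one_div_add_atTop_nhds_zero_nat (𝕜 := ℝ)
  simpa using this.mul_const M

/-- A Laurent series is determined by its restriction. As linear forms are compatible with
restriction and separate points, the same holds for elements of the pullback. -/
theorem covRes_injective (hX : ∀ J, X.Separated Y J)
    (hext : ∀ (J J' : ClosedInterval r) (h : J' ≤ J) (φ : X.Form J), ∃ φ' : X.Form J',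
      ∀ v, φ' (X.res h v) = resFunc h (φ v)) {J J' : ClosedInterval r} (h : J' ≤ J)
    {x : X.Cov Y J} (hx : X.covRes Y h x = 0) : x = 0 := by
  refine hX J x fun φ => ?_
  obtain ⟨φ', hφ'⟩ := hext J J' h φ
  refine coeff_eq_of_restrict (Radii.root_subset (ClosedInterval.radii_subset h)) ?_
  rw [← covForm_res Y h hφ', hx, map_zero, map_zero]

/-- `n` horizontal sections which generate the pullback over each annulus. -/
structure CoverGens (n : ℕ) (W : Fin n → ∀ J, X.Cov Y J) : Prop where
  res : ∀ i (J J' : ClosedInterval r) (h : J' ≤ J), X.covRes Y h (W i J) = W i J'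
  D : ∀ i J, X.covD Y J (W i J) = 0
  span : ∀ J, Submodule.span (CovFunc Y J) (Set.range fun i => W i J) = ⊤

theorem covRes_mono_sum {n : ℕ} {W : Fin n → ∀ J, X.Cov Y J} (hW : CoverGens n W)
    (c : Fin n → N) {J J' : ClosedInterval r} (h : J' ≤ J) :
    X.covRes Y h (∑ i, (mono (c i) 0 : CovFunc Y J) • W i J) =
      ∑ i, (mono (c i) 0 : CovFunc Y J') • W i J' := by
  rw [map_sum]
  exact Finset.sum_congr rfl fun i _ => by rw [covRes_smul, hW.res i J J' h]; rfl

/-- A nontrivial relation, shifted by a power of `u`, acquires a nonzero constant term. The constant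
terms form a relation over `N`, which propagates to all annuli through intervals containing two
given ones. One generator is then redundant everywhere, against the minimality of `n`. -/
theorem CoverGens.linearIndependent [CharZero N] (hX : ∀ J, X.Separated Y J)
    (hext : ∀ (J J' : ClosedInterval r) (h : J' ≤ J) (φ : X.Form J), ∃ φ' : X.Form J',
      ∀ v, φ' (X.res h v) = resFunc h (φ v)) {n : ℕ} {W : Fin n → ∀ J, X.Cov Y J}
    (hW : CoverGens n W) (hmin : ∀ m, m < n → ¬ ∃ W' : Fin m → ∀ J, X.Cov Y J, CoverGens m W')
    (J : ClosedInterval r) : LinearIndependent (CovFunc Y J) fun i => W i J := by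
  rw [Fintype.linearIndependent_iff]
  intro g hg i₀
  by_contra hne
  obtain ⟨k, hk⟩ : ∃ k, (g i₀).coeff k ≠ 0 := by
    by_contra! h
    exact hne (Laurent.ext (funext h))
  have h1 := const_relation (hX J) (fun i => hW.D i J)
    (g := fun i => mono 1 (-k) * g i) (by
      simp only [mul_smul]
      rw [← Finset.smul_sum, hg, smul_zero])
  simp only [coeff_mono_mul, one_mul, sub_neg_eq_add, zero_add] at h1
  have h2 : ∀ J' : ClosedInterval r,
      ∑ i, (mono ((g i).coeff k) 0 : CovFunc Y J') • W i J' = 0 := by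
    intro J'
    let J₀ : ClosedInterval r := ⟨min J.lo J'.lo, max J.hi J'.hi, le_min J.le_lo J'.le_lo,
      (min_le_left _ _).trans (J.lo_le_hi.trans (le_max_left _ _))⟩
    have h0 : ∑ i, (mono ((g i).coeff k) 0 : CovFunc Y J₀) • W i J₀ = 0 :=
      covRes_injective hX hext (J' := J) ⟨min_le_left _ _, le_max_left _ _⟩ (by
        rw [covRes_mono_sum hW, h1])
    rw [← covRes_mono_sum hW _ (J := J₀) ⟨min_le_right _ _, le_max_right _ _⟩, h0, map_zero]
  obtain ⟨m, rfl⟩ : ∃ m, n = m + 1 := ⟨n - 1, by have := i₀.pos; omega⟩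
  refine hmin m (Nat.lt_succ_self m) ⟨fun i => W (i₀.succAbove i), fun i => hW.res _,
    fun i => hW.D _, fun J' => ?_⟩
  rw [eq_top_iff, ← hW.span J', Submodule.span_le]
  rintro _ ⟨i, rfl⟩
  have hsub : ∀ i, W (i₀.succAbove i) J' ∈ Submodule.span (CovFunc Y J')
      (Set.range fun i => W (i₀.succAbove i) J') := fun i => Submodule.subset_span ⟨i, rfl⟩
  rcases Fin.eq_self_or_eq_succAbove i₀ i with rfl | ⟨j, rfl⟩
  · have h3 := h2 J'
    rw [Fin.sum_univ_succAbove _ i] at h3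
    have h4 := congrArg (fun x => (mono ((g i).coeff k)⁻¹ 0 : CovFunc Y J') • x) h3
    simp only [smul_add, smul_zero, smul_smul, mono_mul_mono, add_zero, inv_mul_cancel₀ hk,
      mono_zero_eq_one, one_smul] at h4
    show W i J' ∈ _
    rw [eq_neg_of_add_eq_zero_left h4]
    exact Submodule.neg_mem _ (Submodule.smul_mem _ _ (Submodule.sum_mem _ fun j _ =>
      Submodule.smul_mem _ _ (hsub j)))
  · exact hsub j

/-- A generating family of least cardinality is a basis on each annulus; compatibility of its
coordinates with restriction and derivation follows from the uniqueness of expansions. -/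
theorem exists_coverBasis [CharZero N] (hX : ∀ J, X.Separated Y J)
    (hext : ∀ (J J' : ClosedInterval r) (h : J' ≤ J) (φ : X.Form J), ∃ φ' : X.Form J',
      ∀ v, φ' (X.res h v) = resFunc h (φ v)) (hW : ∃ n, ∃ W : Fin n → ∀ J, X.Cov Y J,
      CoverGens n W) : ∃ n, Nonempty (X.CoverBasis Y r (Fin n)) := by
  classical
  obtain ⟨n, ⟨W, hW⟩, hmin⟩ : ∃ n, (∃ W : Fin n → ∀ J, X.Cov Y J, CoverGens n W) ∧
      ∀ m, m < n → ¬ ∃ W' : Fin m → ∀ J, X.Cov Y J, CoverGens m W' :=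
    ⟨Nat.find hW, Nat.find_spec hW, fun m hm => Nat.find_min hW hm⟩
  have hli := hW.linearIndependent hX hext hmin
  let Bs := fun J => Module.Basis.mk (hli J) (hW.span J).ge
  have hBs : ∀ J i, Bs J i = W i J := fun J i => Module.Basis.mk_apply _ _ i
  let ψ : Fin n → ∀ J, X.sec J →ₗ[Func J] CovFunc Y J := fun i J =>
    ((Bs J).coord i).restrictScalars (Func J) ∘ₗ TensorProduct.mk (Func J) (CovFunc Y J) (X.sec J) 1
  have hsum : ∀ J v, ∑ i, ψ i J v • W i J = (1 : CovFunc Y J) ⊗ₜ[Func J] v := fun J v => by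
    rw [← (Bs J).sum_repr (1 ⊗ₜ v)]
    exact Finset.sum_congr rfl fun i _ => by rw [hBs]; rfl
  have huniq : ∀ J (f g : Fin n → CovFunc Y J), ∑ i, f i • W i J = ∑ i, g i • W i J →
      ∀ i, f i = g i := fun J f g h i => by
    have := Fintype.linearIndependent_iff.1 (hli J) (fun i => f i - g i) (by
      simp only [cov_sub_smul]
      rw [Finset.sum_sub_distrib, h, sub_self]) i
    exact sub_eq_zero.1 this
  refine ⟨n, ⟨⟨W, ψ, fun J _ => hsum J, fun i J J' h _ => hW.res i J J' h, fun i J _ => hW.D i J,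
    fun i J J' h _ v => ?_, fun i J _ v => ?_⟩⟩⟩
  · refine huniq J' (fun i => ψ i J' (X.res h v)) (fun i => restrict _ (ψ i J v)) ?_ i
    rw [hsum, ← map_one (restrict (Radii.root_subset (ClosedInterval.radii_subset h))),
      ← covRes_tmul, ← hsum, map_sum]
    exact Finset.sum_congr rfl fun i _ => by rw [covRes_smul, hW.res i J J' h]
  · refine huniq J (fun i => Laurent.deriv (ψ i J v)) (fun i => Y.jac * ψ i J (X.D J v)) ?_ i
    have h1 := congrArg (X.covD Y J) (hsum J v)
    rw [covD_tmul, Derivation.map_one_eq_zero, TensorProduct.zero_tmul, zero_add, one_mul,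
      map_sum] at h1
    have h2 := congrArg ((Y.jac : CovFunc Y J) • ·) (hsum J (X.D J v))
    simp only [Finset.smul_sum, TensorProduct.smul_tmul', smul_eq_mul, mul_one] at h2
    simp only [mul_smul]
    refine Eq.trans ?_ (h1.trans h2.symm)
    exact Finset.sum_congr rfl fun i _ => by rw [covD_smul, hW.D i J, smul_zero, add_zero]

end PreNabla

end

end PadicDE

/-! ### Specializing the cover at a point -/

namespace PadicDE

noncomputable section

open Laurent

/-- Derivations of a formally unramified algebra along a ring homomorphism are determined by their
values on the base. -/
theorem eq_of_leibniz {R S B : Type*} [CommRing R] [CommRing S] [CommRing B] [Algebra R S]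
    [Algebra.FormallyUnramified R S] (h : S →+* B) {d₁ d₂ : S →+ B}
    (h₁ : ∀ a b, d₁ (a * b) = h a * d₁ b + h b * d₁ a)
    (h₂ : ∀ a b, d₂ (a * b) = h a * d₂ b + h b * d₂ a)
    (hR : ∀ a : R, d₁ (algebraMap R S a) = d₂ (algebraMap R S a)) (s : S) : d₁ s = d₂ s := by
  let _ : Module S B := Module.compHom B h
  let _ : Module R B := Module.compHom B (algebraMap R S)
  have : IsScalarTower R S B := IsScalarTower.of_algebraMap_smul fun _ _ => rfl
  have hsm : ∀ (s : S) (b : B), s • b = h s * b := fun _ _ => rfl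
  have hrm : ∀ (a : R) (b : B), a • b = h (algebraMap R S a) * b := fun _ _ => rfl
  let d : Derivation R S B := Derivation.mk'
    { toFun := fun s => d₁ s - d₂ s
      map_add' := fun a b => by rw [map_add, map_add]; ring
      map_smul' := fun a s => by
        rw [Algebra.smul_def, h₁, h₂, hR, RingHom.id_apply, hrm]; ring }
    (fun a b => by
      simp only [LinearMap.coe_mk, AddHom.coe_mk, hsm]
      rw [h₁, h₂]; ring)
  -- The difference is a derivation over `R`, and there are none besides zero because the module of
  -- differentials of `S` over `R` vanishes.
  have h0 : d = 0 := by
    rw [← d.liftKaehlerDifferential_comp,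
      Subsingleton.elim d.liftKaehlerDifferential 0]
    rfl
  exact sub_eq_zero.1 (DFunLike.congr_fun h0 s)

variable {N : Type u} [NormedField N] [IsUltrametricDist N] [CompleteSpace N]
variable {K : Type u} [NormedField K] [IsUltrametricDist K] [CompleteSpace K] [NormedAlgebra K N]

theorem Radius.halfOpen_subset {r b : Radius K} (h : r ≤ b) :
    b.halfOpen.carrier ⊆ r.halfOpen.carrier := fun _ hρ => ⟨le_trans h hρ.1, hρ.2⟩

/-- A point of the cover given by `S` with values in the functions on the `b`-part of the
ramified annulus. -/
structure CoverPoint (r : Radius K) (S : Type u) [CommRing S] [Algebra (IntFunc r) S]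
    (Y : Ramification N) (b : Radius K) where
  le : r ≤ b
  hom : S →+* Laurent N (b.halfOpen.root Y.e)
  hom_algebraMap : ∀ a : IntFunc r, hom (algebraMap (IntFunc r) S a) =
    Y.pull (restrict (Radius.halfOpen_subset le) a.1)

namespace NablaModule

variable {r : Radius K} (E : NablaModule.{u, v} r)

theorem exists_form_res {J J' : ClosedInterval r} (h : J' ≤ J) (φ : E.sec J →ₗ[Func J] Func J) :
    ∃ φ' : E.sec J' →ₗ[Func J'] Func J', ∀ v, φ' (E.res h v) = resFunc h (φ v) := by
  let _ : Algebra (Func J) (Func J') := (resFunc h).toAlgebra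
  let _ : Module (Func J) (E.sec J') := Module.compHom _ (resFunc h)
  have : IsScalarTower (Func J) (Func J') (E.sec J') :=
    ⟨fun a b c => mul_smul ((resFunc h) a) b c⟩
  let ρ : E.sec J →ₗ[Func J] E.sec J' :=
    { toFun := E.res h
      map_add' := (E.res h).map_add
      map_smul' := fun a m => (E.res h).map_smulₛₗ a m }
  have hb : IsBaseChange (Func J') ρ := E.isBaseChange h
  exact ⟨hb.lift (Algebra.linearMap (Func J) (Func J') ∘ₗ φ), fun v => hb.lift_eq _ v⟩

/-- A finite projective module has a dual basis, which remains one after base change. -/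
theorem separated (Y : Ramification N) (J : ClosedInterval r) :
    E.toPreNabla.Separated Y J := by
  intro x hx
  have : Module.Finite (Func J) (E.toPreNabla.sec J) := E.finite J
  have : Module.Projective (Func J) (E.toPreNabla.sec J) := E.projective J
  obtain ⟨n, f, g, hf, hg, hfg⟩ :=
    Module.Finite.exists_comp_eq_id_of_projective (Func J) (E.toPreNabla.sec J)
  have key : ∀ x : E.toPreNabla.Cov Y J, ∑ i : Fin n,
      PreNabla.covForm Y (LinearMap.proj i ∘ₗ g : E.toPreNabla.Form J) x •
        ((1 : PreNabla.CovFunc Y J) ⊗ₜ[Func J] f (Pi.single i 1)) = x := by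
    intro x
    induction x using TensorProduct.induction_on with
    | zero => simp
    | tmul a v =>
      have h1 : v = ∑ i, g v i • f (Pi.single i 1) := by
        conv_lhs => rw [← LinearMap.id_apply (R := Func J) v, ← hfg, LinearMap.comp_apply,
          ← Finset.univ_sum_single (g v), map_sum]
        refine Finset.sum_congr rfl fun i _ => ?_
        rw [← map_smul, ← Pi.single_smul, smul_eq_mul, mul_one]
      conv_rhs => rw [h1, TensorProduct.tmul_sum]
      refine Finset.sum_congr rfl fun i _ => ?_
      rw [PreNabla.covForm_tmul, TensorProduct.smul_tmul', smul_eq_mul, mul_one,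
        ← TensorProduct.smul_tmul, Y.smul_def, mul_comm]
      rfl
    | add x y hx hy =>
      simp only [map_add, add_smul, Finset.sum_add_distrib]
      rw [hx, hy]
  rw [← key x]
  exact Finset.sum_eq_zero fun i _ => by rw [hx, zero_smul]

end NablaModule

namespace NablaModule

variable {r b : Radius K} (E : NablaModule.{u, v} r) (h : r ≤ b) (J : ClosedInterval b)

/-- Sections of a module and of its restriction. -/
def toRestrict : E.sec (J.up h) ≃+ (E.restrict h).toPreNabla.sec J := AddEquiv.refl _

/-- Functions on a subannulus, seen in a larger and in a smaller annulus. -/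
def funcUp (h : r ≤ b) (J : ClosedInterval b) : Func (J.up h) →+* Func J := RingHom.id _

theorem toRestrict_smul (f : Func (J.up h)) (v : E.sec (J.up h)) :
    E.toRestrict h J (f • v) = funcUp h J f • E.toRestrict h J v := rfl

theorem toRestrict_res {J J' : ClosedInterval b} (hJ : J' ≤ J) (v : E.sec (J.up h)) :
    E.toRestrict h J' (E.res (J := J.up h) (J' := J'.up h) hJ v) =
      (E.restrict h).toPreNabla.res hJ (E.toRestrict h J v) := rfl

theorem toRestrict_D (v : E.sec (J.up h)) :
    E.toRestrict h J (E.D _ v) = (E.restrict h).toPreNabla.D J (E.toRestrict h J v) := rfl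

theorem deriv_funcUp (a : IntFunc r) : Laurent.deriv (funcUp h J (algebraMap _ _ a)) =
    funcUp h J (algebraMap _ _ (Laurent.integralDeriv a)) := rfl

end NablaModule

namespace CoverPoint

open NablaModule (toRestrict funcUp)

variable {r : Radius K} {S : Type u} [CommRing S] [Algebra (IntFunc r) S]
  {Y : Ramification N} {b : Radius K} (P : CoverPoint r S Y b)

/-- The values of functions on the cover over `A(J)`. -/
def eval (J : ClosedInterval b) : S →+* PreNabla.CovFunc Y J :=
  (restrict (Radii.root_subset J.radii_subset_halfOpen)).toRingHom.comp P.hom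

theorem eval_apply (J : ClosedInterval b) (s : S) :
    P.eval J s = restrict (Radii.root_subset J.radii_subset_halfOpen) (P.hom s) := rfl

theorem eval_algebraMap (J : ClosedInterval b) (a : IntFunc r) :
    P.eval J (algebraMap (IntFunc r) S a) = Y.pull (funcUp P.le J (algebraMap _ _ a)) := by
  rw [P.eval_apply, P.hom_algebraMap, Y.restrict_pull J.radii_subset_halfOpen]
  rfl

/-- Both sides are derivations of `S` along `eval`. They agree on the base by the chain rule, and
étaleness leaves no freedom beyond that. -/
theorem deriv_eval [Algebra.Etale (IntFunc r) S]
    (J : ClosedInterval b) (s : S) : Laurent.deriv (P.eval J s) =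
      Y.jac * P.eval J (etaleDeriv (A := IntFunc r) Laurent.integralDeriv s) := by
  refine eq_of_leibniz (R := IntFunc r) (P.eval J)
    (d₁ := (Laurent.deriv : Derivation N _ _).toLinearMap.toAddMonoidHom.comp
      (P.eval J).toAddMonoidHom)
    (d₂ := (AddMonoidHom.mulLeft (Y.jac : PreNabla.CovFunc Y J)).comp
      ((P.eval J).toAddMonoidHom.comp (etaleDeriv (A := IntFunc r) (S := S)
        Laurent.integralDeriv).toLinearMap.toAddMonoidHom)) (fun x y => ?_) (fun x y => ?_)
    (fun a => ?_) s
  · show Laurent.deriv (P.eval J (x * y)) = P.eval J x * Laurent.deriv (P.eval J y) +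
      P.eval J y * Laurent.deriv (P.eval J x)
    rw [map_mul, Derivation.leibniz, smul_eq_mul, smul_eq_mul]
  · show Y.jac * P.eval J (etaleDeriv (A := IntFunc r) Laurent.integralDeriv (x * y)) =
      P.eval J x * (Y.jac * P.eval J (etaleDeriv (A := IntFunc r) Laurent.integralDeriv y)) +
      P.eval J y * (Y.jac * P.eval J (etaleDeriv (A := IntFunc r) Laurent.integralDeriv x))
    rw [Derivation.leibniz, smul_eq_mul, smul_eq_mul, map_add, map_mul, map_mul]
    ring
  · show Laurent.deriv (P.eval J (algebraMap (IntFunc r) S a)) =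
      Y.jac * P.eval J (etaleDeriv (A := IntFunc r) Laurent.integralDeriv
        (algebraMap (IntFunc r) S a))
    rw [etaleDeriv_algebraMap, P.eval_algebraMap, P.eval_algebraMap, Y.deriv_pull,
      NablaModule.deriv_funcUp]

variable (E : NablaModule.{u, v} r)

/-- The pullback of sections along a point of the cover. -/
def spec (J : ClosedInterval b) :
    E.pullback S (J.up P.le) →+ (E.restrict P.le).toPreNabla.Cov Y J :=
  TensorProduct.liftAddHom
    (AddMonoidHom.mk' (fun s => AddMonoidHom.mk'
        (fun v => P.eval J s ⊗ₜ[Func J] E.toRestrict P.le J v)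
        (fun v w => by rw [map_add, TensorProduct.tmul_add]))
      (fun s s' => by
        ext v
        simp only [AddMonoidHom.mk'_apply, AddMonoidHom.add_apply, map_add,
          TensorProduct.add_tmul]))
    (fun a s v => by
      simp only [AddMonoidHom.mk'_apply]
      rw [Algebra.smul_def, map_mul, P.eval_algebraMap, ← Y.smul_def, TensorProduct.smul_tmul,
        ← NablaModule.toRestrict_smul, algebraMap_smul])

theorem spec_tmul (J : ClosedInterval b) (s : S) (v : E.sec (J.up P.le)) :
    P.spec E J (s ⊗ₜ v) = P.eval J s ⊗ₜ[Func J] E.toRestrict P.le J v := rfl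

theorem spec_smul (J : ClosedInterval b) (s : S)
    (x : E.pullback S (J.up P.le)) : P.spec E J (s • x) = P.eval J s • P.spec E J x := by
  induction x using TensorProduct.induction_on with
  | zero => simp
  | tmul a v =>
    rw [TensorProduct.smul_tmul', smul_eq_mul, P.spec_tmul, P.spec_tmul, map_mul,
      TensorProduct.smul_tmul', smul_eq_mul]
  | add x y hx hy => rw [smul_add, map_add, hx, hy, map_add, smul_add]

theorem spec_pullbackSMul (J : ClosedInterval b) (f : Func (J.up P.le))
    (x : E.pullback S (J.up P.le)) : P.spec E J (E.pullbackSMul S (J.up P.le) f x) =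
      (Y.pull (funcUp P.le J f) : PreNabla.CovFunc Y J) • P.spec E J x := by
  induction x using TensorProduct.induction_on with
  | zero => simp
  | tmul a v =>
    rw [P.spec_tmul, TensorProduct.smul_tmul', smul_eq_mul, ← Y.smul_def, TensorProduct.smul_tmul,
      ← NablaModule.toRestrict_smul]
    rfl
  | add x y hx hy => rw [map_add, map_add, hx, hy, map_add, smul_add]

theorem covRes_spec {J J' : ClosedInterval b} (h : J' ≤ J)
    (x : E.pullback S (J.up P.le)) :
    (E.restrict P.le).toPreNabla.covRes Y h (P.spec E J x) = P.spec E J'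
      (E.pullbackRes S (J := J.up P.le) (J' := J'.up P.le) h x) := by
  induction x using TensorProduct.induction_on with
  | zero => simp
  | tmul a v =>
    rw [P.spec_tmul, PreNabla.covRes_tmul, ← NablaModule.toRestrict_res]
    rfl
  | add x y hx hy => rw [map_add, map_add, hx, hy, map_add, map_add]

theorem covD_spec [Algebra.Etale (IntFunc r) S] (J : ClosedInterval b)
    (x : E.pullback S (J.up P.le)) :
    (E.restrict P.le).toPreNabla.covD Y J (P.spec E J x) =
      (Y.jac : PreNabla.CovFunc Y J) • P.spec E J (E.pullbackD S (J.up P.le) x) := by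
  induction x using TensorProduct.induction_on with
  | zero => simp
  | tmul a v =>
    rw [P.spec_tmul, PreNabla.covD_tmul, NablaModule.pullbackD_tmul, map_add, P.spec_tmul,
      P.spec_tmul, smul_add, TensorProduct.smul_tmul', TensorProduct.smul_tmul', smul_eq_mul,
      smul_eq_mul, P.deriv_eval, mul_comm (P.eval J a), NablaModule.toRestrict_D]
  | add x y hx hy => rw [map_add, map_add, hx, hy, map_add, map_add, smul_add]

end CoverPoint

namespace NablaModule

variable {r : Radius K} (E : NablaModule.{u, v} r) {S : Type u} [CommRing S] [Algebra (IntFunc r) S]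
  {Y : Ramification N} {b : Radius K}

/-- The point transports the horizontal generators of `f^* E`; the two connections correspond up to
the factor `jac`, so horizontality survives. -/
theorem exists_coverGens [Algebra.Etale (IntFunc r) S] (P : CoverPoint r S Y b)
    (h : E.IsConstantOver S) :
    ∃ n, ∃ W : Fin n → ∀ J, (E.restrict P.le).toPreNabla.Cov Y J, PreNabla.CoverGens n W := by
  obtain ⟨n, w, hres, hD, hspan⟩ := h
  refine ⟨n, fun i J => P.spec E J (w i (J.up P.le)), fun i J J' hJ => ?_, fun i J => ?_,
    fun J => ?_⟩
  · rw [P.covRes_spec, hres]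
  · rw [P.covD_spec, hD, map_zero, smul_zero]
  · rw [eq_top_iff]
    set T := Submodule.span (PreNabla.CovFunc Y J)
      (Set.range fun i => P.spec E J (w i (J.up P.le))) with hT
    have key : ∀ x : E.pullback S (J.up P.le), P.spec E J x ∈ T := by
      intro x
      have hx : x ∈ Submodule.span S {x | ∃ i, ∃ f : Func (J.up P.le),
          x = E.pullbackSMul S (J.up P.le) f (w i (J.up P.le))} := by
        rw [hspan]; trivial
      induction hx using Submodule.span_induction with
      | mem x hx =>
        obtain ⟨i, f, rfl⟩ := hx
        rw [P.spec_pullbackSMul]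
        exact T.smul_mem _ (Submodule.subset_span ⟨i, rfl⟩)
      | zero => rw [map_zero]; exact T.zero_mem
      | add x y _ _ hx hy => rw [map_add]; exact T.add_mem hx hy
      | smul s x _ hx => rw [P.spec_smul]; exact T.smul_mem _ hx
    rintro x -
    induction x using TensorProduct.induction_on with
    | zero => exact T.zero_mem
    | tmul g v =>
      obtain ⟨v, rfl⟩ := (E.toRestrict P.le J).surjective v
      have h1 := T.smul_mem g (key (1 ⊗ₜ v))
      rwa [P.spec_tmul, map_one, TensorProduct.smul_tmul', smul_eq_mul, mul_one] at h1
    | add x y hx hy => exact T.add_mem hx hy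

theorem veryGood_of_coverPoint [CharZero N] [CharZero K]
    (hN : ∀ n : ℕ, n ≠ 0 → 1 ≤ (n : ℝ) * ‖(n : N)‖) [Algebra.Etale (IntFunc r) S]
    (P : CoverPoint r S Y b) {κ : Type} [Fintype κ] (B : BoundedBasis N K κ)
    (h : E.IsConstantOver S) : E.toPreNabla.VeryGood b := by
  obtain ⟨n, ⟨C⟩⟩ := PreNabla.exists_coverBasis (fun J => (E.restrict P.le).separated Y J)
    (fun J J' h φ => (E.restrict P.le).exists_form_res h φ) (E.exists_coverGens P h)
  exact E.veryGood_of_restrict (C.veryGood hN B le_rfl)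

end NablaModule

end

end PadicDE

/-! ### Embedding finite separable extensions of `κ((t))` into `κ((u))` -/

namespace PadicDE

noncomputable section

section Expansion

/-- Expansion of the elements of an algebra with residue field `κ` as power series in a generator
of the augmentation ideal. -/
theorem exists_expansion {κ D : Type*} [Field κ] [CommRing D] [Algebra κ D] (a : D →ₐ[κ] κ) {π : D}
    (hπ : a π = 0) (hker : ∀ x, a x = 0 → π ∣ x) (hreg : ∀ x, π * x = 0 → x = 0) :
    ∃ E : D →ₐ[κ] PowerSeries κ, E π = PowerSeries.X ∧
      ∀ x, PowerSeries.constantCoeff (E x) = a x := by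
  have h1 : ∀ x, ∃ y, x = algebraMap κ D (a x) + π * y := fun x => by
    obtain ⟨y, hy⟩ := hker (x - algebraMap κ D (a x)) (by simp)
    exact ⟨y, by rw [← hy]; ring⟩
  -- `σ` removes the constant term and divides by `π`; the coefficients of the expansion of `x` are
  -- the constant terms of its iterates under `σ`.
  choose σ hσ using h1
  have huniq : ∀ x y c, x = algebraMap κ D c + π * y → a x = c ∧ σ x = y := by
    intro x y c h
    have hc : a x = c := by rw [h]; simp [hπ]
    refine ⟨hc, sub_eq_zero.1 (hreg _ ?_)⟩
    have := hσ x
    rw [hc] at this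
    rw [mul_sub, sub_eq_zero]
    exact add_left_cancel (this.symm.trans h)
  let F : D → PowerSeries κ := fun x => PowerSeries.mk fun n => a (σ^[n] x)
  have hF : ∀ x, F x = PowerSeries.C (a x) + PowerSeries.X * F (σ x) := by
    intro x
    ext n
    cases n with
    | zero => simp [F]
    | succ n =>
      rw [map_add, PowerSeries.coeff_succ_X_mul, PowerSeries.coeff_mk, PowerSeries.coeff_mk,
        PowerSeries.coeff_C, if_neg (Nat.succ_ne_zero n), zero_add, Function.iterate_succ_apply]
  have hσadd : ∀ x y, σ (x + y) = σ x + σ y := fun x y => (huniq _ _ (a x + a y) (by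
    conv_lhs => rw [hσ x, hσ y]
    rw [map_add]; ring)).2
  have hσsmul : ∀ (c : κ) x, σ (algebraMap κ D c * x) = algebraMap κ D c * σ x := fun c x =>
    (huniq _ _ (c * a x) (by
      conv_lhs => rw [hσ x]
      rw [map_mul]; ring)).2
  -- This twisted Leibniz rule gives the multiplicativity of the expansion by induction on the
  -- degree.
  have hσmul : ∀ x y, σ (x * y) = algebraMap κ D (a x) * σ y + y * σ x := fun x y =>
    (huniq _ _ (a x * a y) (by
      have hx := hσ x
      have hy := hσ y
      rw [map_mul]
      linear_combination y * hx + algebraMap κ D (a x) * hy)).2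
  have hcoeff : ∀ n x, PowerSeries.coeff (n + 1) (F x) = PowerSeries.coeff n (F (σ x)) := by
    intro n x
    simp only [F, PowerSeries.coeff_mk, Function.iterate_succ_apply]
  have hcoeff0 : ∀ x, PowerSeries.coeff 0 (F x) = a x := fun x => by
    simp only [F, PowerSeries.coeff_mk, Function.iterate_zero, id]
  have hFadd : ∀ x y, F (x + y) = F x + F y := by
    intro x y
    ext n
    induction n generalizing x y with
    | zero => rw [map_add, hcoeff0, hcoeff0, hcoeff0, map_add]
    | succ n ih => rw [map_add, hcoeff, hcoeff, hcoeff, hσadd, ih, map_add]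
  have hFsmul : ∀ (c : κ) x, F (algebraMap κ D c * x) = PowerSeries.C c * F x := by
    intro c x
    ext n
    induction n generalizing x with
    | zero => rw [PowerSeries.coeff_C_mul, hcoeff0, hcoeff0, map_mul, AlgHom.commutes]; rfl
    | succ n ih =>
      rw [PowerSeries.coeff_C_mul, hcoeff, hcoeff, hσsmul, ih, PowerSeries.coeff_C_mul]
  have hFmul : ∀ x y, F (x * y) = F x * F y := by
    intro x y
    ext n
    induction n using Nat.strong_induction_on generalizing x y with
    | _ n ih =>
      cases n with
      | zero =>
        rw [PowerSeries.coeff_mul, Finset.Nat.antidiagonal_zero, Finset.sum_singleton, hcoeff0, hcoeff0,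
          hcoeff0, map_mul]
      | succ n =>
        rw [hcoeff, hσmul, hFadd, hFsmul, map_add, PowerSeries.coeff_C_mul, mul_comm y,
          ih n (Nat.lt_succ_self n) (σ x) y]
        conv_rhs => rw [hF x, add_mul, map_add, PowerSeries.coeff_C_mul, hcoeff, mul_assoc,
          PowerSeries.coeff_succ_X_mul]
  have hF1 : ∀ c, F (algebraMap κ D c) = PowerSeries.C c := by
    intro c
    have h2 := huniq (algebraMap κ D c) 0 c (by ring)
    have h3 := huniq (0 : D) 0 0 (by simp)
    have h4 : F 0 = 0 := by
      ext n
      induction n with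
      | zero => rw [hcoeff0, map_zero, map_zero]
      | succ n ih => rw [hcoeff, h3.2, ih, map_zero, map_zero]
    rw [hF, h2.1, h2.2, h4, mul_zero, add_zero]
  let E : D →ₐ[κ] PowerSeries κ :=
    { toFun := F
      map_one' := by have := hF1 1; rwa [map_one, map_one] at this
      map_zero' := by have := hF1 0; rwa [map_zero, map_zero] at this
      map_add' := hFadd
      map_mul' := hFmul
      commutes' := hF1 }
  refine ⟨E, ?_, fun x => ?_⟩
  · show F π = _
    have h2 := huniq π 1 0 (by simp)
    have h3 : F 1 = 1 := E.map_one
    rw [hF, h2.1, h2.2, h3]; simp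
  · rw [← hcoeff0, PowerSeries.coeff_zero_eq_constantCoeff_apply]; rfl

end Expansion

section Uniformize

open PowerSeries

variable {κ : Type*} [Field κ] [IsAlgClosed κ]

theorem algebraMap_comp_constantCoeff {B : Type*} [CommRing B] [Algebra κ⟦X⟧ B]
    (hX : algebraMap κ⟦X⟧ B X = 0) (f : κ⟦X⟧) :
    algebraMap κ⟦X⟧ B f = algebraMap κ⟦X⟧ B (C (constantCoeff f)) := by
  have h := sub_const_eq_X_mul_shift f
  rw [← sub_eq_zero, ← map_sub, h, map_mul, hX, zero_mul]

/-- A finite separable extension of `κ((t))`, for `κ` algebraically closed, embeds into `κ((u))`,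
with `t` being mapped to a power series of positive order. -/
theorem exists_uniformization (L : Type*) [Field L] [Algebra κ⟦X⟧ L] [Algebra (LaurentSeries κ) L]
    [IsScalarTower κ⟦X⟧ (LaurentSeries κ) L] [FiniteDimensional (LaurentSeries κ) L]
    [Algebra.IsSeparable (LaurentSeries κ) L] :
    ∃ (ψ : L →+* LaurentSeries κ) (E : κ⟦X⟧ →+* κ⟦X⟧) (e : ℕ) (w : κ⟦X⟧ˣ), e ≠ 0 ∧
      E X = X ^ e * (w : κ⟦X⟧) ∧ (∀ c : κ, E (C c) = C c) ∧
      ∀ f : κ⟦X⟧, ψ (algebraMap κ⟦X⟧ L f) = HahnSeries.ofPowerSeries ℤ κ (E f) := by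
  let B := integralClosure κ⟦X⟧ L
  have : IsDedekindDomain B := integralClosure.isDedekindDomain κ⟦X⟧ (LaurentSeries κ) L
  have : IsFractionRing B L :=
    integralClosure.isFractionRing_of_finite_extension (LaurentSeries κ) L
  have hinj : Function.Injective (algebraMap κ⟦X⟧ B) := by
    have h1 : Function.Injective (algebraMap κ⟦X⟧ L) := by
      rw [IsScalarTower.algebraMap_eq κ⟦X⟧ (LaurentSeries κ) L]
      exact (algebraMap (LaurentSeries κ) L).injective.comp
        (IsFractionRing.injective κ⟦X⟧ (LaurentSeries κ))
    rw [IsScalarTower.algebraMap_eq κ⟦X⟧ B L] at h1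
    exact Function.Injective.of_comp (f := algebraMap B L) h1
  -- Any prime `Q` of the integral closure above `(X)` will do: its residue field is integral over
  -- the algebraically closed field `κ`, hence equal to it.
  obtain ⟨Q, hQ, hcomap⟩ := Ideal.exists_ideal_over_maximal_of_isIntegral (S := B)
    (IsLocalRing.maximalIdeal κ⟦X⟧) (by
      rw [(RingHom.injective_iff_ker_eq_bot _).1 hinj]; exact bot_le)
  have hXQ : algebraMap κ⟦X⟧ B X ∈ Q := by
    rw [← Ideal.mem_comap, hcomap, IsLocalRing.mem_maximalIdeal]
    exact X_prime.not_isUnit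
  have hQ0 : Q ≠ ⊥ := fun h => X_ne_zero (hinj (by
    rw [map_zero]; rwa [h, Ideal.mem_bot] at hXQ))
  let _ : Field (B ⧸ Q) := Ideal.Quotient.field Q
  let _ : Algebra κ B := ((algebraMap κ⟦X⟧ B).comp C).toAlgebra
  have hX0 : algebraMap κ⟦X⟧ (B ⧸ Q) X = 0 := by
    rw [IsScalarTower.algebraMap_apply κ⟦X⟧ B (B ⧸ Q)]
    exact Ideal.Quotient.eq_zero_iff_mem.2 hXQ
  have hint : Algebra.IsIntegral κ (B ⧸ Q) := ⟨fun x => by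
    obtain ⟨p, hp, hpx⟩ := Algebra.IsIntegral.isIntegral (R := κ⟦X⟧) x
    refine ⟨p.map constantCoeff, hp.map _, ?_⟩
    rw [Polynomial.eval₂_map, ← hpx]
    congr 1
    ext f
    exact (algebraMap_comp_constantCoeff hX0 f).symm⟩
  have hbij := IsAlgClosed.algebraMap_bijective_of_isIntegral (k := κ) (K := B ⧸ Q)
  let ε : κ ≃ₐ[κ] (B ⧸ Q) := AlgEquiv.ofBijective (Algebra.ofId κ (B ⧸ Q)) hbij
  let α : B →ₐ[κ] κ := ε.symm.toAlgHom.comp (Ideal.Quotient.mkₐ κ Q)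
  have hα : ∀ x, α x = 0 ↔ x ∈ Q := fun x => by
    show ε.symm (Ideal.Quotient.mk Q x) = 0 ↔ _
    rw [map_eq_zero_iff _ ε.symm.injective, Ideal.Quotient.eq_zero_iff_mem]
  -- `D` is a discrete valuation ring that contains `κ` and has residue field `κ`, so its elements
  -- expand in powers of a uniformizer. No completion is needed.
  let D := Localization.AtPrime Q
  have hD : IsDiscreteValuationRing D :=
    IsLocalization.AtPrime.isDiscreteValuationRing_of_dedekind_domain B hQ0 D
  let a : D →ₐ[κ] κ := IsLocalization.liftAlgHom (M := Q.primeCompl) (f := α) fun y =>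
    isUnit_iff_ne_zero.2 fun h => y.2 ((hα _).1 h)
  have ha : ∀ x : B, a (algebraMap B D x) = α x := fun x => IsLocalization.lift_eq _ _
  have hamax : ∀ x : D, a x = 0 ↔ x ∈ IsLocalRing.maximalIdeal D := by
    have hm : (RingHom.ker a.toRingHom).IsMaximal := RingHom.ker_isMaximal_of_surjective _
      fun c => ⟨algebraMap κ D c, a.commutes c⟩
    intro x
    rw [← IsLocalRing.eq_maximalIdeal hm]
    rfl
  obtain ⟨π, hπ⟩ := IsDiscreteValuationRing.exists_irreducible D
  have hspan := (IsDiscreteValuationRing.irreducible_iff_uniformizer π).1 hπ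
  obtain ⟨F, hFπ, hF⟩ := exists_expansion a (π := π)
    ((hamax π).2 (hspan ▸ Ideal.mem_span_singleton_self π))
    (fun x hx => by
      have := (hamax x).1 hx
      rwa [hspan, Ideal.mem_span_singleton] at this)
    (fun x hx => (mul_eq_zero.1 hx).resolve_left hπ.ne_zero)
  -- A unit times `π^n` expands to a unit times `X^n`. This yields both the injectivity of the
  -- expansion and the shape `X^e w` of the image of `X`, with `e ≠ 0` since `X` lies in `Q`.
  have hFne : ∀ x : D, x ≠ 0 → ∃ (n : ℕ) (w : κ⟦X⟧ˣ), F x = X ^ n * (w : κ⟦X⟧) ∧ (a x = 0 → n ≠ 0) := by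
    intro x hx
    obtain ⟨n, w, rfl⟩ := IsDiscreteValuationRing.eq_unit_mul_pow_irreducible hx hπ
    refine ⟨n, Units.map F.toRingHom.toMonoidHom w, ?_, fun h0 => ?_⟩
    · rw [map_mul, map_pow, hFπ, mul_comm]; rfl
    · rintro rfl
      rw [pow_zero, mul_one] at h0
      exact (w.isUnit.map a).ne_zero h0
  have hBD : Function.Injective (algebraMap B D) :=
    IsLocalization.injective D (Ideal.primeCompl_le_nonZeroDivisors Q)
  let G : B →+* LaurentSeries κ :=
    (HahnSeries.ofPowerSeries ℤ κ).comp (F.toRingHom.comp (algebraMap B D))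
  have hG : Function.Injective G := by
    rw [injective_iff_map_eq_zero]
    intro x hx
    by_contra hne
    obtain ⟨n, w, hw, -⟩ := hFne (algebraMap B D x) fun h => hne (hBD (by rw [h, map_zero]))
    have h0 : F (algebraMap B D x) = 0 := HahnSeries.ofPowerSeries_injective (hx.trans (map_zero _).symm)
    rw [hw] at h0
    exact (mul_ne_zero (pow_ne_zero n X_ne_zero) w.ne_zero) h0
  obtain ⟨e, w, hw, he⟩ := hFne (algebraMap B D (algebraMap κ⟦X⟧ B X)) fun h =>
    X_ne_zero (hinj (hBD (by rw [h, map_zero, map_zero])))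
  refine ⟨IsFractionRing.lift hG, F.toRingHom.comp ((algebraMap B D).comp (algebraMap κ⟦X⟧ B)), e,
    w, he ((ha _).trans ((hα _).2 hXQ)), hw, fun c => F.commutes c, fun f => ?_⟩
  rw [IsScalarTower.algebraMap_apply κ⟦X⟧ B L, IsFractionRing.lift_algebraMap]
  rfl

end Uniformize

end

end PadicDE

/-! ### `u`-adic convergence and reduction of integral functions to `κ((u))` -/

namespace PadicDE

noncomputable section

section Vanish

variable {κ : Type*} [Field κ]

/-- The coefficients of `x` of index less than `n` vanish. -/
def Vanish (n : ℤ) (x : LaurentSeries κ) : Prop := ∀ i < n, x.coeff i = 0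

theorem Vanish.add {n : ℤ} {x y : LaurentSeries κ} (hx : Vanish n x) (hy : Vanish n y) :
    Vanish n (x + y) := fun i hi => by rw [HahnSeries.coeff_add, hx i hi, hy i hi, add_zero]

theorem Vanish.neg {n : ℤ} {x : LaurentSeries κ} (hx : Vanish n x) : Vanish n (-x) :=
  fun i hi => by rw [HahnSeries.coeff_neg, hx i hi, neg_zero]

theorem Vanish.sub {n : ℤ} {x y : LaurentSeries κ} (hx : Vanish n x) (hy : Vanish n y) :
    Vanish n (x - y) := by rw [sub_eq_add_neg]; exact hx.add hy.neg

theorem Vanish.mono {n m : ℤ} (h : m ≤ n) {x : LaurentSeries κ} (hx : Vanish n x) : Vanish m x :=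
  fun i hi => hx i (hi.trans_le h)

theorem vanish_zero (n : ℤ) : Vanish n (0 : LaurentSeries κ) := fun _ _ => HahnSeries.coeff_zero

theorem Vanish.sum {ι : Type*} {n : ℤ} (s : Finset ι) {x : ι → LaurentSeries κ}
    (hx : ∀ i ∈ s, Vanish n (x i)) : Vanish n (∑ i ∈ s, x i) := by
  classical
  induction s using Finset.induction_on with
  | empty => exact vanish_zero n
  | insert a s ha ih =>
    rw [Finset.sum_insert ha]
    exact (hx a (Finset.mem_insert_self _ _)).add
      (ih fun i hi => hx i (Finset.mem_insert_of_mem hi))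

theorem Vanish.mul {n m : ℤ} {x y : LaurentSeries κ} (hx : Vanish n x) (hy : Vanish m y) :
    Vanish (n + m) (x * y) := fun i hi => by
  rw [HahnSeries.coeff_mul]
  refine Finset.sum_eq_zero fun a ha => ?_
  have h1 : a.1 + a.2 = i := (Finset.mem_antidiagonal.1 ha).2.2
  rcases lt_or_ge a.1 n with h | h
  · rw [hx _ h, zero_mul]
  · rw [hy a.2 (by omega), mul_zero]

theorem vanish_one : Vanish 0 (1 : LaurentSeries κ) := fun i hi => by
  rw [HahnSeries.coeff_one, if_neg hi.ne]

theorem Vanish.pow {n : ℤ} {x : LaurentSeries κ} (hx : Vanish n x) (k : ℕ) :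
    Vanish (k * n) (x ^ k) := by
  induction k with
  | zero => simpa using vanish_one
  | succ k ih => rw [pow_succ]; exact (ih.mul hx).mono (by push_cast; linarith)

theorem vanish_C (c : κ) : Vanish 0 (HahnSeries.C c : LaurentSeries κ) := fun i hi => by
  rw [HahnSeries.C_apply, HahnSeries.coeff_single_of_ne hi.ne]

theorem vanish_single (n : ℤ) (c : κ) : Vanish n (HahnSeries.single n c) := fun i hi => by
  rw [HahnSeries.coeff_single_of_ne hi.ne]

theorem vanish_ofPowerSeries (f : PowerSeries κ) : Vanish 0 (HahnSeries.ofPowerSeries ℤ κ f) :=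
  fun i hi => by
    rw [PowerSeries.coeff_coe, if_pos hi]

theorem exists_vanish (x : LaurentSeries κ) : ∃ n, Vanish n x := by
  rcases eq_or_ne x 0 with rfl | hx
  · exact ⟨0, vanish_zero 0⟩
  · exact ⟨x.order, fun i hi => HahnSeries.coeff_eq_zero_of_lt_order hi⟩

theorem coeff_mul_eq_sum (x y : LaurentSeries κ) (n : ℤ) (s : Finset ℤ)
    (h : ∀ i ∉ s, x.coeff i * y.coeff (n - i) = 0) :
    (x * y).coeff n = ∑ i ∈ s, x.coeff i * y.coeff (n - i) := by
  rw [HahnSeries.coeff_mul]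
  refine Finset.sum_bij_ne_zero (fun a _ _ => a.1) (fun a ha h0 => ?_) (fun a ha _ b hb _ e => ?_)
    (fun i hi h0 => ?_) fun a ha _ => ?_
  · by_contra hs
    have h1 : a.1 + a.2 = n := (Finset.mem_antidiagonal.1 ha).2.2
    apply h0
    rw [← h _ hs, ← h1, add_sub_cancel_left]
  · have h1 : a.1 + a.2 = n := (Finset.mem_antidiagonal.1 ha).2.2
    have h2 : b.1 + b.2 = n := (Finset.mem_antidiagonal.1 hb).2.2
    ext <;> omega
  · refine ⟨(i, n - i), Finset.mem_antidiagonal.2 ⟨left_ne_zero_of_mul h0,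
      right_ne_zero_of_mul h0, by ring⟩, h0, rfl⟩
  · have h1 : a.1 + a.2 = n := (Finset.mem_antidiagonal.1 ha).2.2
    rw [← h1, add_sub_cancel_left]

/-- Convergence of a sequence of Laurent series for the `u`-adic topology. -/
def UConv (s : ℕ → LaurentSeries κ) (x : LaurentSeries κ) : Prop :=
  ∀ n, ∀ᶠ M in atTop, Vanish n (s M - x)

theorem uconv_const (x : LaurentSeries κ) : UConv (fun _ => x) x := fun n =>
  Eventually.of_forall fun _ => by rw [sub_self]; exact vanish_zero n

theorem UConv.add {s t : ℕ → LaurentSeries κ} {x y : LaurentSeries κ} (hs : UConv s x)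
    (ht : UConv t y) : UConv (fun M => s M + t M) (x + y) := fun n => by
  filter_upwards [hs n, ht n] with M h1 h2
  rw [add_sub_add_comm]
  exact h1.add h2

theorem UConv.neg {s : ℕ → LaurentSeries κ} {x : LaurentSeries κ} (hs : UConv s x) :
    UConv (fun M => -s M) (-x) := fun n => by
  filter_upwards [hs n] with M h1
  rw [← neg_sub']
  exact h1.neg

theorem UConv.sub {s t : ℕ → LaurentSeries κ} {x y : LaurentSeries κ} (hs : UConv s x)
    (ht : UConv t y) : UConv (fun M => s M - t M) (x - y) := by
  simp only [sub_eq_add_neg]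
  exact hs.add ht.neg

theorem UConv.mul {s t : ℕ → LaurentSeries κ} {x y : LaurentSeries κ} (hs : UConv s x)
    (ht : UConv t y) : UConv (fun M => s M * t M) (x * y) := fun n => by
  obtain ⟨a, ha⟩ := exists_vanish x
  obtain ⟨b, hb⟩ := exists_vanish y
  filter_upwards [hs (max n (n - b)), ht (max 0 (n - a))] with M h1 h2
  have e : s M * t M - x * y = (s M - x) * (t M - y) + (s M - x) * y + x * (t M - y) := by ring
  rw [e]
  refine (((h1.mul h2).mono ?_).add ((h1.mul hb).mono ?_)).add ((ha.mul h2).mono ?_)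
  · have := le_max_left n (n - b)
    have := le_max_left 0 (n - a)
    omega
  · have := le_max_right n (n - b)
    omega
  · have := le_max_right 0 (n - a)
    omega

theorem UConv.pow {s : ℕ → LaurentSeries κ} {x : LaurentSeries κ} (hs : UConv s x) (k : ℕ) :
    UConv (fun M => s M ^ k) (x ^ k) := by
  induction k with
  | zero => simpa using uconv_const 1
  | succ k ih => simpa only [pow_succ] using ih.mul hs

theorem UConv.sum {ι : Type*} (t : Finset ι) {s : ι → ℕ → LaurentSeries κ}
    {x : ι → LaurentSeries κ} (hs : ∀ i ∈ t, UConv (s i) (x i)) :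
    UConv (fun M => ∑ i ∈ t, s i M) (∑ i ∈ t, x i) := by
  classical
  induction t using Finset.induction_on with
  | empty => simpa using uconv_const 0
  | insert a t ha ih =>
    simp only [Finset.sum_insert ha]
    exact (hs a (Finset.mem_insert_self _ _)).add
      (ih fun i hi => hs i (Finset.mem_insert_of_mem hi))

/-- From `s⁻¹ - x⁻¹ = -(s - x) s⁻¹ x⁻¹`; a common lower bound `a` for the orders of the inverses is
what keeps the product small. -/
theorem UConv.inv {s : ℕ → LaurentSeries κ} {x : LaurentSeries κ} (hs : UConv s x) (hx : x ≠ 0)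
    {a : ℤ} (h0 : ∀ᶠ M in atTop, s M ≠ 0 ∧ Vanish a (s M)⁻¹) : UConv (fun M => (s M)⁻¹) x⁻¹ := by
  intro n
  obtain ⟨b, hb⟩ := exists_vanish x⁻¹
  filter_upwards [hs (n - a - b), h0] with M h1 h2
  have e : (s M)⁻¹ - x⁻¹ = -(s M - x) * (s M)⁻¹ * x⁻¹ := by
    have := h2.1
    field_simp
    ring
  rw [e]
  exact ((h1.neg.mul h2.2).mul hb).mono (by omega)

theorem UConv.zpow {s : ℕ → LaurentSeries κ} {x : LaurentSeries κ} (hs : UConv s x)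
    (hi : UConv (fun M => (s M)⁻¹) x⁻¹) (k : ℤ) : UConv (fun M => s M ^ k) (x ^ k) := by
  obtain ⟨n, rfl | rfl⟩ := k.eq_nat_or_neg
  · simpa only [zpow_natCast] using hs.pow n
  · simpa only [zpow_neg, zpow_natCast, inv_pow] using hi.pow n

theorem UConv.eventually_vanish {s : ℕ → LaurentSeries κ} {x : LaurentSeries κ} (hs : UConv s x)
    {n : ℤ} (hx : Vanish n x) : ∀ᶠ M in atTop, Vanish n (s M) := by
  filter_upwards [hs n] with M h
  simpa using h.add hx

theorem UConv.eval {R : Type*} [CommRing R] {φ : ℕ → R →+* LaurentSeries κ}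
    {φ₀ : R →+* LaurentSeries κ} (hφ : ∀ a, UConv (fun M => φ M a) (φ₀ a))
    {s : ℕ → LaurentSeries κ} {x : LaurentSeries κ} (hs : UConv s x) (p : Polynomial R) :
    UConv (fun M => p.eval₂ (φ M) (s M)) (p.eval₂ φ₀ x) := by
  simp only [Polynomial.eval₂_eq_sum, Polynomial.sum]
  exact UConv.sum _ fun i _ => (hφ _).mul (hs.pow i)

end Vanish

/-- A reduction map from the valuation ring of `N` to a field. -/
structure Reduction (N : Type u) [NormedField N] [IsUltrametricDist N] (κ : Type*) [Field κ] where
  red : IntRing N →+* κ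
  red_eq_zero : ∀ x : IntRing N, ‖(x : N)‖ < 1 → red x = 0

namespace Reduction

variable {N : Type u} [NormedField N] [IsUltrametricDist N] {κ : Type*} [Field κ]
  (R : Reduction N κ)

theorem norm_lt_one {x : IntRing N} (hx : R.red x = 0) : ‖(x : N)‖ < 1 := by
  refine lt_of_le_of_ne x.2 fun h => ?_
  have h0 : (x : N) ≠ 0 := fun h' => by rw [h', norm_zero] at h; exact zero_ne_one h
  have h1 : ‖(x : N)⁻¹‖ ≤ 1 := by rw [norm_inv, h, inv_one]
  have h2 : x * ⟨(x : N)⁻¹, h1⟩ = 1 := Subtype.ext (mul_inv_cancel₀ h0)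
  have h3 := congrArg R.red h2
  rw [map_mul, hx, zero_mul, map_one] at h3
  exact zero_ne_one h3

variable [CompleteSpace N]

/-- The terms tend to zero, so all but finitely many have norm below `1/2`, and the individual
strict bounds combine into a uniform one. -/
theorem norm_tsum_lt_one {a : ℤ → N} (hs : Summable a) (ha : ∀ i, ‖a i‖ < 1) :
    ‖∑' i, a i‖ < 1 := by
  have h1 := (hs.tendsto_cofinite_zero.norm).eventually
    (gt_mem_nhds (show ‖(0 : N)‖ < 1 / 2 by rw [norm_zero]; norm_num))
  rw [Filter.eventually_cofinite] at h1
  obtain ⟨c, hc1, hc⟩ : ∃ c < 1, ∀ i, ‖a i‖ ≤ c := by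
    rcases h1.toFinset.eq_empty_or_nonempty with he | hne
    · refine ⟨1 / 2, by norm_num, fun i => ?_⟩
      by_contra hi
      have : i ∈ h1.toFinset := by rw [Set.Finite.mem_toFinset]; exact fun h => hi h.le
      rw [he] at this
      exact absurd this (Finset.notMem_empty i)
    · obtain ⟨j, -, hj⟩ := h1.toFinset.exists_max_image (fun i => ‖a i‖) hne
      refine ⟨max (1 / 2) ‖a j‖, max_lt (by norm_num) (ha j), fun i => ?_⟩
      by_cases hi : ‖a i‖ < 1 / 2
      · exact hi.le.trans (le_max_left _ _)
      · exact (hj i (by rwa [Set.Finite.mem_toFinset])).trans (le_max_right _ _)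
  exact (IsUltrametricDist.norm_tsum_le_of_forall_le hc).trans_lt hc1

theorem norm_tsum_le_one {a : ℤ → N} (ha : ∀ i, ‖a i‖ ≤ 1) : ‖∑' i, a i‖ ≤ 1 :=
  IsUltrametricDist.norm_tsum_le_of_forall_le ha

theorem red_tsum {a : ℤ → N} (hs : Summable a) (ha : ∀ i, ‖a i‖ ≤ 1) (s : Finset ℤ)
    (h : ∀ i ∉ s, ‖a i‖ < 1) :
    R.red ⟨∑' i, a i, norm_tsum_le_one ha⟩ = ∑ i ∈ s, R.red ⟨a i, ha i⟩ := by
  classical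
  rw [← map_sum, ← sub_eq_zero, ← map_sub]
  apply R.red_eq_zero
  have e : (((⟨∑' i, a i, norm_tsum_le_one ha⟩ : IntRing N) - ∑ i ∈ s, (⟨a i, ha i⟩ : IntRing N) :
      IntRing N) : N) = ∑' i, (a i - if i ∈ s then a i else 0) := by
    have hf : Summable fun i => if i ∈ s then a i else 0 :=
      summable_of_ne_finset_zero (s := s) fun i hi => if_neg hi
    rw [hs.tsum_sub hf, tsum_eq_sum (s := s) (fun i hi => if_neg hi),
      Finset.sum_congr rfl (fun i hi => if_pos hi)]
    push_cast
    rfl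
  rw [e]
  refine norm_tsum_lt_one (hs.sub (summable_of_ne_finset_zero (s := s) fun i hi => if_neg hi))
    fun i => ?_
  by_cases hi : i ∈ s
  · rw [if_pos hi, sub_self, norm_zero]; exact one_pos
  · rw [if_neg hi, sub_zero]; exact h i hi

end Reduction

namespace Laurent

variable {N : Type u} [NormedField N] [IsUltrametricDist N] [CompleteSpace N] {I : Radii}

/-- Convergence at one radius `ρ < 1` makes `‖c_i‖ ρ^i` less than `1` for very negative `i`, where
`ρ^i ≥ 1`. This is why an integral function reduces to a series with finitely many terms of negative
degree. -/
theorem exists_norm_coeff_lt_one [hI : I.InDisc] (f : Laurent N I) :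
    ∃ i₀, ∀ i < i₀, ‖f.coeff i‖ < 1 := by
  obtain ⟨ρ, hρ⟩ := I.nonempty
  have hρ0 := I.pos ρ hρ
  have h1 := (f.tendsto' ρ hρ).eventually (gt_mem_nhds one_pos)
  rw [Filter.eventually_cofinite] at h1
  obtain ⟨m, hm⟩ := h1.bddBelow
  refine ⟨min m 0, fun i hi => ?_⟩
  have h2 : ‖f.coeff i‖ * ρ ^ i < 1 := by
    by_contra hc
    have := hm hc
    omega
  have h3 : 1 ≤ ρ ^ i := one_le_zpow_of_nonpos₀ hρ0 (hI.lt_one ρ hρ).le (by omega)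
  nlinarith [norm_nonneg (f.coeff i)]

/-- The integral coefficients of an integral function. -/
def intCoeff (f : integral N I) (i : ℤ) : IntRing N := ⟨f.1.coeff i, f.2 i⟩

end Laurent

namespace Reduction

open Laurent

variable {N : Type u} [NormedField N] [IsUltrametricDist N] [CompleteSpace N] {κ : Type*} [Field κ]
  (R : Reduction N κ) {I : Radii}

/-- The reduction of an integral function is a formal Laurent series. -/
def res [I.InDisc] : integral N I →+* LaurentSeries κ where
  toFun f := HahnSeries.ofSuppBddBelow (fun i => R.red (intCoeff f i)) (by
    obtain ⟨i₀, h⟩ := exists_norm_coeff_lt_one f.1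
    refine ⟨i₀, fun i hi => ?_⟩
    by_contra hc
    exact hi (R.red_eq_zero _ (h i (not_le.1 hc))))
  map_one' := by
    ext i
    rw [HahnSeries.coeff_ofSuppBddBelow, HahnSeries.coeff_one]
    split_ifs with hi
    · subst hi
      rw [← map_one R.red]
      exact congrArg R.red (Subtype.ext (Pi.single_eq_same (M := fun _ : ℤ => N) 0 1))
    · rw [← map_zero R.red]
      exact congrArg R.red (Subtype.ext (Pi.single_eq_of_ne (M := fun _ : ℤ => N) hi 1))
  map_zero' := by
    ext i
    exact map_zero R.red
  map_add' f g := by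
    ext i
    exact map_add R.red (intCoeff f i) (intCoeff g i)
  map_mul' f g := by
    ext n
    obtain ⟨i₀, hi₀⟩ := exists_norm_coeff_lt_one f.1
    obtain ⟨j₀, hj₀⟩ := exists_norm_coeff_lt_one g.1
    have hlt : ∀ i ∉ Finset.Icc i₀ (n - j₀), ‖f.1.coeff i * g.1.coeff (n - i)‖ < 1 := by
      intro i hi
      rw [norm_mul]
      by_cases h : i < i₀
      · exact mul_lt_one_of_nonneg_of_lt_one_left (norm_nonneg _) (hi₀ i h) (g.2 _)
      · refine mul_lt_one_of_nonneg_of_lt_one_right (f.2 _) (norm_nonneg _) (hj₀ _ ?_)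
        rw [Finset.mem_Icc] at hi
        omega
    rw [coeff_mul_eq_sum _ _ n (Finset.Icc i₀ (n - j₀))]
    · refine (R.red_tsum (summable_mul f.1 g.1 n) (fun i => ?_) _ hlt).trans
        (Finset.sum_congr rfl fun i _ => ?_)
      · rw [norm_mul]; exact mul_le_one₀ (f.2 _) (norm_nonneg _) (g.2 _)
      · exact map_mul R.red (intCoeff f i) (intCoeff g (n - i))
    · intro i hi
      exact (map_mul R.red (intCoeff f i) (intCoeff g (n - i))).symm.trans
        (R.red_eq_zero _ (hlt i hi))

theorem coeff_res [I.InDisc] (f : integral N I) (i : ℤ) :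
    (R.res f).coeff i = R.red (intCoeff f i) := rfl

end Reduction

namespace Ramification

open Laurent

variable {N : Type u} [NormedField N] [IsUltrametricDist N] [CompleteSpace N] (Y : Ramification N)
  {κ : Type*} [Field κ] (R : Reduction N κ) {I : Radii}

/-- The integral powers of `u^e v(u)`. -/
def powInt [I.InDisc] (i : ℤ) : integral N I := ⟨Y.pow i, Y.norm_coeff_pow_le i⟩

theorem powInt_add [I.InDisc] (i j : ℤ) : (Y.powInt (i + j) : integral N I) =
    Y.powInt i * Y.powInt j := Subtype.ext (Y.pow_add i j)

theorem powInt_zero [I.InDisc] : (Y.powInt 0 : integral N I) = 1 := Subtype.ext Y.pow_zero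

theorem res_powInt [I.InDisc] (i : ℤ) :
    R.res (Y.powInt i : integral N I) = R.res (Y.powInt 1 : integral N I) ^ i := by
  have h0 : ∀ n : ℕ, R.res (Y.powInt n : integral N I) = R.res (Y.powInt 1 : integral N I) ^ n := by
    intro n
    induction n with
    | zero => rw [Nat.cast_zero, powInt_zero, map_one, _root_.pow_zero]
    | succ n ih => rw [Nat.cast_succ, powInt_add, map_mul, ih, pow_succ]
  obtain ⟨n, rfl | rfl⟩ := i.eq_nat_or_neg
  · rw [h0, zpow_natCast]
  · rw [zpow_neg, zpow_natCast, ← h0]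
    refine eq_inv_of_mul_eq_one_left ?_
    rw [← map_mul, ← powInt_add, neg_add_cancel, powInt_zero, map_one]

theorem vanish_res_powInt [I.InDisc] (i : ℤ) :
    Vanish (Y.e * i) (R.res (Y.powInt i : integral N I)) := fun n hn => by
  rw [R.coeff_res]
  refine R.red_eq_zero _ ?_
  show ‖(Y.pow i : Laurent N I).coeff n‖ < 1
  rw [coeff_pow_eq_zero _ hn, norm_zero]
  exact one_pos

variable {K : Type u} [NormedField K] [IsUltrametricDist K] [CompleteSpace K] [NormedAlgebra K N]

theorem norm_pull_term_le [I.InDisc] (f : integral K I) (i n : ℤ) :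
    ‖algebraMap K N (f.1.coeff i) * (Y.pow i : Laurent N (I.root Y.e)).coeff n‖ ≤ 1 := by
  rw [norm_mul, norm_algebraMap']
  exact mul_le_one₀ (f.2 i) (norm_nonneg _) (Y.norm_coeff_pow_le i n)

/-- Substitution into integral functions. -/
def pullInt [I.InDisc] : integral K I →+* integral N (I.root Y.e) where
  toFun f := ⟨Y.pull f.1, fun n => by
    rw [Y.coeff_pull]
    exact Reduction.norm_tsum_le_one fun i => Y.norm_pull_term_le f i n⟩
  map_one' := Subtype.ext (map_one Y.pull)
  map_zero' := Subtype.ext (map_zero Y.pull)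
  map_add' f g := Subtype.ext (map_add Y.pull f.1 g.1)
  map_mul' f g := Subtype.ext (map_mul Y.pull f.1 g.1)

/-- Reduction commutes with substitution, up to order `m`. -/
theorem vanish_res_pullInt [I.InDisc] (redK : Reduction K κ)
    (hred : ∀ (x : IntRing K) (y : IntRing N), (y : N) = algebraMap K N x → R.red y = redK.red x)
    (f : integral K I) {i₀ m : ℤ} (h₀ : Vanish i₀ (redK.res f)) :
    Vanish (Y.e * m) (R.res (Y.pullInt f : integral N (I.root Y.e)) -
      ∑ i ∈ Finset.Ico i₀ m, HahnSeries.C ((redK.res f).coeff i) *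
        R.res (Y.powInt 1 : integral N (I.root Y.e)) ^ i) := by
  intro n hn
  rw [HahnSeries.coeff_sub, sub_eq_zero, R.coeff_res, HahnSeries.coeff_sum]
  have hs : Summable fun i : ℤ =>
      algebraMap K N (f.1.coeff i) * (Y.pow i : Laurent N (I.root Y.e)).coeff n := by
    have := (Y.lsummable_pull (N := N) f.1).summable_coeff n
    simpa only [coeff_mono_mul, sub_zero] using this
  have e : intCoeff (Y.pullInt f : integral N (I.root Y.e)) n =
      ⟨_, Reduction.norm_tsum_le_one fun i => Y.norm_pull_term_le (N := N) f i n⟩ :=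
    Subtype.ext (Y.coeff_pull f.1 n)
  rw [e, R.red_tsum hs (fun i => Y.norm_pull_term_le f i n) (Finset.Ico i₀ m)]
  · refine Finset.sum_congr rfl fun i _ => ?_
    rw [← Y.res_powInt, HahnSeries.C_apply, HahnSeries.coeff_single_zero_mul, redK.coeff_res,
      R.coeff_res, ← hred (intCoeff f i) ⟨algebraMap K N (f.1.coeff i), by
        show ‖_‖ ≤ 1
        rw [norm_algebraMap']; exact f.2 i⟩ rfl, ← map_mul]
    rfl
  · intro i hi
    rw [norm_mul, norm_algebraMap']
    rw [Finset.mem_Ico, not_and_or] at hi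
    rcases hi with hi | hi
    · exact mul_lt_one_of_nonneg_of_lt_one_left (norm_nonneg _)
        (redK.norm_lt_one (h₀ i (not_le.1 hi))) (Y.norm_coeff_pow_le i n)
    · rw [coeff_pow_eq_zero, norm_zero, mul_zero]
      · exact one_pos
      · have : (Y.e : ℤ) * m ≤ Y.e * i := by
          have : (0 : ℤ) ≤ Y.e := by positivity
          exact mul_le_mul_of_nonneg_left (not_lt.1 hi) this
        omega

end Ramification

end

end PadicDE

/-! ### Functions of Gauss norm less than `1` and the equations they solve -/

namespace PadicDE

noncomputable section

namespace Laurent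

variable {N : Type u} [NormedField N] [IsUltrametricDist N] [CompleteSpace N] {I : Radii}

/-- The Gauss norms of `f` are smaller than `1`. -/
def Small (f : Laurent N I) : Prop := ∀ ρ ∈ I.carrier, ∃ c : ℝ, 0 ≤ c ∧ c < 1 ∧ GaussLE ρ c f

theorem Small.neg {f : Laurent N I} (hf : Small f) : Small (-f) := fun ρ hρ => by
  obtain ⟨c, h0, h1, hc⟩ := hf ρ hρ
  exact ⟨c, h0, h1, hc.neg⟩

theorem small_zero : Small (0 : Laurent N I) := fun _ _ =>
  ⟨0, le_rfl, one_pos, gaussLE_zero le_rfl⟩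

theorem exists_coeff_bound {Q : Polynomial (Laurent N I)} (hQ : ∀ k, Small (Q.coeff k)) {ρ : ℝ}
    (hρ : ρ ∈ I.carrier) : ∃ c : ℝ, 0 ≤ c ∧ c < 1 ∧ ∀ k, GaussLE ρ c (Q.coeff k) := by
  choose c h0 h1 hc using fun k => hQ k ρ hρ
  rcases Q.support.eq_empty_or_nonempty with he | hne
  · refine ⟨0, le_rfl, one_pos, fun k => ?_⟩
    rw [Polynomial.support_eq_empty.1 he, Polynomial.coeff_zero]
    exact gaussLE_zero le_rfl
  · obtain ⟨j, -, hj⟩ := Q.support.exists_max_image c hne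
    refine ⟨c j, h0 j, h1 j, fun k => ?_⟩
    by_cases hk : k ∈ Q.support
    · exact (hc k).mono (hj k hk)
    · rw [Polynomial.notMem_support_iff.1 hk]
      exact gaussLE_zero (h0 j)

theorem gaussLE_eval {Q : Polynomial (Laurent N I)} {ρ c : ℝ} (hρ : 0 < ρ) (hc0 : 0 ≤ c)
    (hc : ∀ k, GaussLE ρ c (Q.coeff k)) {z : Laurent N I} (hz : GaussLE ρ 1 z) :
    GaussLE ρ c (Q.eval z) := by
  rw [Polynomial.eval_eq_sum, Polynomial.sum]
  refine GaussLE.sum hρ hc0 _ fun k _ => ?_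
  have := (hc k).mul hρ (hz.pow hρ k)
  rwa [one_pow, mul_one] at this

theorem Small.eval {Q : Polynomial (Laurent N I)} (hQ : ∀ k, Small (Q.coeff k)) {z : Laurent N I}
    (hz : ∀ ρ ∈ I.carrier, GaussLE ρ 1 z) : Small (Q.eval z) := fun ρ hρ => by
  obtain ⟨c, h0, h1, hc⟩ := exists_coeff_bound hQ hρ
  exact ⟨c, h0, h1, gaussLE_eval (I.pos ρ hρ) h0 hc (hz ρ hρ)⟩

theorem gaussLE_pow_sub_pow {ρ t : ℝ} (hρ : 0 < ρ) {x y : Laurent N I} (hx : GaussLE ρ 1 x)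
    (hy : GaussLE ρ 1 y) (h : GaussLE ρ t (x - y)) (k : ℕ) : GaussLE ρ t (x ^ k - y ^ k) := by
  induction k with
  | zero => rw [pow_zero, pow_zero, sub_self]; exact gaussLE_zero h.nonneg
  | succ k ih =>
    have e : x ^ (k + 1) - y ^ (k + 1) = (x ^ k - y ^ k) * x + y ^ k * (x - y) := by ring
    rw [e]
    refine GaussLE.add hρ ?_ ?_
    · simpa using ih.mul hρ hx
    · simpa using (hy.pow hρ k).mul hρ h

/-- A polynomial with small coefficients has a fixed point. -/
theorem exists_eval_eq_self (Q : Polynomial (Laurent N I)) (hQ : ∀ k, Small (Q.coeff k)) :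
    ∃ z, (∀ ρ ∈ I.carrier, GaussLE ρ 1 z) ∧ Q.eval z = z := by
  refine exists_fixed_point (D := fun z => ∀ ρ ∈ I.carrier, GaussLE ρ 1 z) (fun z => Q.eval z)
    (fun x y hx hy ρ hρ i => ?_) 0 (fun ρ _ => gaussLE_zero zero_le_one) (fun y hy ρ hρ => ?_)
    fun ρ hρ => ?_
  · exact le_of_tendsto' ((hy i).norm.mul_const (ρ ^ i)) fun k => hx k ρ hρ i
  · obtain ⟨c, h0, h1, hc⟩ := exists_coeff_bound hQ hρ
    exact (gaussLE_eval (I.pos ρ hρ) h0 hc (hy ρ hρ)).mono h1.le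
  · obtain ⟨c, h0, h1, hc⟩ := exists_coeff_bound hQ hρ
    refine ⟨c, h0, h1, fun x y hx hy t ht => ?_⟩
    simp only [Polynomial.eval_eq_sum, Polynomial.sum]
    rw [← Finset.sum_sub_distrib]
    refine GaussLE.sum (I.pos ρ hρ) (mul_nonneg h0 ht.nonneg) _ fun k _ => ?_
    rw [← mul_sub]
    exact (hc k).mul (I.pos ρ hρ)
      (gaussLE_pow_sub_pow (I.pos ρ hρ) (hx ρ hρ) (hy ρ hρ) ht k)

/-- A fixed point `z` of `z ↦ -s - s z` satisfies `(1 + s)(1 + z) = 1`. -/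
theorem isUnit_one_add {s : Laurent N I} (hs : Small s) : IsUnit (1 + s) := by
  obtain ⟨z, -, hz⟩ := exists_eval_eq_self (Polynomial.C (-s) + Polynomial.C (-s) * Polynomial.X)
    (fun k => by
      rw [Polynomial.coeff_add, Polynomial.coeff_C, Polynomial.coeff_C_mul, Polynomial.coeff_X]
      rcases k with _ | _ | k
      · simpa using hs.neg
      · simpa using hs.neg
      · simpa using small_zero)
  rw [Polynomial.eval_add, Polynomial.eval_mul, Polynomial.eval_C, Polynomial.eval_X] at hz
  exact IsUnit.of_mul_eq_one (1 + z) (by linear_combination -hz)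

variable {K : Type u} [NormedField K] {r : Radius K}

/-- Three ranges of indices. Positive ones contribute at most `ρ`. Those below `-m` contribute at
most `1/2`, by comparison with a fixed radius `ρ₀`. For the finitely many from `-m` to `0` the
coefficients are bounded by some `d < 1`, which beats `ρ^(-m)` once `ρ` is close to `1`. -/
theorem small_of_vanish {κ : Type*} [Field κ] (R : Reduction N κ)
    (hcof : ∀ x : ℝ, x < 1 → ∃ b : Radius K, x < b.1) {e : ℕ} [NeZero e]
    (f : integral N (r.halfOpen.root e)) (hf : Vanish 1 (R.res f)) :
    ∃ b : Radius K, ∀ ρ : ℝ, 0 < ρ → b.1 ≤ ρ ^ e → ρ ^ e < 1 →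
      ∃ c : ℝ, 0 ≤ c ∧ c < 1 ∧ GaussLE ρ c f.1 := by
  have hlt : ∀ i : ℤ, i ≤ 0 → ‖f.1.coeff i‖ < 1 := fun i hi =>
    R.norm_lt_one (hf i (by omega))
  obtain ⟨ρ₀, hρ₀⟩ := (r.halfOpen.root e).nonempty
  have h00 := hρ₀.1
  obtain ⟨m, hm⟩ : ∃ m : ℕ, ∀ i : ℤ, i < -m → ‖f.1.coeff i‖ * ρ₀ ^ i ≤ 1 / 2 := by
    obtain ⟨m, hm⟩ := exists_tail hρ₀ f.1 (ε := 1 / 2) (by norm_num)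
    exact ⟨m, fun i hi => hm m le_rfl i (by omega)⟩
  obtain ⟨d, hd0, hd1, hd⟩ : ∃ d : ℝ, 0 < d ∧ d < 1 ∧ ∀ i : ℤ, -m ≤ i → i ≤ 0 →
      ‖f.1.coeff i‖ ≤ d := by
    obtain ⟨j, hj, hmax⟩ := (Finset.Icc (-m : ℤ) 0).exists_max_image (fun i => ‖f.1.coeff i‖)
      ⟨0, by simp⟩
    refine ⟨max (1 / 2) ‖f.1.coeff j‖, by positivity, max_lt (by norm_num)
      (hlt j (Finset.mem_Icc.1 hj).2), fun i h1 h2 => ?_⟩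
    exact (hmax i (Finset.mem_Icc.2 ⟨h1, h2⟩)).trans (le_max_right _ _)
  obtain ⟨σ, hσ1, hσd⟩ : ∃ σ : ℝ, σ < 1 ∧ ∀ ρ, σ < ρ → d < ρ ^ m := by
    have hcont : ContinuousAt (fun ρ : ℝ => ρ ^ m) 1 := by fun_prop
    have := hcont.eventually (lt_mem_nhds (show d < (fun ρ : ℝ => ρ ^ m) 1 by simpa using hd1))
    rw [Metric.eventually_nhds_iff] at this
    obtain ⟨ε, hε, h⟩ := this
    refine ⟨max 0 (1 - ε / 2), max_lt one_pos (by linarith), fun ρ hρ => ?_⟩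
    have h1 := (le_max_right _ _).trans_lt hρ
    have h2 : 0 < ρ := (le_max_left _ _).trans_lt hρ
    rcases le_or_gt ρ 1 with h3 | h3
    · refine h ?_
      rw [Real.dist_eq, abs_lt]
      constructor <;> linarith
    · exact hd1.trans_le (one_le_pow₀ h3.le)
  set τ := max ρ₀ σ with hτ
  have hτ1 : τ < 1 := max_lt (Radii.InDisc.lt_one ρ₀ hρ₀) hσ1
  have hτ0 : 0 < τ := h00.trans_le (le_max_left _ _)
  obtain ⟨b, hb⟩ := hcof (τ ^ e) (pow_lt_one₀ hτ0.le hτ1 (NeZero.ne e))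
  refine ⟨b, fun ρ hρ h1 h2 => ?_⟩
  have hτρ : τ < ρ := lt_of_pow_lt_pow_left₀ e hρ.le (hb.trans_le h1)
  have hρ1 : ρ < 1 := (pow_lt_one_iff_of_nonneg hρ.le (NeZero.ne e)).1 h2
  have hdm := hσd ρ ((le_max_right _ _).trans_lt hτρ)
  have hm0 : 0 < ρ ^ m := by positivity
  refine ⟨max (max (1 / 2) ρ) (d * (ρ ^ m)⁻¹), by positivity,
    max_lt (max_lt (by norm_num) hρ1) ?_, fun i => ?_⟩
  · rw [← div_eq_mul_inv, div_lt_one hm0]; exact hdm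
  rcases lt_or_ge 0 i with hi | hi
  · refine le_trans ?_ ((le_max_right _ _).trans (le_max_left _ _))
    calc ‖f.1.coeff i‖ * ρ ^ i ≤ 1 * ρ ^ (1 : ℤ) := by
          refine mul_le_mul (f.2 i) ?_ (by positivity) zero_le_one
          exact zpow_le_zpow_right_of_le_one₀ hρ hρ1.le hi
      _ = ρ := by rw [one_mul, zpow_one]
  · rcases lt_or_ge i (-m) with him | him
    · refine le_trans ?_ ((le_max_left _ _).trans (le_max_left _ _))
      refine le_trans ?_ (hm i him)
      refine mul_le_mul_of_nonneg_left ?_ (norm_nonneg _)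
      obtain ⟨n, rfl⟩ : ∃ n : ℕ, i = -n := ⟨i.natAbs, by omega⟩
      rw [zpow_neg, zpow_neg, zpow_natCast, zpow_natCast]
      exact inv_anti₀ (by positivity) (pow_le_pow_left₀ h00.le ((le_max_left _ _).trans hτρ.le) n)
    · refine le_trans ?_ (le_max_right _ _)
      refine mul_le_mul (hd i him hi) ?_ (by positivity) hd0.le
      rw [← zpow_natCast, ← zpow_neg]
      exact zpow_le_zpow_right_of_le_one₀ hρ hρ1.le him

end Laurent

end

end PadicDE

/-! ### Newton approximation for standard étale algebras -/

namespace PadicDE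

noncomputable section

section Newton

open Polynomial

variable {B : Type*} [CommRing B]

/-- The coefficients of a polynomial recentred at `a` and rescaled by `μ`. -/
theorem coeff_taylor_comp_C_mul_X (F : B[X]) (a μ : B) (k : ℕ) :
    ((taylor a F).comp (C μ * X)).coeff k = μ ^ k * (hasseDeriv k F).eval a := by
  rw [comp_C_mul_X_coeff, taylor_coeff, mul_comm]

theorem eval_taylor_comp_C_mul_X (F : B[X]) (a μ z : B) :
    ((taylor a F).comp (C μ * X)).eval z = F.eval (a + μ * z) := by
  rw [eval_comp, taylor_eval]
  simp [add_comm]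

/-- The polynomial whose fixed points solve `F(a + μ z) = 0`. -/
def newtonPoly (F : B[X]) (a d μ μ' : B) : B[X] :=
  X - C (d * μ') * (taylor a F).comp (C μ * X)

theorem coeff_newtonPoly (F : B[X]) (a d μ μ' : B) (k : ℕ) : (newtonPoly F a d μ μ').coeff k =
    (if k = 1 then 1 else 0) - d * μ' * (μ ^ k * (hasseDeriv k F).eval a) := by
  rw [newtonPoly, coeff_sub, coeff_C_mul, coeff_taylor_comp_C_mul_X, coeff_X]
  simp only [eq_comm]

/-- As `d` is only an approximate inverse of `F'(a)`, it must be shown to be a unit: it divides the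
unit `1 - coeff 1 = d μ' μ F'(a)`. The fixed point equation amounts to `d F(a + μ z) = 0`. -/
theorem eval_eq_zero_of_newtonPoly {F : B[X]} {a d μ μ' z : B} (hμ : μ * μ' = 1)
    (hz : (newtonPoly F a d μ μ').eval z = z)
    (hu : IsUnit (1 + -(newtonPoly F a d μ μ').coeff 1)) : F.eval (a + μ * z) = 0 := by
  rw [newtonPoly, eval_sub, eval_mul, eval_C, eval_X, eval_taylor_comp_C_mul_X] at hz
  rw [coeff_newtonPoly, if_pos rfl] at hu
  have hd : IsUnit d := isUnit_of_mul_isUnit_left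
    (y := μ' * (μ ^ 1 * (hasseDeriv 1 F).eval a)) (by convert hu using 1; ring)
  have h : d * F.eval (a + μ * z) = 0 := by
    linear_combination -μ * hz - d * F.eval (a + μ * z) * hμ
  rwa [hd.mul_right_eq_zero] at h

/-- The polynomial `e₀ G(a + μ z) - 1`. -/
def unitPoly (G : B[X]) (a e₀ μ : B) : B[X] := C e₀ * (taylor a G).comp (C μ * X) - 1

theorem coeff_unitPoly (G : B[X]) (a e₀ μ : B) (k : ℕ) : (unitPoly G a e₀ μ).coeff k =
    e₀ * (μ ^ k * (hasseDeriv k G).eval a) - if k = 0 then 1 else 0 := by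
  rw [unitPoly, coeff_sub, coeff_C_mul, coeff_taylor_comp_C_mul_X, coeff_one]

theorem isUnit_eval_of_unitPoly {G : B[X]} {a e₀ μ z : B}
    (hu : IsUnit (1 + (unitPoly G a e₀ μ).eval z)) : IsUnit (G.eval (a + μ * z)) := by
  rw [unitPoly, eval_sub, eval_mul, eval_C, eval_one, eval_taylor_comp_C_mul_X] at hu
  exact isUnit_of_mul_isUnit_right (x := e₀) (by convert hu using 1; ring)

theorem map_newtonPoly {B' : Type*} [CommRing B'] (f : B →+* B') (F : B[X]) (a d μ μ' : B) :
    (newtonPoly F a d μ μ').map f = newtonPoly (F.map f) (f a) (f d) (f μ) (f μ') := by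
  simp [newtonPoly, Polynomial.map_comp, map_taylor]

theorem map_unitPoly {B' : Type*} [CommRing B'] (f : B →+* B') (G : B[X]) (a e₀ μ : B) :
    (unitPoly G a e₀ μ).map f = unitPoly (G.map f) (f a) (f e₀) (f μ) := by
  simp [unitPoly, Polynomial.map_comp, map_taylor]

end Newton

open Laurent Polynomial

variable {N : Type u} [NormedField N] [IsUltrametricDist N] [CompleteSpace N]
  {κ : Type*} [Field κ] (R : Reduction N κ)

section

variable {K : Type u} [NormedField K] {r : Radius K}

/-- Only finitely many coefficients are nonzero, so one inner radius serves them all. -/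
theorem exists_small_of_vanish (hcof : ∀ x : ℝ, x < 1 → ∃ b : Radius K, x < b.1) {e : ℕ} [NeZero e]
    (Q : (integral N (r.halfOpen.root e))[X]) (hQ : ∀ k, Vanish 1 (R.res (Q.coeff k))) :
    ∃ b : Radius K, ∀ k (ρ : ℝ), 0 < ρ → b.1 ≤ ρ ^ e → ρ ^ e < 1 →
      ∃ c : ℝ, 0 ≤ c ∧ c < 1 ∧ GaussLE ρ c (Q.coeff k).1 := by
  choose b hb using fun k => small_of_vanish R hcof (Q.coeff k) (hQ k)
  obtain ⟨b₀, hb₀⟩ : ∃ b₀, ∀ k ∈ Q.support, b k ≤ b₀ := by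
    rcases Q.support.eq_empty_or_nonempty with he | hne
    · exact ⟨r, by simp [he]⟩
    · exact ⟨Q.support.sup' hne b, fun k hk => Finset.le_sup' b hk⟩
  refine ⟨b₀, fun k ρ hρ h1 h2 => ?_⟩
  by_cases hk : k ∈ Q.support
  · exact hb k ρ hρ (le_trans (hb₀ k hk) h1) h2
  · rw [notMem_support_iff.1 hk]
    exact ⟨0, le_rfl, one_pos, gaussLE_zero le_rfl⟩

end

variable {K : Type u} [NormedField K] [IsUltrametricDist K] [CompleteSpace K] [NormedAlgebra K N]
  {r : Radius K}

/-- Newton approximation: an approximate solution of the equations of a standard étale algebra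
lifts to a solution near the outer boundary. -/
theorem exists_coverPoint_of_newton (hcof : ∀ x : ℝ, x < 1 → ∃ b : Radius K, x < b.1)
    (Y : Ramification N) (P : StandardEtalePair (IntFunc r))
    (a d e₀ μ μ' : integral N (r.halfOpen.root Y.e)) (hμ : μ * μ' = 1)
    (hF : ∀ k, Vanish 1 ((newtonPoly (P.f.map (R.res.comp Y.pullInt)) (R.res a) (R.res d) (R.res μ)
      (R.res μ')).coeff k))
    (hG : ∀ k, Vanish 1 ((unitPoly (P.g.map (R.res.comp Y.pullInt)) (R.res a) (R.res e₀)
      (R.res μ)).coeff k)) :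
    ∃ b : Radius K, Nonempty (CoverPoint r P.Ring Y b) := by
  set Q := newtonPoly (P.f.map (Y.pullInt (N := N))) a d μ μ' with hQ
  set Q₂ := unitPoly (P.g.map (Y.pullInt (N := N))) a e₀ μ with hQ₂
  obtain ⟨b₁, hb₁⟩ := exists_small_of_vanish R hcof Q fun k => by
    rw [← Polynomial.coeff_map, hQ, map_newtonPoly, Polynomial.map_map]; exact hF k
  obtain ⟨b₂, hb₂⟩ := exists_small_of_vanish R hcof Q₂ fun k => by
    rw [← Polynomial.coeff_map, hQ₂, map_unitPoly, Polynomial.map_map]; exact hG k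
  let b := max r (max b₁ b₂)
  have hrb : r ≤ b := le_max_left _ _
  let η : integral N (r.halfOpen.root Y.e) →+* Laurent N (b.halfOpen.root Y.e) :=
    (restrict (Radii.root_subset (Radius.halfOpen_subset hrb))).toRingHom.comp
      (Subring.subtype _)
  have hsm : ∀ k, Small ((Q.map η).coeff k) := fun k ρ hρ => by
    rw [Polynomial.coeff_map]
    exact hb₁ k ρ hρ.1 (le_trans ((le_max_left b₁ b₂).trans (le_max_right r _)) hρ.2.1) hρ.2.2
  have hsm₂ : ∀ k, Small ((Q₂.map η).coeff k) := fun k ρ hρ => by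
    rw [Polynomial.coeff_map]
    exact hb₂ k ρ hρ.1 (le_trans ((le_max_right b₁ b₂).trans (le_max_right r _)) hρ.2.1) hρ.2.2
  -- A contraction constant for each radius is enough; none uniform up to the outer boundary is
  -- required.
  obtain ⟨z, hz1, hz⟩ := exists_eval_eq_self _ hsm
  have h1 := isUnit_one_add (hsm 1).neg
  have h2 := isUnit_one_add (Small.eval hsm₂ hz1)
  rw [hQ, map_newtonPoly] at hz h1
  rw [hQ₂, map_unitPoly] at h2
  have e1 := eval_eq_zero_of_newtonPoly (by rw [← map_mul, hμ, map_one]) hz h1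
  have e2 := isUnit_eval_of_unitPoly h2
  let _ : Algebra (IntFunc r) (Laurent N (b.halfOpen.root Y.e)) :=
    (η.comp (Y.pullInt (N := N))).toAlgebra
  have hmap : P.HasMap (η a + η μ * z) := by
    refine ⟨?_, ?_⟩
    · rw [aeval_def, ← eval_map, ← e1, Polynomial.map_map]; rfl
    · rw [aeval_def, ← eval_map]
      rwa [Polynomial.map_map] at e2
  refine ⟨b, ⟨⟨hrb, (P.lift _ hmap).toRingHom, fun c => ?_⟩⟩⟩
  refine ((P.lift _ hmap).commutes c).trans ?_
  exact Y.restrict_pull (Radius.halfOpen_subset hrb) c.1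

end

end PadicDE

/-! ### A point of the reduced cover over `κ((u))` -/

namespace PadicDE

noncomputable section

namespace Laurent

variable {K : Type u} [NormedField K] [IsUltrametricDist K] {I : Radii}

/-- The last coefficient at which the Gauss norm is attained. -/
theorem exists_dominant {ρ : ℝ} (hρ : ρ ∈ I.carrier) {f : Laurent K I} (hf : f ≠ 0) :
    ∃ i₀, f.coeff i₀ ≠ 0 ∧ (∀ i, ‖f.coeff i‖ * ρ ^ i ≤ ‖f.coeff i₀‖ * ρ ^ i₀) ∧
      ∀ i, i₀ < i → ‖f.coeff i‖ * ρ ^ i < ‖f.coeff i₀‖ * ρ ^ i₀ := by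
  have hρ0 := I.pos ρ hρ
  obtain ⟨k, hk⟩ : ∃ k, f.coeff k ≠ 0 := by
    by_contra! h
    exact hf (Laurent.ext (funext h))
  have hk0 : 0 < ‖f.coeff k‖ * ρ ^ k := mul_pos (norm_pos_iff.2 hk) (by positivity)
  have hfin : {i | ‖f.coeff k‖ * ρ ^ k ≤ ‖f.coeff i‖ * ρ ^ i}.Finite := by
    have h := (f.tendsto' ρ hρ).eventually (gt_mem_nhds hk0)
    rw [Filter.eventually_cofinite] at h
    simpa only [not_lt] using h
  obtain ⟨i₁, hi₁, hmax⟩ := hfin.toFinset.exists_max_image (fun i => ‖f.coeff i‖ * ρ ^ i)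
    ⟨k, by simp⟩
  rw [Set.Finite.mem_toFinset, Set.mem_ofPred_eq] at hi₁
  have hall : ∀ i, ‖f.coeff i‖ * ρ ^ i ≤ ‖f.coeff i₁‖ * ρ ^ i₁ := fun i => by
    by_cases hi : ‖f.coeff k‖ * ρ ^ k ≤ ‖f.coeff i‖ * ρ ^ i
    · exact hmax i (by simpa using hi)
    · exact (not_le.1 hi).le.trans hi₁
  have hfin' : {i | ‖f.coeff i₁‖ * ρ ^ i₁ ≤ ‖f.coeff i‖ * ρ ^ i}.Finite :=
    hfin.subset fun i hi => hi₁.trans hi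
  obtain ⟨i₀, hi₀, hlast⟩ := hfin'.toFinset.exists_max_image id ⟨i₁, by simp⟩
  rw [Set.Finite.mem_toFinset, Set.mem_ofPred_eq] at hi₀
  refine ⟨i₀, fun h0 => ?_, fun i => (hall i).trans hi₀, fun i hi => ?_⟩
  · rw [h0, norm_zero, zero_mul] at hi₀
    exact absurd (hk0.trans_le hi₁) (not_lt.2 hi₀)
  · refine lt_of_lt_of_le ?_ hi₀
    by_contra h
    exact absurd (hlast i (by simpa using not_lt.1 h)) (not_le.2 hi)

/-- At a fixed radius let `i₀`, `j₀` be the last indices at which the Gauss norms of `f` and `g` are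
attained. In the coefficient of `f g` of index `i₀ + j₀` the term with `i = i₀` strictly dominates.
The ring of integral functions is thus a domain, which is used to see that the cover is faithfully
flat. -/
instance [CompleteSpace K] : NoZeroDivisors (Laurent K I) where
  eq_zero_or_eq_zero_of_mul_eq_zero {f g} h := by
    by_contra! hfg
    obtain ⟨ρ, hρ⟩ := I.nonempty
    have hρ0 := I.pos ρ hρ
    obtain ⟨i₀, hf0, hf1, hf2⟩ := exists_dominant hρ hfg.1
    obtain ⟨j₀, hg0, hg1, hg2⟩ := exists_dominant hρ hfg.2
    set a : ℤ → K := fun i => f.coeff i * g.coeff (i₀ + j₀ - i) / (f.coeff i₀ * g.coeff j₀)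
    have hs : Summable a := (summable_mul f g (i₀ + j₀)).div_const _
    have h0 : ∑' i, a i = 0 := by
      rw [tsum_div_const, ← coeff_mul, h, coeff_zero, zero_div]
    have h1 : a i₀ = 1 := by
      simp only [a, add_sub_cancel_left]
      exact div_self (mul_ne_zero hf0 hg0)
    have hlt : ∀ i ≠ i₀, ‖a i‖ < 1 := fun i hi => by
      have hpos : 0 < ‖f.coeff i₀‖ * ‖g.coeff j₀‖ :=
        mul_pos (norm_pos_iff.2 hf0) (norm_pos_iff.2 hg0)
      have e : ‖f.coeff i‖ * ‖g.coeff (i₀ + j₀ - i)‖ * ρ ^ (i₀ + j₀) =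
          (‖f.coeff i‖ * ρ ^ i) * (‖g.coeff (i₀ + j₀ - i)‖ * ρ ^ (i₀ + j₀ - i)) := by
        rw [show ρ ^ (i₀ + j₀) = ρ ^ i * ρ ^ (i₀ + j₀ - i) by
          rw [← zpow_add₀ hρ0.ne']; congr 1; ring]
        ring
      have e' : ‖f.coeff i₀‖ * ‖g.coeff j₀‖ * ρ ^ (i₀ + j₀) =
          (‖f.coeff i₀‖ * ρ ^ i₀) * (‖g.coeff j₀‖ * ρ ^ j₀) := by
        rw [zpow_add₀ hρ0.ne']; ring
      have hF : 0 < ‖f.coeff i₀‖ * ρ ^ i₀ := mul_pos (norm_pos_iff.2 hf0) (by positivity)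
      have hG : 0 < ‖g.coeff j₀‖ * ρ ^ j₀ := mul_pos (norm_pos_iff.2 hg0) (by positivity)
      rw [norm_div, norm_mul, norm_mul, div_lt_one hpos]
      refine lt_of_mul_lt_mul_right (a := ρ ^ (i₀ + j₀)) ?_ (by positivity)
      rw [e, e']
      rcases lt_or_gt_of_ne hi with hi | hi
      · exact mul_lt_mul' (hf1 i) (hg2 _ (by omega)) (by positivity) hF
      · exact (mul_le_mul_of_nonneg_left (hg1 _) (by positivity)).trans_lt
          (mul_lt_mul_of_pos_right (hf2 i hi) hG)
    have h2 : ‖∑' i, (a i - if i = i₀ then 1 else 0)‖ < 1 := by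
      refine Reduction.norm_tsum_lt_one (hs.sub (hasSum_ite_eq i₀ (1 : K)).summable) fun i => ?_
      by_cases hi : i = i₀
      · rw [hi, h1, if_pos rfl, sub_self, norm_zero]; exact one_pos
      · rw [if_neg hi, sub_zero]; exact hlt i hi
    rw [hs.tsum_sub (hasSum_ite_eq i₀ (1 : K)).summable, h0, tsum_ite_eq, zero_sub, norm_neg,
      norm_one] at h2
    exact lt_irrefl _ h2

instance : Nontrivial (Laurent K I) where
  exists_pair_ne := ⟨0, 1, fun h => zero_ne_one (congrFun (congrArg coeff h) 0)⟩

end Laurent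

theorem exists_eq_ofPowerSeries {κ : Type*} [Field κ] {x : LaurentSeries κ} (hx : Vanish 0 x) :
    ∃ f : PowerSeries κ, x = HahnSeries.ofPowerSeries ℤ κ f := by
  refine ⟨PowerSeries.mk fun n => x.coeff n, ?_⟩
  ext i
  rw [PowerSeries.coeff_coe]
  split_ifs with hi
  · exact hx i hi
  · rw [PowerSeries.coeff_mk, Int.natAbs_of_nonneg (not_lt.1 hi)]

theorem single_one_zpow {κ : Type*} [Field κ] (n : ℤ) :
    (HahnSeries.single 1 1 : LaurentSeries κ) ^ n = HahnSeries.single n 1 :=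
  (RatFunc.single_zpow n).symm

theorem vanish_zpow_uniformizer {κ : Type*} [Field κ] (e : ℕ) (w : (PowerSeries κ)ˣ) (m : ℤ) :
    Vanish (e * m) ((HahnSeries.ofPowerSeries ℤ κ (PowerSeries.X ^ e * (w : PowerSeries κ))) ^ m) := by
  have h : (HahnSeries.ofPowerSeries ℤ κ (w : PowerSeries κ)) ^ m =
      HahnSeries.ofPowerSeries ℤ κ ((w ^ m : (PowerSeries κ)ˣ) : PowerSeries κ) := by
    have := congrArg Units.val (map_zpow (Units.map (HahnSeries.ofPowerSeries ℤ κ).toMonoidHom) w m)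
    rw [Units.val_zpow_eq_zpow_val] at this
    exact this.symm
  rw [map_mul, mul_zpow, h, map_pow, HahnSeries.ofPowerSeries_X, ← zpow_natCast, ← zpow_mul,
    single_one_zpow]
  simpa using (vanish_single (e * m : ℤ) (1 : κ)).mul (vanish_ofPowerSeries _)

/-- A homomorphism from `κ((t))` to `κ((u))` behaves like the substitution `t ↦ u^e w`. -/
def IsSubstitution {κ : Type*} [Field κ] (σ : LaurentSeries κ →+* LaurentSeries κ) (e : ℕ)
    (w : (PowerSeries κ)ˣ) : Prop :=
  ∀ (f : LaurentSeries κ) (i₀ m : ℤ), Vanish i₀ f → Vanish (e * m)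
    (σ f - ∑ i ∈ Finset.Ico i₀ m, HahnSeries.C (f.coeff i) *
      (HahnSeries.ofPowerSeries ℤ κ (PowerSeries.X ^ e * (w : PowerSeries κ))) ^ i)

/-- On a truncation, `σ` is computed from its values on constants and on `t`. The remainder is `t^m`
times a power series, sent to `τ^m` times a power series, which has order at least `e m`. No
continuity of `σ` is assumed. -/
theorem isSubstitution_of_powerSeries {κ : Type*} [Field κ]
    (σ : LaurentSeries κ →+* LaurentSeries κ) (E : PowerSeries κ →+* PowerSeries κ) {e : ℕ}
    {w : (PowerSeries κ)ˣ} (hX : E PowerSeries.X = PowerSeries.X ^ e * (w : PowerSeries κ))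
    (hC : ∀ c : κ, E (PowerSeries.C c) = PowerSeries.C c)
    (hσ : ∀ f : PowerSeries κ, σ (HahnSeries.ofPowerSeries ℤ κ f) =
      HahnSeries.ofPowerSeries ℤ κ (E f)) : IsSubstitution σ e w := by
  intro f i₀ m hf
  set T : LaurentSeries κ := HahnSeries.single 1 1 with hT
  set τ := HahnSeries.ofPowerSeries ℤ κ (PowerSeries.X ^ e * (w : PowerSeries κ)) with hτ
  have hT1 : σ T = τ := by
    rw [hT, ← HahnSeries.ofPowerSeries_X, hσ, hX]
  have hTm : ∀ n : ℤ, T ^ n = HahnSeries.single n 1 := fun n => by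
    rw [hT, single_one_zpow]
  have hσC : ∀ c : κ, σ (HahnSeries.C c) = HahnSeries.C c := fun c => by
    rw [← HahnSeries.ofPowerSeries_C, hσ, hC]
  have h1 : Vanish m (f - ∑ i ∈ Finset.Ico i₀ m, HahnSeries.C (f.coeff i) * T ^ i) := by
    intro n hn
    rw [HahnSeries.coeff_sub, HahnSeries.coeff_sum]
    have : ∀ i ∈ Finset.Ico i₀ m, (HahnSeries.C (f.coeff i) * T ^ i).coeff n =
        if i = n then f.coeff n else 0 := fun i _ => by
      rw [hTm, HahnSeries.C_apply, HahnSeries.single_mul_single, zero_add, mul_one]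
      split_ifs with h
      · rw [h, HahnSeries.coeff_single_same]
      · rw [HahnSeries.coeff_single_of_ne (Ne.symm h)]
    rw [Finset.sum_congr rfl this, Finset.sum_ite_eq']
    split_ifs with h
    · exact sub_self _
    · rw [sub_zero]
      refine hf n ?_
      rw [Finset.mem_Ico] at h
      omega
  obtain ⟨g, hg⟩ := exists_eq_ofPowerSeries (x := T ^ (-m) *
      (f - ∑ i ∈ Finset.Ico i₀ m, HahnSeries.C (f.coeff i) * T ^ i)) (by
    have := (vanish_single (-m) (1 : κ)).mul h1
    rwa [← hTm, neg_add_cancel] at this)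
  have hT0 : T ≠ 0 := by rw [hT]; exact HahnSeries.single_ne_zero one_ne_zero
  have h2 : f - ∑ i ∈ Finset.Ico i₀ m, HahnSeries.C (f.coeff i) * T ^ i =
      T ^ m * HahnSeries.ofPowerSeries ℤ κ g := by
    rw [← hg, ← mul_assoc, ← zpow_add₀ hT0, add_neg_cancel, zpow_zero, one_mul]
  have h3 := congrArg σ h2
  simp only [map_sub, map_sum, map_mul, map_zpow₀, hT1, hσC, hσ] at h3
  rw [h3]
  have := (vanish_zpow_uniformizer e w m).mul (vanish_ofPowerSeries (E g))
  rwa [add_zero] at this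

theorem exists_isSubstitution {κ : Type*} [Field κ] [IsAlgClosed κ] (L : Type*) [Field L]
    [Algebra (LaurentSeries κ) L] [FiniteDimensional (LaurentSeries κ) L]
    [Algebra.IsSeparable (LaurentSeries κ) L] :
    ∃ (ψ : L →+* LaurentSeries κ) (e : ℕ) (w : (PowerSeries κ)ˣ), e ≠ 0 ∧
      IsSubstitution (ψ.comp (algebraMap (LaurentSeries κ) L)) e w := by
  let _ : Algebra (PowerSeries κ) L := ((algebraMap (LaurentSeries κ) L).comp
    (algebraMap (PowerSeries κ) (LaurentSeries κ))).toAlgebra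
  have : IsScalarTower (PowerSeries κ) (LaurentSeries κ) L := IsScalarTower.of_algebraMap_eq' rfl
  obtain ⟨ψ, E, e, w, he, hX, hC, hψ⟩ := exists_uniformization (κ := κ) L
  exact ⟨ψ, e, w, he, isSubstitution_of_powerSeries _ E hX hC hψ⟩

open Polynomial in
/-- A nonempty finite étale cover acquires a point over `κ((u))`, in a standard étale
neighbourhood of which the cover is given by a polynomial. -/
theorem exists_residue_point {R S κ : Type u} [CommRing R] [IsDomain R] [CommRing S] [Algebra R S]
    [Algebra.Etale R S] [Module.Finite R S] [Nontrivial S] [Field κ] [IsAlgClosed κ]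
    (φ : R →+* LaurentSeries κ) :
    ∃ (P : StandardEtalePair R) (_ : S →ₐ[R] P.Ring) (σ : LaurentSeries κ →+* LaurentSeries κ)
      (e : ℕ) (w : (PowerSeries κ)ˣ) (x : LaurentSeries κ), e ≠ 0 ∧ IsSubstitution σ e w ∧
      P.f.eval₂ (σ.comp φ) x = 0 ∧ P.f.derivative.eval₂ (σ.comp φ) x ≠ 0 ∧
      P.g.eval₂ (σ.comp φ) x ≠ 0 := by
  let _ : Algebra R (LaurentSeries κ) := φ.toAlgebra
  -- `R → S` is injective and integral, so surjective on spectra, and `S` is faithfully flat. Its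
  -- base change `A` to the field of Laurent series is therefore not zero and has a maximal ideal.
  have : Module.Flat R S := inferInstance
  have : FaithfulSMul R S := inferInstance
  have : Module.FaithfullyFlat R S :=
    Module.FaithfullyFlat.of_comap_surjective (Algebra.IsIntegral.comap_surjective R S)
  let A := LaurentSeries κ ⊗[R] S
  obtain ⟨p, hp⟩ := Ideal.exists_maximal A
  let _ : Field (A ⧸ p) := Ideal.Quotient.field p
  have : Algebra.FormallyUnramified (LaurentSeries κ) (A ⧸ p) :=
    Algebra.FormallyUnramified.of_surjective (Ideal.Quotient.mkₐ (LaurentSeries κ) p)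
      Ideal.Quotient.mk_surjective
  have : Module.Finite (LaurentSeries κ) (A ⧸ p) := inferInstance
  have : Algebra.IsSeparable (LaurentSeries κ) (A ⧸ p) :=
    Algebra.FormallyUnramified.isSeparable _ _
  obtain ⟨ψ, e, w, he, hσ⟩ := exists_isSubstitution (κ := κ) (A ⧸ p)
  set σ := ψ.comp (algebraMap (LaurentSeries κ) (A ⧸ p)) with hσ'
  let h : S →+* LaurentSeries κ := (ψ.comp (Ideal.Quotient.mk p)).comp
    (Algebra.TensorProduct.includeRight : S →ₐ[R] A).toRingHom
  have hh : ∀ a, h (algebraMap R S a) = σ (φ a) := fun a => by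
    show ψ (Ideal.Quotient.mk p (Algebra.TensorProduct.includeRight (algebraMap R S a))) = _
    rw [AlgHom.commutes]
    rfl
  have : (RingHom.ker h).IsPrime := RingHom.ker_isPrime h
  -- Near a prime an étale algebra is standard étale; since `f` lies outside the kernel of `h`, the
  -- point survives the localization and is given by a root of one polynomial.
  obtain ⟨f, hf, hst⟩ := Algebra.IsEtaleAt.exists_isStandardEtale (R := R) (RingHom.ker h)
  obtain ⟨⟨P⟩⟩ := hst
  let h' : Localization.Away f →+* LaurentSeries κ := IsLocalization.Away.lift f
    (g := h) (isUnit_iff_ne_zero.2 fun h0 => hf h0)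
  let _ : Algebra R (LaurentSeries κ) := (σ.comp φ).toAlgebra
  let h'' : Localization.Away f →ₐ[R] LaurentSeries κ :=
    { h' with
      commutes' := fun a => by
        show h' _ = σ (φ a)
        rw [← hh, IsScalarTower.algebraMap_apply R S (Localization.Away f)]
        exact IsLocalization.Away.lift_eq f _ _ }
  have hm := P.hasMap.map h''
  exact ⟨P.P, (P.equivRing.toAlgHom).comp (IsScalarTower.toAlgHom R S _), σ, e, w, h'' P.x, he, hσ,
    hm.1, hm.isUnit_derivative_f.ne_zero, hm.2.ne_zero⟩

end

end PadicDE

/-! ### Residue fields and finite extensions realizing given residues -/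

namespace PadicDE

noncomputable section

section ResidueField

variable (Ω : Type u) [NormedField Ω] [IsUltrametricDist Ω]

/-- The residue field of an ultrametric normed field. -/
abbrev ResField : Type u := IsLocalRing.ResidueField (IntRing Ω)

-- A monic polynomial over the residue field lifts to a monic one over the valuation ring. A root of
-- the lift is integral, hence lies in the valuation ring, and it reduces to a root.
open Polynomial in
instance [IsAlgClosed Ω] : IsAlgClosed (ResField Ω) := by
  refine IsAlgClosed.of_exists_root _ fun p hp hirr => ?_
  have hl : p ∈ lifts (IsLocalRing.residue (IntRing Ω)) :=
    (lifts_iff_coeff_lifts _).2 fun n => IsLocalRing.residue_surjective _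
  obtain ⟨q, hq, hdeg, hmon⟩ := lifts_and_degree_eq_and_monic hl hp
  have hd : (q.map (algebraMap (IntRing Ω) Ω)).degree ≠ 0 := by
    rw [hmon.degree_map, hdeg]
    exact (degree_pos_of_irreducible hirr).ne'
  obtain ⟨x, hx⟩ := IsAlgClosed.exists_root _ hd
  have hint : IsIntegral (IntRing Ω) x := ⟨q, hmon, by rwa [← eval_map]⟩
  obtain ⟨y, rfl⟩ := IsIntegrallyClosed.isIntegral_iff.1 hint
  refine ⟨IsLocalRing.residue _ y, ?_⟩
  rw [← hq, eval_map, eval₂_hom]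
  rw [IsRoot, eval_map, eval₂_hom] at hx
  rw [(FaithfulSMul.algebraMap_injective (IntRing Ω) Ω) (hx.trans (map_zero _).symm), map_zero]

theorem residue_eq_zero {x : IntRing Ω} (hx : ‖(x : Ω)‖ < 1) :
    IsLocalRing.residue (IntRing Ω) x = 0 := by
  rw [IsLocalRing.residue_eq_zero_iff, IsLocalRing.mem_maximalIdeal, mem_nonunits_iff]
  intro h
  have := IntRing.norm_unit h.unit
  rw [IsUnit.unit_spec] at this
  exact hx.ne this

end ResidueField

/-- The inclusion of valuation rings induced by an isometric embedding of fields. -/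
def intRingMap {K L : Type u} [NormedField K] [IsUltrametricDist K] [NormedField L]
    [IsUltrametricDist L] (f : K →+* L) (hf : ∀ x, ‖f x‖ = ‖x‖) : IntRing K →+* IntRing L where
  toFun x := ⟨f x, by
    show ‖f x‖ ≤ 1
    rw [hf]; exact IntRing.norm_le x⟩
  map_one' := Subtype.ext (map_one f)
  map_zero' := Subtype.ext (map_zero f)
  map_add' x y := Subtype.ext (map_add f (x : K) y)
  map_mul' x y := Subtype.ext (map_mul f (x : K) y)

/-- The reduction map induced by an isometric embedding in a field. -/
def Reduction.ofEmbedding {K L : Type u} [NormedField K] [IsUltrametricDist K] [NormedField L]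
    [IsUltrametricDist L] (f : K →+* L) (hf : ∀ x, ‖f x‖ = ‖x‖) : Reduction K (ResField L) where
  red := (IsLocalRing.residue (IntRing L)).comp (intRingMap f hf)
  red_eq_zero x hx := residue_eq_zero L (by
    show ‖f x‖ < 1
    rwa [hf])

/-- Any finite set of residues is realized in some complete extension of `K` over which `K`-linear
algebra is bounded. -/
def HasFiniteModels {K : Type u} [NormedField K] [IsUltrametricDist K] [CompleteSpace K]
    {κ : Type*} [Field κ] (redK : Reduction K κ) : Prop :=
  ∀ T : Finset κ, ∃ (N : Type u) (_ : NormedField N) (_ : IsUltrametricDist N)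
    (_ : CompleteSpace N) (_ : NormedAlgebra K N) (R : Reduction N κ) (n : ℕ),
    Nonempty (BoundedBasis N K (Fin n)) ∧
    (∀ (x : IntRing K) (y : IntRing N), (y : N) = algebraMap K N x → R.red y = redK.red x) ∧
    ∀ c ∈ T, ∃ x, R.red x = c

theorem exists_boundedBasis {K : Type u} [NontriviallyNormedField K] [IsUltrametricDist K]
    [CompleteSpace K] {N : Type u} [NormedField N] [IsUltrametricDist N] [CompleteSpace N]
    [NormedAlgebra K N] [FiniteDimensional K N] :
    ∃ n : ℕ, Nonempty (BoundedBasis N K (Fin n)) := by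
  let b := Module.finBasis K N
  refine ⟨_, ⟨⟨b, fun i => ⟨b.coord i, ?_⟩, fun x => b.sum_repr x⟩⟩⟩
  let g : N →L[K] K := LinearMap.toContinuousLinearMap (b.coord i)
  exact ⟨‖g‖ + 1, by positivity, fun x => (g.le_opNorm x).trans
    (mul_le_mul_of_nonneg_right (by linarith) (norm_nonneg x))⟩

/-- Descent by traces needs an extension that is complete and finite over `K`, which `Ω` need not
be. Adjoining lifts of the finitely many residues in question gives one, with the same residue field
`κ` as target of the reduction. -/
theorem hasFiniteModels_of_isAlgebraic {K : Type u} [NontriviallyNormedField K]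
    [IsUltrametricDist K] [CompleteSpace K] {Ω : Type u} [NormedField Ω] [IsUltrametricDist Ω]
    [NormedAlgebra K Ω] [Algebra.IsAlgebraic K Ω] :
    HasFiniteModels (Reduction.ofEmbedding (algebraMap K Ω) (norm_algebraMap' Ω)) := by
  classical
  intro T
  choose l hl using IsLocalRing.residue_surjective (R := IntRing Ω)
  let S : Finset Ω := T.image fun c => (l c : Ω)
  let F := IntermediateField.adjoin K (S : Set Ω)
  have hfin : FiniteDimensional K F := IntermediateField.finiteDimensional_adjoin fun x _ =>
    (Algebra.IsAlgebraic.isAlgebraic x).isIntegral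
  have : IsUltrametricDist F := ⟨fun x y z => IsUltrametricDist.dist_triangle_max (x : Ω) y z⟩
  let _ : NormedAlgebra K F :=
    { (inferInstance : Algebra K F) with
      norm_smul_le := fun c x => norm_smul_le c (x : Ω) }
  have : CompleteSpace F := FiniteDimensional.complete K F
  obtain ⟨n, hn⟩ := exists_boundedBasis (K := K) (N := F)
  refine ⟨F, inferInstance, inferInstance, inferInstance, inferInstance,
    Reduction.ofEmbedding (algebraMap F Ω) (fun _ => rfl), n, hn, fun x y hxy => ?_, fun c hc => ?_⟩
  · refine congrArg (IsLocalRing.residue (IntRing Ω)) (Subtype.ext ?_)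
    exact congrArg (algebraMap F Ω) hxy
  · have hmem : (l c : Ω) ∈ F := IntermediateField.subset_adjoin K _
      (by simpa [S] using ⟨c, hc, rfl⟩)
    refine ⟨⟨⟨l c, hmem⟩, IntRing.norm_le (l c)⟩, ?_⟩
    exact hl c

/-- A complete nontrivially normed field of characteristic zero has a reduction to an algebraically
closed field with enough finite models. -/
theorem exists_hasFiniteModels (K : Type u) [NormedField K] [IsUltrametricDist K] [CompleteSpace K]
    (hK : ∃ x : K, x ≠ 0 ∧ ‖x‖ ≠ 1) :
    ∃ (κ : Type u) (_ : Field κ) (_ : IsAlgClosed κ) (redK : Reduction K κ),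
      HasFiniteModels redK := by
  let _ : NontriviallyNormedField K := NontriviallyNormedField.ofNormNeOne hK
  let Ω := AlgebraicClosure K
  let _ : NormedField Ω := spectralNorm.normedField K Ω
  let _ : NormedAlgebra K Ω := spectralNorm.normedAlgebra K Ω
  have : IsUltrametricDist Ω := IsUltrametricDist.isUltrametricDist_of_isNonarchimedean_norm
    isNonarchimedean_spectralNorm
  exact ⟨ResField Ω, inferInstance, inferInstance, _, hasFiniteModels_of_isAlgebraic⟩

/-- Integers are not too small in an extension of a `p`-adic field. -/
theorem one_le_natCast_mul_norm {p : ℕ} [Fact p.Prime] {N : Type u} [NormedField N]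
    [IsUltrametricDist N] (hp : ‖(p : N)‖ = (p : ℝ)⁻¹) (n : ℕ) (hn : n ≠ 0) :
    1 ≤ (n : ℝ) * ‖(n : N)‖ := by
  have hpp : p.Prime := Fact.out
  obtain ⟨k, m, hm, rfl⟩ := Nat.exists_eq_pow_mul_and_not_dvd hn p hpp.ne_one
  have hp0 : (0 : ℝ) < p := by exact_mod_cast hpp.pos
  have h1 : ‖(m : N)‖ = 1 := by
    refine le_antisymm (IsUltrametricDist.norm_natCast_le_one N m) ?_
    have hcop : IsCoprime (m : ℤ) (p : ℤ) :=
      Nat.isCoprime_iff_coprime.2 ((hpp.coprime_iff_not_dvd.2 hm).symm)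
    obtain ⟨a, b, hab⟩ := hcop
    have h2 : (a : N) * m + b * p = 1 := by exact_mod_cast congrArg (Int.cast : ℤ → N) hab
    by_contra hlt
    rw [not_le] at hlt
    have h3 : ‖(a : N) * m‖ < 1 := by
      rw [norm_mul]
      exact mul_lt_one_of_nonneg_of_lt_one_right (IsUltrametricDist.norm_intCast_le_one N a)
        (norm_nonneg _) hlt
    have h4 : ‖(b : N) * p‖ < 1 := by
      rw [norm_mul]
      refine mul_lt_one_of_nonneg_of_lt_one_right (IsUltrametricDist.norm_intCast_le_one N b)
        (norm_nonneg _) ?_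
      rw [hp]
      exact inv_lt_one_of_one_lt₀ (by exact_mod_cast hpp.one_lt)
    have h5 := (IsUltrametricDist.norm_add_le_max ((a : N) * m) (b * p)).trans_lt (max_lt h3 h4)
    rw [h2, norm_one] at h5
    exact lt_irrefl _ h5
  push_cast
  rw [norm_mul, norm_pow, hp, h1, mul_one, inv_pow, mul_right_comm,
    mul_inv_cancel₀ (by positivity), one_mul]
  have : m ≠ 0 := fun h => hm (h ▸ dvd_zero p)
  exact_mod_cast Nat.one_le_iff_ne_zero.2 this

end

end PadicDE

/-! ### Lifting formal series and stability of the Newton conditions -/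

namespace PadicDE

noncomputable section

open Laurent

section Lifts

variable {N : Type u} [NormedField N] [IsUltrametricDist N] [CompleteSpace N] {κ : Type*} [Field κ]
  (R : Reduction N κ)

/-- Finitely many coefficients of a formal Laurent series lift to an integral Laurent polynomial. -/
theorem Reduction.exists_lift {I : Radii} [I.InDisc] (s : Finset ℤ) (y : ℤ → κ)
    (h : ∀ i ∈ s, ∃ c, R.red c = y i) :
    ∃ a : integral N I, ∀ i, (R.res a).coeff i = if i ∈ s then y i else 0 := by
  classical
  choose c hc using h
  let f : Laurent N I := ∑ i : s, mono (c i.1 i.2 : N) i.1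
  have hf : ∀ j, f.coeff j = if h : j ∈ s then (c j h : N) else 0 := fun j => by
    rw [coeff_sum]
    simp only [coeff_mono, Pi.single_apply]
    split_ifs with h
    · rw [Finset.sum_eq_single (⟨j, h⟩ : s)]
      · rw [if_pos rfl]
      · exact fun b _ hb => if_neg fun e => hb (Subtype.ext e.symm)
      · exact fun h' => absurd (Finset.mem_univ _) h'
    · exact Finset.sum_eq_zero fun b _ => if_neg fun e => h (by rw [e]; exact b.2)
  have hint : ∀ j, ‖f.coeff j‖ ≤ 1 := fun j => by
    rw [hf]
    split_ifs with h
    · exact IntRing.norm_le _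
    · rw [norm_zero]; exact zero_le_one
  refine ⟨⟨f, hint⟩, fun i => ?_⟩
  rw [R.coeff_res]
  split_ifs with hi
  · rw [← hc i hi]
    exact congrArg R.red (Subtype.ext ((hf i).trans (dif_pos hi)))
  · rw [← map_zero R.red]
    exact congrArg R.red (Subtype.ext ((hf i).trans (dif_neg hi)))

/-- Formal Laurent series can be approximated by integral functions. -/
theorem Reduction.exists_lift_sub {I : Radii} [I.InDisc] (y : LaurentSeries κ) (M : ℤ)
    (h : ∀ i ∈ Finset.Ico (-M) M, ∃ c, R.red c = y.coeff i) :
    ∃ a : integral N I, Vanish (-M) y → Vanish M (R.res a - y) := by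
  obtain ⟨a, ha⟩ := R.exists_lift (I := I) _ _ h
  refine ⟨a, fun hy i hi => ?_⟩
  rw [HahnSeries.coeff_sub, sub_eq_zero, ha]
  split_ifs with h
  · rfl
  · rw [hy i]
    rw [Finset.mem_Ico] at h
    omega

/-- Power series with invertible constant term can be approximated by units. -/
theorem Reduction.exists_ramification {e : ℕ} (he : e ≠ 0) (w : (PowerSeries κ)ˣ) {M : ℕ}
    (hM : 0 < M) (h : ∀ i < M, ∃ c, R.red c = PowerSeries.coeff i (w : PowerSeries κ)) :
    ∃ Y : Ramification N, Y.e = e ∧ ∀ (I : Radii) [I.InDisc],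
      Vanish (e + M) (R.res (Y.powInt 1 : integral N I) -
        HahnSeries.ofPowerSeries ℤ κ (PowerSeries.X ^ e * (w : PowerSeries κ))) := by
  choose c hc using h
  have : NeZero e := ⟨he⟩
  let F : PowerSeries (IntRing N) := PowerSeries.mk fun i => if h : i < M then c i h else 0
  have hF : ∀ i (h : i < M), PowerSeries.coeff i F = c i h := fun i h => by
    rw [PowerSeries.coeff_mk, dif_pos h]
  -- The constant term of `F` reduces to that of `w`, which is not zero, so it has norm `1` and is
  -- invertible in the valuation ring.
  have hu : IsUnit F := by
    rw [PowerSeries.isUnit_iff_constantCoeff, ← PowerSeries.coeff_zero_eq_constantCoeff_apply,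
      hF 0 hM]
    have h1 : ¬ ‖(c 0 hM : N)‖ < 1 := fun hlt => by
      have h2 := R.red_eq_zero _ hlt
      rw [hc, PowerSeries.coeff_zero_eq_constantCoeff_apply] at h2
      exact ((PowerSeries.isUnit_iff_constantCoeff.1 w.isUnit).ne_zero) h2
    have h2 : ‖(c 0 hM : N)‖ = 1 := le_antisymm (IntRing.norm_le _) (not_lt.1 h1)
    have h3 : (c 0 hM : N) ≠ 0 := fun h => by rw [h, norm_zero] at h2; exact zero_ne_one h2
    have h4 : ‖(c 0 hM : N)⁻¹‖ ≤ 1 := by rw [norm_inv, h2, inv_one]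
    exact IsUnit.of_mul_eq_one ⟨_, h4⟩ (Subtype.ext (mul_inv_cancel₀ h3))
  refine ⟨⟨e, hu.unit⟩, rfl, fun I _ n hn => ?_⟩
  rw [HahnSeries.coeff_sub, sub_eq_zero, R.coeff_res, PowerSeries.coeff_coe]
  have e1 : ((Ramification.powInt ⟨e, hu.unit⟩ 1 : integral N I) : Laurent N I).coeff n =
      psCoeff F (n - e) := by
    show (Ramification.pow ⟨e, hu.unit⟩ 1 : Laurent N I).coeff n = _
    rw [Ramification.coeff_pow, zpow_one, mul_one]
    rfl
  have e2 : ∀ z : IntRing N, (z : N) = psCoeff F (n - e) →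
      R.red (intCoeff (Ramification.powInt ⟨e, hu.unit⟩ 1 : integral N I) n) = R.red z :=
    fun z hz => congrArg R.red (Subtype.ext (e1.trans hz.symm))
  rcases lt_or_ge n e with hne | hne
  · rw [e2 0 (psCoeff_of_neg F (by omega)).symm, map_zero]
    split_ifs with h0
    · rfl
    · rw [PowerSeries.coeff_X_pow_mul', if_neg (by omega)]
  · obtain ⟨k, rfl⟩ : ∃ k : ℕ, n = k + e := ⟨(n - e).toNat, by omega⟩
    have hk : k < M := by omega
    rw [e2 (c k hk) (by rw [add_sub_cancel_right, psCoeff_natCast, hF k hk]), hc,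
      if_neg (by omega), show ((k : ℤ) + e).natAbs = k + e by omega, PowerSeries.coeff_X_pow_mul]

theorem Reduction.res_mono {I : Radii} [I.InDisc] (n : ℤ) (a : integral N I)
    (ha : (a : Laurent N I) = mono 1 n) : R.res a = HahnSeries.single n 1 := by
  ext i
  rw [R.coeff_res, HahnSeries.coeff_single]
  split_ifs with h
  · rw [← map_one R.red]
    refine congrArg R.red (Subtype.ext ?_)
    show (a : Laurent N I).coeff i = 1
    rw [ha, coeff_mono, h, Pi.single_eq_same]
  · rw [← map_zero R.red]
    refine congrArg R.red (Subtype.ext ?_)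
    show (a : Laurent N I).coeff i = 0
    rw [ha, coeff_mono, Pi.single_eq_of_ne h]

end Lifts

section Limits

variable {κ : Type*} [Field κ]

open Polynomial

theorem eval_hasseDeriv_map {A B : Type*} [CommRing A] [CommRing B] (φ : A →+* B) (F : A[X]) (k : ℕ)
    (a : B) : (hasseDeriv k (F.map φ)).eval a = (hasseDeriv k F).eval₂ φ a := by
  rw [← eval_map]
  congr 1
  ext n
  simp [hasseDeriv_coeff]

theorem hasseDeriv_map_eq_zero {A B : Type*} [CommRing A] [CommRing B] (φ : A →+* B) (F : A[X])
    {k : ℕ} (hk : F.natDegree < k) : hasseDeriv k (F.map φ) = 0 :=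
  hasseDeriv_eq_zero_of_lt_natDegree _ _ (natDegree_map_le.trans_lt hk)

variable {A : Type*} [CommRing A] {φ : ℕ → A →+* LaurentSeries κ} {φ₀ : A →+* LaurentSeries κ}
  {a d : ℕ → LaurentSeries κ} {x y : LaurentSeries κ}


/-- Positive order is an open condition for the `u`-adic topology, and each coefficient depends
continuously on the data. In degrees above the degree of `F` and above `1` the coefficients vanish
identically, so finitely many conditions remain. -/
theorem eventually_vanish_newtonPoly (hφ : ∀ c, UConv (fun M => φ M c) (φ₀ c))
    (ha : UConv a x) (hd : UConv d y) (F : A[X]) (μ μ' : LaurentSeries κ)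
    (h : ∀ k, Vanish 1 ((newtonPoly (F.map φ₀) x y μ μ').coeff k)) :
    ∀ᶠ M in atTop, ∀ k, Vanish 1 ((newtonPoly (F.map (φ M)) (a M) (d M) μ μ').coeff k) := by
  have h1 : ∀ᶠ M in atTop, ∀ k ∈ Finset.range (F.natDegree + 2),
      Vanish 1 ((newtonPoly (F.map (φ M)) (a M) (d M) μ μ').coeff k) := by
    rw [Finset.eventually_all]
    intro k _
    refine UConv.eventually_vanish ?_ (h k)
    simp only [coeff_newtonPoly, eval_hasseDeriv_map]
    exact (uconv_const _).sub ((hd.mul (uconv_const _)).mul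
      ((uconv_const _).mul (UConv.eval hφ ha _)))
  filter_upwards [h1] with M hM k
  by_cases hk : k ∈ Finset.range (F.natDegree + 2)
  · exact hM k hk
  · rw [Finset.mem_range] at hk
    rw [coeff_newtonPoly, hasseDeriv_map_eq_zero _ _ (by omega), if_neg (by omega), eval_zero,
      mul_zero, mul_zero, sub_zero]
    exact vanish_zero _

theorem eventually_vanish_unitPoly (hφ : ∀ c, UConv (fun M => φ M c) (φ₀ c))
    (ha : UConv a x) (hd : UConv d y) (G : A[X]) (μ : LaurentSeries κ)
    (h : ∀ k, Vanish 1 ((unitPoly (G.map φ₀) x y μ).coeff k)) :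
    ∀ᶠ M in atTop, ∀ k, Vanish 1 ((unitPoly (G.map (φ M)) (a M) (d M) μ).coeff k) := by
  have h1 : ∀ᶠ M in atTop, ∀ k ∈ Finset.range (G.natDegree + 1),
      Vanish 1 ((unitPoly (G.map (φ M)) (a M) (d M) μ).coeff k) := by
    rw [Finset.eventually_all]
    intro k _
    refine UConv.eventually_vanish ?_ (h k)
    simp only [coeff_unitPoly, eval_hasseDeriv_map]
    exact (hd.mul ((uconv_const _).mul (UConv.eval hφ ha _))).sub (uconv_const _)
  filter_upwards [h1] with M hM k
  by_cases hk : k ∈ Finset.range (G.natDegree + 1)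
  · exact hM k hk
  · rw [Finset.mem_range] at hk
    rw [coeff_unitPoly, hasseDeriv_map_eq_zero _ _ (by omega), if_neg (by omega), eval_zero,
      mul_zero, mul_zero, sub_zero]
    exact vanish_zero _

end Limits

end

end PadicDE

/-! ### Existence of a point of the cover, and the conclusion -/

namespace PadicDE

noncomputable section

open Laurent Polynomial

section

variable {κ : Type*} [Field κ]

theorem exists_vanish_coeff (Q : (LaurentSeries κ)[X]) :
    ∃ n : ℕ, ∀ k, Vanish (-n) (Q.coeff k) := by
  choose b hb using fun k => exists_vanish (Q.coeff k)
  refine ⟨Q.support.sup fun k => (b k).natAbs, fun k => ?_⟩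
  by_cases hk : k ∈ Q.support
  · refine (hb k).mono ?_
    have : (b k).natAbs ≤ Q.support.sup fun k => (b k).natAbs :=
      Finset.le_sup (f := fun k => (b k).natAbs) hk
    omega
  · rw [notMem_support_iff.1 hk]
    exact vanish_zero _

theorem exists_vanish_nat (x : LaurentSeries κ) : ∃ n : ℕ, Vanish (-n) x := by
  obtain ⟨n, hn⟩ := exists_vanish x
  exact ⟨n.natAbs, hn.mono (by omega)⟩

theorem vanish_single_pow (m k : ℕ) :
    Vanish (k * m) ((HahnSeries.single (m : ℤ) (1 : κ) : LaurentSeries κ) ^ k) :=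
  (vanish_single _ _).pow k

/-- With `d = F'(x)⁻¹` the coefficients in degrees `0` and `1` vanish exactly. In degree `k ≥ 2` the
factor `μ' μ^k = u^((k-1)m)` outweighs the poles of `d` and of the Taylor coefficients, of order at
most `l` and `n`, as soon as `m > n + l`. -/
theorem exists_vanish_newtonPoly {F : (LaurentSeries κ)[X]} {x : LaurentSeries κ}
    (hF : F.eval x = 0) (hF' : F.derivative.eval x ≠ 0) :
    ∃ m₀ : ℕ, ∀ m : ℕ, m₀ ≤ m → ∀ k, Vanish 1 ((newtonPoly F x (F.derivative.eval x)⁻¹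
      (HahnSeries.single (m : ℤ) 1) (HahnSeries.single (-m : ℤ) 1)).coeff k) := by
  obtain ⟨n, hn⟩ := exists_vanish_coeff (taylor x F)
  obtain ⟨l, hl⟩ := exists_vanish_nat (F.derivative.eval x)⁻¹
  refine ⟨n + l + 1, fun m hm k => ?_⟩
  rw [coeff_newtonPoly]
  rcases k with _ | _ | k
  · simpa [hF] using vanish_zero 1
  · rw [if_pos rfl, zero_add, pow_one, hasseDeriv_one]
    have e : (HahnSeries.single (-m : ℤ) (1 : κ) : LaurentSeries κ) *
        HahnSeries.single (m : ℤ) 1 = 1 := by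
      rw [HahnSeries.single_mul_single, mul_one, neg_add_cancel]; rfl
    have : (1 : LaurentSeries κ) - (F.derivative.eval x)⁻¹ * HahnSeries.single (-m : ℤ) 1 *
        (HahnSeries.single (m : ℤ) 1 * F.derivative.eval x) = 0 := by
      have h1 := inv_mul_cancel₀ hF'
      linear_combination (-(F.derivative.eval x)⁻¹ * F.derivative.eval x) * e - h1
    rw [this]
    exact vanish_zero 1
  · rw [if_neg (by omega), zero_sub, ← taylor_coeff]
    refine ((hl.mul (vanish_single _ _)).mul ((vanish_single_pow m (k + 2)).mul (hn _))).neg.mono ?_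
    push_cast
    nlinarith

theorem exists_vanish_unitPoly {G : (LaurentSeries κ)[X]} {x : LaurentSeries κ}
    (hG : G.eval x ≠ 0) :
    ∃ m₀ : ℕ, ∀ m : ℕ, m₀ ≤ m → ∀ k, Vanish 1 ((unitPoly G x (G.eval x)⁻¹
      (HahnSeries.single (m : ℤ) 1)).coeff k) := by
  obtain ⟨n, hn⟩ := exists_vanish_coeff (taylor x G)
  obtain ⟨l, hl⟩ := exists_vanish_nat (G.eval x)⁻¹
  refine ⟨n + l + 1, fun m hm k => ?_⟩
  rw [coeff_unitPoly]
  rcases k with _ | k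
  · rw [pow_zero, one_mul, hasseDeriv_zero', inv_mul_cancel₀ hG, if_pos rfl, sub_self]
    exact vanish_zero 1
  · rw [if_neg (by omega), sub_zero, ← taylor_coeff]
    refine (hl.mul ((vanish_single_pow m (k + 1)).mul (hn _))).mono ?_
    push_cast
    nlinarith

/-- Approximate substitutions converge to a substitution. -/
theorem uconv_of_isSubstitution {A : Type*} [CommRing A] {φ : ℕ → A →+* LaurentSeries κ}
    {red : A →+* LaurentSeries κ} {τ : ℕ → LaurentSeries κ} {σ : LaurentSeries κ →+* LaurentSeries κ}
    {e : ℕ} (he : e ≠ 0) {w : (PowerSeries κ)ˣ} (hσ : IsSubstitution σ e w)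
    (hφ : ∀ M f (i₀ m : ℤ), Vanish i₀ (red f) → Vanish (e * m) (φ M f -
      ∑ i ∈ Finset.Ico i₀ m, HahnSeries.C ((red f).coeff i) * τ M ^ i))
    (hτ : UConv τ (HahnSeries.ofPowerSeries ℤ κ (PowerSeries.X ^ e * (w : PowerSeries κ))))
    (hτ0 : ∀ M, τ M ≠ 0 ∧ Vanish (-e) (τ M)⁻¹) (f : A) :
    UConv (fun M => φ M f) (σ.comp red f) := by
  have hτ' := UConv.inv hτ (by
    rw [map_ne_zero_iff _ HahnSeries.ofPowerSeries_injective]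
    exact mul_ne_zero (pow_ne_zero _ PowerSeries.X_ne_zero) w.ne_zero)
    (Eventually.of_forall hτ0)
  intro n
  obtain ⟨i₀, hi₀⟩ := exists_vanish (red f)
  -- Because `e ≥ 1`, both `φ M f` and its candidate limit agree up to order `n` with their
  -- truncations at degree `|n|`. The truncations are finite sums of powers of `τ M`, possibly
  -- negative ones, and these converge.
  have hs : UConv (fun M => ∑ i ∈ Finset.Ico i₀ (n.natAbs : ℤ),
      HahnSeries.C ((red f).coeff i) * τ M ^ i) _ :=
    UConv.sum _ fun i _ => (uconv_const _).mul (hτ.zpow hτ' i)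
  have hn : n ≤ e * (n.natAbs : ℤ) := by
    have : (1 : ℤ) ≤ e := by exact_mod_cast Nat.one_le_iff_ne_zero.2 he
    have h2 : (0 : ℤ) ≤ n.natAbs := by positivity
    have : (n.natAbs : ℤ) ≤ e * n.natAbs := by nlinarith
    omega
  filter_upwards [hs n] with M hM
  have h1 := (hφ M f i₀ n.natAbs hi₀).mono hn
  have h2 := (hσ (red f) i₀ n.natAbs hi₀).mono hn
  have := (h1.add hM).sub h2
  convert this using 1
  rw [RingHom.comp_apply]
  ring

end

variable {K : Type u} [NormedField K] [IsUltrametricDist K] [CompleteSpace K] {r : Radius K}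

/-- The cover given by `S` has a point over a ramified annulus with coefficients in some extension
of `K`. -/
def HasCoverPoint (r : Radius K) (S : Type u) [CommRing S] [Algebra (IntFunc r) S] : Prop :=
  ∃ (N : Type u) (_ : NormedField N) (_ : IsUltrametricDist N) (_ : CompleteSpace N)
    (_ : NormedAlgebra K N) (Y : Ramification N) (b : Radius K) (n : ℕ),
    Nonempty (CoverPoint r S Y b) ∧ Nonempty (BoundedBasis N K (Fin n))

/-- Approximations over a finite extension of a change of variable `t = u^e w` and of the formal
Laurent series `x`, `y`, `z`. -/
theorem exists_approximation {κ : Type u} [Field κ] {redK : Reduction K κ}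
    (hfm : HasFiniteModels redK) (hcof : ∀ x : ℝ, x < 1 → ∃ b : Radius K, x < b.1)
    (P : StandardEtalePair (IntFunc r)) {e : ℕ} (he : e ≠ 0) (w : (PowerSeries κ)ˣ)
    (x y z : LaurentSeries κ) (M : ℕ) :
    ∃ (φ : IntFunc r →+* LaurentSeries κ) (τ a d e₀ : LaurentSeries κ),
      (∀ f (i₀ m : ℤ), Vanish i₀ (redK.res f) → Vanish (e * m) (φ f -
        ∑ i ∈ Finset.Ico i₀ m, HahnSeries.C ((redK.res f).coeff i) * τ ^ i)) ∧
      Vanish M (τ - HahnSeries.ofPowerSeries ℤ κ (PowerSeries.X ^ e * (w : PowerSeries κ))) ∧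
      (τ ≠ 0 ∧ Vanish (-e) τ⁻¹) ∧ (Vanish (-M) x → Vanish M (a - x)) ∧
      (Vanish (-M) y → Vanish M (d - y)) ∧ (Vanish (-M) z → Vanish M (e₀ - z)) ∧
      ∀ m : ℕ, (∀ k, Vanish 1 ((newtonPoly (P.f.map φ) a d (HahnSeries.single (m : ℤ) 1)
          (HahnSeries.single (-m : ℤ) 1)).coeff k)) →
        (∀ k, Vanish 1 ((unitPoly (P.g.map φ) a e₀ (HahnSeries.single (m : ℤ) 1)).coeff k)) →
        HasCoverPoint r P.Ring := by
  classical
  obtain ⟨N, _, _, _, _, R, n, hB, hred, hT⟩ := hfm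
    ((Finset.range (M + 1)).image (fun i => PowerSeries.coeff i (w : PowerSeries κ)) ∪
      (Finset.Ico (-M : ℤ) M).image x.coeff ∪ (Finset.Ico (-M : ℤ) M).image y.coeff ∪
      (Finset.Ico (-M : ℤ) M).image z.coeff)
  simp only [Finset.mem_union, Finset.mem_image] at hT
  -- One more coefficient of `w` is lifted than the precision `M` requires, so that the constant
  -- term is available even when `M = 0`.
  obtain ⟨Y, rfl, hY⟩ := R.exists_ramification he w M.succ_pos fun i hi =>
    hT _ (Or.inl (Or.inl (Or.inl ⟨i, Finset.mem_range.2 hi, rfl⟩)))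
  obtain ⟨a, ha⟩ := R.exists_lift_sub (I := r.halfOpen.root Y.e) x M fun i hi =>
    hT _ (Or.inl (Or.inl (Or.inr ⟨i, hi, rfl⟩)))
  obtain ⟨d, hd⟩ := R.exists_lift_sub (I := r.halfOpen.root Y.e) y M fun i hi =>
    hT _ (Or.inl (Or.inr ⟨i, hi, rfl⟩))
  obtain ⟨e₀, he₀⟩ := R.exists_lift_sub (I := r.halfOpen.root Y.e) z M fun i hi =>
    hT _ (Or.inr ⟨i, hi, rfl⟩)
  have hτ : R.res (Y.powInt (-1) : integral N (r.halfOpen.root Y.e)) =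
      (R.res (Y.powInt 1 : integral N (r.halfOpen.root Y.e)))⁻¹ := by
    rw [Y.res_powInt R (-1), zpow_neg_one]
  refine ⟨R.res.comp Y.pullInt, R.res (Y.powInt 1 : integral N (r.halfOpen.root Y.e)),
    R.res a, R.res d, R.res e₀, fun f i₀ m h => Y.vanish_res_pullInt R redK hred f h,
    (hY _).mono (by push_cast; omega), ⟨?_, ?_⟩, ha, hd, he₀, fun m hF hG => ?_⟩
  · refine left_ne_zero_of_mul_eq_one (b := R.res (Y.powInt (-1) : integral N (r.halfOpen.root Y.e))) ?_
    rw [← map_mul, ← Y.powInt_add, add_neg_cancel, Y.powInt_zero, map_one]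
  · rw [← hτ]
    simpa using Y.vanish_res_powInt R (I := r.halfOpen.root Y.e) (-1)
  · have hint : ∀ n : ℤ, ∃ μ : integral N (r.halfOpen.root Y.e), (μ : Laurent N (r.halfOpen.root Y.e)) = mono 1 n :=
      fun n => ⟨⟨mono 1 n, fun i => by
        rw [coeff_mono, Pi.single_apply]
        split_ifs <;> simp⟩, rfl⟩
    obtain ⟨μ, hμ⟩ := hint m
    obtain ⟨μ', hμ'⟩ := hint (-m)
    rw [← R.res_mono _ μ hμ] at hF hG
    rw [← R.res_mono _ μ' hμ'] at hF
    obtain ⟨b, hb⟩ := exists_coverPoint_of_newton R hcof Y P a d e₀ μ μ' (Subtype.ext (by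
      rw [Subring.coe_mul, hμ, hμ', mono_mul_mono, mul_one, add_neg_cancel]
      rfl)) hF hG
    exact ⟨N, inferInstance, inferInstance, inferInstance, inferInstance, Y, b, n, hb, hB⟩

/-- The residue point satisfies the Newton conditions in `κ((u))` with exact inverses.
Approximations of `w`, of the point and of these inverses converge to the exact data, so the
conditions persist for large `M`. The approximations are reductions of integral functions over some
`N`, and Newton's method over that `N` yields a true point. -/
theorem exists_coverPoint {κ : Type u} [Field κ] [IsAlgClosed κ] {redK : Reduction K κ}
    (hfm : HasFiniteModels redK) (hcof : ∀ x : ℝ, x < 1 → ∃ b : Radius K, x < b.1)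
    (S : Type u) [CommRing S] [Algebra (IntFunc r) S] [Algebra.Etale (IntFunc r) S]
    [Module.Finite (IntFunc r) S] [Nontrivial S] : HasCoverPoint r S := by
  have : IsDomain (Laurent K r.halfOpen) := NoZeroDivisors.to_isDomain _
  obtain ⟨P, j, σ, e, w, x, he, hσ, hF, hF', hG⟩ := exists_residue_point (S := S)
    (redK.res (I := r.halfOpen))
  rw [← eval_map] at hF hF' hG
  rw [← derivative_map] at hF'
  set Fm := P.f.map (σ.comp redK.res) with hFm
  set Gm := P.g.map (σ.comp redK.res) with hGm
  obtain ⟨m₁, hm₁⟩ := exists_vanish_newtonPoly hF hF'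
  obtain ⟨m₂, hm₂⟩ := exists_vanish_unitPoly hG
  -- The field `N` varies with `M`, but all reductions take values in the same `κ((u))`, where the
  -- limit is taken.
  choose φ τ a d e₀ hφ hτ hτ0 ha hd he₀ h using
    exists_approximation hfm hcof P he w x (Fm.derivative.eval x)⁻¹ (Gm.eval x)⁻¹
  have hconv : ∀ (s : ℕ → LaurentSeries κ) (y : LaurentSeries κ),
      (∀ M : ℕ, Vanish (-M) y → Vanish M (s M - y)) → UConv s y := fun s y hs n => by
    obtain ⟨l, hl⟩ := exists_vanish_nat y
    filter_upwards [eventually_ge_atTop (max l n.natAbs)] with M hM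
    exact (hs M (hl.mono (by omega))).mono (by omega)
  have hτc := hconv τ _ fun M _ => hτ M
  have hφc := uconv_of_isSubstitution he hσ hφ hτc hτ0
  have h1 := eventually_vanish_newtonPoly hφc (hconv a _ ha) (hconv d _ hd) P.f _ _
    (hm₁ (max m₁ m₂) (le_max_left _ _))
  have h2 := eventually_vanish_unitPoly hφc (hconv a _ ha) (hconv e₀ _ he₀) P.g _
    (hm₂ (max m₁ m₂) (le_max_right _ _))
  obtain ⟨M, hM1, hM2⟩ := (h1.and h2).exists
  obtain ⟨N, i1, i2, i3, i4, Y, b, n, ⟨Q⟩, hB⟩ := h M (max m₁ m₂) hM1 hM2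
  refine ⟨N, i1, i2, i3, i4, Y, b, n, ⟨⟨Q.le, Q.hom.comp j.toRingHom, fun c => ?_⟩⟩, hB⟩
  rw [← Q.hom_algebraMap c]
  exact congrArg Q.hom (j.commutes c)

theorem Radius.exists_lt_val {p : ℕ} [Fact p.Prime] (hp : ‖(p : K)‖ = (p : ℝ)⁻¹) (x : ℝ) (hx : x < 1) :
    ∃ b : Radius K, x < b.1 := by
  have hp1 : (1 : ℝ) < p := by exact_mod_cast (Fact.out : p.Prime).one_lt
  have hp0 : (0 : ℝ) < (p : ℝ)⁻¹ := by positivity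
  have hpi : (p : ℝ)⁻¹ < 1 := inv_lt_one_of_one_lt₀ hp1
  have hy : max x (1 / 2) < 1 := max_lt hx (by norm_num)
  have hy0 : 0 < max x (1 / 2) := lt_max_of_lt_right (by norm_num)
  obtain ⟨n, hn⟩ := exists_pow_lt_of_lt_one hp0 hy
  have hpow : (((p : ℝ)⁻¹) ^ (((n + 1 : ℕ) : ℝ)⁻¹)) ^ (n + 1) = (p : ℝ)⁻¹ :=
    Real.rpow_inv_natCast_pow hp0.le n.succ_ne_zero
  refine ⟨⟨((p : ℝ)⁻¹) ^ (((n + 1 : ℕ) : ℝ)⁻¹), Real.rpow_pos_of_pos hp0 _,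
    Real.rpow_lt_one hp0.le hpi (by positivity), n + 1, n.succ_pos, (p : K), ?_, ?_⟩, ?_⟩
  · rw [← norm_pos_iff, hp]; exact hp0
  · rw [hp]; exact hpow
  · refine (le_max_left x (1 / 2)).trans_lt
      (lt_of_pow_lt_pow_left₀ (n + 1) (Real.rpow_nonneg hp0.le _) ?_)
    rw [hpow]
    exact (pow_le_pow_of_le_one hy0.le hy.le n.le_succ).trans_lt hn

theorem NablaModule.exists_veryGood_of_isConstantOver {p : ℕ} [Fact p.Prime] [CharZero K]
    (hp : ‖(p : K)‖ = (p : ℝ)⁻¹) (E : NablaModule.{u, v} r) (S : Type u) [CommRing S]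
    [Algebra (IntFunc r) S] [Algebra.Etale (IntFunc r) S] [Module.Finite (IntFunc r) S]
    [Nontrivial S] (hE : E.IsConstantOver S) : ∃ b, E.toPreNabla.VeryGood b := by
  have hp1 : (1 : ℝ) < p := by exact_mod_cast (Fact.out : p.Prime).one_lt
  have hK : ∃ x : K, x ≠ 0 ∧ ‖x‖ ≠ 1 := ⟨p, Nat.cast_ne_zero.2 (Fact.out : p.Prime).ne_zero, by
    rw [hp]; exact (inv_lt_one_of_one_lt₀ hp1).ne⟩
  obtain ⟨κ, _, _, redK, hfm⟩ := exists_hasFiniteModels K hK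
  obtain ⟨N, _, _, _, _, Y, b, n, ⟨P⟩, ⟨B⟩⟩ := exists_coverPoint (r := r) hfm (Radius.exists_lt_val hp) S
  have : CharZero N := charZero_of_injective_algebraMap (algebraMap K N).injective
  have hpN : ‖(p : N)‖ = (p : ℝ)⁻¹ := by rw [← hp, ← map_natCast (algebraMap K N), norm_algebraMap']
  exact ⟨b, E.veryGood_of_coverPoint (one_le_natCast_mul_norm hpN) P B hE⟩

theorem NablaModule.IsQuasiConstant.exists_veryGood {p : ℕ} [Fact p.Prime] [CharZero K]
    (hp : ‖(p : K)‖ = (p : ℝ)⁻¹) {E : NablaModule.{u, v} r} (hE : E.IsQuasiConstant) :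
    ∃ b, E.toPreNabla.VeryGood b := by
  obtain ⟨s, h, S, _, _, _, _, _, hS⟩ := hE
  obtain ⟨b, hb⟩ := (E.restrict h).exists_veryGood_of_isConstantOver hp S hS
  exact ⟨b, E.veryGood_of_restrict hb⟩

end

end PadicDE

theorem propositionP {p : ℕ} [Fact p.Prime] {K : Type u} [NormedField K] [IsUltrametricDist K]
    [CompleteSpace K] [CharZero K] (hp : ‖(p : K)‖ = (p : ℝ)⁻¹) (r : PadicDE.Radius K)
    (E : PadicDE.NablaModule.{u, v} r) :
    (E.IsQuasiConstant → E.IsDualizable) ∧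
      (E.HasQuasiConstantFiltration → E.IsDualizable) := by
  refine ⟨fun hE => ?_, fun hE => ?_⟩
  · obtain ⟨s, h, S, _, _, _, _, _, hS⟩ := hE
    obtain ⟨b, hb⟩ := (E.restrict h).exists_veryGood_of_isConstantOver hp S hS
    exact PadicDE.NablaModule.isDualizable_of_good hb.toGood
  · exact PadicDE.NablaModule.isDualizable_of_filtration (PadicDE.Radius.cofinal hp)
      (fun _ _ hQ => hQ.exists_veryGood hp) E hE
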